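/- Fix real numbers $0<\bar\rho<\rho_m/2$ and write $f=\rho_m-\bar\rho$. For $\sigma\ge 0$ and $T>0$ consider, for $\psi,\varphi:[0,T]\times\mathbb R^2\to\mathbb R$, the forward–backward system \[ \begin{aligned} \partial_t\psi={}&(f-2\bar\rho)\,\partial_x\psi+\bar\rho f^2\Delta\varphi+\sigma\Delta\psi +\nabla\cdot\big((\psi f^2-2f(\bar\rho+\psi)\psi+(\bar\rho+\psi)\psi^2)\nabla\varphi\big) +\tfrac1f\,\partial_x(\psi^3)+\big(\tfrac{\bar\rho}{f}-2\big)\partial_x(\psi^2),\\ \partial_t\varphi={}&f\,\partial_x\varphi-\tfrac1f\psi-\sigma\Delta\varphi+\tfrac12 f^2|\nabla\varphi|^2+\tfrac12(\psi^2-2f\psi)|\nabla\varphi|^2+\tfrac1{2f^2}\psi^2+\partial_x\varphi\big(\tfrac1f\psi^2-2\psi\big),\\ \psi(0)={}&\psi_0,\qquad \varphi(T)=\varphi_T , \end{aligned} \] that is, the system satisfied by the perturbation $(\psi,\varphi)$ when $\rho=\bar\rho+\psi$, $\Phi=x/f+\varphi$ solve $\partial_t\rho=\nabla\cdot(\rho(\rho_m-\rho)^2\nabla\Phi)+\sigma\Delta\rho$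 and $\partial_t\Phi=\tfrac12(\rho_m-\rho)^2|\nabla\Phi|^2-\tfrac12-\sigma\Delta\Phi$. By a solution in $L^2\cap L^\infty$ on $[0,T]$ we mean a weak (distributional) solution with $\psi(t),\nabla\varphi(t)\in L^2\cap L^\infty$ bounded uniformly in $t\in[0,T]$. For data whose Fourier transforms $\hat\psi_0,\hat\varphi_T$ are functions, put \[ N_\sigma=\|(1+|\xi|)^3(1+\sigma|\xi|)\hat\psi_0\|_{L^\infty(\mathbb R^2)},\qquad M_\sigma=\|(1+|\xi|)^3(|\xi|+\sigma|\xi|^2)\hat\varphi_T\|_{L^\infty(\mathbb R^2)} . \] There exist $\varepsilon_0,K>0$, depending only on $\rho_m,\bar\rho$, such that the following holds. (1) For all $\sigma>0$, $T>0$ and all real data with $N_\sigma+M_\sigma\le\varepsilon_0$, the system has a solution $(\psi_\sigma,\varphi_\sigma)$ in $L^2\cap L^\infty$ on $[0,T]$ whose density $\bar\rho+\psi_\sigma$ takes values in $(0,\rho_m/2)$; it is the only solution in $L^2\cap L^\infty$ on $[0,T]$ with density in $(0,\rho_m/2)$. For all $t\in[0,T]$ it satisfies \[ \|\psi_\sigma(t)\|_{L^2}+\|\nabla\varphi_\sigma(t)\|_{L^2}+\sigma\|\nabla^2\varphi_\sigma(t)\|_{L^2}\le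 K\Big(\frac{N_\sigma}{1+t}+\frac{M_\sigma}{1+T-t}\Big), \] \[ \|\psi_\sigma(t)\|_{L^\infty}+\|\nabla\varphi_\sigma(t)\|_{L^\infty}+\sigma\|\nabla^2\varphi_\sigma(t)\|_{L^\infty}\le K\Big(\frac{N_\sigma}{(1+t)^2}+\frac{M_\sigma}{(1+T-t)^2}\Big). \] (2) Let $T>0$, $\sigma_0>0$ and let the data satisfy $N_{\sigma_0}+M_{\sigma_0}\le\varepsilon_0$ and \[ \|(1+|\xi|)^5(1+\sigma_0|\xi|)\hat\psi_0\|_{L^\infty}+\|(1+|\xi|)^7\hat\varphi_T\|_{L^\infty}<\infty . \] Then the system with $\sigma=0$, and the systems with $0<\sigma\le\sigma_0$, with these same data, have solutions $(\psi,\varphi)$ and $(\psi_\sigma,\varphi_\sigma)$ on $[0,T]$, each unique in the sense of (1), and \[ \sup_{t\in[0,T]}\big(\|\psi_\sigma(t)-\psi(t)\|_{L^2\cap L^\infty}+\|\nabla\varphi_\sigma(t)-\nabla\varphi(t)\|_{L^2\cap L^\infty}\big)\to0\qquad\text{as }\sigma\to0^+ . \] -/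

import Mathlib

open MeasureTheory Set Filter Topology
open scoped ContDiff ENNReal NNReal

noncomputable section

namespace Hughes

/-- The plane `ℝ²` with its Euclidean structure; the coordinates are `x 0` and `x 1`. -/
abbrev Plane : Type := EuclideanSpace ℝ (Fin 2)

/-- The unit vector in the direction of the first coordinate. -/
def e₁ : Plane := EuclideanSpace.single (0 : Fin 2) (1 : ℝ)

/-! ### Fourier data -/

/-- `a` is the Fourier transform of `u`, with the convention `û(ξ) = ∫ e^{-i ξ·x} u(x) dx`,
expressed through the inversion formula for an integrable `a`. (A measurable `a` for which one of
the weighted norms below is finite is integrable.) -/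
def HasFourierTransform (u : Plane → ℝ) (a : Plane → ℂ) : Prop :=
  Integrable a volume ∧
    ∀ᵐ x ∂(volume : Measure Plane),
      (u x : ℂ) = ((2 * Real.pi) ^ 2 : ℝ)⁻¹ •
        ∫ ξ : Plane, Complex.exp (Complex.I * (inner ℝ ξ x : ℝ)) * a ξ

/-- `‖w(|ξ|) a(ξ)‖_{L^∞(ℝ²)}`. -/
def weightedSup (w : ℝ → ℝ) (a : Plane → ℂ) : ℝ≥0∞ :=
  eLpNorm (fun ξ => w ‖ξ‖ • a ξ) ∞ volume

/-- `‖(1+|ξ|)^3 (1+σ|ξ|) a‖_{L^∞}`. -/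
def initialNorm (σ : ℝ) (a : Plane → ℂ) : ℝ≥0∞ :=
  weightedSup (fun r => (1 + r) ^ 3 * (1 + σ * r)) a

/-- `‖(1+|ξ|)^3 (|ξ|+σ|ξ|²) b‖_{L^∞}`. -/
def terminalNorm (σ : ℝ) (b : Plane → ℂ) : ℝ≥0∞ :=
  weightedSup (fun r => (1 + r) ^ 3 * (r + σ * r ^ 2)) b

/-! ### Weak derivatives -/

/-- Smooth compactly supported real functions on the plane. -/
def IsTest (η : Plane → ℝ) : Prop := ContDiff ℝ ∞ η ∧ HasCompactSupport η

/-- `g` is the weak gradient of `u`. -/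
def HasWeakGradient (u : Plane → ℝ) (g : Plane → Plane) : Prop :=
  LocallyIntegrable u volume ∧ LocallyIntegrable g volume ∧
    ∀ η : Plane → ℝ, IsTest η → (∫ x, u x • gradient η x) = -(∫ x, η x • g x)

/-- `H` is the weak Jacobian matrix of the vector field `g` (the weak Hessian of `u` when `g` is
the weak gradient of `u`). Its pointwise norm is the Frobenius norm. -/
def HasWeakJacobian (g : Plane → Plane) (H : Plane → EuclideanSpace ℝ (Fin 2 × Fin 2)) : Prop :=
  ∀ i : Fin 2, HasWeakGradient (fun x => g x i)
    (fun x => WithLp.toLp 2 fun j => H x (i, j))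

/-! ### The perturbed system -/

/-- `f(ρ) = ρ_m - ρ`. -/
def speed (ρm ρ : ℝ) : ℝ := ρm - ρ

/-- The first equation is `∂_t ψ = ∇ · flux(ψ, ∇φ) + σ Δψ`. -/
def flux (ρm ρbar ψ : ℝ) (p : Plane) : Plane :=
  ((speed ρm ρbar - 2 * ρbar) * ψ) • e₁ + (ρbar * speed ρm ρbar ^ 2) • p
    + (ψ * speed ρm ρbar ^ 2 - 2 * speed ρm ρbar * (ρbar + ψ) * ψ + (ρbar + ψ) * ψ ^ 2) • p
    + (1 / speed ρm ρbar * ψ ^ 3 + (ρbar / speed ρm ρbar - 2) * ψ ^ 2) • e₁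

/-- The second equation is `∂_t φ = potentialRate(ψ, ∇φ) - σ Δφ`. -/
def potentialRate (ρm ρbar ψ : ℝ) (p : Plane) : ℝ :=
  speed ρm ρbar * p 0 - 1 / speed ρm ρbar * ψ
    + 1 / 2 * speed ρm ρbar ^ 2 * ‖p‖ ^ 2
    + 1 / 2 * (ψ ^ 2 - 2 * speed ρm ρbar * ψ) * ‖p‖ ^ 2
    + 1 / (2 * speed ρm ρbar ^ 2) * ψ ^ 2
    + p 0 * (1 / speed ρm ρbar * ψ ^ 2 - 2 * ψ)

/-- With `ρ = ρ̄ + ψ` and `∇Φ = e₁ / f(ρ̄) + ∇φ`, the flux is `ρ f(ρ)² ∇Φ` minus its constant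
value `ρ̄ f(ρ̄) e₁` at the unperturbed state. -/
theorem flux_eq {ρm ρbar : ℝ} (h : speed ρm ρbar ≠ 0) (ψ : ℝ) (p : Plane) :
    flux ρm ρbar ψ p =
      ((ρbar + ψ) * speed ρm (ρbar + ψ) ^ 2) • ((speed ρm ρbar)⁻¹ • e₁ + p)
        - (ρbar * speed ρm ρbar) • e₁ := by
  have hs : speed ρm (ρbar + ψ) = speed ρm ρbar - ψ := by simp only [speed]; ring
  rw [hs]
  ext i
  simp only [flux, PiLp.add_apply, PiLp.sub_apply, PiLp.smul_apply, smul_eq_mul]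
  field_simp
  ring

/-- With the same notation, the rate is `f(ρ)² |∇Φ|² / 2 - 1 / 2`. -/
theorem potentialRate_eq {ρm ρbar : ℝ} (h : speed ρm ρbar ≠ 0) (ψ : ℝ) (p : Plane) :
    potentialRate ρm ρbar ψ p =
      1 / 2 * speed ρm (ρbar + ψ) ^ 2 * ‖(speed ρm ρbar)⁻¹ • e₁ + p‖ ^ 2 - 1 / 2 := by
  have hs : speed ρm (ρbar + ψ) = speed ρm ρbar - ψ := by simp only [speed]; ring
  rw [hs]
  simp only [potentialRate, EuclideanSpace.norm_sq_eq, Fin.sum_univ_two, Real.norm_eq_abs, sq_abs,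
    e₁, PiLp.add_apply, PiLp.smul_apply, smul_eq_mul, PiLp.single_apply]
  norm_num
  field_simp
  ring

/-- `(ψ, φ)`, with spatial gradient `G = ∇φ`, is a weak solution on `[0, T]` of
`∂_t ψ = ∇ · flux(ψ, ∇φ) + σ Δψ`, `∂_t φ = potentialRate(ψ, ∇φ) - σ Δφ`,
`ψ(0) = ψ₀`, `φ(T) = φT`, such that `ψ` and `∇φ` are bounded on `[0, T]` with values in
`L² ∩ L^∞`. The equations are integrated in time, from `0` for `ψ` and from `T` for `φ`. -/
structure IsSolution (ρm ρbar σ T : ℝ) (ψ₀ φT : Plane → ℝ)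
    (ψ φ : ℝ → Plane → ℝ) (G : ℝ → Plane → Plane) : Prop where
  measurable_density : AEStronglyMeasurable (Function.uncurry ψ)
    (((volume : Measure ℝ).restrict (Icc 0 T)).prod (volume : Measure Plane))
  measurable_gradient : AEStronglyMeasurable (Function.uncurry G)
    (((volume : Measure ℝ).restrict (Icc 0 T)).prod (volume : Measure Plane))
  memLp : ∀ t ∈ Icc 0 T, MemLp (ψ t) 2 volume ∧ MemLp (ψ t) ∞ volume ∧
    MemLp (G t) 2 volume ∧ MemLp (G t) ∞ volume
  bounded : ∃ C : ℝ≥0, ∀ t ∈ Icc 0 T,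
    eLpNorm (ψ t) 2 volume + eLpNorm (ψ t) ∞ volume
      + eLpNorm (G t) 2 volume + eLpNorm (G t) ∞ volume ≤ C
  weak_gradient : ∀ t ∈ Icc 0 T, HasWeakGradient (φ t) (G t)
  density_eq : ∀ η : Plane → ℝ, IsTest η → ∀ t ∈ Icc 0 T,
    (∫ x, ψ t x * η x) = (∫ x, ψ₀ x * η x)
      + ∫ s in (0 : ℝ)..t, ∫ x,
          (-(inner ℝ (flux ρm ρbar (ψ s x) (G s x)) (gradient η x) : ℝ)
            + σ * (ψ s x * Laplacian.laplacian η x))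
  potential_eq : ∀ η : Plane → ℝ, IsTest η → ∀ t ∈ Icc 0 T,
    (∫ x, φ t x * η x) = (∫ x, φT x * η x)
      - ∫ s in t..T, ∫ x,
          (potentialRate ρm ρbar (ψ s x) (G s x) * η x
            + σ * (inner ℝ (G s x) (gradient η x) : ℝ))

/-- The density `ρ̄ + ψ` stays in the monotone range `(0, ρ_m / 2)`. -/
def IsSubcritical (ρm ρbar T : ℝ) (ψ : ℝ → Plane → ℝ) : Prop :=
  ∀ t ∈ Icc 0 T, ∀ᵐ x ∂(volume : Measure Plane), 0 < ρbar + ψ t x ∧ ρbar + ψ t x < ρm / 2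

/-- `(ψ, φ, ∇φ)` is the unique solution with density in `(0, ρ_m / 2)`. -/
def IsUniqueSolution (ρm ρbar σ T : ℝ) (ψ₀ φT : Plane → ℝ)
    (ψ φ : ℝ → Plane → ℝ) (G : ℝ → Plane → Plane) : Prop :=
  IsSolution ρm ρbar σ T ψ₀ φT ψ φ G ∧ IsSubcritical ρm ρbar T ψ ∧
    ∀ (ψ' φ' : ℝ → Plane → ℝ) (G' : ℝ → Plane → Plane),
      IsSolution ρm ρbar σ T ψ₀ φT ψ' φ' G' → IsSubcritical ρm ρbar T ψ' →
        ∀ t ∈ Icc 0 T, ψ' t =ᵐ[volume] ψ t ∧ φ' t =ᵐ[volume] φ t ∧ G' t =ᵐ[volume] G t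

end Hughes

end

/-! Existence is a contraction argument on the Fourier side. With v the transform of |∇|φ, the
linearised system is, for each frequency ξ, a 2×2 linear ODE in time with ψ prescribed at 0 and v at
T. Its exponents are iω ± μ, where μ² = (σ|ξ|² + iρ̄ξ₀)² + ρ̄f|ξ|². The condition ρ̄ < ρ_m/2 means f
> ρ̄, and then Re μ dominates |ξ| + σ|ξ|² (`radicand_re_ge`, `exists_admissible`). So the problem is
elliptic in space-time: one component decays away from time 0, the other away from time T. The
boundary conditions fix both, because the determinant 1 + pq e^{-2μT} stays away from 0 uniformly in
ξ, σ and T. Integrating against these exponentials gains the factor |ξ|(1+σ|ξ|), which pays for the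
derivatives in front of the nonlinear terms (`exists_sol_bound`).

The space is the ball of transforms bounded by a multiple of W = (1+|ξ|)⁻³(N e^{-ct|ξ|} + M
e^{-c(T-t)|ξ|}). By the triangle inequality for |ξ|, and since (1+|ξ|)⁻³ is integrable in the plane,
W∗W ≤ C(N+M)W. All nonlinear terms have degree at least two, so for small N+M the solution map
contracts in the norm weighted by W (`exists_convWeights`, `exists_forceBounds`,
`exists_spectralSol`). Integrating W and W² over ξ gives the rates (1+t)⁻² in L^∞ and (1+t)⁻¹ in L²,
and likewise in T-t. The gain in the linear estimate leaves a spare factor 1/(1+σ|ξ|), which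
controls σ∇²φ.

For the limit σ → 0 the inviscid solution is regarded as a viscous one with the extra forcing
σ|ξ|²U. Half a power of decay in ξ is exchanged for √σ. The weight (1+|ξ|)^{-5/2} is still
integrable and still stable under convolution with W, so the contraction argument bounds the
difference of the transforms by √σ(1+|ξ|)^{-5/2}, hence the difference of the functions by √σ in L²
and L^∞.

Uniqueness among all weak solutions is Lasry–Lions monotonicity. For two solutions with the same
data, the time derivative of ∫(ψ-ψ')(φ-φ') has zero integral over [0,T], because the first factor
vanishes at 0 and the second at T; the viscous terms cancel. What remains is the space-time integral
of an expression that is pointwise nonnegative when both densities lie in (0, ρ_m/2)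
(`monotone_nonneg`). Wherever ∇Φ ≠ 0 for the first solution, the expression vanishes only if the two
states agree, and the constructed solution has ∇Φ ≠ 0 everywhere because ∇φ is small. Weak solutions
lack the regularity for this computation, so it is done after mollification in space, and the
mollifier is then removed (`IsDifference.energy`, `IsDifference.integral_eq_zero`). -/

noncomputable section

namespace Hughes

/-! ### Fourier inversion and products of functions on the plane -/

/-- The plane wave `e^{i ξ·x}`. -/
def wave (ξ x : Plane) : ℂ := Complex.exp (Complex.I * (inner ℝ ξ x : ℝ))

lemma norm_wave (ξ x : Plane) : ‖wave ξ x‖ = 1 := by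
  rw [wave, mul_comm]; exact Complex.norm_exp_ofReal_mul_I _

lemma wave_comm (ξ x : Plane) : wave ξ x = wave x ξ := by
  rw [wave, wave, real_inner_comm]

lemma wave_add_left (ξ η x : Plane) : wave (ξ + η) x = wave ξ x * wave η x := by
  rw [wave, wave, wave, ← Complex.exp_add, inner_add_left]; push_cast; ring_nf

lemma wave_neg_left (ξ x : Plane) : wave (-ξ) x = (starRingEnd ℂ) (wave ξ x) := by
  rw [wave, wave, ← Complex.exp_conj]; simp [inner_neg_left]

lemma continuous_wave : Continuous fun p : Plane × Plane => wave p.1 p.2 := by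
  unfold wave; fun_prop

lemma continuous_wave_left (x : Plane) : Continuous fun ξ => wave ξ x :=
  continuous_wave.comp (Continuous.prodMk_left x)

lemma continuous_wave_right (ξ : Plane) : Continuous fun x => wave ξ x :=
  continuous_wave.comp (Continuous.prodMk_right ξ)

/-- The normalising constant `(2π)⁻²`. -/
def cpi : ℝ := ((2 * Real.pi) ^ 2 : ℝ)⁻¹

lemma cpi_pos : 0 < cpi := by unfold cpi; positivity

lemma cpi_le_one : cpi ≤ 1 := by
  unfold cpi
  apply inv_le_one_of_one_le₀
  nlinarith [Real.pi_gt_three]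

/-- The inverse Fourier transform of `a`. -/
def invFourier (a : Plane → ℂ) (x : Plane) : ℂ := cpi • ∫ ξ, wave ξ x * a ξ

lemma integrable_wave_mul {a : Plane → ℂ} (ha : Integrable a) (x : Plane) :
    Integrable fun ξ => wave ξ x * a ξ :=
  ha.bdd_mul (c := 1) (continuous_wave_left x).aestronglyMeasurable
    (Eventually.of_forall fun ξ => (norm_wave ξ x).le)

lemma norm_invFourier_le (a : Plane → ℂ) (x : Plane) :
    ‖invFourier a x‖ ≤ cpi * ∫ ξ, ‖a ξ‖ := by
  rw [invFourier, norm_smul, Real.norm_of_nonneg cpi_pos.le]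
  refine mul_le_mul_of_nonneg_left ?_ cpi_pos.le
  refine (norm_integral_le_integral_norm _).trans_eq ?_
  simp [norm_wave]

lemma invFourier_add {a b : Plane → ℂ} (ha : Integrable a) (hb : Integrable b) (x : Plane) :
    invFourier (fun ξ => a ξ + b ξ) x = invFourier a x + invFourier b x := by
  simp only [invFourier, mul_add]
  rw [integral_add (integrable_wave_mul ha x) (integrable_wave_mul hb x), smul_add]

lemma invFourier_const_mul (c : ℂ) (a : Plane → ℂ) (x : Plane) :
    invFourier (fun ξ => c * a ξ) x = c * invFourier a x := by
  simp only [invFourier, mul_left_comm _ c]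
  rw [integral_const_mul, mul_smul_comm]

lemma invFourier_conj (a : Plane → ℂ) (x : Plane) :
    (starRingEnd ℂ) (invFourier a x) = invFourier (fun ξ => (starRingEnd ℂ) (a (-ξ))) x := by
  simp only [invFourier, Complex.real_smul, map_mul, Complex.conj_ofReal]
  rw [← integral_conj, ← integral_neg_eq_self]
  simp only [map_mul, wave_neg_left, Complex.conj_conj]

lemma continuous_invFourier {a : Plane → ℂ} (ha : Integrable a) : Continuous (invFourier a) := by
  unfold invFourier
  refine Continuous.const_smul ?_ cpi
  refine continuous_of_dominated (bound := fun ξ => ‖a ξ‖)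
    (fun x => (integrable_wave_mul ha x).aestronglyMeasurable) ?_ ha.norm ?_
  · intro x; exact Eventually.of_forall fun ξ => by simp [norm_wave]
  · exact Eventually.of_forall fun ξ => (continuous_wave_right ξ).mul continuous_const

/-- The convolution on the Fourier side that corresponds to the product of functions. -/
def cv (a b : Plane → ℂ) (ξ : Plane) : ℂ := cpi • ∫ η, a η * b (ξ - η)

lemma cv_eq_convolution (a b : Plane → ℂ) :
    cv a b = fun ξ => (cpi : ℂ) * MeasureTheory.convolution a b (ContinuousLinearMap.mul ℝ ℂ) volume ξ := by
  ext ξ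
  simp [cv, convolution_def]

lemma integrable_cv {a b : Plane → ℂ} (ha : Integrable a) (hb : Integrable b) :
    Integrable (cv a b) := by
  rw [cv_eq_convolution]
  exact (ha.integrable_convolution _ hb).const_mul _

/-- Since e^{iξ·x} = e^{iη·x} e^{i(ξ-η)·x}, modulation commutes with convolution, and the integral
of a convolution is the product of the integrals. The factor `cpi` in `cv` compensates the two
factors in the product. -/
lemma invFourier_cv {a b : Plane → ℂ} (ha : Integrable a) (hb : Integrable b) (x : Plane) :
    invFourier (cv a b) x = invFourier a x * invFourier b x := by
  have h := integral_convolution (ContinuousLinearMap.mul ℝ ℂ)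
    (integrable_wave_mul ha x) (integrable_wave_mul hb x)
  have h2 : (MeasureTheory.convolution (fun ξ => wave ξ x * a ξ) (fun ξ => wave ξ x * b ξ)
      (ContinuousLinearMap.mul ℝ ℂ) volume) = fun ξ => wave ξ x *
        MeasureTheory.convolution a b (ContinuousLinearMap.mul ℝ ℂ) volume ξ := by
    ext ξ
    simp only [convolution_def, ContinuousLinearMap.mul_apply']
    rw [← integral_const_mul]
    congr 1; ext η
    have : wave ξ x = wave η x * wave (ξ - η) x := by rw [← wave_add_left]; congr 1; abel
    rw [this]; ring
  rw [h2] at h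
  rw [cv_eq_convolution, invFourier_const_mul]
  simp only [invFourier, h, Complex.real_smul, ContinuousLinearMap.mul_apply']
  ring

/-- Fubini and the symmetry of the kernel e^{iξ·x}. This moves pairings with test functions to the
Fourier side. -/
lemma integral_invFourier_mul {a b : Plane → ℂ} (ha : Integrable a) (hb : Integrable b) :
    ∫ x, invFourier a x * b x = ∫ ξ, a ξ * invFourier b ξ := by
  have h1 : ∀ x, invFourier a x * b x = cpi • ∫ ξ, wave ξ x * (a ξ * b x) := by
    intro x
    simp only [invFourier, ← mul_assoc]
    rw [integral_mul_const, smul_mul_assoc]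
  have h2 : ∀ ξ, a ξ * invFourier b ξ = cpi • ∫ x, wave ξ x * (a ξ * b x) := by
    intro ξ
    simp only [invFourier, mul_left_comm _ (a ξ)]
    rw [integral_const_mul, mul_smul_comm]
    simp only [wave_comm ξ]
  simp only [h1, h2]
  rw [integral_smul, integral_smul, integral_integral_swap]
  have : Integrable (fun p : Plane × Plane => b p.1 * a p.2) (volume.prod volume) := hb.mul_prod ha
  refine (this.bdd_mul (c := 1) (f := fun p => wave p.2 p.1) ?_ ?_).congr ?_
  · exact (continuous_wave.comp continuous_swap).aestronglyMeasurable
  · exact Eventually.of_forall fun p => (norm_wave _ _).le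
  · exact Eventually.of_forall fun p => by simp [Function.uncurry, mul_comm]

lemma hasFDerivAt_wave (ξ x : Plane) :
    HasFDerivAt (fun x => wave ξ x)
      ((wave ξ x * Complex.I) • (Complex.ofRealCLM.comp (innerSL ℝ ξ))) x := by
  have h1 : HasFDerivAt (fun x : Plane => Complex.I * ((inner ℝ ξ x : ℝ) : ℂ))
      (Complex.I • (Complex.ofRealCLM.comp (innerSL ℝ ξ))) x := by
    have : HasFDerivAt (fun x : Plane => ((inner ℝ ξ x : ℝ) : ℂ))
        (Complex.ofRealCLM.comp (innerSL ℝ ξ)) x :=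
      (Complex.ofRealCLM.comp (innerSL ℝ ξ)).hasFDerivAt
    exact this.const_mul _
  have h2 := h1.cexp
  rw [smul_smul] at h2
  exact h2

/-! ### Partial derivatives of test functions on the Fourier side -/

/-- The `j`-th partial derivative. -/
def pderiv (j : Fin 2) (η : Plane → ℝ) (x : Plane) : ℝ :=
  fderiv ℝ η x (EuclideanSpace.single j 1)

lemma IsTest.pderiv {η : Plane → ℝ} (h : IsTest η) (j : Fin 2) : IsTest (pderiv j η) := by
  refine ⟨?_, ?_⟩
  · exact (h.1.fderiv_right (m := ∞) (by simp)).clm_apply contDiff_const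
  · exact h.2.fderiv_apply ℝ _

lemma IsTest.integrable {η : Plane → ℝ} (h : IsTest η) : Integrable η :=
  h.1.continuous.integrable_of_hasCompactSupport h.2

/-- Integration by parts against the wave. The sign is negative because the kernel is e^{+iξ·x}. -/
lemma invFourier_pderiv {η : Plane → ℝ} (h : IsTest η) (j : Fin 2) (ξ : Plane) :
    invFourier (fun x => (pderiv j η x : ℂ)) ξ =
      -(Complex.I * (ξ j : ℂ)) * invFourier (fun x => (η x : ℂ)) ξ := by
  have hd : ∀ x, HasFDerivAt (fun x => (η x : ℂ)) (Complex.ofRealCLM.comp (fderiv ℝ η x)) x :=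
    fun x => Complex.ofRealCLM.hasFDerivAt.comp x
      ((h.1.differentiable (by simp)).differentiableAt.hasFDerivAt)
  have key := integral_mul_fderiv_eq_neg_fderiv_mul_of_integrable (μ := (volume : Measure Plane))
    (f := fun x => wave ξ x) (g := fun x => (η x : ℂ)) (v := EuclideanSpace.single j (1 : ℝ))
    ?_ ?_ ?_ (fun x _ => (hasFDerivAt_wave ξ x).differentiableAt) (fun x _ => (hd x).differentiableAt)
  · have e1 : ∀ x, fderiv ℝ (fun x => wave ξ x) x (EuclideanSpace.single j (1 : ℝ)) =
        wave ξ x * (Complex.I * (ξ j : ℂ)) := by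
      intro x
      rw [(hasFDerivAt_wave ξ x).fderiv]
      simp [mul_assoc, EuclideanSpace.inner_single_right]
    have e2 : ∀ x, fderiv ℝ (fun x => (η x : ℂ)) x (EuclideanSpace.single j (1 : ℝ)) =
        (Hughes.pderiv j η x : ℂ) := by
      intro x; rw [(hd x).fderiv]; simp [Hughes.pderiv]
    simp only [e1, e2] at key
    simp only [invFourier, wave_comm _ ξ, key]
    simp only [mul_assoc, mul_left_comm (wave ξ _), integral_const_mul]
    simp only [Complex.real_smul]
    ring_nf
  · have : ∀ x, fderiv ℝ (fun x => wave ξ x) x (EuclideanSpace.single j (1 : ℝ)) * (η x : ℂ) =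
        wave x ξ * ((η x : ℂ) * (Complex.I * (ξ j : ℂ))) := by
      intro x
      rw [(hasFDerivAt_wave ξ x).fderiv, wave_comm x]
      simp [EuclideanSpace.inner_single_right]
      ring
    simp only [this]
    exact integrable_wave_mul (h.integrable.ofReal.mul_const _) ξ
  · have : ∀ x, wave ξ x * fderiv ℝ (fun x => (η x : ℂ)) x (EuclideanSpace.single j (1 : ℝ)) =
        wave x ξ * (Hughes.pderiv j η x : ℂ) := by
      intro x; rw [(hd x).fderiv, wave_comm x]; simp [Hughes.pderiv]
    simp only [this]
    exact integrable_wave_mul (h.pderiv j).integrable.ofReal ξ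
  · simp only [wave_comm ξ]
    exact integrable_wave_mul h.integrable.ofReal ξ

lemma laplacian_eq_pderiv {η : Plane → ℝ} (h : IsTest η) (x : Plane) :
    Laplacian.laplacian η x = pderiv 0 (pderiv 0 η) x + pderiv 1 (pderiv 1 η) x := by
  rw [InnerProductSpace.laplacian_eq_iteratedFDeriv_orthonormalBasis η
    (EuclideanSpace.basisFun (Fin 2) ℝ)]
  have hd : DifferentiableAt ℝ (fderiv ℝ η) x :=
    ((h.1.fderiv_right (m := ∞) (by simp)).differentiable (by simp)).differentiableAt
  simp only [Fin.sum_univ_two, iteratedFDeriv_two_apply, EuclideanSpace.basisFun_apply]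
  have e : ∀ j, fderiv ℝ (pderiv j η) x (EuclideanSpace.single j 1) =
      fderiv ℝ (fderiv ℝ η) x (EuclideanSpace.single j 1) (EuclideanSpace.single j 1) := by
    intro j
    change fderiv ℝ (fun y => fderiv ℝ η y (EuclideanSpace.single j 1)) x _ = _
    rw [fderiv_clm_apply hd (by fun_prop)]
    simp
  simp only [pderiv] at e ⊢
  rw [e, e]
  simp

lemma gradient_apply {η : Plane → ℝ} (x : Plane) (j : Fin 2) :
    gradient η x j = pderiv j η x := by
  rw [pderiv, ← toDual_gradient, InnerProductSpace.toDual_apply_apply, EuclideanSpace.inner_single_right]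
  simp

lemma inner_gradient {η : Plane → ℝ} (p x : Plane) :
    inner ℝ p (gradient η x) = p 0 * pderiv 0 η x + p 1 * pderiv 1 η x := by
  rw [PiLp.inner_apply]
  simp [gradient_apply, mul_comm]

/-! ### Plancherel's theorem and the L² bound -/

open FourierTransform in
-- Plancherel holds for the transform extended to L². For a in L¹ ∩ L² that extension is the
-- integral transform: both have the same pairing with every smooth compactly supported function, by
-- duality as a tempered distribution on one side and by Fubini on the other.
lemma eLpNorm_fourier_eq {a : Plane → ℂ} (h1 : Integrable a) (h2 : MemLp a 2) :
    MemLp (𝓕 a) 2 ∧ eLpNorm (𝓕 a) 2 volume = eLpNorm a 2 volume := by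
  set f : Lp ℂ 2 (volume : Measure Plane) := h2.toLp a
  set F : Lp ℂ 2 (volume : Measure Plane) := 𝓕 f
  have hcont : Continuous (𝓕 a) := VectorFourier.fourierIntegral_continuous
    Real.continuous_fourierChar (by simpa using continuous_inner) h1
  have hF : (F : Plane → ℂ) =ᵐ[volume] 𝓕 a := by
    refine ae_eq_of_integral_contDiff_smul_eq ((Lp.memLp F).locallyIntegrable (by norm_num))
      hcont.locallyIntegrable ?_
    intro g hg hgs
    have hgC : ContDiff ℝ ∞ (fun x => (g x : ℂ)) := Complex.ofRealCLM.contDiff.comp hg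
    have hgsC : HasCompactSupport (fun x => (g x : ℂ)) := hgs.comp_left (g := fun r : ℝ => (r : ℂ))
      (by simp)
    set S : SchwartzMap Plane ℂ := hgsC.toSchwartzMap hgC
    have hS : ∀ x, S x = (g x : ℂ) := fun x => rfl
    have e1 := congrArg (fun L => L S) (Lp.fourier_toTemperedDistribution_eq f)
    simp only [TemperedDistribution.fourier_apply, Lp.toTemperedDistribution_apply, hS] at e1
    have e2 : ∫ x, (𝓕 S) x • f x = ∫ x, (𝓕 S) x • a x := by
      refine integral_congr_ae ?_
      filter_upwards [h2.coeFn_toLp] with x hx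
      simp only [f, hx]
    have e3 : ∫ x, (𝓕 S) x • a x = ∫ x, S x • 𝓕 a x := by
      have := VectorFourier.integral_fourierIntegral_smul_eq_flip (μ := (volume : Measure Plane))
        (ν := (volume : Measure Plane)) (L := innerₗ Plane) (f := S) (g := a)
        Real.continuous_fourierChar (by simpa using continuous_inner) S.integrable h1
      rw [flip_innerₗ] at this
      exact this
    have e4 : ∫ x, (g x : ℂ) • F x = ∫ x, (g x : ℂ) • 𝓕 a x := by
      rw [← e1, e2, e3]; simp only [hS]
    simpa using e4
  refine ⟨(memLp_congr_ae hF).1 (Lp.memLp F), ?_⟩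
  rw [← eLpNorm_congr_ae hF, ← eLpNorm_congr_ae h2.coeFn_toLp]
  have := Lp.norm_fourier_eq f
  rw [Lp.norm_def, Lp.norm_def, ENNReal.toReal_eq_toReal_iff' (Lp.eLpNorm_ne_top _)
    (Lp.eLpNorm_ne_top _)] at this
  exact this

open FourierTransform in
lemma invFourier_eq_fourier (a : Plane → ℂ) (x : Plane) :
    invFourier a x = 𝓕 (fun ζ => a ((-(2 * Real.pi)) • ζ)) x := by
  rw [Real.fourier_eq']
  have := Measure.integral_comp_smul (volume : Measure Plane) (fun ξ => wave ξ x * a ξ)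
    (-(2 * Real.pi))
  have h2 : |((-(2 * Real.pi)) ^ Module.finrank ℝ Plane)⁻¹| = cpi := by
    simp only [finrank_euclideanSpace, Fintype.card_fin, even_two.neg_pow]
    exact abs_of_pos cpi_pos
  rw [h2] at this
  rw [invFourier, ← this]
  congr 1
  ext ζ
  rw [smul_eq_mul, wave, real_inner_smul_left]
  congr 2
  push_cast
  ring

/-- The dilation by -2π turns `invFourier` into the normalised transform, which is an isometry of
L². Its Jacobian is the constant `cpi` under the root. -/
lemma eLpNorm_invFourier_le {a : Plane → ℂ} {w : Plane → ℝ} (ha : Integrable a)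
    (haw : ∀ ξ, ‖a ξ‖ ≤ w ξ) (hw : Integrable fun ξ => w ξ ^ 2) :
    MemLp (invFourier a) 2 ∧
      eLpNorm (invFourier a) 2 volume ≤ ENNReal.ofReal (√(cpi * ∫ ξ, w ξ ^ 2)) := by
  have hpi : -(2 * Real.pi) ≠ 0 := by simp [Real.pi_ne_zero]
  set b : Plane → ℂ := fun ζ => a ((-(2 * Real.pi)) • ζ)
  have hb : Integrable b := ha.comp_smul hpi
  have ha2 : Integrable fun ξ => ‖a ξ‖ ^ 2 :=
    hw.mono' (ha.norm.aestronglyMeasurable.pow 2) (Eventually.of_forall fun ξ => by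
      rw [Real.norm_of_nonneg (by positivity)]
      exact pow_le_pow_left₀ (norm_nonneg _) (haw ξ) 2)
  have hb2 : MemLp b 2 := (memLp_two_iff_integrable_sq_norm hb.1).2 (ha2.comp_smul hpi)
  have hE : invFourier a = FourierTransform.fourier b := funext (invFourier_eq_fourier a)
  rw [hE]
  obtain ⟨h1, h2⟩ := eLpNorm_fourier_eq hb hb2
  refine ⟨h1, ?_⟩
  rw [h2, hb2.eLpNorm_eq_integral_rpow_norm (by norm_num) (by norm_num)]
  refine ENNReal.ofReal_le_ofReal ?_
  have e : ∫ ζ, ‖b ζ‖ ^ (2 : ℝ≥0∞).toReal = cpi * ∫ ξ, ‖a ξ‖ ^ 2 := by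
    have := Measure.integral_comp_smul (volume : Measure Plane) (fun ξ => ‖a ξ‖ ^ 2)
      (-(2 * Real.pi))
    have h2 : |((-(2 * Real.pi)) ^ Module.finrank ℝ Plane)⁻¹| = cpi := by
      simp only [finrank_euclideanSpace, Fintype.card_fin, even_two.neg_pow]
      exact abs_of_pos cpi_pos
    rw [h2, smul_eq_mul] at this
    rw [← this]
    simp [b]
  rw [e, Real.sqrt_eq_rpow]
  norm_num
  refine Real.rpow_le_rpow ?_ ?_ (by norm_num)
  · exact mul_nonneg cpi_pos.le (integral_nonneg fun _ => by positivity)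
  · refine mul_le_mul_of_nonneg_left ?_ cpi_pos.le
    exact integral_mono ha2 hw fun ξ => pow_le_pow_left₀ (norm_nonneg _) (haw ξ) 2

/-! ### Real functions given by an integrable transform -/

/-- The real function `F` is the inverse Fourier transform of the integrable function `a`. -/
structure Rep (a : Plane → ℂ) (F : Plane → ℝ) : Prop where
  integrable : Integrable a
  eq : ∀ x, invFourier a x = (F x : ℂ)

namespace Rep

variable {a b : Plane → ℂ} {F G : Plane → ℝ}

lemma congr (h : Rep a F) (hF : ∀ x, G x = F x) : Rep a G :=
  ⟨h.integrable, fun x => by rw [h.eq, hF]⟩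

lemma congr_left (h : Rep a F) (hF : ∀ x, b x = a x) : Rep b F := by
  have : b = a := funext hF
  rwa [this]

lemma add (ha : Rep a F) (hb : Rep b G) : Rep (fun ξ => a ξ + b ξ) (fun x => F x + G x) :=
  ⟨ha.integrable.add hb.integrable, fun x => by
    rw [invFourier_add ha.integrable hb.integrable, ha.eq, hb.eq]; push_cast; rfl⟩

lemma const_mul (c : ℝ) (ha : Rep a F) : Rep (fun ξ => (c : ℂ) * a ξ) (fun x => c * F x) :=
  ⟨ha.integrable.const_mul _, fun x => by
    rw [invFourier_const_mul, ha.eq]; push_cast; rfl⟩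

lemma mul (ha : Rep a F) (hb : Rep b G) : Rep (cv a b) (fun x => F x * G x) :=
  ⟨integrable_cv ha.integrable hb.integrable, fun x => by
    rw [invFourier_cv ha.integrable hb.integrable, ha.eq, hb.eq]; push_cast; rfl⟩

/-- Conjugation of the inverse transform conjugates and reflects the frequency function. Hermitian
symmetry is therefore what makes the function real, and every construction on the Fourier side has
to preserve it. -/
lemma of_hermitian (ha : Integrable a) (h : ∀ ξ, a (-ξ) = (starRingEnd ℂ) (a ξ)) :
    Rep a (fun x => (invFourier a x).re) := by
  refine ⟨ha, fun x => ?_⟩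
  have : (starRingEnd ℂ) (invFourier a x) = invFourier a x := by
    rw [invFourier_conj]; simp [h]
  exact (Complex.conj_eq_iff_re.1 this).symm

lemma continuous (h : Rep a F) : Continuous F := by
  have : F = fun x => (invFourier a x).re := by ext x; rw [h.eq]; simp
  rw [this]
  exact Complex.continuous_re.comp (continuous_invFourier h.integrable)

lemma abs_le (h : Rep a F) {w : Plane → ℝ} (hw : Integrable w) (haw : ∀ ξ, ‖a ξ‖ ≤ w ξ)
    (x : Plane) : |F x| ≤ cpi * ∫ ξ, w ξ := by
  have : |F x| = ‖invFourier a x‖ := by rw [h.eq]; simp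
  rw [this]
  refine (norm_invFourier_le a x).trans (mul_le_mul_of_nonneg_left ?_ cpi_pos.le)
  exact integral_mono h.integrable.norm hw haw

lemma memLp_two (h : Rep a F) {w : Plane → ℝ} (haw : ∀ ξ, ‖a ξ‖ ≤ w ξ)
    (hw : Integrable fun ξ => w ξ ^ 2) :
    MemLp F 2 ∧ eLpNorm F 2 volume ≤ ENNReal.ofReal (√(cpi * ∫ ξ, w ξ ^ 2)) := by
  obtain ⟨h1, h2⟩ := eLpNorm_invFourier_le h.integrable haw hw
  have e : eLpNorm F 2 volume = eLpNorm (invFourier a) 2 volume :=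
    eLpNorm_congr_norm_ae (Eventually.of_forall fun x => by rw [h.eq]; simp)
  refine ⟨⟨h.continuous.aestronglyMeasurable, ?_⟩, ?_⟩
  · rw [e]; exact h1.2
  · rw [e]; exact h2

lemma integral_mul (h : Rep a F) {η : Plane → ℝ} (hη : Integrable η) :
    ((∫ x, F x * η x : ℝ) : ℂ) = ∫ ξ, a ξ * invFourier (fun x => (η x : ℂ)) ξ := by
  rw [← integral_invFourier_mul h.integrable (b := fun x => (η x : ℂ)) hη.ofReal,
    ← integral_complex_ofReal]
  simp [h.eq]

lemma integral_mul_pderiv (h : Rep a F) {η : Plane → ℝ} (hη : IsTest η) (j : Fin 2) :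
    ((∫ x, F x * pderiv j η x : ℝ) : ℂ) =
      ∫ ξ, -(Complex.I * (ξ j : ℂ) * a ξ) * invFourier (fun x => (η x : ℂ)) ξ := by
  rw [h.integral_mul (hη.pderiv j).integrable]
  congr 1; ext ξ
  rw [invFourier_pderiv hη]; ring

lemma integral_mul_pderiv_pderiv (h : Rep a F) {η : Plane → ℝ} (hη : IsTest η) (j : Fin 2) :
    ((∫ x, F x * pderiv j (pderiv j η) x : ℝ) : ℂ) =
      ∫ ξ, -((ξ j : ℂ) ^ 2 * a ξ) * invFourier (fun x => (η x : ℂ)) ξ := by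
  rw [h.integral_mul ((hη.pderiv j).pderiv j).integrable]
  congr 1; ext ξ
  rw [invFourier_pderiv (hη.pderiv j), invFourier_pderiv hη]
  linear_combination (a ξ * (ξ j : ℂ) ^ 2 * invFourier (fun x => (η x : ℂ)) ξ) * Complex.I_sq

end Rep

/-! ### Weak gradients by components -/

lemma integral_plane_apply {h : Plane → Plane} (hh : Integrable h) (j : Fin 2) :
    (∫ x, h x) j = ∫ x, h x j :=
  ((EuclideanSpace.proj (𝕜 := ℝ) j : Plane →L[ℝ] ℝ).integral_comp_comm hh).symm

lemma IsTest.continuous_gradient {η : Plane → ℝ} (h : IsTest η) : Continuous (gradient η) := by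
  unfold gradient
  exact (InnerProductSpace.toDual ℝ Plane).symm.continuous.comp (h.1.continuous_fderiv (by simp))

lemma IsTest.hasCompactSupport_gradient {η : Plane → ℝ} (h : IsTest η) :
    HasCompactSupport (gradient η) := by
  unfold gradient
  exact (h.2.fderiv ℝ).comp_left (g := (InnerProductSpace.toDual ℝ Plane).symm) (by simp)

lemma HasWeakGradient.integral_mul_pderiv {u : Plane → ℝ} {g : Plane → Plane}
    (h : HasWeakGradient u g) {η : Plane → ℝ} (hη : IsTest η) (j : Fin 2) :
    ∫ x, u x * pderiv j η x = -∫ x, g x j * η x := by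
  have h1 : Integrable fun x => u x • gradient η x :=
    h.1.integrable_smul_right_of_hasCompactSupport hη.continuous_gradient
      hη.hasCompactSupport_gradient
  have h2 : Integrable fun x => η x • g x :=
    h.2.1.integrable_smul_left_of_hasCompactSupport hη.1.continuous hη.2
  have := congrArg (fun v : Plane => v j) (h.2.2 η hη)
  simp only [PiLp.neg_apply] at this
  rw [integral_plane_apply h1, integral_plane_apply h2] at this
  simpa [gradient_apply, mul_comm] using this

lemma hasWeakGradient_of_forall {u : Plane → ℝ} {g : Plane → Plane}
    (hu : LocallyIntegrable u) (hg : LocallyIntegrable g)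
    (h : ∀ η, IsTest η → ∀ j, ∫ x, u x * pderiv j η x = -∫ x, g x j * η x) :
    HasWeakGradient u g := by
  refine ⟨hu, hg, fun η hη => ?_⟩
  have h1 : Integrable fun x => u x • gradient η x :=
    hu.integrable_smul_right_of_hasCompactSupport hη.continuous_gradient
      hη.hasCompactSupport_gradient
  have h2 : Integrable fun x => η x • g x :=
    hg.integrable_smul_left_of_hasCompactSupport hη.1.continuous hη.2
  ext j
  rw [PiLp.neg_apply, integral_plane_apply h1, integral_plane_apply h2]
  simpa [gradient_apply, mul_comm] using h η hη j

lemma Rep.hasWeakGradient {a : Plane → ℂ} {F : Plane → ℝ} {G : Plane → Plane} (h : Rep a F)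
    (hG : ∀ j : Fin 2, Rep (fun ξ => Complex.I * (ξ j : ℂ) * a ξ) (fun x => G x j)) :
    HasWeakGradient F G := by
  have hGc : Continuous G := by
    have : G = fun x => WithLp.toLp 2 (fun j => G x j) := rfl
    rw [this]
    exact (PiLp.continuous_toLp 2 _).comp (continuous_pi fun j => (hG j).continuous)
  refine hasWeakGradient_of_forall h.continuous.locallyIntegrable hGc.locallyIntegrable ?_
  intro η hη j
  rw [← Complex.ofReal_inj, h.integral_mul_pderiv hη, Complex.ofReal_neg,
    (hG j).integral_mul hη.integrable, ← integral_neg]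
  simp only [neg_mul]

/-! ### Weights -/

/-- The weight `(1+|ξ|)⁻³`. -/
def decay (ξ : Plane) : ℝ := ((1 + ‖ξ‖) ^ 3)⁻¹

/-- The weight `(1+|ξ|)^{-5/2}`. -/
def slowDecay (ξ : Plane) : ℝ := ((1 + ‖ξ‖) ^ 2 * √(1 + ‖ξ‖))⁻¹

lemma decay_pos (ξ : Plane) : 0 < decay ξ := by unfold decay; positivity

lemma slowDecay_pos (ξ : Plane) : 0 < slowDecay ξ := by unfold slowDecay; positivity

lemma continuous_decay : Continuous decay := by
  unfold decay
  exact Continuous.inv₀ (by fun_prop) fun x => by positivity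

lemma continuous_slowDecay : Continuous slowDecay := by
  unfold slowDecay
  exact Continuous.inv₀ (by fun_prop) fun x => by positivity

lemma decay_le_one (ξ : Plane) : decay ξ ≤ 1 := by
  unfold decay
  exact inv_le_one_of_one_le₀ (one_le_pow₀ (by linarith [norm_nonneg ξ]))

lemma slowDecay_le_one (ξ : Plane) : slowDecay ξ ≤ 1 := by
  unfold slowDecay
  have h : 1 ≤ 1 + ‖ξ‖ := by linarith [norm_nonneg ξ]
  exact inv_le_one_of_one_le₀ (one_le_mul_of_one_le_of_one_le (one_le_pow₀ h) (Real.one_le_sqrt.2 h))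

lemma decay_le_slowDecay (ξ : Plane) : decay ξ ≤ slowDecay ξ := by
  unfold decay slowDecay
  have h : 1 ≤ 1 + ‖ξ‖ := by linarith [norm_nonneg ξ]
  refine inv_anti₀ (by positivity) ?_
  rw [pow_succ]
  refine mul_le_mul_of_nonneg_left ?_ (by positivity)
  rw [Real.sqrt_le_left (by positivity)]
  nlinarith

lemma sqrt_mul_decay (ξ : Plane) : √(1 + ‖ξ‖) * decay ξ = slowDecay ξ := by
  unfold decay slowDecay
  have h : √(1 + ‖ξ‖) ^ 2 = 1 + ‖ξ‖ := Real.sq_sqrt (by positivity)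
  have h0 : √(1 + ‖ξ‖) ≠ 0 := by positivity
  have h1 : (1 + ‖ξ‖) ≠ 0 := by positivity
  field_simp
  exact h

lemma integrable_slowDecay : Integrable slowDecay := by
  have := integrable_one_add_norm (E := Plane) (μ := volume) (r := 5 / 2)
    (by simp; norm_num)
  refine this.congr (Eventually.of_forall fun ξ => ?_)
  have h : 0 < 1 + ‖ξ‖ := by positivity
  simp only [slowDecay]
  rw [Real.rpow_neg h.le, Real.sqrt_eq_rpow, ← Real.rpow_natCast, ← Real.rpow_add h]
  norm_num

lemma integrable_decay : Integrable decay :=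
  integrable_slowDecay.mono' continuous_decay.aestronglyMeasurable
    (Eventually.of_forall fun ξ => by
      rw [Real.norm_of_nonneg (decay_pos ξ).le]; exact decay_le_slowDecay ξ)

/-- One of η and ξ-η carries at least half of 1+|ξ|, and the corresponding factor is then at most 8
times the weight at ξ. Integrated over η, this makes both weights stable under convolution. -/
lemma slowDecay_mul_decay_le (ξ η : Plane) :
    slowDecay η * decay (ξ - η) ≤ 8 * slowDecay ξ * (slowDecay η + decay (ξ - η)) := by
  have hc : 1 + ‖ξ‖ ≤ (1 + ‖η‖) + (1 + ‖ξ - η‖) := by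
    have : ‖ξ‖ ≤ ‖η‖ + ‖ξ - η‖ := by simpa using norm_add_le η (ξ - η)
    linarith
  have p1 := slowDecay_pos η
  have p2 := decay_pos (ξ - η)
  have p3 := slowDecay_pos ξ
  have h1 : 1 ≤ 1 + ‖ξ‖ := by linarith [norm_nonneg ξ]
  rcases le_total ((1 + ‖ξ‖) / 2) (1 + ‖η‖) with h | h
  · have : slowDecay η ≤ 8 * slowDecay ξ := by
      unfold slowDecay
      have e : √(1 + ‖ξ‖) / 2 ≤ √(1 + ‖η‖) := by
        rw [div_le_iff₀ (by norm_num), Real.sqrt_le_left (by positivity), mul_pow,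
          Real.sq_sqrt (by positivity)]
        linarith [norm_nonneg η]
      have e2 : (1 + ‖ξ‖) ^ 2 / 4 ≤ (1 + ‖η‖) ^ 2 := by nlinarith
      calc ((1 + ‖η‖) ^ 2 * √(1 + ‖η‖))⁻¹ ≤ ((1 + ‖ξ‖) ^ 2 / 4 * (√(1 + ‖ξ‖) / 2))⁻¹ := by
            refine inv_anti₀ (by positivity) ?_
            gcongr
        _ = 8 * ((1 + ‖ξ‖) ^ 2 * √(1 + ‖ξ‖))⁻¹ := by field_simp; norm_num
    nlinarith [mul_le_mul_of_nonneg_right this p2.le, mul_pos p3 p1]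
  · have hb : (1 + ‖ξ‖) / 2 ≤ 1 + ‖ξ - η‖ := by linarith
    have : decay (ξ - η) ≤ 8 * slowDecay ξ := by
      refine le_trans ?_ (mul_le_mul_of_nonneg_left (decay_le_slowDecay ξ) (by norm_num))
      unfold decay
      calc ((1 + ‖ξ - η‖) ^ 3)⁻¹ ≤ (((1 + ‖ξ‖) / 2) ^ 3)⁻¹ := by
            refine inv_anti₀ (by positivity) ?_
            gcongr
        _ = 8 * ((1 + ‖ξ‖) ^ 3)⁻¹ := by field_simp; norm_num
    nlinarith [mul_le_mul_of_nonneg_left this p1.le, mul_pos p3 p2]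

lemma decay_mul_decay_le (ξ η : Plane) :
    decay η * decay (ξ - η) ≤ 8 * decay ξ * (decay η + decay (ξ - η)) := by
  have hc : 1 + ‖ξ‖ ≤ (1 + ‖η‖) + (1 + ‖ξ - η‖) := by
    have : ‖ξ‖ ≤ ‖η‖ + ‖ξ - η‖ := by simpa using norm_add_le η (ξ - η)
    linarith
  unfold decay
  have ha : 0 < 1 + ‖η‖ := by positivity
  have hb : 0 < 1 + ‖ξ - η‖ := by positivity
  have hx : 0 < 1 + ‖ξ‖ := by positivity
  set a := 1 + ‖η‖
  set b := 1 + ‖ξ - η‖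
  set c := 1 + ‖ξ‖
  have h3 : c ^ 3 ≤ 8 * (a ^ 3 + b ^ 3) := by
    have : c ^ 3 ≤ (a + b) ^ 3 := by gcongr
    nlinarith [mul_nonneg (add_pos ha hb).le (sq_nonneg (a - b)), pow_pos ha 3, pow_pos hb 3]
  have e : 8 * (c ^ 3)⁻¹ * ((a ^ 3)⁻¹ + (b ^ 3)⁻¹) =
      (8 * (a ^ 3 + b ^ 3)) * (c ^ 3)⁻¹ * ((a ^ 3)⁻¹ * (b ^ 3)⁻¹) := by
    field_simp; ring
  rw [e]
  have : 1 ≤ (8 * (a ^ 3 + b ^ 3)) * (c ^ 3)⁻¹ := by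
    rw [← div_eq_mul_inv, le_div_iff₀ (by positivity)]; linarith
  exact le_mul_of_one_le_left (by positivity) this

/-- The triangle inequality multiplies equal exponentials into the same exponential. A mixed product
decays at least at the smaller of the two rates, so it is bounded by the sum of both profiles. -/
lemma exp_profile_mul_le {N M p q r₁ r₂ r : ℝ} (hN : 0 ≤ N) (hM : 0 ≤ M) (hp : 0 ≤ p)
    (hq : 0 ≤ q) (h1 : 0 ≤ r₁) (h2 : 0 ≤ r₂) (hr : r ≤ r₁ + r₂) :
    (N * Real.exp (-(p * r₁)) + M * Real.exp (-(q * r₁))) *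
        (N * Real.exp (-(p * r₂)) + M * Real.exp (-(q * r₂))) ≤
      2 * (N + M) * (N * Real.exp (-(p * r)) + M * Real.exp (-(q * r))) := by
  have a1 : Real.exp (-(p * r₁)) * Real.exp (-(p * r₂)) ≤ Real.exp (-(p * r)) := by
    rw [← Real.exp_add]; apply Real.exp_le_exp.2; nlinarith
  have a2 : Real.exp (-(q * r₁)) * Real.exp (-(q * r₂)) ≤ Real.exp (-(q * r)) := by
    rw [← Real.exp_add]; apply Real.exp_le_exp.2; nlinarith
  have a3 : Real.exp (-(p * r₁)) * Real.exp (-(q * r₂)) ≤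
      Real.exp (-(p * r)) + Real.exp (-(q * r)) := by
    rw [← Real.exp_add]
    rcases le_total p q with h | h
    · refine le_trans (Real.exp_le_exp.2 ?_) (le_add_of_nonneg_right (Real.exp_pos _).le)
      nlinarith
    · refine le_trans (Real.exp_le_exp.2 ?_) (le_add_of_nonneg_left (Real.exp_pos _).le)
      nlinarith
  have a4 : Real.exp (-(q * r₁)) * Real.exp (-(p * r₂)) ≤
      Real.exp (-(p * r)) + Real.exp (-(q * r)) := by
    rw [← Real.exp_add]
    rcases le_total p q with h | h
    · refine le_trans (Real.exp_le_exp.2 ?_) (le_add_of_nonneg_right (Real.exp_pos _).le)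
      nlinarith
    · refine le_trans (Real.exp_le_exp.2 ?_) (le_add_of_nonneg_left (Real.exp_pos _).le)
      nlinarith
  have b1 := mul_le_mul_of_nonneg_left a1 (mul_nonneg hN hN)
  have b2 := mul_le_mul_of_nonneg_left a2 (mul_nonneg hM hM)
  have b3 := mul_le_mul_of_nonneg_left a3 (mul_nonneg hN hM)
  have b4 := mul_le_mul_of_nonneg_left a4 (mul_nonneg hN hM)
  have e1 := (Real.exp_pos (-(p * r))).le
  have e2 := (Real.exp_pos (-(q * r))).le
  nlinarith [mul_nonneg (mul_nonneg hN hN) e1, mul_nonneg (mul_nonneg hM hM) e2]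

/-- For s ≤ 1 the integral of `decay` suffices. For s ≥ 1 the weight is dropped and the dilation by
s in two dimensions gives s⁻². This is the source of the quadratic decay in time. -/
lemma exists_integral_decay_mul_exp_le {c : ℝ} (hc : 0 < c) :
    ∃ C > 0, ∀ s, 0 ≤ s → Integrable (fun ξ => decay ξ * Real.exp (-(c * s * ‖ξ‖))) ∧
      ∫ ξ, decay ξ * Real.exp (-(c * s * ‖ξ‖)) ≤ C / (1 + s) ^ 2 := by
  have hint : ∀ s, 0 ≤ s → Integrable (fun ξ => decay ξ * Real.exp (-(c * s * ‖ξ‖))) := by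
    intro s hs
    refine integrable_decay.mono' ?_ (Eventually.of_forall fun ξ => ?_)
    · exact (continuous_decay.mul (by fun_prop)).aestronglyMeasurable
    · rw [Real.norm_of_nonneg (mul_nonneg (decay_pos ξ).le (Real.exp_pos _).le)]
      refine mul_le_of_le_one_right (decay_pos ξ).le (Real.exp_le_one_iff.2 ?_)
      simp; positivity
  have hexp : ∀ ξ : Plane, Real.exp (-(c * ‖ξ‖)) ≤ (1 + 6 / c ^ 3 * Real.exp c) * decay ξ := by
    intro ξ
    have hx : 0 ≤ c * (1 + ‖ξ‖) := by positivity
    have h1 := Real.pow_div_factorial_le_exp (c * (1 + ‖ξ‖)) hx 3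
    have e : Real.exp (-(c * ‖ξ‖)) = Real.exp c * (Real.exp (c * (1 + ‖ξ‖)))⁻¹ := by
      rw [← Real.exp_neg, ← Real.exp_add]; congr 1; ring
    rw [e]
    -- The cubic term of the exponential series already dominates (1+|ξ|)³.
    have h2 : (Real.exp (c * (1 + ‖ξ‖)))⁻¹ ≤ 6 / c ^ 3 * decay ξ := by
      unfold decay
      refine (inv_anti₀ (by positivity) h1).trans_eq ?_
      norm_num [Nat.factorial]
      field_simp
    have h3 := mul_le_mul_of_nonneg_left h2 (Real.exp_pos c).le
    have := decay_pos ξ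
    nlinarith
  have hint2 : Integrable fun ξ : Plane => Real.exp (-(c * ‖ξ‖)) := by
    refine (integrable_decay.const_mul (1 + 6 / c ^ 3 * Real.exp c)).mono'
      (Continuous.aestronglyMeasurable (by fun_prop)) (Eventually.of_forall fun ξ => ?_)
    rw [Real.norm_of_nonneg (Real.exp_pos _).le]
    exact hexp ξ
  set A := ∫ ξ, decay ξ
  set B := ∫ ξ : Plane, Real.exp (-(c * ‖ξ‖))
  have hA : 0 ≤ A := integral_nonneg fun ξ => (decay_pos ξ).le
  have hB : 0 ≤ B := integral_nonneg fun ξ => (Real.exp_pos _).le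
  refine ⟨4 * A + 4 * B + 1, by positivity, fun s hs => ⟨hint s hs, ?_⟩⟩
  rw [le_div_iff₀ (by positivity)]
  rcases le_total s 1 with h | h
  · have : ∫ ξ, decay ξ * Real.exp (-(c * s * ‖ξ‖)) ≤ A := by
      refine integral_mono (hint s hs) integrable_decay fun ξ => ?_
      refine mul_le_of_le_one_right (decay_pos ξ).le (Real.exp_le_one_iff.2 ?_)
      simp; positivity
    have h4 : (1 + s) ^ 2 ≤ 4 := by nlinarith
    have h0 : 0 ≤ ∫ ξ, decay ξ * Real.exp (-(c * s * ‖ξ‖)) :=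
      integral_nonneg fun ξ => mul_nonneg (decay_pos ξ).le (Real.exp_pos _).le
    nlinarith [mul_le_mul this h4 (by positivity) hA]
  · have hs0 : 0 < s := by linarith
    have key := Measure.integral_comp_smul (volume : Measure Plane)
      (fun ξ => Real.exp (-(c * ‖ξ‖))) s
    simp only [finrank_euclideanSpace, Fintype.card_fin, norm_smul, Real.norm_of_nonneg hs,
      smul_eq_mul] at key
    rw [abs_of_pos (by positivity)] at key
    have hi : Integrable fun ξ : Plane => Real.exp (-(c * s * ‖ξ‖)) := by
      have := hint2.comp_smul hs0.ne'
      simpa [norm_smul, abs_of_pos hs0, mul_assoc] using this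
    have : ∫ ξ, decay ξ * Real.exp (-(c * s * ‖ξ‖)) ≤ (s ^ 2)⁻¹ * B := by
      rw [← key]
      refine (integral_mono (hint s hs) hi fun ξ => ?_).trans_eq (by simp [mul_assoc])
      exact mul_le_of_le_one_left (Real.exp_pos _).le (decay_le_one ξ)
    have h4 : (1 + s) ^ 2 ≤ 4 * s ^ 2 := by nlinarith
    calc (∫ ξ, decay ξ * Real.exp (-(c * s * ‖ξ‖))) * (1 + s) ^ 2
        ≤ ((s ^ 2)⁻¹ * B) * (4 * s ^ 2) := by gcongr
      _ = 4 * B := by field_simp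
      _ ≤ _ := by linarith

/-! ### The linear two-point boundary value problem for one frequency -/

/-- The solution at time `t` of `x' = -l x + a`, `x(0) = 0`. -/
def duhamel (l : ℂ) (a : ℝ → ℂ) (t : ℝ) : ℂ :=
  ∫ s in (0 : ℝ)..t, Complex.exp (-(l * (t - s : ℝ))) * a s

/-- The negative of the solution at time `t` of `y' = l y + b`, `y(T) = 0`. -/
def backDuhamel (l : ℂ) (b : ℝ → ℂ) (T t : ℝ) : ℂ :=
  ∫ s in t..T, Complex.exp (-(l * (s - t : ℝ))) * b s

lemma norm_cexp_neg_mul (l : ℂ) (t : ℝ) : ‖Complex.exp (-(l * (t : ℂ)))‖ = Real.exp (-(l.re * t)) := by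
  rw [Complex.norm_exp]; simp

/-- The kernel decays at rate Re l, while the weight loses at most e^{ρ(t-s)} between s and t. The
remaining rate is at least κL, so integrating in time divides by κL and removes the factor L of the
forcing. -/
lemma norm_duhamel_le {l : ℂ} {a : ℝ → ℂ} {g : ℝ → ℝ} {t κ L θ ρ : ℝ} (ht : 0 ≤ t)
    (hκ : 0 < κ) (hL : 0 ≤ L) (hθ : 0 ≤ θ) (hg0 : 0 ≤ g t)
    (ha : ∀ s ∈ Icc 0 t, ‖a s‖ ≤ θ * L * g s)
    (hg : ∀ s ∈ Icc 0 t, g s ≤ Real.exp (ρ * (t - s)) * g t) (hl : κ * L ≤ l.re - ρ) :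
    ‖duhamel l a t‖ ≤ θ / κ * g t := by
  have hprim : ∀ s, HasDerivAt (fun s : ℝ => θ / κ * g t * Real.exp (-(κ * L * (t - s))))
      (θ * L * g t * Real.exp (-(κ * L * (t - s)))) s := by
    intro s
    have h1 : HasDerivAt (fun s : ℝ => -(κ * L * (t - s))) (κ * L) s := by
      have := (((hasDerivAt_id s).const_sub t).const_mul (κ * L)).fun_neg
      simpa using this
    have := h1.exp.const_mul (θ / κ * g t)
    refine this.congr_deriv ?_
    field_simp
  have hcont : Continuous fun s => θ * L * g t * Real.exp (-(κ * L * (t - s))) := by fun_prop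
  have hint := intervalIntegral.integral_eq_sub_of_hasDerivAt (fun s _ => hprim s)
    (hcont.intervalIntegrable 0 t)
  have hle : ‖duhamel l a t‖ ≤ ∫ s in (0 : ℝ)..t, θ * L * g t * Real.exp (-(κ * L * (t - s))) := by
    refine intervalIntegral.norm_integral_le_of_norm_le ht (Eventually.of_forall fun s hs => ?_)
      (hcont.intervalIntegrable 0 t)
    have hs' : s ∈ Icc 0 t := ⟨hs.1.le, hs.2⟩
    rw [norm_mul, norm_cexp_neg_mul]
    have e1 : ‖a s‖ ≤ θ * L * (Real.exp (ρ * (t - s)) * g t) :=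
      (ha s hs').trans (mul_le_mul_of_nonneg_left (hg s hs') (by positivity))
    refine (mul_le_mul_of_nonneg_left e1 (Real.exp_pos _).le).trans ?_
    have e2 : Real.exp (-(l.re * (t - s))) * Real.exp (ρ * (t - s)) ≤
        Real.exp (-(κ * L * (t - s))) := by
      rw [← Real.exp_add]
      apply Real.exp_le_exp.2
      nlinarith [sub_nonneg.2 hs.2]
    calc _ = θ * L * g t * (Real.exp (-(l.re * (t - s))) * Real.exp (ρ * (t - s))) := by ring
      _ ≤ _ := mul_le_mul_of_nonneg_left e2 (by positivity)
  refine hle.trans ?_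
  rw [hint]
  simp only [sub_self, mul_zero, neg_zero, Real.exp_zero, mul_one]
  have : 0 ≤ θ / κ * g t * Real.exp (-(κ * L * (t - 0))) := by positivity
  linarith

/-- Time reversal, so that the estimates and the derivative need proof only for the forward problem.
-/
lemma backDuhamel_eq (l : ℂ) (b : ℝ → ℂ) (T t : ℝ) :
    backDuhamel l b T t = duhamel l (fun s => b (T - s)) (T - t) := by
  have := intervalIntegral.integral_comp_sub_left (a := 0) (b := T - t)
    (fun s => Complex.exp (-(l * (s - t : ℝ))) * b s) T
  rw [backDuhamel, duhamel]
  simp only [sub_sub_cancel, sub_zero] at this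
  rw [← this]
  congr 1; ext s
  congr 4; push_cast; ring

lemma hasDerivAt_duhamel {l : ℂ} {a : ℝ → ℂ} (ha : Continuous a) (t : ℝ) :
    HasDerivAt (duhamel l a) (-l * duhamel l a t + a t) t := by
  have e : duhamel l a = fun t : ℝ => Complex.exp (-l * (t : ℂ)) *
      ∫ s in (0 : ℝ)..t, Complex.exp (l * (s : ℂ)) * a s := by
    ext t
    rw [duhamel, ← intervalIntegral.integral_const_mul]
    congr 1; ext s
    rw [← mul_assoc, ← Complex.exp_add]
    congr 2; push_cast; ring
  have hc : Continuous fun s : ℝ => Complex.exp (l * (s : ℂ)) * a s := by fun_prop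
  have h1 : HasDerivAt (fun t : ℝ => ∫ s in (0 : ℝ)..t, Complex.exp (l * (s : ℂ)) * a s)
      (Complex.exp (l * (t : ℂ)) * a t) t :=
    intervalIntegral.integral_hasDerivAt_right (hc.intervalIntegrable _ _)
      (hc.stronglyMeasurableAtFilter _ _) hc.continuousAt
  have h2 : HasDerivAt (fun t : ℝ => Complex.exp (-l * (t : ℂ)))
      (Complex.exp (-l * (t : ℂ)) * (-l * 1)) t :=
    ((Complex.ofRealCLM.hasDerivAt (x := t)).const_mul (-l)).cexp
  have h3 := h2.mul h1
  rw [e]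
  refine h3.congr_deriv ?_
  have : Complex.exp (-l * (t : ℂ)) * Complex.exp (l * (t : ℂ)) = 1 := by
    rw [← Complex.exp_add]; simp
  simp only []
  linear_combination a t * this

lemma hasDerivAt_backDuhamel {l : ℂ} {b : ℝ → ℂ} (hb : Continuous b) (T t : ℝ) :
    HasDerivAt (backDuhamel l b T) (l * backDuhamel l b T t - b t) t := by
  have e : backDuhamel l b T = fun t => duhamel l (fun s => b (T - s)) (T - t) :=
    funext (backDuhamel_eq l b T)
  have h := hasDerivAt_duhamel (l := l) (a := fun s => b (T - s)) (by fun_prop) (T - t)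
  have h2 := h.scomp t ((hasDerivAt_id t).const_sub T)
  rw [e]
  refine h2.congr_deriv ?_
  simp
  ring

/-! ### Diagonalisation of the system for one frequency -/

/-- The coefficients of the system `ψ' = (i·om - d) ψ - α v + A₁`, `v' = (i·om + d) v - γ ψ + A₂`,
where `μ² = d² + α γ`. -/
structure Mode where
  om : ℝ
  α : ℝ
  γ : ℝ
  d : ℂ
  μ : ℂ

namespace Mode

variable (c : Mode)

/-- The substitution ψ = x - q y, v = p x + y diagonalises the system: x' = -λx + fwd and y' = νy +
bwd, with λ = μ - iω and ν = μ + iω. When Re μ > 0, x is stable forwards in time and y backwards. -/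
def p : ℂ := c.γ / (c.d + c.μ)
def q : ℂ := c.α / (c.d + c.μ)
def lam : ℂ := c.μ - Complex.I * c.om
def nu : ℂ := c.μ + Complex.I * c.om
def fwd (A₁ A₂ : ℝ → ℂ) (s : ℝ) : ℂ := (A₁ s + c.q * A₂ s) / (1 + c.p * c.q)
def bwd (A₁ A₂ : ℝ → ℂ) (s : ℝ) : ℂ := (A₂ s - c.p * A₁ s) / (1 + c.p * c.q)
def det (T : ℝ) : ℂ := 1 + c.p * c.q * Complex.exp (-(2 * c.μ * T))

/-- The value x(0), found by inserting y(T) = v(T) - p x(T) and the two Duhamel formulas into x(0) =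
ψ₀ + q y(0). The coefficient of x(0) in the resulting equation is `det`. -/
def x0 (T : ℝ) (ψ₀ vT : ℂ) (A₁ A₂ : ℝ → ℂ) : ℂ :=
  (ψ₀ - c.q * backDuhamel c.nu (c.bwd A₁ A₂) T 0
    + c.q * Complex.exp (-(c.nu * T)) * (vT - c.p * duhamel c.lam (c.fwd A₁ A₂) T)) / c.det T

def yT (T : ℝ) (ψ₀ vT : ℂ) (A₁ A₂ : ℝ → ℂ) : ℂ :=
  vT - c.p * (Complex.exp (-(c.lam * T)) * c.x0 T ψ₀ vT A₁ A₂ + duhamel c.lam (c.fwd A₁ A₂) T)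

def x (T : ℝ) (ψ₀ vT : ℂ) (A₁ A₂ : ℝ → ℂ) (t : ℝ) : ℂ :=
  Complex.exp (-(c.lam * t)) * c.x0 T ψ₀ vT A₁ A₂ + duhamel c.lam (c.fwd A₁ A₂) t

def y (T : ℝ) (ψ₀ vT : ℂ) (A₁ A₂ : ℝ → ℂ) (t : ℝ) : ℂ :=
  Complex.exp (-(c.nu * (T - t : ℝ))) * c.yT T ψ₀ vT A₁ A₂ - backDuhamel c.nu (c.bwd A₁ A₂) T t

/-- The first component of the solution. -/
def solψ (T : ℝ) (ψ₀ vT : ℂ) (A₁ A₂ : ℝ → ℂ) (t : ℝ) : ℂ :=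
  c.x T ψ₀ vT A₁ A₂ t - c.q * c.y T ψ₀ vT A₁ A₂ t

/-- The second component of the solution. -/
def solv (T : ℝ) (ψ₀ vT : ℂ) (A₁ A₂ : ℝ → ℂ) (t : ℝ) : ℂ :=
  c.p * c.x T ψ₀ vT A₁ A₂ t + c.y T ψ₀ vT A₁ A₂ t

/-- Bounds for the coefficients: `ρ` is the growth rate of the weights and `L` the size of the
forcing. -/
structure Admissible (C κ ρ L : ℝ) : Prop where
  C_nonneg : 0 ≤ C
  L_nonneg : 0 ≤ L
  α_nonneg : 0 ≤ c.α
  γ_nonneg : 0 ≤ c.γ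
  sq : c.μ ^ 2 = c.d ^ 2 + c.α * c.γ
  re_pos : 0 < c.μ.re
  d_re : 0 ≤ c.d.re
  angle : 0 ≤ c.μ.re * c.d.re + c.μ.im * c.d.im
  d_le : ‖c.d‖ ≤ C * c.μ.re
  μ_le : ‖c.μ‖ ≤ 2 * c.μ.re
  α_le : c.α ≤ C * c.μ.re
  γ_le : c.γ ≤ C * c.μ.re
  gap : κ * L ≤ c.μ.re - ρ

namespace Admissible

variable {c : Mode} {C κ ρ L : ℝ} (h : c.Admissible C κ ρ L)
include h

lemma re_le_norm : c.μ.re ≤ ‖c.d + c.μ‖ := by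
  refine le_trans ?_ (Complex.re_le_norm _)
  simp [h.d_re]

lemma sum_ne_zero : c.d + c.μ ≠ 0 := norm_pos_iff.1 (h.re_pos.trans_le h.re_le_norm)

lemma μ_ne_zero : c.μ ≠ 0 := fun h0 => by have := h.re_pos; simp [h0] at this

lemma norm_p_le : ‖c.p‖ ≤ C := by
  rw [p, norm_div, Complex.norm_real, Real.norm_of_nonneg h.γ_nonneg,
    div_le_iff₀ (h.re_pos.trans_le h.re_le_norm)]
  exact h.γ_le.trans (mul_le_mul_of_nonneg_left h.re_le_norm h.C_nonneg)

lemma norm_q_le : ‖c.q‖ ≤ C := by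
  rw [q, norm_div, Complex.norm_real, Real.norm_of_nonneg h.α_nonneg,
    div_le_iff₀ (h.re_pos.trans_le h.re_le_norm)]
  exact h.α_le.trans (mul_le_mul_of_nonneg_left h.re_le_norm h.C_nonneg)

lemma pq_eq : c.p * c.q = (c.μ - c.d) / (c.d + c.μ) := by
  have := h.sum_ne_zero
  rw [p, q]
  field_simp
  linear_combination -h.sq

lemma one_add_pq : 1 + c.p * c.q = 2 * c.μ / (c.d + c.μ) := by
  have := h.sum_ne_zero
  rw [h.pq_eq]
  field_simp
  ring

lemma one_add_pq_ne_zero : 1 + c.p * c.q ≠ 0 := by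
  rw [h.one_add_pq]
  exact div_ne_zero (mul_ne_zero two_ne_zero h.μ_ne_zero) h.sum_ne_zero

/-- Here pq = (μ-d)/(μ+d), and `angle` says Re(μ d̄) ≥ 0, so that μ is at least as close to d as to
-d. -/
lemma norm_pq_le : ‖c.p * c.q‖ ≤ 1 := by
  rw [h.pq_eq, norm_div, div_le_one (h.re_pos.trans_le h.re_le_norm)]
  rw [Complex.norm_def, Complex.norm_def]
  apply Real.sqrt_le_sqrt
  simp only [Complex.normSq_apply, Complex.sub_re, Complex.sub_im, Complex.add_re, Complex.add_im]
  nlinarith [h.angle]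

lemma norm_sum_le : ‖c.d + c.μ‖ ≤ (2 + C) * c.μ.re :=
  (norm_add_le _ _).trans (by linarith [h.d_le, h.μ_le])

lemma norm_one_add_pq_ge : 2 / (2 + C) ≤ ‖1 + c.p * c.q‖ := by
  have hC := h.C_nonneg
  rw [h.one_add_pq, norm_div, norm_mul, Complex.norm_ofNat,
    div_le_div_iff₀ (by linarith) (h.re_pos.trans_le h.re_le_norm)]
  have := h.norm_sum_le
  have h2 := Complex.re_le_norm c.μ
  nlinarith

omit h in
-- If Re μ·T is small, then det is close to 1 + pq = 2μ/(d+μ), which is bounded below. Otherwise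
-- |pq| ≤ 1 and the exponential is bounded by a constant less than 1. Neither bound depends on the
-- mode or on T.
lemma exists_det_lower_bound (hC : 0 ≤ C) : ∃ η > 0, ∀ (c : Mode) (κ ρ L T : ℝ),
    c.Admissible C κ ρ L → 0 ≤ T → η ≤ ‖c.det T‖ := by
  -- Below this threshold the exponential differs from 1 by at most 8s₀ = 1/(2+C), half of the lower
  -- bound 2/(2+C) for |1+pq|.
  set s₀ : ℝ := 1 / (8 * (2 + C)) with hs₀
  have hs₀p : 0 < s₀ := by positivity
  have hs₀1 : 8 * s₀ * (2 + C) = 1 := by rw [hs₀]; field_simp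
  have hexp : Real.exp (-(2 * s₀)) < 1 := by rw [Real.exp_lt_one_iff]; linarith
  refine ⟨min (1 / (2 + C)) (1 - Real.exp (-(2 * s₀))), lt_min (by positivity) (by linarith), ?_⟩
  intro c κ ρ L T h hT
  have hpq := h.norm_pq_le
  rcases le_total (c.μ.re * T) s₀ with hs | hs
  · refine (min_le_left _ _).trans ?_
    have hz : ‖-(2 * c.μ * (T : ℂ))‖ ≤ 4 * s₀ := by
      rw [norm_neg, norm_mul, norm_mul, Complex.norm_real, Real.norm_of_nonneg hT]
      simp only [Complex.norm_ofNat]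
      nlinarith [mul_le_mul_of_nonneg_right h.μ_le hT]
    have hz1 : ‖-(2 * c.μ * (T : ℂ))‖ ≤ 1 := by nlinarith
    have h1 := Complex.norm_exp_sub_one_le hz1
    have e : c.det T = (1 + c.p * c.q) + c.p * c.q * (Complex.exp (-(2 * c.μ * T)) - 1) := by
      rw [det]; ring
    have h2 : ‖c.p * c.q * (Complex.exp (-(2 * c.μ * T)) - 1)‖ ≤ 8 * s₀ := by
      rw [norm_mul]
      calc _ ≤ 1 * (2 * (4 * s₀)) := by
            refine mul_le_mul hpq (h1.trans ?_) (norm_nonneg _) zero_le_one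
            linarith
        _ = 8 * s₀ := by ring
    have h3 := h.norm_one_add_pq_ge
    have h4 : ‖1 + c.p * c.q‖ ≤ ‖c.det T‖ + ‖c.p * c.q * (Complex.exp (-(2 * c.μ * T)) - 1)‖ := by
      have : 1 + c.p * c.q = c.det T - c.p * c.q * (Complex.exp (-(2 * c.μ * T)) - 1) := by
        rw [e]; ring
      rw [this]; exact norm_sub_le _ _
    have h5 : 8 * s₀ = 1 / (2 + C) := by rw [hs₀]; field_simp
    have h6 : 2 / (2 + C) = 1 / (2 + C) + 1 / (2 + C) := by ring
    linarith
  · refine (min_le_right _ _).trans ?_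
    have h1 : ‖Complex.exp (-(2 * c.μ * T))‖ ≤ Real.exp (-(2 * s₀)) := by
      rw [Complex.norm_exp]
      apply Real.exp_le_exp.2
      simp
      nlinarith
    have h2 : ‖c.p * c.q * Complex.exp (-(2 * c.μ * T))‖ ≤ Real.exp (-(2 * s₀)) := by
      rw [norm_mul]
      calc _ ≤ 1 * Real.exp (-(2 * s₀)) := mul_le_mul hpq h1 (norm_nonneg _) zero_le_one
        _ = _ := one_mul _
    have h3 : ‖(1 : ℂ)‖ ≤ ‖c.det T‖ + ‖c.p * c.q * Complex.exp (-(2 * c.μ * T))‖ := by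
      have : (1 : ℂ) = c.det T - c.p * c.q * Complex.exp (-(2 * c.μ * T)) := by rw [det]; ring
      conv_lhs => rw [this]
      exact norm_sub_le _ _
    rw [norm_one] at h3
    linarith

lemma det_ne_zero {T : ℝ} (hT : 0 ≤ T) : c.det T ≠ 0 := by
  obtain ⟨η, hη, hd⟩ := exists_det_lower_bound h.C_nonneg
  exact norm_pos_iff.1 (hη.trans_le (hd c κ ρ L T h hT))

end Admissible

end Mode

namespace Mode

lemma continuous_fwd (c : Mode) {A₁ A₂ : ℝ → ℂ} (h1 : Continuous A₁) (h2 : Continuous A₂) :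
    Continuous (c.fwd A₁ A₂) := by unfold fwd; fun_prop

lemma continuous_bwd (c : Mode) {A₁ A₂ : ℝ → ℂ} (h1 : Continuous A₁) (h2 : Continuous A₂) :
    Continuous (c.bwd A₁ A₂) := by unfold bwd; fun_prop

lemma hasDerivAt_x (c : Mode) (T : ℝ) (ψ₀ vT : ℂ) {A₁ A₂ : ℝ → ℂ} (h1 : Continuous A₁)
    (h2 : Continuous A₂) (t : ℝ) :
    HasDerivAt (c.x T ψ₀ vT A₁ A₂) (-c.lam * c.x T ψ₀ vT A₁ A₂ t + c.fwd A₁ A₂ t) t := by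
  have e : HasDerivAt (fun t : ℝ => Complex.exp (-(c.lam * (t : ℂ))))
      (Complex.exp (-(c.lam * (t : ℂ))) * (-(c.lam * 1))) t :=
    ((Complex.ofRealCLM.hasDerivAt (x := t)).const_mul c.lam).fun_neg.cexp
  have := (e.mul_const (c.x0 T ψ₀ vT A₁ A₂)).add
    (hasDerivAt_duhamel (l := c.lam) (c.continuous_fwd h1 h2) t)
  refine this.congr_deriv ?_
  simp only [x]; ring

lemma hasDerivAt_y (c : Mode) (T : ℝ) (ψ₀ vT : ℂ) {A₁ A₂ : ℝ → ℂ} (h1 : Continuous A₁)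
    (h2 : Continuous A₂) (t : ℝ) :
    HasDerivAt (c.y T ψ₀ vT A₁ A₂) (c.nu * c.y T ψ₀ vT A₁ A₂ t + c.bwd A₁ A₂ t) t := by
  have e0 : HasDerivAt (fun t : ℝ => ((T - t : ℝ) : ℂ)) (-1) t := by
    have := ((hasDerivAt_id t).const_sub T).ofReal_comp
    simpa using this
  have e : HasDerivAt (fun t : ℝ => Complex.exp (-(c.nu * ((T - t : ℝ) : ℂ))))
      (Complex.exp (-(c.nu * ((T - t : ℝ) : ℂ))) * (-(c.nu * -1))) t :=
    (e0.const_mul c.nu).fun_neg.cexp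
  have := (e.mul_const (c.yT T ψ₀ vT A₁ A₂)).sub
    (hasDerivAt_backDuhamel (l := c.nu) (c.continuous_bwd h1 h2) T t)
  refine this.congr_deriv ?_
  simp only [y]; ring

namespace Admissible

variable {c : Mode} {C κ ρ L : ℝ} (h : c.Admissible C κ ρ L)
include h

lemma fwd_sub_bwd (A₁ A₂ : ℝ → ℂ) (t : ℝ) : c.fwd A₁ A₂ t - c.q * c.bwd A₁ A₂ t = A₁ t := by
  rw [fwd, bwd, mul_div_assoc', ← sub_div, div_eq_iff h.one_add_pq_ne_zero]; ring

lemma fwd_add_bwd (A₁ A₂ : ℝ → ℂ) (t : ℝ) : c.p * c.fwd A₁ A₂ t + c.bwd A₁ A₂ t = A₂ t := by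
  rw [fwd, bwd, mul_div_assoc', ← add_div, div_eq_iff h.one_add_pq_ne_zero]; ring

lemma alpha_mul_p : (c.α : ℂ) * c.p = c.μ - c.d := by
  have := h.sum_ne_zero
  rw [p]; field_simp; linear_combination -h.sq

lemma gamma_mul_q : (c.γ : ℂ) * c.q = c.μ - c.d := by
  have := h.sum_ne_zero
  rw [q]; field_simp; linear_combination -h.sq

lemma q_mul : c.q * (c.d + c.μ) = c.α := by
  have := h.sum_ne_zero
  rw [q]; field_simp

lemma p_mul : c.p * (c.d + c.μ) = c.γ := by
  have := h.sum_ne_zero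
  rw [p]; field_simp

lemma hasDerivAt_solψ (T : ℝ) (ψ₀ vT : ℂ) {A₁ A₂ : ℝ → ℂ} (h1 : Continuous A₁)
    (h2 : Continuous A₂) (t : ℝ) :
    HasDerivAt (c.solψ T ψ₀ vT A₁ A₂) ((Complex.I * c.om - c.d) * c.solψ T ψ₀ vT A₁ A₂ t
      - c.α * c.solv T ψ₀ vT A₁ A₂ t + A₁ t) t := by
  have := (c.hasDerivAt_x T ψ₀ vT h1 h2 t).sub
    ((c.hasDerivAt_y T ψ₀ vT h1 h2 t).const_mul c.q)
  refine this.congr_deriv ?_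
  simp only [solψ, solv]
  have e1 := h.fwd_sub_bwd A₁ A₂ t
  have e2 := h.alpha_mul_p
  have e3 := h.q_mul
  simp only [lam, nu]
  linear_combination e1 + e2 * c.x T ψ₀ vT A₁ A₂ t - e3 * c.y T ψ₀ vT A₁ A₂ t

lemma hasDerivAt_solv (T : ℝ) (ψ₀ vT : ℂ) {A₁ A₂ : ℝ → ℂ} (h1 : Continuous A₁)
    (h2 : Continuous A₂) (t : ℝ) :
    HasDerivAt (c.solv T ψ₀ vT A₁ A₂) ((Complex.I * c.om + c.d) * c.solv T ψ₀ vT A₁ A₂ t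
      - c.γ * c.solψ T ψ₀ vT A₁ A₂ t + A₂ t) t := by
  have := ((c.hasDerivAt_x T ψ₀ vT h1 h2 t).const_mul c.p).add
    (c.hasDerivAt_y T ψ₀ vT h1 h2 t)
  refine this.congr_deriv ?_
  simp only [solψ, solv]
  have e1 := h.fwd_add_bwd A₁ A₂ t
  have e2 := h.gamma_mul_q
  have e3 := h.p_mul
  simp only [lam, nu]
  linear_combination e1 - e2 * c.y T ψ₀ vT A₁ A₂ t - e3 * c.x T ψ₀ vT A₁ A₂ t

omit h in
lemma duhamel_zero (l : ℂ) (a : ℝ → ℂ) : duhamel l a 0 = 0 := by simp [duhamel]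

omit h in
lemma backDuhamel_self (l : ℂ) (b : ℝ → ℂ) (T : ℝ) : backDuhamel l b T T = 0 := by
  simp [backDuhamel]

omit h in
lemma exp_lam_mul_exp_nu (c : Mode) (T : ℝ) :
    Complex.exp (-(c.nu * T)) * Complex.exp (-(c.lam * T)) = Complex.exp (-(2 * c.μ * T)) := by
  rw [← Complex.exp_add, lam, nu]; congr 1; ring

lemma solψ_zero {T : ℝ} (hT : 0 ≤ T) (ψ₀ vT : ℂ) (A₁ A₂ : ℝ → ℂ) :
    c.solψ T ψ₀ vT A₁ A₂ 0 = ψ₀ := by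
  have hd := h.det_ne_zero hT
  have e : c.x0 T ψ₀ vT A₁ A₂ * c.det T = _ := div_mul_cancel₀ _ hd
  have e2 := exp_lam_mul_exp_nu c T
  simp only [solψ, x, y, yT, duhamel_zero, Complex.ofReal_zero, mul_zero, neg_zero,
    Complex.exp_zero, sub_zero]
  rw [det] at e
  linear_combination e + c.p * c.q * c.x0 T ψ₀ vT A₁ A₂ * e2

omit h in
lemma solv_end (T : ℝ) (ψ₀ vT : ℂ) (A₁ A₂ : ℝ → ℂ) :
    c.solv T ψ₀ vT A₁ A₂ T = vT := by
  simp only [solv, x, y, yT, backDuhamel_self, sub_self, Complex.ofReal_zero, mul_zero, neg_zero,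
    Complex.exp_zero]
  ring

/-- The two-point boundary value problem has only one solution. -/
lemma eq_sol {T : ℝ} (hT : 0 ≤ T) {ψ₀ vT : ℂ} {A₁ A₂ z₁ z₂ : ℝ → ℂ} (h1 : Continuous A₁)
    (h2 : Continuous A₂)
    (hz₁ : ∀ t, HasDerivAt z₁ ((Complex.I * c.om - c.d) * z₁ t - c.α * z₂ t + A₁ t) t)
    (hz₂ : ∀ t, HasDerivAt z₂ ((Complex.I * c.om + c.d) * z₂ t - c.γ * z₁ t + A₂ t) t)
    (h0 : z₁ 0 = ψ₀) (hend : z₂ T = vT) (t : ℝ) :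
    z₁ t = c.solψ T ψ₀ vT A₁ A₂ t ∧ z₂ t = c.solv T ψ₀ vT A₁ A₂ t := by
  set w₁ : ℝ → ℂ := fun t => z₁ t - c.solψ T ψ₀ vT A₁ A₂ t with hw₁
  set w₂ : ℝ → ℂ := fun t => z₂ t - c.solv T ψ₀ vT A₁ A₂ t with hw₂
  have d1 : ∀ t, HasDerivAt w₁ ((Complex.I * c.om - c.d) * w₁ t - c.α * w₂ t) t := fun t =>
    ((hz₁ t).sub (h.hasDerivAt_solψ T ψ₀ vT h1 h2 t)).congr_deriv (by simp only [hw₁, hw₂]; ring)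
  have d2 : ∀ t, HasDerivAt w₂ ((Complex.I * c.om + c.d) * w₂ t - c.γ * w₁ t) t := fun t =>
    ((hz₂ t).sub (h.hasDerivAt_solv T ψ₀ vT h1 h2 t)).congr_deriv (by simp only [hw₁, hw₂]; ring)
  have b0 : w₁ 0 = 0 := by simp only [hw₁, h.solψ_zero hT, h0, sub_self]
  have bT : w₂ T = 0 := by simp only [hw₂, solv_end, hend, sub_self]
  have hexp : ∀ (l : ℂ) (t : ℝ), HasDerivAt (fun t : ℝ => Complex.exp (l * (t : ℂ)))
      (Complex.exp (l * (t : ℂ)) * (l * 1)) t := fun l t =>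
    ((Complex.ofRealCLM.hasDerivAt (x := t)).const_mul l).cexp
  have hconst : ∀ {f : ℝ → ℂ}, (∀ t, HasDerivAt f 0 t) → ∀ s t, f s = f t := fun hf =>
    is_const_of_deriv_eq_zero (fun t => (hf t).differentiableAt) fun t => (hf t).deriv
  have e2 := h.alpha_mul_p
  have e3 := h.q_mul
  have e2' := h.gamma_mul_q
  have e3' := h.p_mul
  -- The unforced diagonal variables multiplied by their integrating factors are constant in time.
  -- The two homogeneous boundary conditions then reduce to w₂(0)·det = 0.
  have kx : ∀ s t : ℝ, Complex.exp (c.lam * s) * (w₁ s + c.q * w₂ s) =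
      Complex.exp (c.lam * t) * (w₁ t + c.q * w₂ t) := by
    refine hconst fun t => ?_
    refine ((hexp c.lam t).mul ((d1 t).add ((d2 t).const_mul c.q))).congr_deriv ?_
    simp only [lam, Pi.add_apply]
    linear_combination Complex.exp ((c.μ - Complex.I * c.om) * t) * (e3 * w₂ t - e2' * w₁ t)
  have ky : ∀ s t : ℝ, Complex.exp (-c.nu * s) * (w₂ s - c.p * w₁ s) =
      Complex.exp (-c.nu * t) * (w₂ t - c.p * w₁ t) := by
    refine hconst fun t => ?_
    refine ((hexp (-c.nu) t).mul ((d2 t).sub ((d1 t).const_mul c.p))).congr_deriv ?_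
    simp only [nu, Pi.sub_apply]
    linear_combination Complex.exp (-(c.μ + Complex.I * c.om) * t) * (e3' * w₁ t + e2 * w₂ t)
  have k1 := kx T 0
  have k2 := ky 0 T
  rw [b0, bT] at k1 k2
  simp only [Complex.ofReal_zero, mul_zero, Complex.exp_zero, one_mul, zero_add, add_zero,
    sub_zero, zero_sub] at k1 k2
  have hll : Complex.exp (-(c.lam * T)) * Complex.exp (c.lam * T) = 1 := by
    rw [← Complex.exp_add]; simp
  have k3 : w₁ T = Complex.exp (-(c.lam * T)) * (c.q * w₂ 0) := by
    linear_combination (-w₁ T) * hll + Complex.exp (-(c.lam * T)) * k1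
  have k4 : w₂ 0 * c.det T = 0 := by
    have := exp_lam_mul_exp_nu c T
    rw [det]
    rw [k3] at k2
    rw [neg_mul] at k2
    linear_combination k2 - c.p * c.q * w₂ 0 * this
  have k5 : w₂ 0 = 0 := (mul_eq_zero.1 k4).resolve_right (h.det_ne_zero hT)
  have m1 := kx t 0
  have m2 := ky t 0
  rw [b0, k5] at m1 m2
  simp only [mul_zero, add_zero, sub_zero, mul_eq_zero, Complex.exp_ne_zero, false_or] at m1 m2
  have hne := h.one_add_pq_ne_zero
  have n1 : w₁ t = 0 := by
    have : w₁ t * (1 + c.p * c.q) = 0 := by linear_combination m1 - c.q * m2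
    exact (mul_eq_zero.1 this).resolve_right hne
  have n2 : w₂ t = 0 := by rw [n1] at m2; simpa using m2
  exact ⟨sub_eq_zero.1 n1, sub_eq_zero.1 n2⟩

set_option maxHeartbeats 1000000 in
omit h in
-- The weight g may vary in time at most at the rate ρ ≤ Re μ. Free exponentials then carry it from
-- one time to another without loss, the Duhamel terms gain 1/L by `norm_duhamel_le`, and the
-- determinant is bounded below. Hence data of size D and forcing of size θL, both relative to g,
-- give a solution of size D+θ relative to g, with a constant independent of ξ, σ and T.
lemma exists_sol_bound {C κ : ℝ} (hC : 0 ≤ C) (hκ : 0 < κ) : ∃ B > 0, ∀ (c : Mode) (ρ L T : ℝ),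
    c.Admissible C κ ρ L → 0 ≤ T → ∀ (ψ₀ vT : ℂ) (A₁ A₂ : ℝ → ℂ) (g : ℝ → ℝ) (D θ : ℝ),
      0 ≤ D → 0 ≤ θ → (∀ t ∈ Icc 0 T, 0 ≤ g t) →
      (∀ s ∈ Icc 0 T, ∀ t ∈ Icc 0 T, g s ≤ Real.exp (ρ * |t - s|) * g t) →
      ‖ψ₀‖ ≤ D * g 0 → ‖vT‖ ≤ D * g T →
      (∀ s ∈ Icc 0 T, ‖A₁ s‖ ≤ θ * L * g s) → (∀ s ∈ Icc 0 T, ‖A₂ s‖ ≤ θ * L * g s) →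
      ∀ t ∈ Icc 0 T, ‖c.solψ T ψ₀ vT A₁ A₂ t‖ ≤ B * (D + θ) * g t ∧
        ‖c.solv T ψ₀ vT A₁ A₂ t‖ ≤ B * (D + θ) * g t := by
  obtain ⟨η, hη, hdet⟩ := exists_det_lower_bound hC
  -- C₁ bounds the diagonalised forcing, C₂ the Duhamel terms, K₁ the value x(0) and K₂ the value
  -- y(T).
  set C₁ : ℝ := (2 + C) / 2 * (1 + C) with hC₁
  set C₂ : ℝ := C₁ / κ with hC₂
  set K₁ : ℝ := (1 + C) * (1 + C * C₂ + C₂) / η with hK₁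
  set K₂ : ℝ := 1 + C * (K₁ + C₂) with hK₂
  have hC₁0 : 0 ≤ C₁ := by positivity
  have hC₂0 : 0 ≤ C₂ := by positivity
  have hK₁0 : 0 ≤ K₁ := by positivity
  have hK₂0 : 0 ≤ K₂ := by positivity
  refine ⟨(1 + C) * (K₁ + K₂ + C₂ + C₂) + 1, by positivity, ?_⟩
  intro c ρ L T h hT ψ₀ vT A₁ A₂ g D θ hD hθ hg0 hg hψ₀ hvT hA₁ hA₂
  have h0m : (0 : ℝ) ∈ Icc 0 T := ⟨le_rfl, hT⟩
  have hTm : T ∈ Icc 0 T := ⟨hT, le_rfl⟩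
  have hp := h.norm_p_le
  have hq := h.norm_q_le
  have hL := h.L_nonneg
  have hρ : ρ ≤ c.μ.re := by nlinarith [h.gap, mul_nonneg hκ.le hL]
  have hinv : ‖(1 + c.p * c.q)⁻¹‖ ≤ (2 + C) / 2 := by
    rw [norm_inv]
    have := h.norm_one_add_pq_ge
    calc _ ≤ (2 / (2 + C))⁻¹ := inv_anti₀ (by positivity) this
      _ = _ := by rw [inv_div]
  have hfwd : ∀ s ∈ Icc 0 T, ‖c.fwd A₁ A₂ s‖ ≤ (C₁ * θ) * L * g s := by
    intro s hs
    have hgs := hg0 s hs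
    rw [fwd, div_eq_mul_inv, norm_mul]
    have : ‖A₁ s + c.q * A₂ s‖ ≤ (1 + C) * (θ * L * g s) := by
      refine (norm_add_le _ _).trans ?_
      rw [norm_mul]
      have := mul_le_mul hq (hA₂ s hs) (norm_nonneg _) hC
      linarith [hA₁ s hs]
    calc _ ≤ ((1 + C) * (θ * L * g s)) * ((2 + C) / 2) :=
          mul_le_mul this hinv (norm_nonneg _) (by positivity)
      _ = _ := by rw [hC₁]; ring
  have hbwd : ∀ s ∈ Icc 0 T, ‖c.bwd A₁ A₂ s‖ ≤ (C₁ * θ) * L * g s := by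
    intro s hs
    have hgs := hg0 s hs
    rw [bwd, div_eq_mul_inv, norm_mul]
    have : ‖A₂ s - c.p * A₁ s‖ ≤ (1 + C) * (θ * L * g s) := by
      refine (norm_sub_le _ _).trans ?_
      rw [norm_mul]
      have := mul_le_mul hp (hA₁ s hs) (norm_nonneg _) hC
      linarith [hA₂ s hs]
    calc _ ≤ ((1 + C) * (θ * L * g s)) * ((2 + C) / 2) :=
          mul_le_mul this hinv (norm_nonneg _) (by positivity)
      _ = _ := by rw [hC₁]; ring
  have hlre : c.lam.re = c.μ.re := by simp [lam]
  have hnre : c.nu.re = c.μ.re := by simp [nu]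
  have hDu : ∀ t ∈ Icc 0 T, ‖duhamel c.lam (c.fwd A₁ A₂) t‖ ≤ C₂ * θ * g t := by
    intro t ht
    have := norm_duhamel_le (l := c.lam) (a := c.fwd A₁ A₂) (g := g) (t := t) (κ := κ) (L := L)
      (θ := C₁ * θ) (ρ := ρ) ht.1 hκ hL (by positivity) (hg0 t ht)
      (fun s hs => hfwd s ⟨hs.1, hs.2.trans ht.2⟩)
      (fun s hs => by
        have := hg s ⟨hs.1, hs.2.trans ht.2⟩ t ht
        rwa [abs_of_nonneg (sub_nonneg.2 hs.2)] at this) (by rw [hlre]; exact h.gap)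
    refine this.trans_eq ?_
    rw [hC₂]; ring
  have hBu : ∀ t ∈ Icc 0 T, ‖backDuhamel c.nu (c.bwd A₁ A₂) T t‖ ≤ C₂ * θ * g t := by
    intro t ht
    rw [backDuhamel_eq]
    have hm : ∀ s ∈ Icc 0 (T - t), T - s ∈ Icc 0 T := fun s hs =>
      ⟨by linarith [hs.2, ht.1], by linarith [hs.1]⟩
    have := norm_duhamel_le (l := c.nu) (a := fun s => c.bwd A₁ A₂ (T - s))
      (g := fun s => g (T - s)) (t := T - t) (κ := κ) (L := L)
      (θ := C₁ * θ) (ρ := ρ) (by linarith [ht.2]) hκ hL (by positivity)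
      (by simpa using hg0 t ht)
      (fun s hs => hbwd _ (hm s hs))
      (fun s hs => by
        have := hg _ (hm s hs) t ht
        rw [abs_sub_comm, abs_of_nonneg (by linarith [hs.2])] at this
        simpa [sub_right_comm] using this) (by rw [hnre]; exact h.gap)
    refine this.trans_eq ?_
    rw [hC₂]; simp only [sub_sub_cancel]; ring
  have hexpl : ∀ s : ℝ, ‖Complex.exp (-(c.lam * s))‖ = Real.exp (-(c.μ.re * s)) := fun s => by
    rw [norm_cexp_neg_mul, hlre]
  have hexpn : ∀ s : ℝ, ‖Complex.exp (-(c.nu * s))‖ = Real.exp (-(c.μ.re * s)) := fun s => by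
    rw [norm_cexp_neg_mul, hnre]
  -- The decay e^{-Re μ|t-s|} beats the growth e^{ρ|t-s|} of the weight.
  have hmove : ∀ s ∈ Icc 0 T, ∀ t ∈ Icc 0 T,
      Real.exp (-(c.μ.re * |t - s|)) * g s ≤ g t := by
    intro s hs t ht
    have h1 := hg s hs t ht
    have h2 : Real.exp (-(c.μ.re * |t - s|)) * Real.exp (ρ * |t - s|) ≤ 1 := by
      rw [← Real.exp_add, Real.exp_le_one_iff]
      nlinarith [abs_nonneg (t - s)]
    calc _ ≤ Real.exp (-(c.μ.re * |t - s|)) * (Real.exp (ρ * |t - s|) * g t) :=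
          mul_le_mul_of_nonneg_left h1 (Real.exp_pos _).le
      _ = (Real.exp (-(c.μ.re * |t - s|)) * Real.exp (ρ * |t - s|)) * g t := by ring
      _ ≤ g t := mul_le_of_le_one_left (hg0 t ht) h2
  have hET : Real.exp (-(c.μ.re * T)) * g T ≤ g 0 := by
    have := hmove T hTm 0 h0m
    simpa [abs_of_nonneg hT] using this
  have hET' : Real.exp (-(c.μ.re * T)) * g 0 ≤ g T := by
    have := hmove 0 h0m T hTm
    simpa [abs_of_nonneg hT] using this
  have hg00 := hg0 0 h0m
  have hgT0 := hg0 T hTm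
  have hS : D + C * (C₂ * θ) ≤ (1 + C * C₂ + C₂) * (D + θ) := by
    nlinarith [mul_nonneg (mul_nonneg hC hC₂0) hD, mul_nonneg hC₂0 hD, mul_nonneg hC₂0 hθ]
  have hx0 : ‖c.x0 T ψ₀ vT A₁ A₂‖ ≤ K₁ * (D + θ) * g 0 := by
    rw [x0, norm_div]
    have hd := hdet c κ ρ L T h hT
    have b1 : ‖c.q * backDuhamel c.nu (c.bwd A₁ A₂) T 0‖ ≤ C * (C₂ * θ * g 0) := by
      rw [norm_mul]; exact mul_le_mul hq (hBu 0 h0m) (norm_nonneg _) hC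
    have b2 : ‖vT - c.p * duhamel c.lam (c.fwd A₁ A₂) T‖ ≤ (D + C * (C₂ * θ)) * g T := by
      refine (norm_sub_le _ _).trans ?_
      rw [norm_mul]
      have := mul_le_mul hp (hDu T hTm) (norm_nonneg _) hC
      linarith
    have b3 : ‖c.q * Complex.exp (-(c.nu * T)) * (vT - c.p * duhamel c.lam (c.fwd A₁ A₂) T)‖ ≤
        C * ((D + C * (C₂ * θ)) * g 0) := by
      rw [norm_mul, norm_mul, hexpn, mul_assoc]
      refine mul_le_mul hq ?_ (by positivity) hC
      calc _ ≤ Real.exp (-(c.μ.re * T)) * ((D + C * (C₂ * θ)) * g T) :=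
            mul_le_mul_of_nonneg_left b2 (Real.exp_pos _).le
        _ = (D + C * (C₂ * θ)) * (Real.exp (-(c.μ.re * T)) * g T) := by ring
        _ ≤ _ := mul_le_mul_of_nonneg_left hET (by positivity)
    have b4 : ‖ψ₀ - c.q * backDuhamel c.nu (c.bwd A₁ A₂) T 0
        + c.q * Complex.exp (-(c.nu * T)) * (vT - c.p * duhamel c.lam (c.fwd A₁ A₂) T)‖ ≤
        (1 + C) * ((1 + C * C₂ + C₂) * (D + θ)) * g 0 := by
      refine (norm_add_le _ _).trans ?_
      have b5 := (norm_sub_le ψ₀ (c.q * backDuhamel c.nu (c.bwd A₁ A₂) T 0))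
      have b6 : (1 + C) * (D + C * (C₂ * θ)) * g 0 ≤
          (1 + C) * ((1 + C * C₂ + C₂) * (D + θ)) * g 0 := by gcongr
      linarith
    have b7 : 0 ≤ (1 + C) * ((1 + C * C₂ + C₂) * (D + θ)) * g 0 := by positivity
    calc _ ≤ (1 + C) * ((1 + C * C₂ + C₂) * (D + θ)) * g 0 / η :=
          div_le_div₀ b7 b4 hη hd
      _ = _ := by rw [hK₁]; ring
  have hyT : ‖c.yT T ψ₀ vT A₁ A₂‖ ≤ K₂ * (D + θ) * g T := by
    rw [yT]
    refine (norm_sub_le _ _).trans ?_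
    have b1 : ‖Complex.exp (-(c.lam * T)) * c.x0 T ψ₀ vT A₁ A₂‖ ≤ K₁ * (D + θ) * g T := by
      rw [norm_mul, hexpl]
      calc _ ≤ Real.exp (-(c.μ.re * T)) * (K₁ * (D + θ) * g 0) :=
            mul_le_mul_of_nonneg_left hx0 (Real.exp_pos _).le
        _ = K₁ * (D + θ) * (Real.exp (-(c.μ.re * T)) * g 0) := by ring
        _ ≤ _ := mul_le_mul_of_nonneg_left hET' (by positivity)
    have b2 := norm_add_le (Complex.exp (-(c.lam * T)) * c.x0 T ψ₀ vT A₁ A₂)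
      (duhamel c.lam (c.fwd A₁ A₂) T)
    have b3 := hDu T hTm
    rw [norm_mul]
    have b4 := mul_le_mul hp (b2.trans (add_le_add b1 b3)) (norm_nonneg _) hC
    have b5 : C₂ * θ * g T ≤ C₂ * (D + θ) * g T := by gcongr; linarith
    have b6 : D * g T ≤ (D + θ) * g T := by gcongr; linarith
    have b7 := mul_le_mul_of_nonneg_left b5 hC
    rw [hK₂]
    linarith
  intro t ht
  have hgt := hg0 t ht
  have hx : ‖c.x T ψ₀ vT A₁ A₂ t‖ ≤ (K₁ + C₂) * (D + θ) * g t := by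
    rw [x]
    refine (norm_add_le _ _).trans ?_
    have b1 : ‖Complex.exp (-(c.lam * t)) * c.x0 T ψ₀ vT A₁ A₂‖ ≤ K₁ * (D + θ) * g t := by
      rw [norm_mul, hexpl]
      have e := hmove 0 h0m t ht
      rw [sub_zero, abs_of_nonneg ht.1] at e
      calc _ ≤ Real.exp (-(c.μ.re * t)) * (K₁ * (D + θ) * g 0) :=
            mul_le_mul_of_nonneg_left hx0 (Real.exp_pos _).le
        _ = K₁ * (D + θ) * (Real.exp (-(c.μ.re * t)) * g 0) := by ring
        _ ≤ _ := mul_le_mul_of_nonneg_left e (by positivity)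
    have b2 := hDu t ht
    have b5 : C₂ * θ * g t ≤ C₂ * (D + θ) * g t := by gcongr; linarith
    linarith
  have hy : ‖c.y T ψ₀ vT A₁ A₂ t‖ ≤ (K₂ + C₂) * (D + θ) * g t := by
    rw [y]
    refine (norm_sub_le _ _).trans ?_
    have b1 : ‖Complex.exp (-(c.nu * (T - t : ℝ))) * c.yT T ψ₀ vT A₁ A₂‖ ≤
        K₂ * (D + θ) * g t := by
      rw [norm_mul, hexpn]
      have e := hmove T hTm t ht
      rw [abs_sub_comm, abs_of_nonneg (sub_nonneg.2 ht.2)] at e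
      calc _ ≤ Real.exp (-(c.μ.re * (T - t))) * (K₂ * (D + θ) * g T) :=
            mul_le_mul_of_nonneg_left hyT (Real.exp_pos _).le
        _ = K₂ * (D + θ) * (Real.exp (-(c.μ.re * (T - t))) * g T) := by ring
        _ ≤ _ := mul_le_mul_of_nonneg_left e (by positivity)
    have b2 := hBu t ht
    have b5 : C₂ * θ * g t ≤ C₂ * (D + θ) * g t := by gcongr; linarith
    linarith
  have hfin : ∀ u w : ℝ, 0 ≤ u → u ≤ C → w = (D + θ) * g t →
      (K₁ + C₂) * w + u * ((K₂ + C₂) * w) ≤ ((1 + C) * (K₁ + K₂ + C₂ + C₂) + 1) * w ∧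
      u * ((K₁ + C₂) * w) + (K₂ + C₂) * w ≤ ((1 + C) * (K₁ + K₂ + C₂ + C₂) + 1) * w := by
    intro u w hu huC hw
    have hw0 : 0 ≤ w := by rw [hw]; positivity
    have i1 : u * ((K₂ + C₂) * w) ≤ C * ((K₂ + C₂) * w) := by gcongr
    have i2 : u * ((K₁ + C₂) * w) ≤ C * ((K₁ + C₂) * w) := by gcongr
    have i3 : 0 ≤ C * ((K₁ + C₂) * w) := by positivity
    have i4 : 0 ≤ C * ((K₂ + C₂) * w) := by positivity
    have i5 : 0 ≤ (K₁ + C₂) * w := by positivity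
    have i6 : 0 ≤ (K₂ + C₂) * w := by positivity
    have e : ((1 + C) * (K₁ + K₂ + C₂ + C₂) + 1) * w = (K₁ + C₂) * w + (K₂ + C₂) * w
        + C * ((K₁ + C₂) * w) + C * ((K₂ + C₂) * w) + w := by ring
    rw [e]
    constructor <;> linarith
  constructor
  · rw [solψ]
    refine (norm_sub_le _ _).trans ?_
    rw [norm_mul]
    have := (hfin ‖c.q‖ _ (norm_nonneg _) hq rfl).1
    have i := mul_le_mul_of_nonneg_left hy (norm_nonneg c.q)
    linarith
  · rw [solv]
    refine (norm_add_le _ _).trans ?_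
    rw [norm_mul]
    have := (hfin ‖c.p‖ _ (norm_nonneg _) hp rfl).2
    have i := mul_le_mul_of_nonneg_left hx (norm_nonneg c.p)
    linarith

end Admissible

end Mode

/-! ### The spectral gap of the linearised system -/

/-- The coefficients of the linearised system at the frequency `ξ`. -/
def freqMode (ρm ρbar σ : ℝ) (ξ : Plane) : Mode where
  om := (speed ρm ρbar - ρbar) * ξ 0
  α := ρbar * speed ρm ρbar ^ 2 * ‖ξ‖
  γ := 1 / speed ρm ρbar * ‖ξ‖
  d := ⟨σ * ‖ξ‖ ^ 2, ρbar * ξ 0⟩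
  μ := ((⟨σ * ‖ξ‖ ^ 2, ρbar * ξ 0⟩ : ℂ) ^ 2
    + ((ρbar * speed ρm ρbar ^ 2 * ‖ξ‖ : ℝ) : ℂ) * ((1 / speed ρm ρbar * ‖ξ‖ : ℝ) : ℂ)) ^ (2⁻¹ : ℂ)

lemma apply_sq_le (ξ : Plane) (j : Fin 2) : ξ j ^ 2 ≤ ‖ξ‖ ^ 2 := by
  have h := PiLp.norm_apply_le ξ j
  rw [Real.norm_eq_abs] at h
  rw [← sq_abs]
  exact pow_le_pow_left₀ (abs_nonneg _) h 2

lemma abs_apply_le (ξ : Plane) (j : Fin 2) : |ξ j| ≤ ‖ξ‖ := PiLp.norm_apply_le ξ j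

/-- A mode whose root `μ` has real part bounded below by the viscous rate and by `c₀ r` is
admissible. -/
lemma Mode.admissible_of_root {c : Mode} {c₀ ρbar f σ r s : ℝ} (hpos : 0 < ρbar) (hf : 0 < f)
    (hc₀p : 0 < c₀) (hσ : 0 ≤ σ) (hr : 0 < r) (hs : |s| ≤ r) (hα : c.α = ρbar * f ^ 2 * r)
    (hγ : c.γ = 1 / f * r) (hdre : c.d.re = σ * r ^ 2) (hdim : c.d.im = ρbar * s)
    (hsq : c.μ ^ 2 = c.d ^ 2 + c.α * c.γ) (hre0 : 0 ≤ c.μ.re)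
    (hwre : (σ * r ^ 2) ^ 2 + c₀ ^ 2 * r ^ 2 ≤ (c.d ^ 2 + c.α * c.γ).re) :
    c.Admissible (1 + ρbar / c₀ + ρbar * f ^ 2 / c₀ + 1 / f / c₀) (min (1 / 2) (c₀ / 4)) (c₀ / 4 * r)
      (r * (1 + σ * r)) := by
  have hre_eq : c.μ.re ^ 2 - c.μ.im ^ 2 = (c.d ^ 2 + c.α * c.γ).re := by
    rw [← hsq, sq c.μ, Complex.mul_re]; ring
  have hre2 : (σ * r ^ 2) ^ 2 + c₀ ^ 2 * r ^ 2 ≤ c.μ.re ^ 2 - c.μ.im ^ 2 := by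
    rw [hre_eq]; exact hwre
  -- The imaginary part of μ² = d² + αγ, in which αγ is real.
  have him : c.μ.re * c.μ.im = c.d.re * c.d.im := by
    have := congrArg Complex.im hsq
    rw [sq c.μ, sq c.d, ← Complex.ofReal_mul] at this
    simp only [Complex.mul_im, Complex.add_im, Complex.ofReal_im] at this
    linarith
  have hrepos : 0 < c.μ.re := by
    rcases hre0.eq_or_lt with h | h
    · rw [← h] at hre2
      have : 0 < c₀ ^ 2 * r ^ 2 := by positivity
      nlinarith [sq_nonneg (σ * r ^ 2), sq_nonneg c.μ.im]
    · exact h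
  have hs0 : 0 ≤ σ * r ^ 2 := by positivity
  have hb1 : σ * r ^ 2 ≤ c.μ.re := by
    refine (pow_le_pow_iff_left₀ hs0 hre0 two_ne_zero).1 ?_
    nlinarith [sq_nonneg c.μ.im, sq_nonneg (c₀ * r)]
  have hb2 : c₀ * r ≤ c.μ.re := by
    refine (pow_le_pow_iff_left₀ (by positivity) hre0 two_ne_zero).1 ?_
    nlinarith [sq_nonneg c.μ.im, sq_nonneg (σ * r ^ 2)]
  have hq1 : ρbar * r ≤ ρbar / c₀ * c.μ.re := by
    rw [div_mul_eq_mul_div, le_div_iff₀ hc₀p]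
    have := mul_le_mul_of_nonneg_left hb2 hpos.le
    linarith
  have hq2 : ρbar * f ^ 2 * r ≤ ρbar * f ^ 2 / c₀ * c.μ.re := by
    rw [div_mul_eq_mul_div, le_div_iff₀ hc₀p]
    have : 0 ≤ ρbar * f ^ 2 := by positivity
    have := mul_le_mul_of_nonneg_left hb2 this
    linarith
  have hq3 : 1 / f * r ≤ 1 / f / c₀ * c.μ.re := by
    rw [div_mul_eq_mul_div _ c₀, le_div_iff₀ hc₀p]
    have : 0 ≤ 1 / f := by positivity
    have := mul_le_mul_of_nonneg_left hb2 this
    linarith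
  have hp1 : 0 ≤ ρbar / c₀ * c.μ.re := by positivity
  have hp2 : 0 ≤ ρbar * f ^ 2 / c₀ * c.μ.re := by positivity
  have hp3 : 0 ≤ 1 / f / c₀ * c.μ.re := by positivity
  refine ⟨by positivity, by positivity, ?_, ?_, hsq, hrepos, hdre ▸ hs0, ?_, ?_, ?_, ?_, ?_,
    ?_⟩
  · rw [hα]; positivity
  · rw [hγ]; positivity
  -- Multiplication by Re μ > 0 turns the angle condition into Re d·((Re μ)² + (Im d)²) ≥ 0, by the
  -- identity for the imaginary parts.
  · have : 0 ≤ c.μ.re * (c.μ.re * c.d.re + c.μ.im * c.d.im) := by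
      have e : c.μ.re * (c.μ.re * c.d.re + c.μ.im * c.d.im) =
          c.d.re * (c.μ.re ^ 2 + c.d.im ^ 2) := by linear_combination c.d.im * him
      rw [e, hdre]; positivity
    exact nonneg_of_mul_nonneg_right this hrepos
  · refine (Complex.norm_le_abs_re_add_abs_im _).trans ?_
    rw [hdre, hdim, abs_of_nonneg hs0, abs_mul, abs_of_pos hpos]
    have := mul_le_mul_of_nonneg_left hs hpos.le
    linarith
  · refine (Complex.norm_le_abs_re_add_abs_im _).trans ?_
    have : |c.μ.im| ≤ c.μ.re := by
      refine abs_le_of_sq_le_sq ?_ hre0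
      nlinarith [sq_nonneg (σ * r ^ 2), sq_nonneg (c₀ * r)]
    rw [abs_of_nonneg hre0]; linarith
  · rw [hα]; linarith
  · rw [hγ]; linarith
  -- Re μ is at least the mean of σr² and c₀r. After subtraction of the growth rate c₀r/4 there
  -- remain c₀r/4 and σr²/2, hence the minimum of 1/2 and c₀/4.
  · have h1 : min (1 / 2) (c₀ / 4) * r ≤ c₀ / 4 * r := by gcongr; exact min_le_right _ _
    have h2 : min (1 / 2) (c₀ / 4) * (σ * r ^ 2) ≤ 1 / 2 * (σ * r ^ 2) := by
      gcongr; exact min_le_left _ _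
    have e : min (1 / 2) (c₀ / 4) * (r * (1 + σ * r)) =
      min (1 / 2) (c₀ / 4) * r + min (1 / 2) (c₀ / 4) * (σ * r ^ 2) := by ring
    rw [e]
    linarith

section Radicand

variable {ρm ρbar : ℝ} (hpos : 0 < ρbar) (hlt : ρbar < ρm / 2)
include hpos hlt

lemma speed_pos : 0 < speed ρm ρbar := by unfold speed; linarith

/-- The product αγ is ρ̄f|ξ|², and the squared imaginary part of d takes away ρ̄²ξ₀² ≤ ρ̄²|ξ|². The
difference ρ̄(f-ρ̄) is positive exactly because ρ̄ < ρ_m/2. This is the ellipticity of the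
linearisation, and it does not need σ > 0. -/
lemma radicand_re_ge (σ : ℝ) (ξ : Plane) :
    (σ * ‖ξ‖ ^ 2) ^ 2 + ρbar * (speed ρm ρbar - ρbar) * ‖ξ‖ ^ 2 ≤
      ((⟨σ * ‖ξ‖ ^ 2, ρbar * ξ 0⟩ : ℂ) ^ 2 + ((ρbar * speed ρm ρbar ^ 2 * ‖ξ‖ : ℝ) : ℂ)
        * ((1 / speed ρm ρbar * ‖ξ‖ : ℝ) : ℂ)).re := by
  have hf := speed_pos hpos hlt
  have e : (ρbar * speed ρm ρbar ^ 2 * ‖ξ‖) * (1 / speed ρm ρbar * ‖ξ‖) =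
      ρbar * speed ρm ρbar * ‖ξ‖ ^ 2 := by field_simp
  rw [← Complex.ofReal_mul, e, Complex.add_re, Complex.ofReal_re, sq (⟨_, _⟩ : ℂ), Complex.mul_re]
  have h0 := mul_le_mul_of_nonneg_left (apply_sq_le ξ 0) (sq_nonneg ρbar)
  simp only
  nlinarith

lemma exists_admissible : ∃ C κ c₁ : ℝ, 0 ≤ C ∧ 0 < κ ∧ 0 < c₁ ∧ ∀ σ : ℝ, 0 ≤ σ →
    ∀ ξ : Plane, ξ ≠ 0 →
      (freqMode ρm ρbar σ ξ).Admissible C κ (c₁ * ‖ξ‖) (‖ξ‖ * (1 + σ * ‖ξ‖)) := by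
  have hf := speed_pos hpos hlt
  have hfρ : 0 < speed ρm ρbar - ρbar := by unfold speed; linarith
  set f := speed ρm ρbar with hfdef
  set c₀ := √(ρbar * (f - ρbar)) with hc₀
  have hc₀p : 0 < c₀ := Real.sqrt_pos.2 (by positivity)
  have hc₀sq : c₀ ^ 2 = ρbar * (f - ρbar) := Real.sq_sqrt (by positivity)
  refine ⟨1 + ρbar / c₀ + ρbar * f ^ 2 / c₀ + 1 / f / c₀, min (1 / 2) (c₀ / 4), c₀ / 4,
    by positivity, by positivity, by positivity, ?_⟩
  intro σ hσ ξ hξ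
  have hr : 0 < ‖ξ‖ := norm_pos_iff.2 hξ
  set c := freqMode ρm ρbar σ ξ with hc
  have hsq : c.μ ^ 2 = c.d ^ 2 + c.α * c.γ := by
    have := Complex.cpow_nat_inv_pow (c.d ^ 2 + c.α * c.γ) (n := 2) two_ne_zero
    exact this
  have hwre := radicand_re_ge hpos hlt σ ξ
  rw [← hc₀sq] at hwre
  -- `freqMode` takes the principal square root, whose real part is nonnegative.
  have hre0 : 0 ≤ c.μ.re := by
    have : c.μ.re = _ := Complex.cpow_inv_two_re _
    rw [this]; exact Real.sqrt_nonneg _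
  exact Mode.admissible_of_root hpos hf hc₀p hσ hr (abs_apply_le ξ 0) rfl rfl rfl rfl hsq hre0 hwre

omit hpos hlt in
-- Conjugation maps the boundary value problem at ξ to the one at -ξ: it changes the sign of ω and
-- conjugates d. The claim then follows from uniqueness, with no need to follow the formula for the
-- solution.
lemma freqMode_sol_neg {C κ ρ L : ℝ} {σ T : ℝ} (hT : 0 ≤ T) {ξ : Plane}
    (h : (freqMode ρm ρbar σ ξ).Admissible C κ ρ L)
    (h' : (freqMode ρm ρbar σ (-ξ)).Admissible C κ ρ L)
    (ψ₀ vT : ℂ) {A₁ A₂ : ℝ → ℂ} (h1 : Continuous A₁) (h2 : Continuous A₂) (t : ℝ) :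
    (freqMode ρm ρbar σ (-ξ)).solψ T ((starRingEnd ℂ) ψ₀) ((starRingEnd ℂ) vT)
        (fun s => (starRingEnd ℂ) (A₁ s)) (fun s => (starRingEnd ℂ) (A₂ s)) t =
      (starRingEnd ℂ) ((freqMode ρm ρbar σ ξ).solψ T ψ₀ vT A₁ A₂ t) ∧
    (freqMode ρm ρbar σ (-ξ)).solv T ((starRingEnd ℂ) ψ₀) ((starRingEnd ℂ) vT)
        (fun s => (starRingEnd ℂ) (A₁ s)) (fun s => (starRingEnd ℂ) (A₂ s)) t =
      (starRingEnd ℂ) ((freqMode ρm ρbar σ ξ).solv T ψ₀ vT A₁ A₂ t) := by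
  have hom : (freqMode ρm ρbar σ (-ξ)).om = -(freqMode ρm ρbar σ ξ).om := by simp [freqMode]
  have hα : (freqMode ρm ρbar σ (-ξ)).α = (freqMode ρm ρbar σ ξ).α := by simp [freqMode]
  have hγ : (freqMode ρm ρbar σ (-ξ)).γ = (freqMode ρm ρbar σ ξ).γ := by simp [freqMode]
  have hd : (freqMode ρm ρbar σ (-ξ)).d = (starRingEnd ℂ) (freqMode ρm ρbar σ ξ).d := by
    apply Complex.ext <;> simp [freqMode]
  have hstar : ∀ {z : ℝ → ℂ} {z' : ℂ} {t : ℝ}, HasDerivAt z z' t →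
      HasDerivAt (fun s => (starRingEnd ℂ) (z s)) ((starRingEnd ℂ) z') t := by
    intro z z' t hz
    exact (Complex.conjCLE.toContinuousLinearMap.hasFDerivAt.comp_hasDerivAt t hz)
  have := h'.eq_sol hT (ψ₀ := (starRingEnd ℂ) ψ₀) (vT := (starRingEnd ℂ) vT)
    (A₁ := fun s => (starRingEnd ℂ) (A₁ s)) (A₂ := fun s => (starRingEnd ℂ) (A₂ s))
    (z₁ := fun s => (starRingEnd ℂ) ((freqMode ρm ρbar σ ξ).solψ T ψ₀ vT A₁ A₂ s))
    (z₂ := fun s => (starRingEnd ℂ) ((freqMode ρm ρbar σ ξ).solv T ψ₀ vT A₁ A₂ s))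
    (Complex.continuous_conj.comp h1) (Complex.continuous_conj.comp h2)
    (fun s => (hstar (h.hasDerivAt_solψ T ψ₀ vT h1 h2 s)).congr_deriv (by
      rw [hom, hα, hd]; simp))
    (fun s => (hstar (h.hasDerivAt_solv T ψ₀ vT h1 h2 s)).congr_deriv (by
      rw [hom, hγ, hd]; simp))
    (by rw [h.solψ_zero hT]) (by rw [Mode.Admissible.solv_end]) t
  exact ⟨this.1.symm, this.2.symm⟩

end Radicand

/-! ### Measurability in the frequency -/

lemma measurable_duhamel {l : Plane → ℂ} {a : Plane → ℝ → ℂ} (hl : Measurable l)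
    (ha : Measurable (Function.uncurry a)) (t : ℝ) : Measurable fun ξ => duhamel (l ξ) (a ξ) t := by
  have h : Measurable (Function.uncurry fun (ξ : Plane) (s : ℝ) =>
      Complex.exp (-(l ξ * (t - s : ℝ))) * a ξ s) := by
    refine Measurable.mul ?_ ha
    have : Measurable fun p : Plane × ℝ => l p.1 := hl.comp measurable_fst
    exact Complex.measurable_exp.comp (this.mul (by fun_prop)).neg
  simp only [duhamel, intervalIntegral]
  exact ((h.stronglyMeasurable.integral_prod_right).measurable).sub
    ((h.stronglyMeasurable.integral_prod_right).measurable)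

lemma measurable_backDuhamel {l : Plane → ℂ} {b : Plane → ℝ → ℂ} (hl : Measurable l)
    (hb : Measurable (Function.uncurry b)) (T t : ℝ) :
    Measurable fun ξ => backDuhamel (l ξ) (b ξ) T t := by
  simp only [backDuhamel_eq]
  refine measurable_duhamel (a := fun ξ s => b ξ (T - s)) hl ?_ (T - t)
  exact hb.comp (measurable_fst.prodMk (measurable_const.sub measurable_snd))

section

variable (ρm ρbar σ : ℝ)

lemma measurable_freqMode_d : Measurable fun ξ => (freqMode ρm ρbar σ ξ).d := by
  refine measurable_of_re_im ?_ ?_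
  · change Measurable fun ξ : Plane => σ * ‖ξ‖ ^ 2; fun_prop
  · change Measurable fun ξ : Plane => ρbar * ξ 0
    exact Continuous.measurable (by fun_prop)

lemma measurable_freqMode_μ : Measurable fun ξ => (freqMode ρm ρbar σ ξ).μ := by
  have h := measurable_freqMode_d ρm ρbar σ
  change Measurable fun ξ : Plane => ((freqMode ρm ρbar σ ξ).d ^ 2 + _) ^ (2⁻¹ : ℂ)
  refine Measurable.pow_const ?_ _
  refine (h.pow_const 2).add (Continuous.measurable (by fun_prop))

lemma measurable_freqMode_p : Measurable fun ξ => (freqMode ρm ρbar σ ξ).p :=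
  Measurable.div (Continuous.measurable (by unfold freqMode; fun_prop))
    ((measurable_freqMode_d ρm ρbar σ).add (measurable_freqMode_μ ρm ρbar σ))

lemma measurable_freqMode_q : Measurable fun ξ => (freqMode ρm ρbar σ ξ).q :=
  Measurable.div (Continuous.measurable (by unfold freqMode; fun_prop))
    ((measurable_freqMode_d ρm ρbar σ).add (measurable_freqMode_μ ρm ρbar σ))

lemma measurable_freqMode_om : Measurable fun ξ => ((freqMode ρm ρbar σ ξ).om : ℂ) :=
  Continuous.measurable (by unfold freqMode; fun_prop)

lemma measurable_freqMode_lam : Measurable fun ξ => (freqMode ρm ρbar σ ξ).lam :=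
  (measurable_freqMode_μ ρm ρbar σ).sub ((measurable_freqMode_om ρm ρbar σ).const_mul _)

lemma measurable_freqMode_nu : Measurable fun ξ => (freqMode ρm ρbar σ ξ).nu :=
  (measurable_freqMode_μ ρm ρbar σ).add ((measurable_freqMode_om ρm ρbar σ).const_mul _)

lemma measurable_freqMode_sol {ψ₀ vT : Plane → ℂ} {A₁ A₂ : Plane → ℝ → ℂ} (hψ₀ : Measurable ψ₀)
    (hvT : Measurable vT) (h1 : Measurable (Function.uncurry A₁))
    (h2 : Measurable (Function.uncurry A₂)) (T t : ℝ) :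
    (Measurable fun ξ => (freqMode ρm ρbar σ ξ).solψ T (ψ₀ ξ) (vT ξ) (A₁ ξ) (A₂ ξ) t) ∧
      Measurable fun ξ => (freqMode ρm ρbar σ ξ).solv T (ψ₀ ξ) (vT ξ) (A₁ ξ) (A₂ ξ) t := by
  have hp := measurable_freqMode_p ρm ρbar σ
  have hq := measurable_freqMode_q ρm ρbar σ
  have hμ := measurable_freqMode_μ ρm ρbar σ
  have hl := measurable_freqMode_lam ρm ρbar σ
  have hn := measurable_freqMode_nu ρm ρbar σ
  have hfwd : Measurable (Function.uncurry fun ξ => (freqMode ρm ρbar σ ξ).fwd (A₁ ξ) (A₂ ξ)) :=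
    Measurable.div (h1.add ((hq.comp measurable_fst).mul h2))
      (((hp.comp measurable_fst).mul (hq.comp measurable_fst)).const_add 1)
  have hbwd : Measurable (Function.uncurry fun ξ => (freqMode ρm ρbar σ ξ).bwd (A₁ ξ) (A₂ ξ)) :=
    Measurable.div (h2.sub ((hp.comp measurable_fst).mul h1))
      (((hp.comp measurable_fst).mul (hq.comp measurable_fst)).const_add 1)
  have hD := fun t => measurable_duhamel hl hfwd t
  have hB := fun t => measurable_backDuhamel hn hbwd T t
  have hexp : ∀ {l : Plane → ℂ} (s : ℂ), Measurable l →
      Measurable fun ξ => Complex.exp (-(l ξ * s)) := fun s hl =>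
    Complex.measurable_exp.comp (hl.mul_const s).neg
  have hx0 : Measurable fun ξ => (freqMode ρm ρbar σ ξ).x0 T (ψ₀ ξ) (vT ξ) (A₁ ξ) (A₂ ξ) := by
    unfold Mode.x0 Mode.det
    refine Measurable.div ?_ (((hp.mul hq).mul (hexp _ (hμ.const_mul 2))).const_add 1)
    exact (hψ₀.sub (hq.mul (hB 0))).add
      ((hq.mul (hexp _ hn)).mul (hvT.sub (hp.mul (hD T))))
  have hyT : Measurable fun ξ => (freqMode ρm ρbar σ ξ).yT T (ψ₀ ξ) (vT ξ) (A₁ ξ) (A₂ ξ) := by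
    unfold Mode.yT
    exact hvT.sub (hp.mul (((hexp _ hl).mul hx0).add (hD T)))
  have hx : Measurable fun ξ => (freqMode ρm ρbar σ ξ).x T (ψ₀ ξ) (vT ξ) (A₁ ξ) (A₂ ξ) t := by
    unfold Mode.x
    exact ((hexp _ hl).mul hx0).add (hD t)
  have hy : Measurable fun ξ => (freqMode ρm ρbar σ ξ).y T (ψ₀ ξ) (vT ξ) (A₁ ξ) (A₂ ξ) t := by
    unfold Mode.y
    exact ((hexp _ hn).mul hyT).sub (hB t)
  exact ⟨hx.sub (hq.mul hy), (hp.mul hx).add hy⟩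

end

/-! ### Symbols and their convolution algebra -/

/-- A time-dependent Fourier transform of a real function: continuous in time, measurable and
hermitian in the frequency, and bounded by the weight `W`. -/
structure IsSymbol (W : ℝ → Plane → ℝ) (a : ℝ → Plane → ℂ) : Prop where
  cont : ∀ ξ, Continuous fun t => a t ξ
  meas : ∀ t, Measurable (a t)
  herm : ∀ t ξ, a t (-ξ) = (starRingEnd ℂ) (a t ξ)
  bound : ∀ t ξ, ‖a t ξ‖ ≤ W t ξ

/-- `W` is a weight that is compatible with convolutions, with constant `δ`, and `V` is a weight
for differences. -/
structure ConvWeights (W V : ℝ → Plane → ℝ) (δ : ℝ) : Prop where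
  δ_nonneg : 0 ≤ δ
  δ_le : δ ≤ 1
  nonneg : ∀ t ξ, 0 ≤ W t ξ
  nonneg' : ∀ t ξ, 0 ≤ V t ξ
  dom : ∃ D, 0 ≤ D ∧ ∀ t ξ, W t ξ ≤ D * decay ξ
  int : ∀ t ξ, Integrable fun η => W t η * W t (ξ - η)
  int' : ∀ t ξ, Integrable fun η => V t η * W t (ξ - η)
  conv : ∀ t ξ, cpi * ∫ η, W t η * W t (ξ - η) ≤ δ * W t ξ
  conv' : ∀ t ξ, cpi * ∫ η, V t η * W t (ξ - η) ≤ δ * V t ξ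

namespace IsSymbol

variable {W W' : ℝ → Plane → ℝ} {a b : ℝ → Plane → ℂ}

lemma mono (h : IsSymbol W a) (hW : ∀ t ξ, W t ξ ≤ W' t ξ) : IsSymbol W' a :=
  ⟨h.cont, h.meas, h.herm, fun t ξ => (h.bound t ξ).trans (hW t ξ)⟩

lemma add (ha : IsSymbol W a) (hb : IsSymbol W' b) :
    IsSymbol (fun t ξ => W t ξ + W' t ξ) (fun t ξ => a t ξ + b t ξ) :=
  ⟨fun ξ => (ha.cont ξ).add (hb.cont ξ), fun t => (ha.meas t).add (hb.meas t),
    fun t ξ => by rw [ha.herm, hb.herm, map_add],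
    fun t ξ => (norm_add_le _ _).trans (add_le_add (ha.bound t ξ) (hb.bound t ξ))⟩

lemma const_mul (c : ℝ) (ha : IsSymbol W a) :
    IsSymbol (fun t ξ => |c| * W t ξ) (fun t ξ => (c : ℂ) * a t ξ) :=
  ⟨fun ξ => continuous_const.mul (ha.cont ξ), fun t => (ha.meas t).const_mul _,
    fun t ξ => by rw [ha.herm, map_mul, Complex.conj_ofReal],
    fun t ξ => by
      rw [norm_mul, Complex.norm_real]
      exact mul_le_mul_of_nonneg_left (ha.bound t ξ) (abs_nonneg c)⟩

lemma uncurry_measurable (ha : IsSymbol W a) : Measurable (Function.uncurry a) :=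
  (stronglyMeasurable_uncurry_of_continuous_of_stronglyMeasurable ha.cont
    fun t => (ha.meas t).stronglyMeasurable).measurable

lemma integrable (ha : IsSymbol W a) {D : ℝ} (hD : ∀ t ξ, W t ξ ≤ D * decay ξ) (t : ℝ) :
    Integrable (a t) :=
  (integrable_decay.const_mul D).mono' (ha.meas t).aestronglyMeasurable
    (Eventually.of_forall fun ξ => (ha.bound t ξ).trans (hD t ξ))

end IsSymbol

lemma continuous_cv {a b : ℝ → Plane → ℂ} {D D' : ℝ} (hD : 0 ≤ D) (hD' : 0 ≤ D')
    (hac : ∀ ξ, Continuous fun t => a t ξ) (hbc : ∀ ξ, Continuous fun t => b t ξ)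
    (ham : ∀ t, Measurable (a t)) (hbm : ∀ t, Measurable (b t))
    (ha : ∀ t ξ, ‖a t ξ‖ ≤ D * decay ξ) (hb : ∀ t ξ, ‖b t ξ‖ ≤ D' * decay ξ) (ξ : Plane) :
    Continuous fun t => cv (a t) (b t) ξ := by
  unfold cv
  refine Continuous.const_smul ?_ cpi
  refine continuous_of_dominated (bound := fun η => D * D' * decay η) ?_ ?_
    (integrable_decay.const_mul _) ?_
  · exact fun t => ((ham t).mul ((hbm t).comp (measurable_const.sub measurable_id))).aestronglyMeasurable
  · refine fun t => Eventually.of_forall fun η => ?_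
    rw [norm_mul]
    have h1 : ‖b t (ξ - η)‖ ≤ D' :=
      (hb t _).trans (mul_le_of_le_one_right hD' (decay_le_one _))
    calc _ ≤ (D * decay η) * D' := mul_le_mul (ha t η) h1 (norm_nonneg _)
          (mul_nonneg hD (decay_pos η).le)
      _ = _ := by ring
  · exact Eventually.of_forall fun η => (hac η).mul (hbc (ξ - η))

lemma measurable_cv {a b : Plane → ℂ} (ha : Measurable a) (hb : Measurable b) :
    Measurable (cv a b) := by
  unfold cv
  have h : Measurable (Function.uncurry fun ξ η : Plane => a η * b (ξ - η)) :=
    (ha.comp measurable_snd).mul (hb.comp (measurable_fst.sub measurable_snd))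
  exact (h.stronglyMeasurable.integral_prod_right).measurable.const_smul cpi

lemma cv_herm {a b : Plane → ℂ} (ha : ∀ ξ, a (-ξ) = (starRingEnd ℂ) (a ξ))
    (hb : ∀ ξ, b (-ξ) = (starRingEnd ℂ) (b ξ)) (ξ : Plane) :
    cv a b (-ξ) = (starRingEnd ℂ) (cv a b ξ) := by
  unfold cv
  rw [Complex.real_smul, Complex.real_smul, map_mul, Complex.conj_ofReal, ← integral_conj,
    ← integral_neg_eq_self]
  congr 2; ext η
  rw [map_mul, ha, ← hb, neg_sub, sub_neg_eq_add, neg_add_eq_sub]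

lemma norm_cv_le {a b : Plane → ℂ} {w : Plane → ℝ} {A : ℝ} (ξ : Plane) (hw : Integrable w)
    (h : ∀ η, ‖a η‖ * ‖b (ξ - η)‖ ≤ A * w η) : ‖cv a b ξ‖ ≤ A * (cpi * ∫ η, w η) := by
  unfold cv
  rw [norm_smul, Real.norm_of_nonneg cpi_pos.le]
  have : ‖∫ η, a η * b (ξ - η)‖ ≤ ∫ η, A * w η :=
    norm_integral_le_of_norm_le (hw.const_mul A) (Eventually.of_forall fun η => by
      rw [norm_mul]; exact h η)
  rw [integral_const_mul] at this
  calc _ ≤ cpi * (A * ∫ η, w η) := mul_le_mul_of_nonneg_left this cpi_pos.le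
    _ = _ := by ring

/-- Two symbols bounded by `A W` whose difference is bounded by `A k V`. -/
structure SymPair (W V : ℝ → Plane → ℝ) (k A : ℝ) (a b : ℝ → Plane → ℂ) : Prop where
  left : IsSymbol (fun t ξ => A * W t ξ) a
  right : IsSymbol (fun t ξ => A * W t ξ) b
  diff : ∀ t ξ, ‖a t ξ - b t ξ‖ ≤ A * (k * V t ξ)

namespace SymPair

variable {W V : ℝ → Plane → ℝ} {k δ A A' : ℝ} {a b a' b' : ℝ → Plane → ℂ}

lemma mono (hW : ConvWeights W V δ) (hk : 0 ≤ k) (h : SymPair W V k A a b) (hA : A ≤ A') :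
    SymPair W V k A' a b :=
  ⟨h.left.mono fun t ξ => mul_le_mul_of_nonneg_right hA (hW.nonneg t ξ),
    h.right.mono fun t ξ => mul_le_mul_of_nonneg_right hA (hW.nonneg t ξ),
    fun t ξ => (h.diff t ξ).trans
      (mul_le_mul_of_nonneg_right hA (mul_nonneg hk (hW.nonneg' t ξ)))⟩

lemma add (h : SymPair W V k A a b) (h' : SymPair W V k A' a' b') :
    SymPair W V k (A + A') (fun t ξ => a t ξ + a' t ξ) (fun t ξ => b t ξ + b' t ξ) := by
  refine ⟨(h.left.add h'.left).mono fun t ξ => (add_mul _ _ _).ge,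
    (h.right.add h'.right).mono fun t ξ => (add_mul _ _ _).ge, fun t ξ => ?_⟩
  have : a t ξ + a' t ξ - (b t ξ + b' t ξ) = (a t ξ - b t ξ) + (a' t ξ - b' t ξ) := by ring
  rw [this, add_mul]
  exact (norm_add_le _ _).trans (add_le_add (h.diff t ξ) (h'.diff t ξ))

lemma const_mul (c : ℝ) (h : SymPair W V k A a b) :
    SymPair W V k (|c| * A) (fun t ξ => (c : ℂ) * a t ξ) (fun t ξ => (c : ℂ) * b t ξ) := by
  refine ⟨(h.left.const_mul c).mono fun t ξ => (mul_assoc _ _ _).ge,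
    (h.right.const_mul c).mono fun t ξ => (mul_assoc _ _ _).ge, fun t ξ => ?_⟩
  rw [← mul_sub, norm_mul, Complex.norm_real, mul_assoc]
  exact mul_le_mul_of_nonneg_left (h.diff t ξ) (abs_nonneg c)

lemma isSymbol_cv (hW : ConvWeights W V δ) (hA : 0 ≤ A) (hA' : 0 ≤ A')
    (ha : IsSymbol (fun t ξ => A * W t ξ) a) (hb : IsSymbol (fun t ξ => A' * W t ξ) b) :
    IsSymbol (fun t ξ => A * A' * (δ * W t ξ)) (fun t => cv (a t) (b t)) := by
  obtain ⟨D, hD, hdom⟩ := hW.dom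
  have hd : ∀ {A : ℝ}, 0 ≤ A → ∀ t ξ, A * W t ξ ≤ (A * D) * decay ξ := by
    intro A hA t ξ
    rw [mul_assoc]
    exact mul_le_mul_of_nonneg_left (hdom t ξ) hA
  refine ⟨continuous_cv (mul_nonneg hA hD) (mul_nonneg hA' hD) ha.cont hb.cont ha.meas hb.meas
    (fun t ξ => (ha.bound t ξ).trans (hd hA t ξ)) (fun t ξ => (hb.bound t ξ).trans (hd hA' t ξ)),
    fun t => measurable_cv (ha.meas t) (hb.meas t),
    fun t ξ => cv_herm (ha.herm t) (hb.herm t) ξ, fun t ξ => ?_⟩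
  refine (norm_cv_le (A := A * A') ξ (hW.int t ξ) fun η => ?_).trans
    (mul_le_mul_of_nonneg_left (hW.conv t ξ) (mul_nonneg hA hA'))
  calc _ ≤ (A * W t η) * (A' * W t (ξ - η)) := mul_le_mul (ha.bound t η) (hb.bound t _)
        (norm_nonneg _) (mul_nonneg hA (hW.nonneg t η))
    _ = _ := by ring

lemma cv_sub {a a' b b' : Plane → ℂ} (ξ : Plane) (h1 : Integrable fun η => a η * a' (ξ - η))
    (h2 : Integrable fun η => b η * b' (ξ - η)) (h3 : Integrable fun η => b η * a' (ξ - η)) :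
    cv a a' ξ - cv b b' ξ = cv (fun η => a η - b η) a' ξ + cv b (fun η => a' η - b' η) ξ := by
  unfold cv
  rw [← smul_sub, ← smul_add]
  simp only [sub_mul, mul_sub]
  rw [integral_sub h1 h3, integral_sub h3 h2]
  congr 1; ring

lemma cv_comm (a b : Plane → ℂ) : cv a b = cv b a := by
  ext ξ
  unfold cv
  rw [← integral_sub_left_eq_self _ volume ξ]
  simp only [sub_sub_cancel, mul_comm]

/-- Bilinearity: a∗a' - b∗b' = (a-b)∗a' + b∗(a'-b'). Each term pairs one factor V with one factor W,
so `conv'` keeps the weight V of the difference and yields the small constant δ. -/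
lemma mul (hW : ConvWeights W V δ) (hk : 0 ≤ k) (hA : 0 ≤ A) (hA' : 0 ≤ A')
    (h : SymPair W V k A a b) (h' : SymPair W V k A' a' b') :
    SymPair W V k (2 * A * A' * δ) (fun t => cv (a t) (a' t)) (fun t => cv (b t) (b' t)) := by
  have hδ := hW.δ_nonneg
  have hle : ∀ t ξ, A * A' * (δ * W t ξ) ≤ 2 * A * A' * δ * W t ξ := fun t ξ => by
    have := hW.nonneg t ξ
    have : 0 ≤ A * A' * (δ * W t ξ) := by positivity
    linarith
  refine ⟨(isSymbol_cv hW hA hA' h.left h'.left).mono hle,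
    (isSymbol_cv hW hA hA' h.right h'.right).mono hle, fun t ξ => ?_⟩
  have hint : ∀ {a b : ℝ → Plane → ℂ}, IsSymbol (fun t ξ => A * W t ξ) a →
      IsSymbol (fun t ξ => A' * W t ξ) b → Integrable fun η => a t η * b t (ξ - η) := by
    intro a b ha hb
    refine ((hW.int t ξ).const_mul (A * A')).mono' ((ha.meas t).mul
      ((hb.meas t).comp (measurable_const.sub measurable_id))).aestronglyMeasurable
      (Eventually.of_forall fun η => ?_)
    rw [norm_mul]
    calc _ ≤ (A * W t η) * (A' * W t (ξ - η)) := mul_le_mul (ha.bound t η) (hb.bound t _)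
          (norm_nonneg _) (mul_nonneg hA (hW.nonneg t η))
      _ = _ := by ring
  rw [cv_sub ξ (hint h.left h'.left) (hint h.right h'.right) (hint h.right h'.left)]
  have e1 : ‖cv (fun η => a t η - b t η) (a' t) ξ‖ ≤ A * A' * k * (δ * V t ξ) := by
    refine (norm_cv_le (A := A * A' * k) ξ (hW.int' t ξ) fun η => ?_).trans
      (mul_le_mul_of_nonneg_left (hW.conv' t ξ) (by positivity))
    calc _ ≤ (A * (k * V t η)) * (A' * W t (ξ - η)) := mul_le_mul (h.diff t η) (h'.left.bound t _)
          (norm_nonneg _) (mul_nonneg hA (mul_nonneg hk (hW.nonneg' t η)))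
      _ = _ := by ring
  have e2 : ‖cv (b t) (fun η => a' t η - b' t η) ξ‖ ≤ A * A' * k * (δ * V t ξ) := by
    rw [cv_comm]
    refine (norm_cv_le (A := A * A' * k) ξ (hW.int' t ξ) fun η => ?_).trans
      (mul_le_mul_of_nonneg_left (hW.conv' t ξ) (by positivity))
    calc _ ≤ (A' * (k * V t η)) * (A * W t (ξ - η)) := mul_le_mul (h'.diff t η) (h.right.bound t _)
          (norm_nonneg _) (mul_nonneg hA' (mul_nonneg hk (hW.nonneg' t η)))
      _ = _ := by ring
  refine (norm_add_le _ _).trans ((add_le_add e1 e2).trans_eq ?_)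
  ring

end SymPair

/-! ### The nonlinear terms -/

/-- The Fourier transform of the superlinear part of the `j`-th component of the flux. -/
def fluxHat (f ρbar : ℝ) (j : Fin 2) (u : Plane → ℂ) (p : Fin 2 → Plane → ℂ) (ξ : Plane) : ℂ :=
  ((f ^ 2 - 2 * f * ρbar : ℝ) : ℂ) * cv u (p j) ξ
    + (((ρbar - 2 * f : ℝ) : ℂ) * cv (cv u u) (p j) ξ
    + (((1 : ℝ) : ℂ) * cv (cv (cv u u) u) (p j) ξ
    + (((if j = 0 then 1 / f else 0 : ℝ) : ℂ) * cv (cv u u) u ξ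
    + ((if j = 0 then ρbar / f - 2 else 0 : ℝ) : ℂ) * cv u u ξ)))

/-- The Fourier transform of `|∇φ|²`. -/
def sqHat (p : Fin 2 → Plane → ℂ) (ξ : Plane) : ℂ := cv (p 0) (p 0) ξ + cv (p 1) (p 1) ξ

/-- The Fourier transform of the superlinear part of the rate. -/
def rateHat (f : ℝ) (u : Plane → ℂ) (p : Fin 2 → Plane → ℂ) (ξ : Plane) : ℂ :=
  ((1 / 2 * f ^ 2 : ℝ) : ℂ) * sqHat p ξ
    + (((1 / 2 : ℝ) : ℂ) * cv (cv u u) (sqHat p) ξ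
    + (((-f : ℝ) : ℂ) * cv u (sqHat p) ξ
    + (((1 / (2 * f ^ 2) : ℝ) : ℂ) * cv u u ξ
    + (((1 / f : ℝ) : ℂ) * cv (cv u u) (p 0) ξ
    + ((-2 : ℝ) : ℂ) * cv u (p 0) ξ))))

/-- Every monomial has degree at least two, so it gains at least one factor δ; further factors are
absorbed by δ ≤ 1. Working with pairs gives the bound and the Lipschitz estimate in one computation,
and c depends on f and ρ̄ only. -/
lemma exists_symPair_nonlinear (f ρbar : ℝ) : ∃ c : ℝ, 0 ≤ c ∧ ∀ (W V : ℝ → Plane → ℝ) (δ k : ℝ)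
    (u u' : ℝ → Plane → ℂ) (p p' : ℝ → Fin 2 → Plane → ℂ), ConvWeights W V δ → 0 ≤ k →
    SymPair W V k 1 u u' → (∀ j, SymPair W V k 1 (fun t => p t j) (fun t => p' t j)) →
    (∀ j, SymPair W V k (c * δ) (fun t => fluxHat f ρbar j (u t) (p t))
      (fun t => fluxHat f ρbar j (u' t) (p' t))) ∧
    SymPair W V k (c * δ) (fun t => rateHat f (u t) (p t)) (fun t => rateHat f (u' t) (p' t)) := by
  set c₁ : Fin 2 → ℝ := fun j => |f ^ 2 - 2 * f * ρbar| * 2 + (|ρbar - 2 * f| * 4 + (|1| * 8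
    + (|if j = 0 then 1 / f else 0| * 4 + |if j = 0 then ρbar / f - 2 else 0| * 2))) with hc₁
  set c₂ : ℝ := |1 / 2 * f ^ 2| * (2 + 2) + (|1 / 2| * (2 * 2 * (2 + 2)) + (|-f| * (2 * (2 + 2))
    + (|1 / (2 * f ^ 2)| * 2 + (|1 / f| * 4 + |-2| * 2)))) with hc₂
  have hc₁0 : ∀ j, 0 ≤ c₁ j := fun j => by positivity
  have hc₂0 : 0 ≤ c₂ := by positivity
  refine ⟨c₁ 0 + c₁ 1 + c₂, by linarith [hc₁0 0, hc₁0 1], ?_⟩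
  intro W V δ k u u' p p' hW hk hu hp
  have hδ := hW.δ_nonneg
  have hδ1 := hW.δ_le
  have q1 : ∀ {a b a' b' : ℝ → Plane → ℂ}, SymPair W V k 1 a b → SymPair W V k 1 a' b' →
      SymPair W V k (2 * δ) (fun t => cv (a t) (a' t)) (fun t => cv (b t) (b' t)) := by
    intro a b a' b' h h'
    refine (SymPair.mul hW hk zero_le_one zero_le_one h h').mono hW hk (by linarith)
  have q2 : ∀ {a b a' b' : ℝ → Plane → ℂ} {c : ℝ}, 0 ≤ c → SymPair W V k (c * δ) a b →
      SymPair W V k 1 a' b' →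
      SymPair W V k (2 * c * δ) (fun t => cv (a t) (a' t)) (fun t => cv (b t) (b' t)) := by
    intro a b a' b' c hc h h'
    refine (SymPair.mul hW hk (by positivity) zero_le_one h h').mono hW hk ?_
    have : c * δ * δ ≤ c * δ * 1 := mul_le_mul_of_nonneg_left hδ1 (by positivity)
    linarith
  have q2' : ∀ {a b a' b' : ℝ → Plane → ℂ} {c : ℝ}, 0 ≤ c → SymPair W V k 1 a b →
      SymPair W V k (c * δ) a' b' →
      SymPair W V k (2 * c * δ) (fun t => cv (a t) (a' t)) (fun t => cv (b t) (b' t)) := by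
    intro a b a' b' c hc h h'
    refine (SymPair.mul hW hk zero_le_one (by positivity) h h').mono hW hk ?_
    have : c * δ * δ ≤ c * δ * 1 := mul_le_mul_of_nonneg_left hδ1 (by positivity)
    linarith
  have q3 : ∀ {a b a' b' : ℝ → Plane → ℂ} {c c' : ℝ}, 0 ≤ c → 0 ≤ c' → SymPair W V k (c * δ) a b →
      SymPair W V k (c' * δ) a' b' →
      SymPair W V k (2 * c * c' * δ) (fun t => cv (a t) (a' t)) (fun t => cv (b t) (b' t)) := by
    intro a b a' b' c c' hc hc' h h'
    refine (SymPair.mul hW hk (by positivity) (by positivity) h h').mono hW hk ?_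
    have h2 : δ * δ ≤ 1 := by nlinarith
    have : c * c' * δ * (δ * δ) ≤ c * c' * δ * 1 := mul_le_mul_of_nonneg_left h2 (by positivity)
    linarith
  have u2 := q1 hu hu
  have u3 := q2 (by norm_num) u2 hu
  have hP : SymPair W V k ((2 + 2) * δ) (fun t => sqHat (p t)) (fun t => sqHat (p' t)) := by
    have := (q1 (hp 0) (hp 0)).add (q1 (hp 1) (hp 1))
    rwa [← add_mul] at this
  constructor
  · intro j
    have := ((q1 hu (hp j)).const_mul (f ^ 2 - 2 * f * ρbar)).add
      (((q2 (by norm_num) u2 (hp j)).const_mul (ρbar - 2 * f)).add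
      (((q2 (by norm_num) u3 (hp j)).const_mul 1).add
      ((u3.const_mul (if j = 0 then 1 / f else 0)).add
        (u2.const_mul (if j = 0 then ρbar / f - 2 else 0)))))
    refine SymPair.mono (a := fun t => fluxHat f ρbar j (u t) (p t)) hW hk this ?_
    have e : c₁ j ≤ c₁ 0 + c₁ 1 + c₂ := by
      fin_cases j
      · simpa using by linarith [hc₁0 1]
      · simpa using by linarith [hc₁0 0]
    refine le_trans (le_of_eq ?_) (mul_le_mul_of_nonneg_right e hδ)
    rw [hc₁]; ring
  · have := (hP.const_mul (1 / 2 * f ^ 2)).add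
      (((q3 (by norm_num) (by norm_num) u2 hP).const_mul (1 / 2)).add
      (((q2' (by norm_num) hu hP).const_mul (-f)).add
      ((u2.const_mul (1 / (2 * f ^ 2))).add
      (((q2 (by norm_num) u2 (hp 0)).const_mul (1 / f)).add ((q1 hu (hp 0)).const_mul (-2))))))
    refine SymPair.mono (a := fun t => rateHat f (u t) (p t)) hW hk this ?_
    have e : c₂ ≤ c₁ 0 + c₁ 1 + c₂ := by linarith [hc₁0 0, hc₁0 1]
    refine le_trans (le_of_eq ?_) (mul_le_mul_of_nonneg_right e hδ)
    rw [hc₂]; ring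

/-! ### The weight adapted to the two-point problem -/

/-- Projection of the time axis to `[0, T]`. -/
def clamp (T t : ℝ) : ℝ := max 0 (min t T)

lemma clamp_mem {T : ℝ} (hT : 0 ≤ T) (t : ℝ) : clamp T t ∈ Icc 0 T :=
  ⟨le_max_left _ _, max_le hT (min_le_right _ _)⟩

lemma clamp_of_mem {T t : ℝ} (ht : t ∈ Icc 0 T) : clamp T t = t := by
  rw [clamp, min_eq_left ht.2, max_eq_right ht.1]

lemma clamp_clamp {T : ℝ} (hT : 0 ≤ T) (t : ℝ) : clamp T (clamp T t) = clamp T t :=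
  clamp_of_mem (clamp_mem hT t)

lemma continuous_clamp (T : ℝ) : Continuous (clamp T) := by unfold clamp; fun_prop

/-- The weight `(1+|ξ|)⁻³ (N e^{-c t |ξ|} + M e^{-c (T-t) |ξ|})`. -/
def twoSided (c N M T t : ℝ) (ξ : Plane) : ℝ :=
  decay ξ * (N * Real.exp (-(c * clamp T t * ‖ξ‖)) + M * Real.exp (-(c * (T - clamp T t) * ‖ξ‖)))

section TwoSided

variable {c N M T : ℝ} (hc : 0 ≤ c) (hN : 0 ≤ N) (hM : 0 ≤ M) (hT : 0 ≤ T)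
include hc hN hM hT

omit hc hT in
lemma twoSided_nonneg (t : ℝ) (ξ : Plane) : 0 ≤ twoSided c N M T t ξ := by
  have := decay_pos ξ
  unfold twoSided; positivity

lemma twoSided_le (t : ℝ) (ξ : Plane) : twoSided c N M T t ξ ≤ (N + M) * decay ξ := by
  unfold twoSided
  have h := clamp_mem hT t
  have e1 : Real.exp (-(c * clamp T t * ‖ξ‖)) ≤ 1 := Real.exp_le_one_iff.2 (by
    have := h.1; have : 0 ≤ c * clamp T t * ‖ξ‖ := by positivity
    linarith)
  have e2 : Real.exp (-(c * (T - clamp T t) * ‖ξ‖)) ≤ 1 := Real.exp_le_one_iff.2 (by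
    have := sub_nonneg.2 h.2; have : 0 ≤ c * (T - clamp T t) * ‖ξ‖ := by positivity
    linarith)
  rw [mul_comm]
  refine mul_le_mul_of_nonneg_right ?_ (decay_pos ξ).le
  nlinarith

omit hT in
-- Each of the two exponentials changes at most at the rate c|ξ|. This is the growth condition on
-- the weight in the linear estimate, with ρ = c|ξ|.
lemma twoSided_growth {s t : ℝ} (hs : s ∈ Icc 0 T) (ht : t ∈ Icc 0 T) (ξ : Plane) :
    twoSided c N M T s ξ ≤ Real.exp (c * ‖ξ‖ * |t - s|) * twoSided c N M T t ξ := by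
  unfold twoSided
  rw [clamp_of_mem hs, clamp_of_mem ht, mul_left_comm]
  refine mul_le_mul_of_nonneg_left ?_ (decay_pos ξ).le
  have hcr : 0 ≤ c * ‖ξ‖ := by positivity
  have e1 : Real.exp (-(c * s * ‖ξ‖)) ≤
      Real.exp (c * ‖ξ‖ * |t - s|) * Real.exp (-(c * t * ‖ξ‖)) := by
    rw [← Real.exp_add]
    apply Real.exp_le_exp.2
    nlinarith [le_abs_self (t - s)]
  have e2 : Real.exp (-(c * (T - s) * ‖ξ‖)) ≤
      Real.exp (c * ‖ξ‖ * |t - s|) * Real.exp (-(c * (T - t) * ‖ξ‖)) := by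
    rw [← Real.exp_add]
    apply Real.exp_le_exp.2
    nlinarith [neg_abs_le (t - s)]
  nlinarith [mul_le_mul_of_nonneg_left e1 hN, mul_le_mul_of_nonneg_left e2 hM]

omit hc hN in
lemma le_twoSided_zero (ξ : Plane) : N * decay ξ ≤ twoSided c N M T 0 ξ := by
  have hd := decay_pos ξ
  unfold twoSided
  rw [clamp_of_mem ⟨le_rfl, hT⟩]
  have : 0 ≤ decay ξ * (M * Real.exp (-(c * (T - 0) * ‖ξ‖))) := by positivity
  simp only [mul_zero, zero_mul, neg_zero, Real.exp_zero, mul_one, mul_add]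
  linarith

omit hc hM in
lemma le_twoSided_end (ξ : Plane) : M * decay ξ ≤ twoSided c N M T T ξ := by
  have hd := decay_pos ξ
  unfold twoSided
  rw [clamp_of_mem ⟨hT, le_rfl⟩]
  have : 0 ≤ decay ξ * (N * Real.exp (-(c * T * ‖ξ‖))) := by positivity
  simp only [sub_self, mul_zero, zero_mul, neg_zero, Real.exp_zero, mul_one, mul_add]
  linarith

omit hc hN hM hT in
lemma continuous_twoSided (t : ℝ) : Continuous (twoSided c N M T t) := by
  unfold twoSided
  exact continuous_decay.mul (by fun_prop)

lemma twoSided_mul_le (t : ℝ) (ξ η : Plane) :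
    twoSided c N M T t η * twoSided c N M T t (ξ - η) ≤
      16 * (N + M) * twoSided c N M T t ξ * (decay η + decay (ξ - η)) := by
  have h := clamp_mem hT t
  have h1 := decay_mul_decay_le ξ η
  have hr : ‖ξ‖ ≤ ‖η‖ + ‖ξ - η‖ := by simpa using norm_add_le η (ξ - η)
  have h2 := exp_profile_mul_le hN hM (mul_nonneg hc h.1) (mul_nonneg hc (sub_nonneg.2 h.2))
    (norm_nonneg η) (norm_nonneg (ξ - η)) hr
  unfold twoSided
  have d1 := decay_pos η
  have d2 := decay_pos (ξ - η)
  have d3 := decay_pos ξ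
  calc _ = (decay η * decay (ξ - η)) *
        ((N * Real.exp (-(c * clamp T t * ‖η‖)) + M * Real.exp (-(c * (T - clamp T t) * ‖η‖))) *
        (N * Real.exp (-(c * clamp T t * ‖ξ - η‖))
          + M * Real.exp (-(c * (T - clamp T t) * ‖ξ - η‖)))) := by ring
    _ ≤ (8 * decay ξ * (decay η + decay (ξ - η))) * _ :=
        mul_le_mul h1 h2 (by positivity) (by positivity)
    _ = _ := by ring

end TwoSided

lemma integrable_decay_sub (ξ : Plane) : Integrable fun η => decay (ξ - η) :=
  (integrable_decay.comp_sub_left ξ)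

lemma integral_decay_sub (ξ : Plane) : ∫ η, decay (ξ - η) = ∫ η, decay η :=
  integral_sub_left_eq_self decay volume ξ

lemma integral_le_of_le_decay_sub {F h : Plane → ℝ} {k : ℝ} {ξ : Plane} (hF : Integrable F)
    (hh : Integrable h) (hle : ∀ η, F η ≤ k * (h η + decay (ξ - η))) :
    ∫ η, F η ≤ k * ((∫ η, h η) + ∫ η, decay η) := by
  have h1 : ∫ η, F η ≤ ∫ η, k * (h η + decay (ξ - η)) :=
    integral_mono hF ((hh.add (integrable_decay_sub ξ)).const_mul k) hle
  rwa [integral_const_mul, integral_add hh (integrable_decay_sub ξ), integral_decay_sub] at h1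

/-- Two weights for differences are needed with the same W: W itself for the contraction, and the
time-independent `slowDecay` for the comparison of different viscosities. In both cases convolution
with W costs a constant proportional to N+M. -/
lemma exists_convWeights : ∃ C > 0, ∀ c N M T B : ℝ, 0 ≤ c → 0 ≤ N → 0 ≤ M → 0 ≤ T → 0 ≤ B →
    C * B * (N + M) ≤ 1 →
    ConvWeights (fun t ξ => B * twoSided c N M T t ξ) (fun t ξ => B * twoSided c N M T t ξ)
      (C * B * (N + M)) ∧
    ConvWeights (fun t ξ => B * twoSided c N M T t ξ) (fun _ ξ => slowDecay ξ)
      (C * B * (N + M)) := by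
  obtain ⟨I, hI⟩ : ∃ I, I = ∫ η, decay η := ⟨_, rfl⟩
  obtain ⟨J, hJ⟩ : ∃ J, J = ∫ η, slowDecay η := ⟨_, rfl⟩
  have hI0 : 0 ≤ I := hI ▸ integral_nonneg fun η => (decay_pos η).le
  have hJ0 : 0 ≤ J := hJ ▸ integral_nonneg fun η => (slowDecay_pos η).le
  -- The larger of the pointwise constants, 16, times two copies of the integral; the summand 1
  -- makes the constant positive.
  refine ⟨32 * (I + J) + 1, by positivity, ?_⟩
  intro c N M T B hc hN hM hT hB hδ
  obtain ⟨W, hW⟩ : ∃ W : ℝ → Plane → ℝ, W = fun t ξ => B * twoSided c N M T t ξ := ⟨_, rfl⟩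
  rw [← hW]
  have hW0 : ∀ t ξ, 0 ≤ W t ξ := fun t ξ => by
    rw [hW]; exact mul_nonneg hB (twoSided_nonneg hN hM t ξ)
  have hWle : ∀ t ξ, W t ξ ≤ B * (N + M) * decay ξ := fun t ξ => by
    rw [hW, mul_assoc]; exact mul_le_mul_of_nonneg_left (twoSided_le hc hN hM hT t ξ) hB
  have hWc : ∀ t, Continuous (W t) := fun t => by
    rw [hW]; exact continuous_const.mul (continuous_twoSided t)
  have hcont : ∀ t ξ, Continuous fun η => W t (ξ - η) := fun t ξ => (hWc t).comp (by fun_prop)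
  have hNM : 0 ≤ N + M := add_nonneg hN hM
  have hWW : ∀ t ξ η, W t η * W t (ξ - η) ≤
      16 * B * (N + M) * W t ξ * (decay η + decay (ξ - η)) := by
    intro t ξ η
    have := mul_le_mul_of_nonneg_left (twoSided_mul_le hc hN hM hT t ξ η) (mul_nonneg hB hB)
    simp only [hW]
    linarith
  have hVW : ∀ t ξ η, slowDecay η * W t (ξ - η) ≤
      8 * B * (N + M) * slowDecay ξ * (slowDecay η + decay (ξ - η)) := by
    intro t ξ η
    have h1 := mul_le_mul_of_nonneg_left (hWle t (ξ - η)) (slowDecay_pos η).le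
    have h2 := mul_le_mul_of_nonneg_left (slowDecay_mul_decay_le ξ η) (mul_nonneg hB hNM)
    linarith
  have iWW : ∀ t ξ, Integrable fun η => W t η * W t (ξ - η) := fun t ξ =>
    ((integrable_decay.add (integrable_decay_sub ξ)).const_mul
      (16 * B * (N + M) * W t ξ)).mono'
      ((hWc t).mul (hcont t ξ)).aestronglyMeasurable
      (Eventually.of_forall fun η => by
        rw [Real.norm_of_nonneg (mul_nonneg (hW0 _ _) (hW0 _ _))]; exact hWW t ξ η)
  have iVW : ∀ t ξ, Integrable fun η => slowDecay η * W t (ξ - η) := fun t ξ =>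
    ((integrable_slowDecay.add (integrable_decay_sub ξ)).const_mul
      (8 * B * (N + M) * slowDecay ξ)).mono'
      (continuous_slowDecay.mul (hcont t ξ)).aestronglyMeasurable
      (Eventually.of_forall fun η => by
        rw [Real.norm_of_nonneg (mul_nonneg (slowDecay_pos _).le (hW0 _ _))]; exact hVW t ξ η)
  have cWW : ∀ t ξ, cpi * ∫ η, W t η * W t (ξ - η) ≤
      (32 * (I + J) + 1) * B * (N + M) * W t ξ := by
    intro t ξ
    have h1 : ∫ η, W t η * W t (ξ - η) ≤ 16 * B * (N + M) * W t ξ * (I + I) :=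
      hI ▸ integral_le_of_le_decay_sub (iWW t ξ) integrable_decay (hWW t ξ)
    have h2 : 0 ≤ ∫ η, W t η * W t (ξ - η) :=
      integral_nonneg fun η => mul_nonneg (hW0 _ _) (hW0 _ _)
    have h3 := mul_le_of_le_one_left h2 cpi_le_one
    have h4 : 0 ≤ B * (N + M) * W t ξ * (32 * J + 1) := by have := hW0 t ξ; positivity
    linarith
  have cVW : ∀ t ξ, cpi * ∫ η, slowDecay η * W t (ξ - η) ≤
      (32 * (I + J) + 1) * B * (N + M) * slowDecay ξ := by
    intro t ξ
    have h1 : ∫ η, slowDecay η * W t (ξ - η) ≤ 8 * B * (N + M) * slowDecay ξ * (J + I) :=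
      hI ▸ hJ ▸ integral_le_of_le_decay_sub (iVW t ξ) integrable_slowDecay (hVW t ξ)
    have h2 : 0 ≤ ∫ η, slowDecay η * W t (ξ - η) :=
      integral_nonneg fun η => mul_nonneg (slowDecay_pos _).le (hW0 _ _)
    have h3 := mul_le_of_le_one_left h2 cpi_le_one
    have h4 : 0 ≤ B * (N + M) * slowDecay ξ * (24 * (I + J) + 1) := by
      have := slowDecay_pos ξ; positivity
    linarith
  have hδ0 : 0 ≤ (32 * (I + J) + 1) * B * (N + M) := by positivity
  have hdom : ∃ D, 0 ≤ D ∧ ∀ t ξ, W t ξ ≤ D * decay ξ := ⟨B * (N + M), by positivity, hWle⟩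
  exact ⟨⟨hδ0, hδ, hW0, hW0, hdom, iWW, iWW, cWW, cWW⟩,
    ⟨hδ0, hδ, hW0, fun _ ξ => (slowDecay_pos ξ).le, hdom, iWW, iVW, cWW, cVW⟩⟩

/-! ### Forcing terms -/

/-- The Fourier transform of `∇φ`, where `v` is the transform of `|∇| φ`. -/
def pHat (v : ℝ → Plane → ℂ) (t : ℝ) (j : Fin 2) (ξ : Plane) : ℂ :=
  Complex.I * ((ξ j / ‖ξ‖ : ℝ) : ℂ) * v t ξ

lemma abs_div_norm_le (ξ : Plane) (j : Fin 2) : |ξ j / ‖ξ‖| ≤ 1 := by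
  rw [abs_div, abs_norm]
  exact div_le_one_of_le₀ (abs_apply_le ξ j) (norm_nonneg _)

lemma norm_pHat_factor_le (ξ : Plane) (j : Fin 2) :
    ‖Complex.I * ((ξ j / ‖ξ‖ : ℝ) : ℂ)‖ ≤ 1 := by
  rw [norm_mul, Complex.norm_I, one_mul, Complex.norm_real]
  exact abs_div_norm_le ξ j

lemma IsSymbol.pHat {W : ℝ → Plane → ℝ} {v : ℝ → Plane → ℂ} (h : IsSymbol W v) (j : Fin 2) :
    IsSymbol W (fun t => pHat v t j) := by
  refine ⟨fun ξ => continuous_const.mul (h.cont ξ), fun t => ?_, fun t ξ => ?_, fun t ξ => ?_⟩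
  · refine Measurable.mul (Measurable.const_mul (Complex.measurable_ofReal.comp ?_) _) (h.meas t)
    exact Measurable.div (Continuous.measurable (by fun_prop)) measurable_norm
  · simp only [Hughes.pHat, h.herm, norm_neg, PiLp.neg_apply, map_mul, Complex.conj_I,
      Complex.conj_ofReal]
    push_cast; ring
  · rw [Hughes.pHat, norm_mul]
    exact (mul_le_of_le_one_left (norm_nonneg _) (norm_pHat_factor_le ξ j)).trans (h.bound t ξ)

lemma SymPair.pHat {W V : ℝ → Plane → ℝ} {k A : ℝ} {v v' : ℝ → Plane → ℂ}
    (h : SymPair W V k A v v') (j : Fin 2) :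
    SymPair W V k A (fun t => pHat v t j) (fun t => pHat v' t j) := by
  refine ⟨h.left.pHat j, h.right.pHat j, fun t ξ => ?_⟩
  rw [Hughes.pHat, Hughes.pHat, ← mul_sub, norm_mul]
  exact (mul_le_of_le_one_left (norm_nonneg _) (norm_pHat_factor_le ξ j)).trans (h.diff t ξ)

/-- The forcing term in the first equation. -/
def forceψ (f ρbar : ℝ) (U : Fin 2 → ℝ → Plane → ℂ) (ξ : Plane) (t : ℝ) : ℂ :=
  Complex.I * (ξ 0 : ℂ) * fluxHat f ρbar 0 (U 0 t) (pHat (U 1) t) ξ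
    + Complex.I * (ξ 1 : ℂ) * fluxHat f ρbar 1 (U 0 t) (pHat (U 1) t) ξ

/-- The forcing term in the second equation, multiplied by `|ξ|`. -/
def forcev (f : ℝ) (U : Fin 2 → ℝ → Plane → ℂ) (ξ : Plane) (t : ℝ) : ℂ :=
  (‖ξ‖ : ℂ) * rateHat f (U 0 t) (pHat (U 1) t) ξ

structure ForceBounds (f ρbar θ k : ℝ) (W V : ℝ → Plane → ℝ) (U U' : Fin 2 → ℝ → Plane → ℂ) :
    Prop where
  contψ : ∀ ξ, Continuous (forceψ f ρbar U ξ)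
  contv : ∀ ξ, Continuous (forcev f U ξ)
  measψ : Measurable (Function.uncurry (forceψ f ρbar U))
  measv : Measurable (Function.uncurry (forcev f U))
  hermψ : ∀ ξ t, forceψ f ρbar U (-ξ) t = (starRingEnd ℂ) (forceψ f ρbar U ξ t)
  hermv : ∀ ξ t, forcev f U (-ξ) t = (starRingEnd ℂ) (forcev f U ξ t)
  boundψ : ∀ ξ t, ‖forceψ f ρbar U ξ t‖ ≤ θ * ‖ξ‖ * W t ξ
  boundv : ∀ ξ t, ‖forcev f U ξ t‖ ≤ θ * ‖ξ‖ * W t ξ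
  diffψ : ∀ ξ t, ‖forceψ f ρbar U ξ t - forceψ f ρbar U' ξ t‖ ≤ θ * k * ‖ξ‖ * V t ξ
  diffv : ∀ ξ t, ‖forcev f U ξ t - forcev f U' ξ t‖ ≤ θ * k * ‖ξ‖ * V t ξ

/-- The forcing consists of symbols of order one applied to nonlinear terms of size cδ. The factor
|ξ| is kept explicit because the linear estimate removes it. -/
lemma exists_forceBounds (f ρbar : ℝ) : ∃ c : ℝ, 0 < c ∧ ∀ (W V : ℝ → Plane → ℝ) (δ k : ℝ)
    (U U' : Fin 2 → ℝ → Plane → ℂ), ConvWeights W V δ → 0 ≤ k → (∀ i, IsSymbol W (U i)) →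
    (∀ i, IsSymbol W (U' i)) → (∀ i t ξ, ‖U i t ξ - U' i t ξ‖ ≤ k * V t ξ) →
    ForceBounds f ρbar (c * δ) k W V U U' := by
  obtain ⟨c, hc, H⟩ := exists_symPair_nonlinear f ρbar
  refine ⟨2 * c + 1, by positivity, ?_⟩
  intro W V δ k U U' hW hk hU hU' hd
  have hδ := hW.δ_nonneg
  have hp : ∀ i, SymPair W V k 1 (U i) (U' i) := fun i =>
    ⟨by simpa using hU i, by simpa using hU' i, by simpa using hd i⟩
  obtain ⟨hF, hR⟩ := H W V δ k (U 0) (U' 0) (fun t => pHat (U 1) t) (fun t => pHat (U' 1) t) hW hk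
    (hp 0) (fun j => (hp 1).pHat j)
  have hcd : 0 ≤ c * δ := mul_nonneg hc hδ
  have hmul : ∀ (j : Fin 2) (ξ : Plane) (z : ℂ) (w : ℝ), ‖z‖ ≤ c * δ * w →
      ‖Complex.I * (ξ j : ℂ) * z‖ ≤ ‖ξ‖ * (c * δ * w) := by
    intro j ξ z w hz
    rw [norm_mul, norm_mul, Complex.norm_I, one_mul, Complex.norm_real]
    exact mul_le_mul (abs_apply_le ξ j) hz (norm_nonneg _) (norm_nonneg _)
  have hmulv : ∀ (ξ : Plane) (z : ℂ) (w : ℝ), ‖z‖ ≤ c * δ * w →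
      ‖(‖ξ‖ : ℂ) * z‖ ≤ ‖ξ‖ * (c * δ * w) := by
    intro ξ z w hz
    rw [norm_mul, Complex.norm_real, norm_norm]
    exact mul_le_mul_of_nonneg_left hz (norm_nonneg _)
  have hm : ∀ {W : ℝ → Plane → ℝ} {a : ℝ → Plane → ℂ}, IsSymbol W a →
      Measurable fun q : Plane × ℝ => a q.2 q.1 := fun h =>
    h.uncurry_measurable.comp measurable_swap
  have hmc : ∀ j : Fin 2, Measurable fun q : Plane × ℝ => Complex.I * ((q.1 j : ℝ) : ℂ) := fun j =>
    Continuous.measurable (by fun_prop)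
  refine ⟨fun ξ => ?_, fun ξ => ?_, ?_, ?_, fun ξ t => ?_, fun ξ t => ?_, fun ξ t => ?_,
    fun ξ t => ?_, fun ξ t => ?_, fun ξ t => ?_⟩
  · exact (continuous_const.mul ((hF 0).left.cont ξ)).add
      (continuous_const.mul ((hF 1).left.cont ξ))
  · exact continuous_const.mul (hR.left.cont ξ)
  · exact ((hmc 0).mul (hm (hF 0).left)).add ((hmc 1).mul (hm (hF 1).left))
  · exact Measurable.mul (Continuous.measurable (by fun_prop)) (hm hR.left)
  · have e0 := (hF 0).left.herm t ξ
    have e1 := (hF 1).left.herm t ξ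
    simp only [forceψ, e0, e1, PiLp.neg_apply, map_add, map_mul, Complex.conj_I,
      Complex.conj_ofReal]
    push_cast; ring
  · have e0 := hR.left.herm t ξ
    simp only [forcev, e0, norm_neg, map_mul, Complex.conj_ofReal]
  · have b0 := hmul 0 ξ _ _ ((hF 0).left.bound t ξ)
    have b1 := hmul 1 ξ _ _ ((hF 1).left.bound t ξ)
    have h0 := mul_nonneg (mul_nonneg hδ (norm_nonneg ξ)) (hW.nonneg t ξ)
    refine (norm_add_le _ _).trans ((add_le_add b0 b1).trans ?_)
    linarith
  · have b0 := hmulv ξ _ _ (hR.left.bound t ξ)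
    have h0 := mul_nonneg (mul_nonneg hδ (norm_nonneg ξ)) (hW.nonneg t ξ)
    have h1 := mul_nonneg hc h0
    refine b0.trans ?_
    linarith
  · have b0 := hmul 0 ξ _ _ ((hF 0).diff t ξ)
    have b1 := hmul 1 ξ _ _ ((hF 1).diff t ξ)
    have h0 := mul_nonneg (mul_nonneg (mul_nonneg hδ hk) (norm_nonneg ξ)) (hW.nonneg' t ξ)
    have e : forceψ f ρbar U ξ t - forceψ f ρbar U' ξ t =
        Complex.I * (ξ 0 : ℂ) * (fluxHat f ρbar 0 (U 0 t) (pHat (U 1) t) ξ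
          - fluxHat f ρbar 0 (U' 0 t) (pHat (U' 1) t) ξ)
        + Complex.I * (ξ 1 : ℂ) * (fluxHat f ρbar 1 (U 0 t) (pHat (U 1) t) ξ
          - fluxHat f ρbar 1 (U' 0 t) (pHat (U' 1) t) ξ) := by
      simp only [forceψ]; ring
    rw [e]
    refine (norm_add_le _ _).trans ((add_le_add b0 b1).trans ?_)
    linarith
  · have b0 := hmulv ξ _ _ (hR.diff t ξ)
    have h0 := mul_nonneg (mul_nonneg (mul_nonneg hδ hk) (norm_nonneg ξ)) (hW.nonneg' t ξ)
    have h1 := mul_nonneg hc h0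
    have e : forcev f U ξ t - forcev f U' ξ t =
        (‖ξ‖ : ℂ) * (rateHat f (U 0 t) (pHat (U 1) t) ξ
          - rateHat f (U' 0 t) (pHat (U' 1) t) ξ) := by
      simp only [forcev]; ring
    rw [e]
    refine b0.trans ?_
    linarith

/-! ### A fixed point theorem for functions dominated by a weight -/

/-- Picard iteration from 0 in the norm weighted by W, done pointwise so that W may vanish. Two
points of the ball differ by at most 2W, so the iterates converge geometrically; `hlim` transfers
the side conditions in P, such as continuity in time and measurability, to the limit. -/
lemma exists_fixed_point {ι : Type*} (S : (ι → ℂ) → ι → ℂ) (W : ι → ℝ) (P : (ι → ℂ) → Prop)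
    (hW : ∀ i, 0 ≤ W i) (h0 : P 0)
    (hS : ∀ u, P u → (∀ i, ‖u i‖ ≤ W i) → P (S u) ∧ ∀ i, ‖S u i‖ ≤ W i)
    (hc : ∀ u v, P u → P v → (∀ i, ‖u i‖ ≤ W i) → (∀ i, ‖v i‖ ≤ W i) → ∀ k, 0 ≤ k →
      (∀ i, ‖u i - v i‖ ≤ k * W i) → ∀ i, ‖S u i - S v i‖ ≤ k / 2 * W i)
    (hlim : ∀ (F : ℕ → ι → ℂ) (u : ι → ℂ), (∀ n, P (F n)) → (∀ i, ‖u i‖ ≤ W i) →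
      (∀ n i, ‖F n i - u i‖ ≤ 4 * (1 / 2) ^ n * W i) → P u) :
    ∃ u, P u ∧ (∀ i, ‖u i‖ ≤ W i) ∧ S u = u := by
  set F : ℕ → ι → ℂ := fun n => S^[n] 0 with hF
  have hsucc : ∀ n, F (n + 1) = S (F n) := fun n => Function.iterate_succ_apply' S n 0
  have hP : ∀ n, P (F n) ∧ ∀ i, ‖F n i‖ ≤ W i := by
    intro n
    induction n with
    | zero => exact ⟨h0, fun i => by simpa [hF] using hW i⟩
    | succ n ih => rw [hsucc]; exact hS _ ih.1 ih.2
  have hstep : ∀ n i, ‖F n i - F (n + 1) i‖ ≤ 2 * (1 / 2) ^ n * W i := by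
    intro n
    induction n with
    | zero =>
      intro i
      refine (norm_sub_le _ _).trans ?_
      have h1 := (hP 0).2 i
      have h2 := (hP 1).2 i
      simp only [pow_zero, zero_add]
      linarith
    | succ n ih =>
      intro i
      have := hc _ _ (hP n).1 (hP (n + 1)).1 (hP n).2 (hP (n + 1)).2 (2 * (1 / 2) ^ n)
        (by positivity) ih i
      rw [← hsucc, ← hsucc] at this
      refine this.trans_eq ?_
      ring
  have hcau : ∀ i, ∃ l, Tendsto (fun n => F n i) atTop (𝓝 l) ∧
      ∀ n, ‖F n i - l‖ ≤ 4 * (1 / 2) ^ n * W i := by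
    intro i
    have hd : ∀ n, dist (F n i) (F (n + 1) i) ≤ (2 * W i) * (1 / 2) ^ n := fun n => by
      rw [dist_eq_norm]; refine (hstep n i).trans_eq ?_; ring
    obtain ⟨l, hl⟩ := cauchySeq_tendsto_of_complete
      (cauchySeq_of_le_geometric (1 / 2) (2 * W i) (by norm_num) hd)
    refine ⟨l, hl, fun n => ?_⟩
    have := dist_le_of_le_geometric_of_tendsto (1 / 2) (2 * W i) (by norm_num) hd hl n
    rw [dist_eq_norm] at this
    refine this.trans_eq ?_
    ring
  choose u hu hrate using hcau
  have hub : ∀ i, ‖u i‖ ≤ W i := fun i =>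
    le_of_tendsto (hu i).norm (Eventually.of_forall fun n => (hP n).2 i)
  have hPu : P u := hlim F u (fun n => (hP n).1) hub fun n i => hrate i n
  refine ⟨u, hPu, hub, funext fun i => ?_⟩
  refine tendsto_nhds_unique ?_ ((hu i).comp (tendsto_add_atTop_nat 1))
  rw [tendsto_iff_norm_sub_tendsto_zero]
  refine squeeze_zero (g := fun n : ℕ => 2 * (1 / 2) ^ n * W i) (fun n => norm_nonneg _) (fun n => ?_) ?_
  · have := hc _ _ (hP n).1 hPu (hP n).2 hub (4 * (1 / 2) ^ n) (by positivity)
      (fun i => hrate i n) i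
    simp only [Function.comp, hsucc]
    refine this.trans_eq ?_
    ring
  · have := (tendsto_pow_atTop_nhds_zero_of_lt_one (r := (1 / 2 : ℝ)) (by norm_num)
      (by norm_num)).const_mul 2 |>.mul_const (W i)
    simpa using this

/-! ### The system on the Fourier side -/

/-- `z₁`, `z₂` solve the linearised system at the frequency `ξ` with forcing `A₁`, `A₂`. -/
structure IsModeSol (ρm ρbar σ : ℝ) (ξ : Plane) (A₁ A₂ z₁ z₂ : ℝ → ℂ) : Prop where
  deriv₁ : ∀ t, HasDerivAt z₁ ((Complex.I * (freqMode ρm ρbar σ ξ).om - (freqMode ρm ρbar σ ξ).d)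
    * z₁ t - (freqMode ρm ρbar σ ξ).α * z₂ t + A₁ t) t
  deriv₂ : ∀ t, HasDerivAt z₂ ((Complex.I * (freqMode ρm ρbar σ ξ).om + (freqMode ρm ρbar σ ξ).d)
    * z₂ t - (freqMode ρm ρbar σ ξ).γ * z₁ t + A₂ t) t

lemma IsModeSol.sub {ρm ρbar σ : ℝ} {ξ : Plane} {A₁ A₂ z₁ z₂ A₁' A₂' z₁' z₂' : ℝ → ℂ}
    (h : IsModeSol ρm ρbar σ ξ A₁ A₂ z₁ z₂) (h' : IsModeSol ρm ρbar σ ξ A₁' A₂' z₁' z₂') :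
    IsModeSol ρm ρbar σ ξ (fun t => A₁ t - A₁' t) (fun t => A₂ t - A₂' t)
      (fun t => z₁ t - z₁' t) (fun t => z₂ t - z₂' t) :=
  ⟨fun t => ((h.deriv₁ t).sub (h'.deriv₁ t)).congr_deriv (by ring),
    fun t => ((h.deriv₂ t).sub (h'.deriv₂ t)).congr_deriv (by ring)⟩

/-- The inviscid system is the viscous one with an additional forcing. -/
lemma IsModeSol.viscous {ρm ρbar : ℝ} (σ : ℝ) {ξ : Plane} {A₁ A₂ z₁ z₂ : ℝ → ℂ}
    (h : IsModeSol ρm ρbar 0 ξ A₁ A₂ z₁ z₂) :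
    IsModeSol ρm ρbar σ ξ (fun t => A₁ t + ((σ * ‖ξ‖ ^ 2 : ℝ) : ℂ) * z₁ t)
      (fun t => A₂ t - ((σ * ‖ξ‖ ^ 2 : ℝ) : ℂ) * z₂ t) z₁ z₂ := by
  have hd : (freqMode ρm ρbar σ ξ).d = (freqMode ρm ρbar 0 ξ).d + ((σ * ‖ξ‖ ^ 2 : ℝ) : ℂ) := by
    apply Complex.ext <;> simp [freqMode, -Complex.ofReal_mul, -Complex.ofReal_pow]
  refine ⟨fun t => (h.deriv₁ t).congr_deriv ?_, fun t => (h.deriv₂ t).congr_deriv ?_⟩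
  · rw [hd]; simp only [freqMode]; ring
  · rw [hd]; simp only [freqMode]; ring

lemma IsModeSol.continuous {ρm ρbar σ : ℝ} {ξ : Plane} {A₁ A₂ z₁ z₂ : ℝ → ℂ}
    (h : IsModeSol ρm ρbar σ ξ A₁ A₂ z₁ z₂) : Continuous z₁ ∧ Continuous z₂ :=
  ⟨continuous_iff_continuousAt.2 fun t => (h.deriv₁ t).continuousAt,
    continuous_iff_continuousAt.2 fun t => (h.deriv₂ t).continuousAt⟩

/-- The solution operator for given forcing. -/
def rawStep (ρm ρbar σ T : ℝ) (a b : Plane → ℂ) (U : Fin 2 → ℝ → Plane → ℂ) (i : Fin 2) (t : ℝ)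
    (ξ : Plane) : ℂ :=
  if i = 0 then (freqMode ρm ρbar σ ξ).solψ T (a ξ) (‖ξ‖ * b ξ)
    (forceψ (speed ρm ρbar) ρbar U ξ) (forcev (speed ρm ρbar) U ξ) t
  else (freqMode ρm ρbar σ ξ).solv T (a ξ) (‖ξ‖ * b ξ)
    (forceψ (speed ρm ρbar) ρbar U ξ) (forcev (speed ρm ρbar) U ξ) t

/-- The map whose fixed points are the solutions. -/
def step (ρm ρbar σ T : ℝ) (a b : Plane → ℂ) (U : Fin 2 → ℝ → Plane → ℂ) (i : Fin 2) (t : ℝ)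
    (ξ : Plane) : ℂ :=
  if ξ = 0 then 0 else rawStep ρm ρbar σ T a b U i (clamp T t) ξ

/-- Hermitian data with the decay used in the theorem. -/
structure GoodData (σ N M : ℝ) (a b : Plane → ℂ) : Prop where
  meas : Measurable a ∧ Measurable b
  herm₁ : ∀ ξ, a (-ξ) = (starRingEnd ℂ) (a ξ)
  herm₂ : ∀ ξ, b (-ξ) = (starRingEnd ℂ) (b ξ)
  bound₁ : ∀ ξ, (1 + σ * ‖ξ‖) * ‖a ξ‖ ≤ N * decay ξ
  bound₂ : ∀ ξ, (1 + σ * ‖ξ‖) * (‖ξ‖ * ‖b ξ‖) ≤ M * decay ξ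

lemma GoodData.mono {σ σ' N M : ℝ} {a b : Plane → ℂ} (h : GoodData σ N M a b) (hσ : σ' ≤ σ) :
    GoodData σ' N M a b :=
  ⟨h.meas, h.herm₁, h.herm₂, fun ξ => le_trans (by gcongr) (h.bound₁ ξ),
    fun ξ => le_trans (by gcongr) (h.bound₂ ξ)⟩

/-- The Fourier transforms of `ψ` and `|∇| φ` for a solution. -/
structure IsSpectralSol (ρm ρbar σ T : ℝ) (W : ℝ → Plane → ℝ) (a b : Plane → ℂ)
    (U : Fin 2 → ℝ → Plane → ℂ) : Prop where
  sym : ∀ i, IsSymbol W (U i)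
  viscous : ∀ i t ξ, (1 + σ * ‖ξ‖) * ‖U i t ξ‖ ≤ W t ξ
  zero : ∀ i t, U i t 0 = 0
  conv : ∃ δ, ConvWeights W W δ
  clamp_eq : ∀ i t ξ, U i (clamp T t) ξ = U i t ξ
  ode : ∀ ξ, ξ ≠ 0 → ∃ z₁ z₂ : ℝ → ℂ, IsModeSol ρm ρbar σ ξ
    (forceψ (speed ρm ρbar) ρbar U ξ) (forcev (speed ρm ρbar) U ξ) z₁ z₂ ∧ z₁ 0 = a ξ ∧
    z₂ T = ‖ξ‖ * b ξ ∧ ∀ t ∈ Icc 0 T, U 0 t ξ = z₁ t ∧ U 1 t ξ = z₂ t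

/-- Write √σ|ξ| = √(σ|ξ|)·√|ξ|. The first root is at most 1+σ|ξ|, the second is at most the quotient
`slowDecay`/`decay`. So √σ is gained for half a power of decay. -/
lemma mul_sqrt_mul_decay_le {σ : ℝ} (hσ : 0 ≤ σ) (ξ : Plane) :
    √σ * ‖ξ‖ * decay ξ ≤ (1 + σ * ‖ξ‖) * slowDecay ξ := by
  have hr := norm_nonneg ξ
  have hd := decay_pos ξ
  rw [← sqrt_mul_decay, ← mul_assoc]
  refine mul_le_mul_of_nonneg_right ?_ hd.le
  have h1 : √σ * ‖ξ‖ = √(σ * ‖ξ‖) * √‖ξ‖ := by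
    rw [Real.sqrt_mul hσ, mul_assoc, Real.mul_self_sqrt hr]
  rw [h1]
  refine mul_le_mul ?_ (Real.sqrt_le_sqrt (by linarith)) (Real.sqrt_nonneg _) (by positivity)
  rw [Real.sqrt_le_left (by positivity)]
  nlinarith [mul_nonneg hσ hr]

/-! ### The contraction on the Fourier side and the comparison of viscosities -/

section Exist

variable {ρm ρbar : ℝ} (hpos : 0 < ρbar) (hlt : ρbar < ρm / 2)
include hpos hlt

/-- Uniqueness of the two-point problem transfers the bound for the explicit solution to any
solution. In this form it applies to the solution map, to the difference of two of its values, and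
to the difference of solutions with different viscosities. -/
lemma exists_modeSol_bound : ∃ C κ c₁ B : ℝ, 0 < c₁ ∧ 0 < B ∧
    (∀ σ, 0 ≤ σ → ∀ ξ, ξ ≠ 0 →
      (freqMode ρm ρbar σ ξ).Admissible C κ (c₁ * ‖ξ‖) (‖ξ‖ * (1 + σ * ‖ξ‖))) ∧
    ∀ σ T : ℝ, 0 ≤ σ → 0 ≤ T → ∀ ξ, ξ ≠ 0 → ∀ (A₁ A₂ z₁ z₂ : ℝ → ℂ) (g : ℝ → ℝ) (D θ : ℝ),
      IsModeSol ρm ρbar σ ξ A₁ A₂ z₁ z₂ → Continuous A₁ → Continuous A₂ →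
      0 ≤ D → 0 ≤ θ → (∀ t ∈ Icc 0 T, 0 ≤ g t) →
      (∀ s ∈ Icc 0 T, ∀ t ∈ Icc 0 T, g s ≤ Real.exp (c₁ * ‖ξ‖ * |t - s|) * g t) →
      ‖z₁ 0‖ ≤ D * g 0 → ‖z₂ T‖ ≤ D * g T →
      (∀ s ∈ Icc 0 T, ‖A₁ s‖ ≤ θ * (‖ξ‖ * (1 + σ * ‖ξ‖)) * g s) →
      (∀ s ∈ Icc 0 T, ‖A₂ s‖ ≤ θ * (‖ξ‖ * (1 + σ * ‖ξ‖)) * g s) →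
      ∀ t ∈ Icc 0 T, ‖z₁ t‖ ≤ B * (D + θ) * g t ∧ ‖z₂ t‖ ≤ B * (D + θ) * g t := by
  obtain ⟨C, κ, c₁, hC, hκ, hc₁, hadm⟩ := exists_admissible hpos hlt
  obtain ⟨B, hB, hbd⟩ := Mode.Admissible.exists_sol_bound hC hκ
  refine ⟨C, κ, c₁, B, hc₁, hB, hadm, ?_⟩
  intro σ T hσ hT ξ hξ A₁ A₂ z₁ z₂ g D θ hz h1 h2 hD hθ hg hgg h0 hend hA₁ hA₂ t ht
  have e := (hadm σ hσ ξ hξ).eq_sol hT h1 h2 hz.deriv₁ hz.deriv₂ rfl rfl t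
  rw [e.1, e.2]
  exact hbd _ _ _ T (hadm σ hσ ξ hξ) hT _ _ A₁ A₂ g D θ hD hθ hg hgg h0 hend hA₁ hA₂ t ht

omit hpos hlt in
lemma rawStep_isModeSol {C κ ρ L : ℝ} {σ T : ℝ} {a b : Plane → ℂ} {U : Fin 2 → ℝ → Plane → ℂ}
    {ξ : Plane} (h : (freqMode ρm ρbar σ ξ).Admissible C κ ρ L)
    (h1 : Continuous (forceψ (speed ρm ρbar) ρbar U ξ))
    (h2 : Continuous (forcev (speed ρm ρbar) U ξ)) :
    IsModeSol ρm ρbar σ ξ (forceψ (speed ρm ρbar) ρbar U ξ) (forcev (speed ρm ρbar) U ξ)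
      (fun t => rawStep ρm ρbar σ T a b U 0 t ξ) (fun t => rawStep ρm ρbar σ T a b U 1 t ξ) := by
  refine ⟨fun t => ?_, fun t => ?_⟩
  · simpa [rawStep] using h.hasDerivAt_solψ T (a ξ) (‖ξ‖ * b ξ) h1 h2 t
  · simpa [rawStep] using h.hasDerivAt_solv T (a ξ) (‖ξ‖ * b ξ) h1 h2 t

/-- For small data the system on the Fourier side has a solution; solutions with different
viscosities are close to each other. -/
theorem exists_spectralSol : ∃ c₁ > 0, ∃ B > 0, ∃ ε > 0, B * ε ≤ 1 ∧
    ∀ σ T N M : ℝ, 0 ≤ σ → 0 ≤ T → 0 ≤ N → 0 ≤ M → N + M ≤ ε → ∀ a b : Plane → ℂ,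
    GoodData σ N M a b → ∃ U : Fin 2 → ℝ → Plane → ℂ,
      IsSpectralSol ρm ρbar σ T (fun t ξ => B * twoSided c₁ N M T t ξ) a b U ∧
      ∀ U₀ : Fin 2 → ℝ → Plane → ℂ,
        IsSpectralSol ρm ρbar 0 T (fun t ξ => B * twoSided c₁ N M T t ξ) a b U₀ →
        ∀ i t ξ, ‖U i t ξ - U₀ i t ξ‖ ≤ B * √σ * slowDecay ξ := by
  obtain ⟨C, κ, c₁, B, hc₁, hB, hadm, hbd⟩ := exists_modeSol_bound hpos hlt
  obtain ⟨Cw, hCw, hconv⟩ := exists_convWeights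
  obtain ⟨cf, hcf, hforce⟩ := exists_forceBounds (speed ρm ρbar) ρbar
  set A : ℝ := Cw * (2 * B) with hAdef
  have hA : 0 < A := by positivity
  -- The three summands of the denominator give the three smallness conditions A(N+M) ≤ 1, Bθ ≤ 1/2
  -- and 2B(N+M) ≤ 1.
  refine ⟨c₁, hc₁, 2 * B, by positivity, 1 / (A + 2 * B * cf * A + 2 * B), by positivity, ?_, ?_⟩
  · rw [mul_one_div]
    refine div_le_one_of_le₀ ?_ (by positivity)
    have : 0 < A + 2 * B * cf * A := by positivity
    linarith
  intro σ T N M hσ hT hN hM hNM a b hdata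
  rw [le_div_iff₀ (by positivity)] at hNM
  have hNM0 : 0 ≤ N + M := add_nonneg hN hM
  have hδ0 : 0 ≤ A * (N + M) := by positivity
  have hδ : A * (N + M) ≤ 1 := by nlinarith [mul_nonneg hNM0 (by positivity : 0 ≤ 2 * B * cf * A + 2 * B)]
  have hθ0 : 0 ≤ cf * (A * (N + M)) := by positivity
  have hθ : B * (cf * (A * (N + M))) ≤ 1 / 2 := by
    nlinarith [mul_nonneg hNM0 (by positivity : 0 ≤ A + 2 * B)]
  have hBNM : 2 * B * (N + M) ≤ 1 := by
    nlinarith [mul_nonneg hNM0 (by positivity : 0 ≤ A + 2 * B * cf * A)]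
  obtain ⟨cw1, cw2⟩ := hconv c₁ N M T (2 * B) hc₁.le hN hM hT (by positivity) hδ
  obtain ⟨θ, hθd⟩ : ∃ θ, θ = cf * (A * (N + M)) := ⟨_, rfl⟩
  obtain ⟨W, hW⟩ : ∃ W : ℝ → Plane → ℝ, W = fun t ξ => 2 * B * twoSided c₁ N M T t ξ := ⟨_, rfl⟩
  rw [← hW] at cw1 cw2 ⊢
  have hf1 := fun k U U' => hforce W W _ k U U' cw1
  have hf2 := fun k U U' => hforce W (fun _ ξ => slowDecay ξ) _ k U U' cw2
  rw [← hθd] at hf1 hf2 hθ hθ0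
  have hW0 := cw1.nonneg
  have hWd : ∀ t ξ, W t ξ ≤ decay ξ := by
    intro t ξ
    rw [hW]
    have h1 := mul_le_mul_of_nonneg_left (twoSided_le hc₁.le hN hM hT t ξ)
      (by positivity : 0 ≤ 2 * B)
    have h2 := mul_le_mul_of_nonneg_right hBNM (decay_pos ξ).le
    linarith
  have hWc : ∀ t ξ, W (clamp T t) ξ = W t ξ := by
    intro t ξ; simp only [hW, twoSided, clamp_clamp hT]
  have hWg : ∀ ξ, ∀ s ∈ Icc 0 T, ∀ t ∈ Icc 0 T,
      W s ξ ≤ Real.exp (c₁ * ‖ξ‖ * |t - s|) * W t ξ := by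
    intro ξ s hs t ht
    have h1 := mul_le_mul_of_nonneg_left (twoSided_growth hc₁.le hN hM hs ht ξ)
      (by positivity : 0 ≤ 2 * B)
    simp only [hW]
    linarith
  have hden : ∀ ξ : Plane, 0 < 1 + σ * ‖ξ‖ := fun ξ => by positivity
  have hW1 : ∀ t ξ, W t ξ / (1 + σ * ‖ξ‖) ≤ W t ξ := fun t ξ =>
    div_le_self (hW0 t ξ) (by have : 0 ≤ σ * ‖ξ‖ := by positivity
                              linarith)
  -- The linear estimate is applied with the weight W/(1+σ|ξ|). A forcing of size θ|ξ|W has the size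
  -- admitted there, and the solution keeps the extra factor 1/(1+σ|ξ|).
  have hlin : ∀ ξ, ξ ≠ 0 → ∀ (A₁ A₂ z₁ z₂ : ℝ → ℂ) (D θ : ℝ), IsModeSol ρm ρbar σ ξ A₁ A₂ z₁ z₂ →
      Continuous A₁ → Continuous A₂ → 0 ≤ D → 0 ≤ θ →
      (1 + σ * ‖ξ‖) * ‖z₁ 0‖ ≤ D * W 0 ξ → (1 + σ * ‖ξ‖) * ‖z₂ T‖ ≤ D * W T ξ →
      (∀ s, ‖A₁ s‖ ≤ θ * ‖ξ‖ * W s ξ) → (∀ s, ‖A₂ s‖ ≤ θ * ‖ξ‖ * W s ξ) →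
      ∀ t ∈ Icc 0 T, (1 + σ * ‖ξ‖) * ‖z₁ t‖ ≤ B * (D + θ) * W t ξ ∧
        (1 + σ * ‖ξ‖) * ‖z₂ t‖ ≤ B * (D + θ) * W t ξ := by
    intro ξ hξ A₁ A₂ z₁ z₂ D θ hz h1 h2 hD hθ h0 hend hA₁ hA₂ t ht
    have hd := hden ξ
    have e : ∀ s, θ * ‖ξ‖ * W s ξ = θ * (‖ξ‖ * (1 + σ * ‖ξ‖)) * (W s ξ / (1 + σ * ‖ξ‖)) := by
      intro s; field_simp
    have := hbd σ T hσ hT ξ hξ A₁ A₂ z₁ z₂ (fun t => W t ξ / (1 + σ * ‖ξ‖)) D θ hz h1 h2 hD hθ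
      (fun t _ => div_nonneg (hW0 t ξ) hd.le)
      (fun s hs t ht => by
        rw [← mul_div_assoc]; exact div_le_div_of_nonneg_right (hWg ξ s hs t ht) hd.le)
      (by rw [← mul_div_assoc, le_div_iff₀ hd, mul_comm]; exact h0)
      (by rw [← mul_div_assoc, le_div_iff₀ hd, mul_comm]; exact hend)
      (fun s _ => (hA₁ s).trans_eq (e s)) (fun s _ => (hA₂ s).trans_eq (e s)) t ht
    simpa only [← mul_div_assoc, le_div_iff₀ hd, mul_comm _ (1 + σ * ‖ξ‖)] using this
  -- the map preserves the ball
  have hsol : ∀ U : Fin 2 → ℝ → Plane → ℂ, (∀ i, IsSymbol W (U i)) → ∀ ξ, ξ ≠ 0 →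
      IsModeSol ρm ρbar σ ξ (forceψ (speed ρm ρbar) ρbar U ξ) (forcev (speed ρm ρbar) U ξ)
        (fun t => rawStep ρm ρbar σ T a b U 0 t ξ) (fun t => rawStep ρm ρbar σ T a b U 1 t ξ) := by
    intro U hU ξ hξ
    -- Only the bounds for a single U are used, so the second argument is U again and the value of k
    -- is immaterial.
    have hF := hf1 2 U U two_pos.le hU hU (fun i t ξ => by simpa using hW0 t ξ)
    exact rawStep_isModeSol (hadm σ hσ ξ hξ) (hF.contψ ξ) (hF.contv ξ)
  have hraw0 : ∀ U ξ, ξ ≠ 0 → rawStep ρm ρbar σ T a b U 0 0 ξ = a ξ := fun U ξ hξ => by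
    simp [rawStep, (hadm σ hσ ξ hξ).solψ_zero hT]
  have hraw1 : ∀ U ξ, rawStep ρm ρbar σ T a b U 1 T ξ = ‖ξ‖ * b ξ := fun U ξ => by
    simp [rawStep, Mode.Admissible.solv_end]
  have hbound : ∀ U : Fin 2 → ℝ → Plane → ℂ, (∀ i, IsSymbol W (U i)) → ∀ i t ξ,
      (1 + σ * ‖ξ‖) * ‖step ρm ρbar σ T a b U i t ξ‖ ≤ W t ξ := by
    intro U hU i t ξ
    by_cases hξ : ξ = 0
    · simpa [step, hξ] using hW0 t 0
    have hF := hf1 2 U U two_pos.le hU hU (fun i t ξ => by simpa using hW0 t ξ)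
    -- The ball has the weight 2B times `twoSided`, so the data have relative size 1/(2B). They
    -- contribute 1/2, and the forcing contributes Bθ ≤ 1/2.
    have h := hlin ξ hξ _ _ _ _ (1 / (2 * B)) θ (hsol U hU ξ hξ) (hF.contψ ξ) (hF.contv ξ)
      (by positivity) hθ0
      (by
        simp only [hraw0 U ξ hξ]
        refine (hdata.bound₁ ξ).trans ((le_twoSided_zero (c := c₁) hM hT ξ).trans_eq ?_)
        rw [hW]; field_simp)
      (by
        simp only [hraw1 U ξ, norm_mul, Complex.norm_real, norm_norm]
        refine (hdata.bound₂ ξ).trans ((le_twoSided_end (c := c₁) hN hT ξ).trans_eq ?_)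
        rw [hW]; field_simp)
      (hF.boundψ ξ) (hF.boundv ξ) (clamp T t) (clamp_mem hT t)
    have hk : B * (1 / (2 * B) + θ) * W (clamp T t) ξ ≤ W t ξ := by
      rw [hWc]
      refine mul_le_of_le_one_left (hW0 t ξ) ?_
      have : B * (1 / (2 * B)) = 1 / 2 := by field_simp
      linarith
    simp only [step, hξ, if_false]
    fin_cases i
    · exact h.1.trans hk
    · exact h.2.trans hk
  have hbound' : ∀ U : Fin 2 → ℝ → Plane → ℂ, (∀ i, IsSymbol W (U i)) → ∀ i t ξ,
      ‖step ρm ρbar σ T a b U i t ξ‖ ≤ W t ξ := by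
    intro U hU i t ξ
    refine le_trans ?_ (hbound U hU i t ξ)
    have : 0 ≤ σ * ‖ξ‖ * ‖step ρm ρbar σ T a b U i t ξ‖ := by positivity
    linarith
  have hsym : ∀ U : Fin 2 → ℝ → Plane → ℂ, (∀ i, IsSymbol W (U i)) → ∀ i,
      IsSymbol W (step ρm ρbar σ T a b U i) := by
    intro U hU i
    have hF := hf1 2 U U two_pos.le hU hU (fun i t ξ => by simpa using hW0 t ξ)
    refine ⟨fun ξ => ?_, fun t => ?_, fun t ξ => ?_, hbound' U hU i⟩
    · by_cases hξ : ξ = 0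
      · simp only [step, hξ, if_true]; exact continuous_const
      · have := (hsol U hU ξ hξ).continuous
        simp only [step, hξ, if_false]
        fin_cases i
        · exact this.1.comp (continuous_clamp T)
        · exact this.2.comp (continuous_clamp T)
    · have := measurable_freqMode_sol ρm ρbar σ hdata.meas.1
        (Measurable.mul (Continuous.measurable (by fun_prop)) hdata.meas.2 :
          Measurable fun ξ : Plane => (‖ξ‖ : ℂ) * b ξ) hF.measψ hF.measv T (clamp T t)
      refine Measurable.ite (measurableSet_singleton 0) measurable_const ?_
      fin_cases i
      · exact this.1
      · exact this.2
    · by_cases hξ : ξ = 0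
      · simp [step, hξ]
      · have hξ' : -ξ ≠ 0 := neg_ne_zero.2 hξ
        have h1 := hadm σ hσ ξ hξ
        have h2 := hadm σ hσ (-ξ) hξ'
        rw [norm_neg] at h2
        have := freqMode_sol_neg hT h1 h2 (a ξ) (‖ξ‖ * b ξ) (hF.contψ ξ) (hF.contv ξ) (clamp T t)
        simp only [step, hξ, hξ', if_false, rawStep]
        have e1 : (starRingEnd ℂ) (‖ξ‖ * b ξ) = ‖ξ‖ * b (-ξ) := by
          rw [map_mul, Complex.conj_ofReal, hdata.herm₂]
        rw [e1, ← hdata.herm₁] at this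
        have e2 : forceψ (speed ρm ρbar) ρbar U (-ξ) = fun s =>
          (starRingEnd ℂ) (forceψ (speed ρm ρbar) ρbar U ξ s) := funext (hF.hermψ ξ)
        have e3 : forcev (speed ρm ρbar) U (-ξ) = fun s =>
          (starRingEnd ℂ) (forcev (speed ρm ρbar) U ξ s) := funext (hF.hermv ξ)
        rw [e2, e3, norm_neg]
        split_ifs
        · exact this.1
        · exact this.2
  have hcontr : ∀ U U' : Fin 2 → ℝ → Plane → ℂ, (∀ i, IsSymbol W (U i)) →
      (∀ i, IsSymbol W (U' i)) → ∀ k, 0 ≤ k → (∀ i t ξ, ‖U i t ξ - U' i t ξ‖ ≤ k * W t ξ) →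
      ∀ i t ξ, ‖step ρm ρbar σ T a b U i t ξ - step ρm ρbar σ T a b U' i t ξ‖ ≤ k / 2 * W t ξ := by
    intro U U' hU hU' k hk hd i t ξ
    by_cases hξ : ξ = 0
    · have := hW0 t 0
      simp only [step, hξ, if_true, sub_self, norm_zero]; positivity
    have hF := hf1 k U U' hk hU hU' hd
    have hF' := hf1 2 U' U' two_pos.le hU' hU' (fun i t ξ => by simpa using hW0 t ξ)
    have h := hlin ξ hξ _ _ _ _ 0 (θ * k) ((hsol U hU ξ hξ).sub (hsol U' hU' ξ hξ))
      ((hF.contψ ξ).sub (hF'.contψ ξ)) ((hF.contv ξ).sub (hF'.contv ξ)) le_rfl (by positivity)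
      (by simp [hraw0 _ ξ hξ]) (by simp [hraw1]) (hF.diffψ ξ) (hF.diffv ξ) (clamp T t)
      (clamp_mem hT t)
    have hk' : B * (0 + θ * k) * W (clamp T t) ξ ≤ k / 2 * W t ξ := by
      rw [hWc]
      refine mul_le_mul_of_nonneg_right ?_ (hW0 t ξ)
      have := mul_le_mul_of_nonneg_right hθ hk
      linarith
    have hmul : ∀ z : ℂ, ‖z‖ ≤ (1 + σ * ‖ξ‖) * ‖z‖ := fun z => by
      have : 0 ≤ σ * ‖ξ‖ * ‖z‖ := by positivity
      linarith
    simp only [step, hξ, if_false]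
    fin_cases i
    · exact (hmul _).trans (h.1.trans hk')
    · exact (hmul _).trans (h.2.trans hk')
  -- the fixed point
  set cur : (Fin 2 × ℝ × Plane → ℂ) → Fin 2 → ℝ → Plane → ℂ := fun u i t ξ => u (i, t, ξ) with hcur
  set Wι : Fin 2 × ℝ × Plane → ℝ := fun p => W p.2.1 p.2.2 with hWι
  set P : (Fin 2 × ℝ × Plane → ℂ) → Prop := fun u => ∀ i, (∀ ξ, Continuous fun t => u (i, t, ξ)) ∧
    (∀ t, Measurable fun ξ => u (i, t, ξ)) ∧
    ∀ t ξ, u (i, t, -ξ) = (starRingEnd ℂ) (u (i, t, ξ)) with hP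
  have hPs : ∀ u, P u → (∀ p, ‖u p‖ ≤ Wι p) → ∀ i, IsSymbol W (cur u i) := fun u hu hb i =>
    ⟨(hu i).1, (hu i).2.1, (hu i).2.2, fun t ξ => hb (i, t, ξ)⟩
  obtain ⟨u, hPu, hub, hfix⟩ := exists_fixed_point
    (fun u p => step ρm ρbar σ T a b (cur u) p.1 p.2.1 p.2.2) Wι P (fun p => hW0 _ _)
    (fun i => ⟨fun ξ => continuous_const, fun t => measurable_const, fun t ξ => by simp⟩)
    (fun u hu hb => by
      have h := hsym _ (hPs u hu hb)
      exact ⟨fun i => ⟨(h i).cont, (h i).meas, (h i).herm⟩, fun p => hbound' _ (hPs u hu hb) _ _ _⟩)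
    (fun u v hu hv hub hvb k hk hd p => hcontr _ _ (hPs u hu hub) (hPs v hv hvb) k hk
      (fun i t ξ => hd (i, t, ξ)) _ _ _)
    (fun F u hF hub hd i => by
      have hlim : Tendsto (fun n : ℕ => 4 * (1 / 2 : ℝ) ^ n) atTop (𝓝 0) := by
        simpa using (tendsto_pow_atTop_nhds_zero_of_lt_one (r := (1 / 2 : ℝ)) (by norm_num)
          (by norm_num)).const_mul 4
      have hpt : ∀ p, Tendsto (fun n => F n p) atTop (𝓝 (u p)) := fun p => by
        rw [tendsto_iff_norm_sub_tendsto_zero]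
        refine squeeze_zero (fun n => norm_nonneg _) (fun n => hd n p) ?_
        simpa using hlim.mul_const (Wι p)
      refine ⟨fun ξ => ?_, fun t => ?_, fun t ξ => ?_⟩
      -- W is at most 1, so the geometric rate is uniform in t and the limit is continuous in time.
      · have hu : TendstoUniformly (fun n t => F n (i, t, ξ)) (fun t => u (i, t, ξ)) atTop := by
          rw [Metric.tendstoUniformly_iff]
          intro e he
          filter_upwards [hlim.eventually (gt_mem_nhds he)] with n hn t
          rw [dist_comm, dist_eq_norm]
          refine lt_of_le_of_lt ((hd n _).trans ?_) hn
          exact mul_le_of_le_one_right (by positivity) ((hWd t ξ).trans (decay_le_one ξ))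
        exact hu.continuous (Frequently.of_forall fun n => (hF n i).1 ξ)
      · exact measurable_of_tendsto_metrizable (fun n => (hF n i).2.1 t)
          (tendsto_pi_nhds.2 fun ξ => hpt (i, t, ξ))
      · refine tendsto_nhds_unique (hpt (i, t, -ξ)) ?_
        have := (Complex.continuous_conj.tendsto _).comp (hpt (i, t, ξ))
        refine this.congr fun n => ((hF n i).2.2 t ξ).symm)
  have hU := hPs u hPu hub
  have hfix' : ∀ i t ξ, step ρm ρbar σ T a b (cur u) i t ξ = cur u i t ξ := fun i t ξ =>
    congrFun hfix (i, t, ξ)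
  have hspec : IsSpectralSol ρm ρbar σ T W a b (cur u) := by
    refine ⟨hU, fun i t ξ => ?_, fun i t => ?_, ⟨_, cw1⟩, fun i t ξ => ?_, fun ξ hξ => ?_⟩
    · rw [← hfix']; exact hbound _ hU i t ξ
    · rw [← hfix']; simp only [step, if_true]
    · rw [← hfix', ← hfix']; simp only [step, clamp_clamp hT]
    · refine ⟨_, _, hsol _ hU ξ hξ, hraw0 _ ξ hξ, hraw1 _ ξ, fun t ht => ?_⟩
      constructor
      · rw [← hfix']; simp only [step, hξ, if_false, clamp_of_mem ht]
      · rw [← hfix']; simp only [step, hξ, if_false, clamp_of_mem ht]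
  refine ⟨cur u, hspec, ?_⟩
  intro U₀ hU₀
  obtain ⟨U, hUe⟩ : ∃ U, U = cur u := ⟨_, rfl⟩
  rw [← hUe] at hspec hU ⊢
  have hs0 := Real.sqrt_nonneg σ
  -- A self-improving bound: the difference of the nonlinear terms contributes k/2 and the viscous
  -- term applied to the inviscid solution contributes B√σ.
  have himp : ∀ k, 0 ≤ k → (∀ i t ξ, ‖U i t ξ - U₀ i t ξ‖ ≤ k * slowDecay ξ) →
      ∀ i t ξ, ‖U i t ξ - U₀ i t ξ‖ ≤ (k / 2 + B * √σ) * slowDecay ξ := by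
    intro k hk hd i t ξ
    rw [← hspec.clamp_eq, ← hU₀.clamp_eq]
    by_cases hξ : ξ = 0
    · have := slowDecay_pos ξ
      rw [hξ, hspec.zero, hU₀.zero, sub_self, norm_zero, ← hξ]; positivity
    have hF := hf2 k U U₀ hk hU hU₀.sym hd
    have hF' := hf1 2 U₀ U₀ two_pos.le hU₀.sym hU₀.sym (fun i t ξ => by simpa using hW0 t ξ)
    obtain ⟨z₁, z₂, hz, hz0, hzT, hzU⟩ := hspec.ode ξ hξ
    obtain ⟨y₁, y₂, hy, hy0, hyT, hyU⟩ := hU₀.ode ξ hξ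
    have hV := slowDecay_pos ξ
    have hr : 0 ≤ ‖ξ‖ := norm_nonneg ξ
    have hvisc : ∀ i s, ‖((σ * ‖ξ‖ ^ 2 : ℝ) : ℂ) * U₀ i s ξ‖ ≤
        √σ * (‖ξ‖ * (1 + σ * ‖ξ‖)) * slowDecay ξ := by
      intro i s
      rw [norm_mul, Complex.norm_real, Real.norm_of_nonneg (by positivity)]
      have h1 := ((hU₀.sym i).bound s ξ).trans (hWd s ξ)
      have h2 := mul_sqrt_mul_decay_le hσ ξ
      calc _ ≤ σ * ‖ξ‖ ^ 2 * decay ξ := mul_le_mul_of_nonneg_left h1 (by positivity)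
        _ = √σ * ‖ξ‖ * (√σ * ‖ξ‖ * decay ξ) := by
          nth_rw 1 [← Real.mul_self_sqrt hσ]; ring
        _ ≤ √σ * ‖ξ‖ * ((1 + σ * ‖ξ‖) * slowDecay ξ) := by gcongr
        _ = _ := by ring
    have hfr : ∀ z : ℂ, ‖z‖ ≤ θ * k * ‖ξ‖ * slowDecay ξ →
        ‖z‖ ≤ θ * k * (‖ξ‖ * (1 + σ * ‖ξ‖)) * slowDecay ξ := fun z hz => hz.trans (by
      have : 0 ≤ θ * k * ‖ξ‖ * (σ * ‖ξ‖) * slowDecay ξ := by positivity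
      linarith)
    -- The weight is constant in time, so its growth condition is trivial, and equal boundary data
    -- give D = 0.
    have h := hbd σ T hσ hT ξ hξ _ _ _ _ (fun _ => slowDecay ξ) 0 (θ * k + √σ)
      (hz.sub (hy.viscous σ))
      ((hF.contψ ξ).sub ((hF'.contψ ξ).add (continuous_const.mul hy.continuous.1)))
      ((hF.contv ξ).sub ((hF'.contv ξ).sub (continuous_const.mul hy.continuous.2)))
      le_rfl (by positivity) (fun _ _ => hV.le)
      (fun s _ t _ => le_mul_of_one_le_left hV.le (Real.one_le_exp (by positivity)))
      (by simp [hz0, hy0]) (by simp [hzT, hyT])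
      (fun s hs => by
        rw [← sub_sub, ← (hyU s hs).1]
        refine (norm_sub_le _ _).trans ?_
        have := hfr _ (hF.diffψ ξ s)
        have := hvisc 0 s
        linarith)
      (fun s hs => by
        rw [← sub_add, ← (hyU s hs).2]
        refine (norm_add_le _ _).trans ?_
        have := hfr _ (hF.diffv ξ s)
        have := hvisc 1 s
        linarith) (clamp T t) (clamp_mem hT t)
    have hk' : B * (0 + (θ * k + √σ)) * slowDecay ξ ≤ (k / 2 + B * √σ) * slowDecay ξ := by
      refine mul_le_mul_of_nonneg_right ?_ hV.le
      have := mul_le_mul_of_nonneg_right hθ hk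
      linarith
    have e1 := hzU (clamp T t) (clamp_mem hT t)
    have e2 := hyU (clamp T t) (clamp_mem hT t)
    fin_cases i
    · simp only [Fin.zero_eta]; rw [e1.1, e2.1]; exact h.1.trans hk'
    · simp only [Fin.mk_one]; rw [e1.2, e2.2]; exact h.2.trans hk'
  -- Iteration of k ↦ k/2 + B√σ, whose fixed point is 2B√σ. The start k = 2 + 2B√σ is allowed since
  -- both solutions are bounded by `slowDecay`.
  have hk : ∀ n : ℕ, ∀ i t ξ, ‖U i t ξ - U₀ i t ξ‖ ≤
      (2 * (1 / 2) ^ n + 2 * B * √σ) * slowDecay ξ := by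
    intro n
    induction n with
    | zero =>
      intro i t ξ
      refine (norm_sub_le _ _).trans ?_
      have h1 := (hU i).bound t ξ
      have h2 := (hU₀.sym i).bound t ξ
      have h3 := (hWd t ξ).trans (decay_le_slowDecay ξ)
      have h4 : 0 ≤ 2 * B * √σ * slowDecay ξ := by have := slowDecay_pos ξ; positivity
      simp only [pow_zero]
      linarith
    | succ n ih =>
      intro i t ξ
      refine (himp _ (by positivity) ih i t ξ).trans_eq ?_
      ring
  intro i t ξ
  refine ge_of_tendsto' (x := atTop) ?_ (fun n => hk n i t ξ)
  have : Tendsto (fun n : ℕ => (2 * (1 / 2 : ℝ) ^ n + 2 * B * √σ) * slowDecay ξ) atTop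
      (𝓝 ((2 * 0 + 2 * B * √σ) * slowDecay ξ)) :=
    (((tendsto_pow_atTop_nhds_zero_of_lt_one (r := (1 / 2 : ℝ)) (by norm_num)
      (by norm_num)).const_mul 2).add_const _).mul_const _
  simpa using this

end Exist

/-! ### Pairing with test functions -/

/-- Two integrations by parts. Quadratic decay of the test function absorbs the two powers of |ξ|
from σΔ and leaves the integrable weight `decay`. -/
lemma norm_invFourier_test_le {η : Plane → ℝ} (h : IsTest η) : ∃ C, 0 ≤ C ∧ ∀ ξ : Plane,
    (1 + ‖ξ‖) ^ 2 * ‖invFourier (fun x => (η x : ℂ)) ξ‖ ≤ C := by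
  obtain ⟨g, hg⟩ : ∃ g, g = invFourier (fun x => (η x : ℂ)) := ⟨_, rfl⟩
  set C₀ := cpi * ∫ x, ‖(η x : ℂ)‖ with hC₀
  set D : Fin 2 → ℝ := fun j => cpi * ∫ x, ‖(pderiv j (pderiv j η) x : ℂ)‖ with hD
  have h0 : ∀ ξ, ‖g ξ‖ ≤ C₀ := fun ξ => by rw [hg]; exact norm_invFourier_le _ ξ
  have h1 : ∀ j ξ, (ξ j) ^ 2 * ‖g ξ‖ ≤ D j := by
    intro j ξ
    have := norm_invFourier_le (fun x => (pderiv j (pderiv j η) x : ℂ)) ξ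
    rw [invFourier_pderiv (h.pderiv j), invFourier_pderiv h, ← hg, norm_mul, norm_mul, norm_neg,
      norm_mul, Complex.norm_I, one_mul, Complex.norm_real, Real.norm_eq_abs, ← mul_assoc,
      abs_mul_abs_self, ← sq] at this
    exact this
  have hC0 : 0 ≤ C₀ := (norm_nonneg _).trans (h0 0)
  have hD0 : ∀ j, 0 ≤ D j := fun j => le_trans (by positivity) (h1 j 0)
  refine ⟨2 * (C₀ + D 0 + D 1), by linarith [hD0 0, hD0 1], fun ξ => ?_⟩
  rw [← hg]
  have e : ‖ξ‖ ^ 2 = ξ 0 ^ 2 + ξ 1 ^ 2 := by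
    rw [EuclideanSpace.norm_sq_eq]; simp
  have : (1 + ‖ξ‖) ^ 2 ≤ 2 * (1 + ξ 0 ^ 2 + ξ 1 ^ 2) := by nlinarith [sq_nonneg (1 - ‖ξ‖)]
  have := mul_le_mul_of_nonneg_right this (norm_nonneg (g ξ))
  linarith [h0 ξ, h1 0 ξ, h1 1 ξ]

/-- Integration in time of a family of symbols, tested against `e`. -/
lemma integral_mul_eq_add_intervalIntegral {u D : ℝ → Plane → ℂ} {t₀ t K : ℝ} {e : Plane → ℂ}
    (hD : Measurable (Function.uncurry D)) (he : Continuous e)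
    (hbd : ∀ s ξ, ‖D s ξ * e ξ‖ ≤ K * decay ξ) (hu₀ : Integrable fun ξ => u t₀ ξ * e ξ)
    (hu : ∀ ξ, ξ ≠ 0 → u t ξ = u t₀ ξ + ∫ s in t₀..t, D s ξ) :
    ∫ ξ, u t ξ * e ξ = (∫ ξ, u t₀ ξ * e ξ) + ∫ s in t₀..t, ∫ ξ, D s ξ * e ξ := by
  have hm : Measurable (Function.uncurry fun s ξ => D s ξ * e ξ) :=
    hD.mul (he.measurable.comp measurable_snd)
  have hint : Integrable (Function.uncurry fun s ξ => D s ξ * e ξ)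
      ((volume.restrict (uIoc t₀ t)).prod volume) := by
    refine Integrable.mono' (g := fun p : ℝ × Plane => K * decay p.2) ?_ hm.aestronglyMeasurable
      (Eventually.of_forall fun p => hbd p.1 p.2)
    have h1 : Integrable (fun _ : ℝ => (1 : ℝ)) (volume.restrict (uIoc t₀ t)) := by
      unfold uIoc; exact integrable_const _
    simpa using h1.mul_prod (integrable_decay.const_mul K)
  have hswap := intervalIntegral_integral_swap (μ := volume) hint
  have hae : ∀ᵐ ξ ∂(volume : Measure Plane), u t ξ * e ξ =
      u t₀ ξ * e ξ + ∫ s in t₀..t, D s ξ * e ξ := by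
    have : ∀ᵐ ξ ∂(volume : Measure Plane), ξ ≠ 0 := by
      simp [ae_iff, measure_singleton]
    filter_upwards [this] with ξ hξ
    rw [hu ξ hξ, add_mul, intervalIntegral.integral_mul_const]
  have hI : Integrable fun ξ => ∫ s in t₀..t, D s ξ * e ξ := by
    have := hint.integral_prod_right
    simp only [intervalIntegral]
    rcases le_total t₀ t with h | h
    · rw [uIoc_of_le h] at this
      simpa [Ioc_eq_empty_of_le h] using this
    · rw [uIoc_of_ge h] at this
      simpa [Ioc_eq_empty_of_le h] using this.neg
  rw [integral_congr_ae hae, integral_add hu₀ hI, hswap]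

/-- In polar coordinates the area element r dr cancels 1/r. Thus v/|ξ|, the transform of φ, is
integrable near the origin although only v is bounded there. -/
lemma integrable_decay_div_norm : Integrable fun ξ : Plane => decay ξ / ‖ξ‖ := by
  have := (integrable_fun_norm_addHaar (volume : Measure Plane)
    (f := fun y : ℝ => ((1 + y) ^ 3)⁻¹ / y)).2 ?_
  · exact this
  have h1 : Integrable fun y : ℝ => (1 + ‖y‖) ^ (-(3 : ℝ)) :=
    integrable_one_add_norm (by simp)
  refine h1.integrableOn.congr_fun (fun y hy => ?_) measurableSet_Ioi
  have hy' : 0 < y := hy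
  have h2 : 0 < 1 + y := by linarith
  simp only [Real.norm_of_nonneg hy'.le, finrank_euclideanSpace, Fintype.card_fin, smul_eq_mul]
  rw [Real.rpow_neg h2.le]
  norm_num
  field_simp

/-! ### The functions in physical space -/

/-- `ψ`. -/
def psiOf (U : Fin 2 → ℝ → Plane → ℂ) (t : ℝ) (x : Plane) : ℝ := (invFourier (U 0 t) x).re

/-- `φ`. -/
def phiOf (U : Fin 2 → ℝ → Plane → ℂ) (t : ℝ) (x : Plane) : ℝ :=
  (invFourier (fun ξ => U 1 t ξ / (‖ξ‖ : ℂ)) x).re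

/-- `∇φ`. -/
def gradOf (U : Fin 2 → ℝ → Plane → ℂ) (t : ℝ) (x : Plane) : Plane :=
  WithLp.toLp 2 fun j => (invFourier (pHat (U 1) t j) x).re

/-- The Hessian of `φ`. -/
def hessOf (U : Fin 2 → ℝ → Plane → ℂ) (t : ℝ) (x : Plane) : EuclideanSpace ℝ (Fin 2 × Fin 2) :=
  WithLp.toLp 2 fun p => (invFourier (fun ξ => Complex.I * (ξ p.2 : ℂ) * pHat (U 1) t p.1 ξ) x).re

lemma IsSymbol.rep {W : ℝ → Plane → ℝ} {a : ℝ → Plane → ℂ} (h : IsSymbol W a) {D : ℝ}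
    (hD : ∀ t ξ, W t ξ ≤ D * decay ξ) (t : ℝ) : Rep (a t) fun x => (invFourier (a t) x).re :=
  Rep.of_hermitian (h.integrable hD t) (h.herm t)

/-- Dominated convergence in both variables at once; it supplies the joint measurability in the
definition of a solution. -/
lemma IsSymbol.continuous_uncurry {W : ℝ → Plane → ℝ} {a : ℝ → Plane → ℂ} (h : IsSymbol W a)
    {D : ℝ} (hD : ∀ t ξ, W t ξ ≤ D * decay ξ) :
    Continuous fun q : ℝ × Plane => (invFourier (a q.1) q.2).re := by
  refine Complex.continuous_re.comp ?_
  unfold invFourier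
  refine Continuous.const_smul ?_ cpi
  refine continuous_of_dominated (bound := fun ξ => D * decay ξ)
    (fun q => (integrable_wave_mul (h.integrable hD q.1) q.2).aestronglyMeasurable) ?_
    (integrable_decay.const_mul D) ?_
  · intro q
    refine Eventually.of_forall fun ξ => ?_
    rw [norm_mul, norm_wave, one_mul]
    exact (h.bound _ _).trans (hD _ _)
  · exact Eventually.of_forall fun ξ => ((continuous_wave_right ξ).comp continuous_snd).mul
      ((h.cont ξ).comp continuous_fst)

lemma Rep.flux {u : Plane → ℂ} {p : Fin 2 → Plane → ℂ} {ψ : Plane → ℝ} {G : Plane → Plane}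
    (hu : Rep u ψ) (hp : ∀ j, Rep (p j) fun x => G x j) (ρm ρbar : ℝ) (j : Fin 2) :
    Rep (fun ξ => ((if j = 0 then speed ρm ρbar - 2 * ρbar else 0 : ℝ) : ℂ) * u ξ
      + (((ρbar * speed ρm ρbar ^ 2 : ℝ) : ℂ) * p j ξ + fluxHat (speed ρm ρbar) ρbar j u p ξ))
      (fun x => flux ρm ρbar (ψ x) (G x) j) := by
  have := (hu.const_mul (if j = 0 then speed ρm ρbar - 2 * ρbar else 0)).add
    (((hp j).const_mul (ρbar * speed ρm ρbar ^ 2)).add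
    (((hu.mul (hp j)).const_mul (speed ρm ρbar ^ 2 - 2 * speed ρm ρbar * ρbar)).add
      ((((hu.mul hu).mul (hp j)).const_mul (ρbar - 2 * speed ρm ρbar)).add
      (((((hu.mul hu).mul hu).mul (hp j)).const_mul 1).add
      ((((hu.mul hu).mul hu).const_mul (if j = 0 then 1 / speed ρm ρbar else 0)).add
        ((hu.mul hu).const_mul (if j = 0 then ρbar / speed ρm ρbar - 2 else 0)))))))
  refine (this.congr_left fun ξ => rfl).congr fun x => ?_
  simp only [Hughes.flux, e₁, PiLp.add_apply, PiLp.smul_apply, smul_eq_mul, PiLp.single_apply]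
  split_ifs <;> ring

lemma Rep.rate {u : Plane → ℂ} {p : Fin 2 → Plane → ℂ} {ψ : Plane → ℝ} {G : Plane → Plane}
    (hu : Rep u ψ) (hp : ∀ j, Rep (p j) fun x => G x j) (ρm ρbar : ℝ) :
    Rep (fun ξ => (speed ρm ρbar : ℂ) * p 0 ξ
      + (((-(1 / speed ρm ρbar) : ℝ) : ℂ) * u ξ + rateHat (speed ρm ρbar) u p ξ))
      (fun x => potentialRate ρm ρbar (ψ x) (G x)) := by
  have hsq := ((hp 0).mul (hp 0)).add ((hp 1).mul (hp 1))
  have := ((hp 0).const_mul (speed ρm ρbar)).add ((hu.const_mul (-(1 / speed ρm ρbar))).add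
    ((hsq.const_mul (1 / 2 * speed ρm ρbar ^ 2)).add
    ((((hu.mul hu).mul hsq).const_mul (1 / 2)).add
    (((hu.mul hsq).const_mul (-speed ρm ρbar)).add
    (((hu.mul hu).const_mul (1 / (2 * speed ρm ρbar ^ 2))).add
    ((((hu.mul hu).mul (hp 0)).const_mul (1 / speed ρm ρbar)).add
      ((hu.mul (hp 0)).const_mul (-2))))))))
  refine (this.congr_left fun ξ => rfl).congr fun x => ?_
  simp only [potentialRate, EuclideanSpace.norm_sq_eq, Fin.sum_univ_two, Real.norm_eq_abs, sq_abs]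
  ring

lemma eLpNorm_le_sum_apply {ι : Type*} [Fintype ι] {p : ℝ≥0∞} (hp : 1 ≤ p)
    {F : Plane → EuclideanSpace ℝ ι} (hF : ∀ i, AEStronglyMeasurable (fun x => F x i) volume) :
    eLpNorm F p volume ≤ ∑ i, eLpNorm (fun x => F x i) p volume := by
  have h1 : eLpNorm F p volume ≤ eLpNorm (∑ i, fun x => ‖F x i‖) p volume := by
    refine eLpNorm_mono_real fun x => ?_
    rw [Finset.sum_apply, EuclideanSpace.norm_eq]
    refine (Real.sqrt_le_sqrt (Finset.sum_sq_le_sq_sum_of_nonneg fun i _ => norm_nonneg _)).trans_eq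
      (Real.sqrt_sq (Finset.sum_nonneg fun i _ => norm_nonneg _))
  refine (h1.trans (eLpNorm_sum_le (fun i _ => (hF i).norm) hp)).trans_eq ?_
  simp only [eLpNorm_norm]

lemma norm_sq_eq_sum (ξ : Plane) : ‖ξ‖ ^ 2 = ξ 0 ^ 2 + ξ 1 ^ 2 := by
  rw [EuclideanSpace.norm_sq_eq]; simp

lemma integrable_mul_test {g e : Plane → ℂ} {K C : ℝ} (hK : 0 ≤ K) (hg : AEStronglyMeasurable g)
    (he : Continuous e) (hC : ∀ ξ, (1 + ‖ξ‖) ^ 2 * ‖e ξ‖ ≤ C)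
    (hb : ∀ ξ, ‖g ξ‖ ≤ K * ((1 + ‖ξ‖) ^ 2 * decay ξ)) :
    (∀ ξ, ‖g ξ * e ξ‖ ≤ (K * C) * decay ξ) ∧ Integrable fun ξ => g ξ * e ξ := by
  have h : ∀ ξ, ‖g ξ * e ξ‖ ≤ (K * C) * decay ξ := by
    intro ξ
    rw [norm_mul]
    have hd := decay_pos ξ
    calc ‖g ξ‖ * ‖e ξ‖ ≤ K * ((1 + ‖ξ‖) ^ 2 * decay ξ) * ‖e ξ‖ :=
          mul_le_mul_of_nonneg_right (hb ξ) (norm_nonneg _)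
      _ = K * decay ξ * ((1 + ‖ξ‖) ^ 2 * ‖e ξ‖) := by ring
      _ ≤ K * decay ξ * C := mul_le_mul_of_nonneg_left (hC ξ) (by positivity)
      _ = _ := by ring
  exact ⟨h, (integrable_decay.const_mul (K * C)).mono' (hg.mul he.aestronglyMeasurable)
    (Eventually.of_forall h)⟩

/-! ### The integrated equations, on the Fourier side and against test functions -/

/-- The Fourier transform of the flux. -/
def fluxSym (ρm ρbar : ℝ) (U : Fin 2 → ℝ → Plane → ℂ) (j : Fin 2) (t : ℝ) (ξ : Plane) : ℂ :=
  ((if j = 0 then speed ρm ρbar - 2 * ρbar else 0 : ℝ) : ℂ) * U 0 t ξ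
    + (((ρbar * speed ρm ρbar ^ 2 : ℝ) : ℂ) * pHat (U 1) t j ξ
      + fluxHat (speed ρm ρbar) ρbar j (U 0 t) (pHat (U 1) t) ξ)

/-- The Fourier transform of the rate. -/
def rateSym (ρm ρbar : ℝ) (U : Fin 2 → ℝ → Plane → ℂ) (t : ℝ) (ξ : Plane) : ℂ :=
  (speed ρm ρbar : ℂ) * pHat (U 1) t 0 ξ
    + (((-(1 / speed ρm ρbar) : ℝ) : ℂ) * U 0 t ξ
      + rateHat (speed ρm ρbar) (U 0 t) (pHat (U 1) t) ξ)

namespace IsSpectralSol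

variable {ρm ρbar σ T : ℝ} {W : ℝ → Plane → ℝ} {a b : Plane → ℂ} {U : Fin 2 → ℝ → Plane → ℂ}
  (h : IsSpectralSol ρm ρbar σ T W a b U)
include h

lemma exists_isSymbol_nonlinear : ∃ A : ℝ, 0 ≤ A ∧
    (∀ j, IsSymbol (fun t ξ => A * W t ξ)
      (fun t => fluxHat (speed ρm ρbar) ρbar j (U 0 t) (pHat (U 1) t))) ∧
    IsSymbol (fun t ξ => A * W t ξ)
      (fun t => rateHat (speed ρm ρbar) (U 0 t) (pHat (U 1) t)) := by
  obtain ⟨δ, hW⟩ := h.conv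
  obtain ⟨c, hc, H⟩ := exists_symPair_nonlinear (speed ρm ρbar) ρbar
  have hp : ∀ i, SymPair W W 0 1 (U i) (U i) := fun i =>
    ⟨by simpa using h.sym i, by simpa using h.sym i, fun t ξ => by simp⟩
  obtain ⟨hF, hR⟩ := H W W δ 0 (U 0) (U 0) (fun t => pHat (U 1) t) (fun t => pHat (U 1) t) hW
    le_rfl (hp 0) (fun j => (hp 1).pHat j)
  exact ⟨c * δ, mul_nonneg hc hW.δ_nonneg, fun j => (hF j).left, hR.left⟩

lemma exists_isSymbol (hW : ∀ t ξ, W t ξ ≤ decay ξ) : ∃ K : ℝ, 0 ≤ K ∧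
    (∀ j, IsSymbol (fun _ ξ => K * decay ξ) (fluxSym ρm ρbar U j)) ∧
    IsSymbol (fun _ ξ => K * decay ξ) (rateSym ρm ρbar U) := by
  obtain ⟨A, hA, hF, hR⟩ := h.exists_isSymbol_nonlinear
  have hflux : ∀ j, ∃ K : ℝ, 0 ≤ K ∧ IsSymbol (fun _ ξ => K * decay ξ) (fluxSym ρm ρbar U j) := by
    intro j
    refine ⟨|if j = 0 then speed ρm ρbar - 2 * ρbar else 0| + (|ρbar * speed ρm ρbar ^ 2| + A),
      by positivity, ?_⟩
    refine (((h.sym 0).const_mul (if j = 0 then speed ρm ρbar - 2 * ρbar else 0)).add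
      ((((h.sym 1).pHat j).const_mul (ρbar * speed ρm ρbar ^ 2)).add (hF j))).mono fun t ξ => ?_
    rw [← add_mul, ← add_mul]
    exact mul_le_mul_of_nonneg_left (hW t ξ) (by positivity)
  obtain ⟨K0, hK0, h0⟩ := hflux 0
  obtain ⟨K1, hK1, h1⟩ := hflux 1
  have hrate : IsSymbol (fun _ ξ => (|speed ρm ρbar| + (|-(1 / speed ρm ρbar)| + A)) * decay ξ)
      (rateSym ρm ρbar U) := by
    refine ((((h.sym 1).pHat 0).const_mul (speed ρm ρbar)).add
      (((h.sym 0).const_mul (-(1 / speed ρm ρbar))).add hR)).mono fun t ξ => ?_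
    rw [← add_mul, ← add_mul]
    exact mul_le_mul_of_nonneg_left (hW t ξ) (by positivity)
  set K2 := |speed ρm ρbar| + (|-(1 / speed ρm ρbar)| + A) with hK2
  have hK20 : 0 ≤ K2 := by positivity
  refine ⟨K0 + K1 + K2, by positivity, fun j => ?_, ?_⟩
  · fin_cases j
    · exact h0.mono fun t ξ => mul_le_mul_of_nonneg_right (by linarith) (decay_pos ξ).le
    · exact h1.mono fun t ξ => mul_le_mul_of_nonneg_right (by linarith) (decay_pos ξ).le
  · exact hrate.mono fun t ξ => mul_le_mul_of_nonneg_right (by linarith) (decay_pos ξ).le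

lemma continuous_force (ξ : Plane) : Continuous (forceψ (speed ρm ρbar) ρbar U ξ) ∧
    Continuous (forcev (speed ρm ρbar) U ξ) := by
  obtain ⟨A, hA, hF, hR⟩ := h.exists_isSymbol_nonlinear
  exact ⟨(continuous_const.mul ((hF 0).cont ξ)).add (continuous_const.mul ((hF 1).cont ξ)),
    continuous_const.mul (hR.cont ξ)⟩

/-- The ODE integrated in time and rewritten as the transform of the divergence form. The coupling
term becomes a divergence because ∇φ has the transform iξv/|ξ|, hence |ξ|v is minus iξ applied to
it. -/
lemma density_hat_eq {ξ : Plane} (hξ : ξ ≠ 0) {t₀ t : ℝ} (ht₀ : t₀ ∈ Icc 0 T) (ht : t ∈ Icc 0 T) :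
    U 0 t ξ = U 0 t₀ ξ + ∫ s in t₀..t, (Complex.I * (ξ 0 : ℂ) * fluxSym ρm ρbar U 0 s ξ
      + Complex.I * (ξ 1 : ℂ) * fluxSym ρm ρbar U 1 s ξ
      - (σ : ℂ) * ((ξ 0 : ℂ) ^ 2 + (ξ 1 : ℂ) ^ 2) * U 0 s ξ) := by
  obtain ⟨z₁, z₂, hz, -, -, hU⟩ := h.ode ξ hξ
  have hc := h.continuous_force ξ
  have hzc := hz.continuous
  have key := intervalIntegral.integral_eq_sub_of_hasDerivAt (fun s _ => hz.deriv₁ s)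
    (Continuous.intervalIntegrable (by
      have := hc.1; have := hzc.1; have := hzc.2; fun_prop) t₀ t)
  rw [(hU t ht).1, (hU t₀ ht₀).1, ← sub_eq_iff_eq_add', ← key]
  refine intervalIntegral.integral_congr fun s hs => ?_
  have hs' : s ∈ Icc 0 T := (ordConnected_Icc.uIcc_subset ht₀ ht) hs
  simp only
  rw [← (hU s hs').1, ← (hU s hs').2]
  have hr : (‖ξ‖ : ℂ) ≠ 0 := by exact_mod_cast (norm_pos_iff.2 hξ).ne'
  have hr2 : (‖ξ‖ : ℂ) ^ 2 = (ξ 0 : ℂ) ^ 2 + (ξ 1 : ℂ) ^ 2 := by exact_mod_cast norm_sq_eq_sum ξ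
  have hd : (freqMode ρm ρbar σ ξ).d = (σ : ℂ) * ‖ξ‖ ^ 2 + ρbar * ξ 0 * Complex.I := by
    apply Complex.ext <;> simp [freqMode, ← Complex.ofReal_pow]
  rw [hd]
  simp only [fluxSym, forceψ, freqMode, pHat]
  simp only [if_true, one_ne_zero, if_false]
  push_cast
  have hR := mul_inv_cancel₀ hr
  linear_combination (-(ρbar * speed ρm ρbar ^ 2 * U 1 s ξ * ((ξ 0 : ℂ) ^ 2 + (ξ 1 : ℂ) ^ 2)
    * (‖ξ‖ : ℂ)⁻¹)) * Complex.I_sq + (-(ρbar * speed ρm ρbar ^ 2 * U 1 s ξ * (‖ξ‖ : ℂ)⁻¹)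
    - σ * U 0 s ξ) * hr2 + (ρbar * speed ρm ρbar ^ 2 * U 1 s ξ * ‖ξ‖) * hR

lemma potential_hat_eq {ξ : Plane} (hξ : ξ ≠ 0) {t₀ t : ℝ} (ht₀ : t₀ ∈ Icc 0 T)
    (ht : t ∈ Icc 0 T) :
    U 1 t ξ / ‖ξ‖ = U 1 t₀ ξ / ‖ξ‖ + ∫ s in t₀..t, (rateSym ρm ρbar U s ξ
      - (σ : ℂ) * (Complex.I * (ξ 0 : ℂ) * pHat (U 1) s 0 ξ
        + Complex.I * (ξ 1 : ℂ) * pHat (U 1) s 1 ξ)) := by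
  obtain ⟨z₁, z₂, hz, -, -, hU⟩ := h.ode ξ hξ
  have hc := h.continuous_force ξ
  have hzc := hz.continuous
  have key := intervalIntegral.integral_eq_sub_of_hasDerivAt (fun s _ => hz.deriv₂ s)
    (Continuous.intervalIntegrable (by
      have := hc.2; have := hzc.1; have := hzc.2; fun_prop) t₀ t)
  rw [(hU t ht).2, (hU t₀ ht₀).2, ← sub_eq_iff_eq_add', ← sub_div, ← key,
    ← intervalIntegral.integral_div]
  refine intervalIntegral.integral_congr fun s hs => ?_
  have hs' : s ∈ Icc 0 T := (ordConnected_Icc.uIcc_subset ht₀ ht) hs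
  simp only
  rw [← (hU s hs').1, ← (hU s hs').2]
  have hr : (‖ξ‖ : ℂ) ≠ 0 := by exact_mod_cast (norm_pos_iff.2 hξ).ne'
  have hr2 : (‖ξ‖ : ℂ) ^ 2 = (ξ 0 : ℂ) ^ 2 + (ξ 1 : ℂ) ^ 2 := by exact_mod_cast norm_sq_eq_sum ξ
  have hd : (freqMode ρm ρbar σ ξ).d = (σ : ℂ) * ‖ξ‖ ^ 2 + ρbar * ξ 0 * Complex.I := by
    apply Complex.ext <;> simp [freqMode, ← Complex.ofReal_pow]
  rw [hd]
  simp only [rateSym, forcev, freqMode, pHat]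
  push_cast
  have hR := mul_inv_cancel₀ hr
  linear_combination (σ * ((ξ 0 : ℂ) ^ 2 + (ξ 1 : ℂ) ^ 2) * (‖ξ‖ : ℂ)⁻¹ * U 1 s ξ) * Complex.I_sq
    + (σ * U 1 s ξ * (‖ξ‖ : ℂ)⁻¹) * hr2
    + (rateHat (speed ρm ρbar) (U 0 s) (pHat (U 1) s) ξ - 1 / speed ρm ρbar * U 0 s ξ) * hR

end IsSpectralSol

lemma norm_coord_mul_le {K : ℝ} (ξ : Plane) (j : Fin 2) {z : ℂ} (hz : ‖z‖ ≤ K * decay ξ) : ‖Complex.I * (ξ j : ℂ) * z‖ ≤ K * ((1 + ‖ξ‖) ^ 2 * decay ξ) := by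
  rw [norm_mul, norm_mul, Complex.norm_I, one_mul, Complex.norm_real]
  have h1 : |ξ j| ≤ (1 + ‖ξ‖) ^ 2 := (abs_apply_le ξ j).trans (by nlinarith [norm_nonneg ξ])
  calc _ ≤ (1 + ‖ξ‖) ^ 2 * (K * decay ξ) := mul_le_mul h1 hz (norm_nonneg _) (by positivity)
    _ = _ := by ring

lemma norm_coord_sq_mul_le {K : ℝ} (ξ : Plane) (j : Fin 2) {z : ℂ} (hz : ‖z‖ ≤ K * decay ξ) : ‖(ξ j : ℂ) ^ 2 * z‖ ≤ K * ((1 + ‖ξ‖) ^ 2 * decay ξ) := by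
  rw [norm_mul, norm_pow, Complex.norm_real, Real.norm_eq_abs]
  have h1 : |ξ j| ^ 2 ≤ (1 + ‖ξ‖) ^ 2 :=
    pow_le_pow_left₀ (abs_nonneg _) ((abs_apply_le ξ j).trans (by linarith)) 2
  calc _ ≤ (1 + ‖ξ‖) ^ 2 * (K * decay ξ) := mul_le_mul h1 hz (norm_nonneg _) (by positivity)
    _ = _ := by ring

lemma le_weight {K : ℝ} (ξ : Plane) {z : ℂ} (hz : ‖z‖ ≤ K * decay ξ) (hK : 0 ≤ K) :
    ‖z‖ ≤ K * ((1 + ‖ξ‖) ^ 2 * decay ξ) := by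
  refine hz.trans (mul_le_mul_of_nonneg_left ?_ hK)
  exact le_mul_of_one_le_left (decay_pos ξ).le (by nlinarith [norm_nonneg ξ])

lemma measurable_coord (j : Fin 2) : Measurable fun q : ℝ × Plane => ((q.2 j : ℝ) : ℂ) :=
  Continuous.measurable (by fun_prop)

lemma IsTest.integrable_continuous_mul {η F : Plane → ℝ} (hη : IsTest η) (hF : Continuous F) :
    Integrable fun x => F x * η x :=
  (hF.mul hη.1.continuous).integrable_of_hasCompactSupport hη.2.mul_left

lemma integral_add_mul_add {𝕜 : Type*} [RCLike 𝕜] {f p q : Plane → 𝕜} (d : 𝕜) (hf : Integrable f)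
    (hp : Integrable p) (hq : Integrable q) :
    ∫ x, (f x + d * (p x + q x)) = (∫ x, f x) + d * ((∫ x, p x) + ∫ x, q x) := by
  have h : Integrable fun x => d * (p x + q x) := (hp.add hq).const_mul d
  rw [integral_add hf h, integral_const_mul, integral_add hp hq]

lemma integral_mul_add_add_mul_add {𝕜 : Type*} [RCLike 𝕜] {f g p q : Plane → 𝕜} (c d : 𝕜)
    (hf : Integrable f) (hg : Integrable g) (hp : Integrable p) (hq : Integrable q) :
    ∫ x, (c * (f x + g x) + d * (p x + q x)) =
      c * ((∫ x, f x) + ∫ x, g x) + d * ((∫ x, p x) + ∫ x, q x) := by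
  have h : Integrable fun x => c * (f x + g x) := (hf.add hg).const_mul c
  rw [integral_add_mul_add d h hp hq, integral_const_mul, integral_add hf hg]

namespace IsSpectralSol

variable {ρm ρbar σ T : ℝ} {W : ℝ → Plane → ℝ} {a b : Plane → ℂ} {U : Fin 2 → ℝ → Plane → ℂ}
  (h : IsSpectralSol ρm ρbar σ T W a b U) (hW : ∀ t ξ, W t ξ ≤ decay ξ)
include h hW

lemma rep_psi (t : ℝ) : Rep (U 0 t) (psiOf U t) :=
  (h.sym 0).rep (D := 1) (by simpa using hW) t

lemma rep_grad (t : ℝ) (j : Fin 2) : Rep (pHat (U 1) t j) (fun x => gradOf U t x j) :=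
  ((h.sym 1).pHat j).rep (D := 1) (by simpa using hW) t

lemma rep_phi (t : ℝ) : Rep (fun ξ => U 1 t ξ / (‖ξ‖ : ℂ)) (phiOf U t) := by
  refine Rep.of_hermitian ?_ fun ξ => ?_
  · refine integrable_decay_div_norm.mono' ?_ (Eventually.of_forall fun ξ => ?_)
    · exact (((h.sym 1).meas t).div (Continuous.measurable (by fun_prop))).aestronglyMeasurable
    · rw [norm_div, Complex.norm_real, norm_norm]
      exact div_le_div_of_nonneg_right (((h.sym 1).bound t ξ).trans (hW t ξ)) (norm_nonneg _)
  · rw [(h.sym 1).herm, norm_neg, map_div₀, Complex.conj_ofReal]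

lemma rep_flux (t : ℝ) (j : Fin 2) :
    Rep (fluxSym ρm ρbar U j t) (fun x => flux ρm ρbar (psiOf U t x) (gradOf U t x) j) :=
  (h.rep_psi hW t).flux (h.rep_grad hW t) ρm ρbar j

lemma rep_rate (t : ℝ) :
    Rep (rateSym ρm ρbar U t) (fun x => potentialRate ρm ρbar (psiOf U t x) (gradOf U t x)) :=
  (h.rep_psi hW t).rate (h.rep_grad hW t) ρm ρbar

lemma hasWeakGradient (t : ℝ) : HasWeakGradient (phiOf U t) (gradOf U t) := by
  refine (h.rep_phi hW t).hasWeakGradient fun j => (h.rep_grad hW t j).congr_left fun ξ => ?_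
  rw [pHat]; push_cast; ring

/-- The identity for each frequency is multiplied by the transform of η and integrated. The decay of
that transform justifies exchanging the time and frequency integrals, and duality returns every term
to physical space with the derivatives on η. -/
lemma density_pairing {η : Plane → ℝ} (hη : IsTest η) {t₀ t : ℝ} (ht₀ : t₀ ∈ Icc 0 T)
    (ht : t ∈ Icc 0 T) :
    (∫ x, psiOf U t x * η x) = (∫ x, psiOf U t₀ x * η x)
      + ∫ s in t₀..t, ∫ x,
          (-(inner ℝ (flux ρm ρbar (psiOf U s x) (gradOf U s x)) (gradient η x) : ℝ)
            + σ * (psiOf U s x * Laplacian.laplacian η x)) := by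
  obtain ⟨K, hK, hF, -⟩ := h.exists_isSymbol hW
  obtain ⟨C, hC, hCe⟩ := norm_invFourier_test_le hη
  have hUb : ∀ s ξ, ‖U 0 s ξ‖ ≤ 1 * decay ξ := fun s ξ => by
    rw [one_mul]; exact ((h.sym 0).bound s ξ).trans (hW s ξ)
  obtain ⟨e, he⟩ : ∃ e, e = invFourier (fun x => (η x : ℂ)) := ⟨_, rfl⟩
  have hec : Continuous e := by rw [he]; exact continuous_invFourier hη.integrable.ofReal
  rw [← he] at hCe
  have iF : ∀ s j, _ := fun s (j : Fin 2) => integrable_mul_test hK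
    (g := fun ξ => Complex.I * (ξ j : ℂ) * fluxSym ρm ρbar U j s ξ)
    (Measurable.aestronglyMeasurable (Measurable.mul (Continuous.measurable (by fun_prop))
      ((hF j).meas s))) hec hCe (fun ξ => norm_coord_mul_le ξ j ((hF j).bound s ξ))
  have iU : ∀ s j, _ := fun s (j : Fin 2) => integrable_mul_test zero_le_one
    (g := fun ξ => (ξ j : ℂ) ^ 2 * U 0 s ξ)
    (Measurable.aestronglyMeasurable (Measurable.mul (Continuous.measurable (by fun_prop))
      ((h.sym 0).meas s))) hec hCe (fun ξ => norm_coord_sq_mul_le ξ j (hUb s ξ))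
  have iu : ∀ s, Integrable fun ξ => U 0 s ξ * e ξ := fun s =>
    (integrable_mul_test zero_le_one (((h.sym 0).meas s).aestronglyMeasurable) hec hCe
      (fun ξ => le_weight ξ (hUb s ξ) zero_le_one)).2
  have key := integral_mul_eq_add_intervalIntegral (u := U 0) (t₀ := t₀) (t := t) (e := e)
    (D := fun s ξ => Complex.I * (ξ 0 : ℂ) * fluxSym ρm ρbar U 0 s ξ
      + Complex.I * (ξ 1 : ℂ) * fluxSym ρm ρbar U 1 s ξ
      - (σ : ℂ) * ((ξ 0 : ℂ) ^ 2 + (ξ 1 : ℂ) ^ 2) * U 0 s ξ)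
    (K := K * C + K * C + |σ| * (1 * C + 1 * C))
    (by
      have m0 := (hF 0).uncurry_measurable
      have m1 := (hF 1).uncurry_measurable
      have m2 := (h.sym 0).uncurry_measurable
      have c0 := measurable_coord 0
      have c1 := measurable_coord 1
      exact (((c0.const_mul _).mul m0).add ((c1.const_mul _).mul m1)).sub
        ((((c0.pow_const 2).add (c1.pow_const 2)).const_mul _).mul m2)) hec
    (fun s ξ => by
      have e0 := (iF s 0).1 ξ
      have e1 := (iF s 1).1 ξ
      have e2 := (iU s 0).1 ξ
      have e3 := (iU s 1).1 ξ
      have : (Complex.I * (ξ 0 : ℂ) * fluxSym ρm ρbar U 0 s ξ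
        + Complex.I * (ξ 1 : ℂ) * fluxSym ρm ρbar U 1 s ξ
        - (σ : ℂ) * ((ξ 0 : ℂ) ^ 2 + (ξ 1 : ℂ) ^ 2) * U 0 s ξ) * e ξ =
        Complex.I * (ξ 0 : ℂ) * fluxSym ρm ρbar U 0 s ξ * e ξ
        + Complex.I * (ξ 1 : ℂ) * fluxSym ρm ρbar U 1 s ξ * e ξ
        - (σ : ℂ) * ((ξ 0 : ℂ) ^ 2 * U 0 s ξ * e ξ + (ξ 1 : ℂ) ^ 2 * U 0 s ξ * e ξ) := by ring
      rw [this]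
      refine (norm_sub_le _ _).trans ?_
      rw [norm_mul, Complex.norm_real, Real.norm_eq_abs]
      have n1 := norm_add_le (Complex.I * (ξ 0 : ℂ) * fluxSym ρm ρbar U 0 s ξ * e ξ)
        (Complex.I * (ξ 1 : ℂ) * fluxSym ρm ρbar U 1 s ξ * e ξ)
      have n2 := mul_le_mul_of_nonneg_left ((norm_add_le ((ξ 0 : ℂ) ^ 2 * U 0 s ξ * e ξ)
        ((ξ 1 : ℂ) ^ 2 * U 0 s ξ * e ξ)).trans (add_le_add e2 e3)) (abs_nonneg σ)
      linarith)
    (iu t₀) (fun ξ hξ => h.density_hat_eq hξ ht₀ ht)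
  have hpair : ∀ s, ∫ ξ, (Complex.I * (ξ 0 : ℂ) * fluxSym ρm ρbar U 0 s ξ
      + Complex.I * (ξ 1 : ℂ) * fluxSym ρm ρbar U 1 s ξ
      - (σ : ℂ) * ((ξ 0 : ℂ) ^ 2 + (ξ 1 : ℂ) ^ 2) * U 0 s ξ) * e ξ =
      ((∫ x, (-(inner ℝ (flux ρm ρbar (psiOf U s x) (gradOf U s x)) (gradient η x) : ℝ)
            + σ * (psiOf U s x * Laplacian.laplacian η x)) : ℝ) : ℂ) := by
    intro s
    have hψ := h.rep_psi hW s
    have f0 := h.rep_flux hW s 0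
    have f1 := h.rep_flux hW s 1
    have p0 := f0.integral_mul_pderiv hη 0
    have p1 := f1.integral_mul_pderiv hη 1
    have q0 := hψ.integral_mul_pderiv_pderiv hη 0
    have q1 := hψ.integral_mul_pderiv_pderiv hη 1
    rw [← he] at p0 p1 q0 q1
    have r0 := (hη.pderiv 0).integrable_continuous_mul f0.continuous
    have r1 := (hη.pderiv 1).integrable_continuous_mul f1.continuous
    have r2 := ((hη.pderiv 0).pderiv 0).integrable_continuous_mul hψ.continuous
    have r3 := ((hη.pderiv 1).pderiv 1).integrable_continuous_mul hψ.continuous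
    have e1 : (∫ x, (-(inner ℝ (flux ρm ρbar (psiOf U s x) (gradOf U s x)) (gradient η x) : ℝ)
            + σ * (psiOf U s x * Laplacian.laplacian η x))) =
        (-1) * ((∫ x, flux ρm ρbar (psiOf U s x) (gradOf U s x) 0 * pderiv 0 η x)
          + ∫ x, flux ρm ρbar (psiOf U s x) (gradOf U s x) 1 * pderiv 1 η x)
        + σ * ((∫ x, psiOf U s x * pderiv 0 (pderiv 0 η) x)
          + ∫ x, psiOf U s x * pderiv 1 (pderiv 1 η) x) := by
      rw [← integral_mul_add_add_mul_add (-1) σ r0 r1 r2 r3]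
      congr 1; ext x
      rw [inner_gradient, laplacian_eq_pderiv hη]
      ring
    have e2 : ∫ ξ, (Complex.I * (ξ 0 : ℂ) * fluxSym ρm ρbar U 0 s ξ
      + Complex.I * (ξ 1 : ℂ) * fluxSym ρm ρbar U 1 s ξ
      - (σ : ℂ) * ((ξ 0 : ℂ) ^ 2 + (ξ 1 : ℂ) ^ 2) * U 0 s ξ) * e ξ =
        1 * ((∫ ξ, Complex.I * (ξ 0 : ℂ) * fluxSym ρm ρbar U 0 s ξ * e ξ)
        + ∫ ξ, Complex.I * (ξ 1 : ℂ) * fluxSym ρm ρbar U 1 s ξ * e ξ)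
        + (-σ : ℂ) * ((∫ ξ, (ξ 0 : ℂ) ^ 2 * U 0 s ξ * e ξ)
          + ∫ ξ, (ξ 1 : ℂ) ^ 2 * U 0 s ξ * e ξ) := by
      rw [← integral_mul_add_add_mul_add 1 (-σ : ℂ) (iF s 0).2 (iF s 1).2 (iU s 0).2 (iU s 1).2]
      congr 1; ext ξ
      ring
    simp only [neg_mul, integral_neg] at p0 p1 q0 q1
    rw [e1, e2]
    push_cast
    rw [p0, p1, q0, q1]
    ring
  rw [← Complex.ofReal_inj, (h.rep_psi hW t).integral_mul hη.integrable, Complex.ofReal_add,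
    (h.rep_psi hW t₀).integral_mul hη.integrable, ← intervalIntegral.integral_ofReal, ← he, key]
  simp only [hpair]

lemma potential_pairing {η : Plane → ℝ} (hη : IsTest η) {t₀ t : ℝ} (ht₀ : t₀ ∈ Icc 0 T)
    (ht : t ∈ Icc 0 T) :
    (∫ x, phiOf U t x * η x) = (∫ x, phiOf U t₀ x * η x)
      + ∫ s in t₀..t, ∫ x,
          (potentialRate ρm ρbar (psiOf U s x) (gradOf U s x) * η x
            + σ * (inner ℝ (gradOf U s x) (gradient η x) : ℝ)) := by
  obtain ⟨K, hK, -, hR⟩ := h.exists_isSymbol hW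
  obtain ⟨C, hC, hCe⟩ := norm_invFourier_test_le hη
  have hp := fun j => (h.sym 1).pHat j
  have hpb : ∀ j s ξ, ‖pHat (U 1) s j ξ‖ ≤ 1 * decay ξ := fun j s ξ => by
    rw [one_mul]; exact ((hp j).bound s ξ).trans (hW s ξ)
  obtain ⟨e, he⟩ : ∃ e, e = invFourier (fun x => (η x : ℂ)) := ⟨_, rfl⟩
  have hec : Continuous e := by rw [he]; exact continuous_invFourier hη.integrable.ofReal
  rw [← he] at hCe
  have iP : ∀ s j, _ := fun s (j : Fin 2) => integrable_mul_test zero_le_one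
    (g := fun ξ => Complex.I * (ξ j : ℂ) * pHat (U 1) s j ξ)
    (Measurable.aestronglyMeasurable (Measurable.mul (Continuous.measurable (by fun_prop))
      ((hp j).meas s))) hec hCe (fun ξ => norm_coord_mul_le ξ j (hpb j s ξ))
  have iR : ∀ s, _ := fun s => integrable_mul_test hK (((hR.meas s).aestronglyMeasurable)) hec hCe
      (fun ξ => le_weight ξ (hR.bound s ξ) hK)
  have iφ : ∀ s, Integrable fun ξ => (U 1 s ξ / ‖ξ‖) * e ξ := fun s =>
    (h.rep_phi hW s).integrable.mul_bdd (c := C) hec.aestronglyMeasurable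
      (Eventually.of_forall fun ξ => (le_mul_of_one_le_left (norm_nonneg _)
        (by nlinarith [norm_nonneg ξ])).trans (hCe ξ))
  have key := integral_mul_eq_add_intervalIntegral (u := fun t ξ => U 1 t ξ / ‖ξ‖) (t₀ := t₀)
    (t := t) (e := e)
    (D := fun s ξ => rateSym ρm ρbar U s ξ
      - (σ : ℂ) * (Complex.I * (ξ 0 : ℂ) * pHat (U 1) s 0 ξ
        + Complex.I * (ξ 1 : ℂ) * pHat (U 1) s 1 ξ))
    (K := K * C + |σ| * (1 * C + 1 * C))
    (by
      have m0 := (hp 0).uncurry_measurable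
      have m1 := (hp 1).uncurry_measurable
      have m2 := hR.uncurry_measurable
      have c0 := measurable_coord 0
      have c1 := measurable_coord 1
      exact m2.sub ((((c0.const_mul _).mul m0).add ((c1.const_mul _).mul m1)).const_mul _)) hec
    (fun s ξ => by
      have e1 := (iR s).1 ξ
      have e2 := (iP s 0).1 ξ
      have e3 := (iP s 1).1 ξ
      have : (rateSym ρm ρbar U s ξ
        - (σ : ℂ) * (Complex.I * (ξ 0 : ℂ) * pHat (U 1) s 0 ξ
        + Complex.I * (ξ 1 : ℂ) * pHat (U 1) s 1 ξ)) * e ξ = rateSym ρm ρbar U s ξ * e ξ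
        - (σ : ℂ) * (Complex.I * (ξ 0 : ℂ) * pHat (U 1) s 0 ξ * e ξ
        + Complex.I * (ξ 1 : ℂ) * pHat (U 1) s 1 ξ * e ξ) := by ring
      rw [this]
      refine (norm_sub_le _ _).trans ?_
      rw [norm_mul (σ : ℂ), Complex.norm_real, Real.norm_eq_abs]
      have n2 := mul_le_mul_of_nonneg_left ((norm_add_le
        (Complex.I * (ξ 0 : ℂ) * pHat (U 1) s 0 ξ * e ξ)
        (Complex.I * (ξ 1 : ℂ) * pHat (U 1) s 1 ξ * e ξ)).trans (add_le_add e2 e3)) (abs_nonneg σ)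
      linarith)
    (iφ t₀) (fun ξ hξ => h.potential_hat_eq hξ ht₀ ht)
  have hpair : ∀ s, ∫ ξ, (rateSym ρm ρbar U s ξ
        - (σ : ℂ) * (Complex.I * (ξ 0 : ℂ) * pHat (U 1) s 0 ξ
        + Complex.I * (ξ 1 : ℂ) * pHat (U 1) s 1 ξ)) * e ξ =
      ((∫ x, (potentialRate ρm ρbar (psiOf U s x) (gradOf U s x) * η x
            + σ * (inner ℝ (gradOf U s x) (gradient η x) : ℝ)) : ℝ) : ℂ) := by
    intro s
    have g0 := h.rep_grad hW s 0
    have g1 := h.rep_grad hW s 1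
    have hR' := h.rep_rate hW s
    have p0 := g0.integral_mul_pderiv hη 0
    have p1 := g1.integral_mul_pderiv hη 1
    have q := hR'.integral_mul hη.integrable
    rw [← he] at p0 p1 q
    have r0 := (hη.pderiv 0).integrable_continuous_mul g0.continuous
    have r1 := (hη.pderiv 1).integrable_continuous_mul g1.continuous
    have r2 := hη.integrable_continuous_mul hR'.continuous
    have e1 : (∫ x, (potentialRate ρm ρbar (psiOf U s x) (gradOf U s x) * η x
            + σ * (inner ℝ (gradOf U s x) (gradient η x) : ℝ))) =
        (∫ x, potentialRate ρm ρbar (psiOf U s x) (gradOf U s x) * η x)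
        + σ * ((∫ x, gradOf U s x 0 * pderiv 0 η x) + ∫ x, gradOf U s x 1 * pderiv 1 η x) := by
      rw [← integral_add_mul_add σ r2 r0 r1]
      congr 1; ext x
      rw [inner_gradient]
    have e2 : ∫ ξ, (rateSym ρm ρbar U s ξ
        - (σ : ℂ) * (Complex.I * (ξ 0 : ℂ) * pHat (U 1) s 0 ξ
        + Complex.I * (ξ 1 : ℂ) * pHat (U 1) s 1 ξ)) * e ξ =
        (∫ ξ, rateSym ρm ρbar U s ξ * e ξ)
        + (-σ : ℂ) * ((∫ ξ, Complex.I * (ξ 0 : ℂ) * pHat (U 1) s 0 ξ * e ξ)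
          + ∫ ξ, Complex.I * (ξ 1 : ℂ) * pHat (U 1) s 1 ξ * e ξ) := by
      rw [← integral_add_mul_add (-σ : ℂ) (iR s).2 (iP s 0).2 (iP s 1).2]
      congr 1; ext ξ
      ring
    simp only [neg_mul, integral_neg] at p0 p1
    rw [e1, e2]
    push_cast
    rw [p0, p1, q]
    ring
  rw [← Complex.ofReal_inj, (h.rep_phi hW t).integral_mul hη.integrable, Complex.ofReal_add,
    (h.rep_phi hW t₀).integral_mul hη.integrable, ← intervalIntegral.integral_ofReal, ← he, key]
  simp only [hpair]

end IsSpectralSol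

/-! ### Spectral solutions are weak solutions -/

lemma continuous_toLp_of_apply {X ι : Type*} [TopologicalSpace X] [Fintype ι]
    {F : X → EuclideanSpace ℝ ι} (h : ∀ i, Continuous fun x => F x i) : Continuous F :=
  (PiLp.continuous_toLp 2 _).comp (continuous_pi h)

/-- `u` is, almost everywhere, the inverse Fourier transform of `a`. -/
def HasInvFourier (u : Plane → ℝ) (a : Plane → ℂ) : Prop :=
  Integrable a ∧ ∀ᵐ x ∂(volume : Measure Plane), (u x : ℂ) = invFourier a x

lemma HasInvFourier.integral_mul {u : Plane → ℝ} {a : Plane → ℂ} (h : HasInvFourier u a)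
    {η : Plane → ℝ} (hη : Integrable η) :
    ((∫ x, u x * η x : ℝ) : ℂ) = ∫ ξ, a ξ * invFourier (fun x => (η x : ℂ)) ξ := by
  rw [← integral_invFourier_mul h.1 (b := fun x => (η x : ℂ)) hη.ofReal,
    ← integral_complex_ofReal]
  refine integral_congr_ae (h.2.mono fun x hx => ?_)
  simp only [Complex.ofReal_mul, hx]

lemma ae_ne_zero : ∀ᵐ ξ ∂(volume : Measure Plane), ξ ≠ 0 := by
  simp [ae_iff, measure_singleton]

namespace IsSpectralSol

variable {ρm ρbar σ T : ℝ} {W : ℝ → Plane → ℝ} {a b : Plane → ℂ} {U : Fin 2 → ℝ → Plane → ℂ}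
  (h : IsSpectralSol ρm ρbar σ T W a b U) (hW : ∀ t ξ, W t ξ ≤ decay ξ)
include h hW

/-- The `L²` and `L^∞` norms of `ψ` and of the components of `∇φ`. -/
lemma norm_le {w : Plane → ℝ} {t : ℝ} (hw : Integrable w) (hw2 : Integrable fun ξ => w ξ ^ 2)
    (hWw : ∀ ξ, W t ξ ≤ w ξ) {F : Plane → ℝ}
    (hF : F = psiOf U t ∨ ∃ j, F = fun x => gradOf U t x j) :
    (∀ x, |F x| ≤ cpi * ∫ ξ, w ξ) ∧ MemLp F 2 ∧
      eLpNorm F 2 volume ≤ ENNReal.ofReal (√(cpi * ∫ ξ, w ξ ^ 2)) := by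
  have key : ∀ {c : Plane → ℂ} {F : Plane → ℝ}, Rep c F → (∀ ξ, ‖c ξ‖ ≤ W t ξ) →
      (∀ x, |F x| ≤ cpi * ∫ ξ, w ξ) ∧ MemLp F 2 ∧
      eLpNorm F 2 volume ≤ ENNReal.ofReal (√(cpi * ∫ ξ, w ξ ^ 2)) := fun hr hb =>
    ⟨hr.abs_le hw fun ξ => (hb ξ).trans (hWw ξ), hr.memLp_two (fun ξ => (hb ξ).trans (hWw ξ)) hw2⟩
  rcases hF with rfl | ⟨j, rfl⟩
  · exact key (h.rep_psi hW t) ((h.sym 0).bound t)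
  · exact key (h.rep_grad hW t j) (((h.sym 1).pHat j).bound t)

omit h hW in
lemma integrable_decay_sq : Integrable fun ξ => decay ξ ^ 2 :=
  integrable_decay.mono' (continuous_decay.pow 2).aestronglyMeasurable
    (Eventually.of_forall fun ξ => by
      have := decay_pos ξ
      rw [Real.norm_of_nonneg (by positivity), sq]
      exact mul_le_of_le_one_left this.le (decay_le_one ξ))

theorem isSolution {ψ₀ φT : Plane → ℝ} (hT : 0 ≤ T) (hψ₀ : HasInvFourier ψ₀ a)
    (hφT : HasInvFourier φT b) :
    IsSolution ρm ρbar σ T ψ₀ φT (psiOf U) (phiOf U) (gradOf U) := by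
  have h0m : (0 : ℝ) ∈ Icc 0 T := ⟨le_rfl, hT⟩
  have hTm : T ∈ Icc 0 T := ⟨hT, le_rfl⟩
  have hW1 : ∀ t ξ, W t ξ ≤ 1 * decay ξ := by simpa using hW
  have cψ : Continuous (Function.uncurry (psiOf U)) := (h.sym 0).continuous_uncurry hW1
  have cG : Continuous (Function.uncurry (gradOf U)) :=
    continuous_toLp_of_apply fun j => ((h.sym 1).pHat j).continuous_uncurry hW1
  have cψt : ∀ t, Continuous (psiOf U t) := fun t => (h.rep_psi hW t).continuous
  have cGt : ∀ t, Continuous (gradOf U t) := fun t =>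
    continuous_toLp_of_apply fun j => (h.rep_grad hW t j).continuous
  set A := cpi * ∫ ξ, decay ξ with hA
  set B := √(cpi * ∫ ξ, decay ξ ^ 2) with hB
  have hn : ∀ t (F : Plane → ℝ), (F = psiOf U t ∨ ∃ j, F = fun x => gradOf U t x j) →
      eLpNorm F 2 volume ≤ ENNReal.ofReal B ∧ eLpNorm F ∞ volume ≤ ENNReal.ofReal A := by
    intro t F hF
    obtain ⟨h1, h2, h3⟩ := h.norm_le hW integrable_decay integrable_decay_sq (hW t) hF
    exact ⟨h3, eLpNormEssSup_le_of_ae_bound (Eventually.of_forall h1)⟩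
  have hG : ∀ t, eLpNorm (gradOf U t) 2 volume ≤ ENNReal.ofReal B + ENNReal.ofReal B ∧
      eLpNorm (gradOf U t) ∞ volume ≤ ENNReal.ofReal A + ENNReal.ofReal A := by
    intro t
    have m : ∀ i, AEStronglyMeasurable (fun x => gradOf U t x i) volume := fun i =>
      (h.rep_grad hW t i).continuous.aestronglyMeasurable
    constructor
    · refine (eLpNorm_le_sum_apply (by norm_num) m).trans ?_
      rw [Fin.sum_univ_two]
      exact add_le_add (hn t _ (Or.inr ⟨0, rfl⟩)).1 (hn t _ (Or.inr ⟨1, rfl⟩)).1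
    · refine (eLpNorm_le_sum_apply (by simp) m).trans ?_
      rw [Fin.sum_univ_two]
      exact add_le_add (hn t _ (Or.inr ⟨0, rfl⟩)).2 (hn t _ (Or.inr ⟨1, rfl⟩)).2
  have lt2 : ENNReal.ofReal B + ENNReal.ofReal B < (⊤ : ℝ≥0∞) := by simp
  have ltA : ENNReal.ofReal A + ENNReal.ofReal A < (⊤ : ℝ≥0∞) := by simp
  refine ⟨cψ.aestronglyMeasurable, cG.aestronglyMeasurable, fun t _ => ?_, ?_,
    fun t _ => h.hasWeakGradient hW t, fun η hη t ht => ?_, fun η hη t ht => ?_⟩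
  · exact ⟨⟨(cψt t).aestronglyMeasurable, (hn t _ (Or.inl rfl)).1.trans_lt ENNReal.ofReal_lt_top⟩,
      ⟨(cψt t).aestronglyMeasurable, (hn t _ (Or.inl rfl)).2.trans_lt ENNReal.ofReal_lt_top⟩,
      ⟨(cGt t).aestronglyMeasurable, (hG t).1.trans_lt lt2⟩,
      ⟨(cGt t).aestronglyMeasurable, (hG t).2.trans_lt ltA⟩⟩
  · refine ⟨(ENNReal.ofReal B + ENNReal.ofReal A + (ENNReal.ofReal B + ENNReal.ofReal B)
      + (ENNReal.ofReal A + ENNReal.ofReal A)).toNNReal, fun t _ => ?_⟩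
    rw [ENNReal.coe_toNNReal (by simp)]
    exact add_le_add (add_le_add (add_le_add (hn t _ (Or.inl rfl)).1 (hn t _ (Or.inl rfl)).2)
      (hG t).1) (hG t).2
  · rw [h.density_pairing hW hη h0m ht]
    congr 1
    rw [← Complex.ofReal_inj, (h.rep_psi hW 0).integral_mul hη.integrable,
      hψ₀.integral_mul hη.integrable]
    -- The transforms agree with the data off the origin, which is a null set; at the origin U was
    -- set to 0.
    refine integral_congr_ae (ae_ne_zero.mono fun ξ hξ => ?_)
    obtain ⟨z₁, z₂, -, hz0, -, hU⟩ := h.ode ξ hξ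
    simp only [(hU 0 h0m).1, hz0]
  · rw [h.potential_pairing hW hη hTm ht, intervalIntegral.integral_symm t T, ← sub_eq_add_neg]
    congr 1
    rw [← Complex.ofReal_inj, (h.rep_phi hW T).integral_mul hη.integrable,
      hφT.integral_mul hη.integrable]
    refine integral_congr_ae (ae_ne_zero.mono fun ξ hξ => ?_)
    obtain ⟨z₁, z₂, -, -, hzT, hU⟩ := h.ode ξ hξ
    have hr : (‖ξ‖ : ℂ) ≠ 0 := by exact_mod_cast (norm_pos_iff.2 hξ).ne'
    simp only [(hU T hTm).2, hzT, mul_div_cancel_left₀ _ hr]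

/-- The scaled second derivatives of `φ` obey the same bounds as its gradient. -/
lemma hessian (hσ : 0 < σ) (t : ℝ) : HasWeakJacobian (gradOf U t) (hessOf U t) ∧
    ∀ p, Rep (fun ξ => (σ : ℂ) * (Complex.I * (ξ p.2 : ℂ) * pHat (U 1) t p.1 ξ))
      (fun x => σ * hessOf U t x p) ∧
      ∀ ξ, ‖(σ : ℂ) * (Complex.I * (ξ p.2 : ℂ) * pHat (U 1) t p.1 ξ)‖ ≤ W t ξ := by
  -- Here σ|ξ||v| ≤ (1+σ|ξ|)|v|, which the field `viscous` bounds by W.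
  have hb : ∀ (p : Fin 2 × Fin 2) ξ,
      ‖(σ : ℂ) * (Complex.I * (ξ p.2 : ℂ) * pHat (U 1) t p.1 ξ)‖ ≤ W t ξ := by
    intro p ξ
    refine le_trans ?_ (h.viscous 1 t ξ)
    rw [norm_mul, norm_mul, norm_mul, Complex.norm_I, one_mul, Complex.norm_real, Complex.norm_real,
      Real.norm_of_nonneg hσ.le, pHat, norm_mul]
    have h1 := norm_pHat_factor_le ξ p.1
    have h2 := abs_apply_le ξ p.2
    have h3 : ‖Complex.I * ((ξ p.1 / ‖ξ‖ : ℝ) : ℂ)‖ * ‖U 1 t ξ‖ ≤ ‖U 1 t ξ‖ :=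
      mul_le_of_le_one_left (norm_nonneg _) h1
    have h4 := mul_le_mul h2 h3 (by positivity) (norm_nonneg ξ)
    have h5 := mul_le_mul_of_nonneg_left h4 hσ.le
    rw [Real.norm_eq_abs]
    have h6 := norm_nonneg (U 1 t ξ)
    linarith
  have hrep : ∀ p : Fin 2 × Fin 2, Rep (fun ξ => Complex.I * (ξ p.2 : ℂ) * pHat (U 1) t p.1 ξ)
      (fun x => hessOf U t x p) := by
    intro p
    refine Rep.of_hermitian ?_ fun ξ => ?_
    · have hm : Measurable fun ξ : Plane => Complex.I * (ξ p.2 : ℂ) * pHat (U 1) t p.1 ξ :=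
        Measurable.mul (Continuous.measurable (by fun_prop)) (((h.sym 1).pHat p.1).meas t)
      refine (integrable_decay.const_mul σ⁻¹).mono' hm.aestronglyMeasurable
        (Eventually.of_forall fun ξ => ?_)
      have := (hb p ξ).trans (hW t ξ)
      rw [norm_mul, Complex.norm_real, Real.norm_of_nonneg hσ.le] at this
      rwa [inv_mul_eq_div, le_div_iff₀ hσ, mul_comm]
    · rw [((h.sym 1).pHat p.1).herm]
      simp only [PiLp.neg_apply, map_mul, Complex.conj_I, Complex.conj_ofReal]
      push_cast; ring
  exact ⟨fun i => (h.rep_grad hW t i).hasWeakGradient fun j => hrep (i, j),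
    fun p => ⟨(hrep p).const_mul σ, hb p⟩⟩

end IsSpectralSol

/-! ### Decay in time -/

/-- The L^∞ bound is the integral of the weight. The L² bound is the root of the integral of its
square, which is controlled by the same exponential integral; the root turns (1+t)⁻² into (1+t)⁻¹.
-/
lemma exists_twoSided_bounds {c B : ℝ} (hc : 0 < c) (hB : 0 < B) : ∃ K > 0, ∀ N M T t : ℝ, 0 ≤ N →
    0 ≤ M → t ∈ Icc 0 T → ∀ (a : Plane → ℂ) (F : Plane → ℝ), Rep a F →
    (∀ ξ, ‖a ξ‖ ≤ B * twoSided c N M T t ξ) →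
    (∀ x, |F x| ≤ K * (N / (1 + t) ^ 2 + M / (1 + T - t) ^ 2)) ∧
    eLpNorm F 2 volume ≤ ENNReal.ofReal (K * (N / (1 + t) + M / (1 + T - t))) := by
  obtain ⟨C, hC, hint⟩ := exists_integral_decay_mul_exp_le hc
  refine ⟨B * C + B * √(2 * C), by positivity, ?_⟩
  intro N M T t hN hM ht a F hr hb
  have ht0 := ht.1
  have ht1 : 0 ≤ T - t := sub_nonneg.2 ht.2
  obtain ⟨i1, b1⟩ := hint t ht0
  obtain ⟨i2, b2⟩ := hint (T - t) ht1
  have e1 : 1 + (T - t) = 1 + T - t := by ring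
  rw [e1] at b2
  have ep : 0 < 1 + T - t := by linarith
  set E₁ : Plane → ℝ := fun ξ => decay ξ * Real.exp (-(c * t * ‖ξ‖)) with hE₁
  set E₂ : Plane → ℝ := fun ξ => decay ξ * Real.exp (-(c * (T - t) * ‖ξ‖)) with hE₂
  have hw : ∀ ξ, B * twoSided c N M T t ξ = B * (N * E₁ ξ + M * E₂ ξ) := by
    intro ξ; simp only [twoSided, clamp_of_mem ht, hE₁, hE₂]; ring
  have hE : ∀ ξ, 0 ≤ E₁ ξ ∧ E₁ ξ ≤ 1 ∧ 0 ≤ E₂ ξ ∧ E₂ ξ ≤ 1 := by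
    intro ξ
    have d := decay_pos ξ
    have d1 := decay_le_one ξ
    refine ⟨by positivity, mul_le_one₀ d1 (by positivity) (Real.exp_le_one_iff.2 (by simp; positivity)),
      by positivity, mul_le_one₀ d1 (by positivity) (Real.exp_le_one_iff.2 (by simp; positivity))⟩
  have iw : Integrable fun ξ => B * (N * E₁ ξ + M * E₂ ξ) :=
    ((i1.const_mul N).add (i2.const_mul M)).const_mul B
  have hI : ∫ ξ, B * (N * E₁ ξ + M * E₂ ξ) ≤ B * C * (N / (1 + t) ^ 2 + M / (1 + T - t) ^ 2) := by
    rw [integral_const_mul, integral_add (i1.const_mul N) (i2.const_mul M), integral_const_mul,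
      integral_const_mul, mul_assoc]
    refine mul_le_mul_of_nonneg_left ?_ hB.le
    have := mul_le_mul_of_nonneg_left b1 hN
    have := mul_le_mul_of_nonneg_left b2 hM
    calc _ ≤ N * (C / (1 + t) ^ 2) + M * (C / (1 + T - t) ^ 2) := by linarith
      _ = _ := by ring
  -- Both profiles are at most 1, so their squares are bounded by the profiles themselves.
  have hsq : ∀ ξ, (B * (N * E₁ ξ + M * E₂ ξ)) ^ 2 ≤ 2 * B ^ 2 * (N ^ 2 * E₁ ξ + M ^ 2 * E₂ ξ) := by
    intro ξ
    obtain ⟨h1, h2, h3, h4⟩ := hE ξ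
    have s1 : E₁ ξ ^ 2 ≤ E₁ ξ := by nlinarith
    have s2 : E₂ ξ ^ 2 ≤ E₂ ξ := by nlinarith
    have s3 : (N * E₁ ξ + M * E₂ ξ) ^ 2 ≤ 2 * (N ^ 2 * E₁ ξ ^ 2 + M ^ 2 * E₂ ξ ^ 2) := by
      nlinarith [sq_nonneg (N * E₁ ξ - M * E₂ ξ)]
    have s4 := mul_le_mul_of_nonneg_left s1 (sq_nonneg N)
    have s5 := mul_le_mul_of_nonneg_left s2 (sq_nonneg M)
    rw [mul_pow]
    nlinarith [sq_nonneg B]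
  have iw2' : Integrable fun ξ => 2 * B ^ 2 * (N ^ 2 * E₁ ξ + M ^ 2 * E₂ ξ) :=
    ((i1.const_mul (N ^ 2)).add (i2.const_mul (M ^ 2))).const_mul (2 * B ^ 2)
  have iw2 : Integrable fun ξ => (B * (N * E₁ ξ + M * E₂ ξ)) ^ 2 :=
    iw2'.mono' (iw.aestronglyMeasurable.pow 2) (Eventually.of_forall fun ξ => by
      rw [Real.norm_of_nonneg (sq_nonneg _)]; exact hsq ξ)
  have hI2 : ∫ ξ, (B * (N * E₁ ξ + M * E₂ ξ)) ^ 2 ≤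
      (B * √(2 * C) * (N / (1 + t) + M / (1 + T - t))) ^ 2 := by
    refine (integral_mono iw2 iw2' hsq).trans ?_
    rw [integral_const_mul, integral_add (i1.const_mul _) (i2.const_mul _), integral_const_mul,
      integral_const_mul]
    have s1 := mul_le_mul_of_nonneg_left b1 (sq_nonneg N)
    have s2 := mul_le_mul_of_nonneg_left b2 (sq_nonneg M)
    have s3 : 0 ≤ N / (1 + t) * (M / (1 + T - t)) := by positivity
    calc _ ≤ 2 * B ^ 2 * (N ^ 2 * (C / (1 + t) ^ 2) + M ^ 2 * (C / (1 + T - t) ^ 2)) := by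
          gcongr
      _ = B ^ 2 * (2 * C) * ((N / (1 + t)) ^ 2 + (M / (1 + T - t)) ^ 2) := by
          rw [div_pow, div_pow]; ring
      _ ≤ B ^ 2 * (2 * C) * (N / (1 + t) + M / (1 + T - t)) ^ 2 := by
          gcongr; nlinarith
      _ = _ := by rw [mul_pow, mul_pow, Real.sq_sqrt (by positivity)]
  have hb' : ∀ ξ, ‖a ξ‖ ≤ B * (N * E₁ ξ + M * E₂ ξ) := fun ξ => (hb ξ).trans_eq (hw ξ)
  have hs0 : 0 ≤ N / (1 + t) + M / (1 + T - t) := by positivity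
  have hs1 : 0 ≤ N / (1 + t) ^ 2 + M / (1 + T - t) ^ 2 := by positivity
  constructor
  · intro x
    refine (hr.abs_le iw hb' x).trans ?_
    have h0 : 0 ≤ ∫ ξ, B * (N * E₁ ξ + M * E₂ ξ) := integral_nonneg fun ξ => by
      obtain ⟨h1, h2, h3, h4⟩ := hE ξ
      positivity
    refine (mul_le_of_le_one_left h0 cpi_le_one).trans (hI.trans ?_)
    refine mul_le_mul_of_nonneg_right ?_ hs1
    have : 0 ≤ B * √(2 * C) := by positivity
    linarith
  · refine (hr.memLp_two hb' iw2).2.trans (ENNReal.ofReal_le_ofReal ?_)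
    have h0 : 0 ≤ ∫ ξ, (B * (N * E₁ ξ + M * E₂ ξ)) ^ 2 := integral_nonneg fun ξ => sq_nonneg _
    refine (Real.sqrt_le_sqrt ((mul_le_of_le_one_left h0 cpi_le_one).trans hI2)).trans ?_
    rw [Real.sqrt_sq (by positivity)]
    refine mul_le_mul_of_nonneg_right ?_ hs0
    have : 0 ≤ B * C := by positivity
    linarith

/-! ### Mollification in space -/

/-- The convolution of `h` with the kernel `k`. -/
def mollify (h k : Plane → ℝ) (x : Plane) : ℝ := ∫ y, h y * k (x - y)

lemma IsTest.reflect {k : Plane → ℝ} (hk : IsTest k) (x : Plane) : IsTest fun y => k (x - y) :=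
  ⟨hk.1.comp (contDiff_const.sub contDiff_id),
    hk.2.comp_homeomorph (Homeomorph.subLeft x)⟩

lemma IsTest.differentiable {k : Plane → ℝ} (hk : IsTest k) : Differentiable ℝ k :=
  hk.1.differentiable (by simp)

lemma pderiv_reflect {k : Plane → ℝ} (hk : IsTest k) (j : Fin 2) (x y : Plane) :
    pderiv j (fun y => k (x - y)) y = -pderiv j k (x - y) := by
  have h1 : HasFDerivAt (fun y : Plane => x - y) (-ContinuousLinearMap.id ℝ Plane) y := by
    simpa using (hasFDerivAt_id y).const_sub x
  have := (hk.differentiable (x - y)).hasFDerivAt.comp y h1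
  unfold pderiv
  rw [show (fun y => k (x - y)) = k ∘ fun y => x - y from rfl, this.fderiv]
  simp

lemma pderiv_pderiv_reflect {k : Plane → ℝ} (hk : IsTest k) (j : Fin 2) (x y : Plane) :
    pderiv j (pderiv j (fun y => k (x - y))) y = pderiv j (pderiv j k) (x - y) := by
  have e : pderiv j (fun y => k (x - y)) = fun y => -pderiv j k (x - y) :=
    funext (pderiv_reflect hk j x)
  rw [e]
  have h := pderiv_reflect (hk.pderiv j) j x y
  unfold pderiv at h ⊢
  rw [fderiv_fun_neg, neg_apply, h, neg_neg]

lemma mollify_eq_convolution (h k : Plane → ℝ) :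
    mollify h k = convolution h k (ContinuousLinearMap.mul ℝ ℝ) volume := rfl

lemma hasFDerivAt_mollify {h k : Plane → ℝ} (hh : LocallyIntegrable h) (hk : IsTest k)
    (x : Plane) : DifferentiableAt ℝ (mollify h k) x ∧
      ∀ j, fderiv ℝ (mollify h k) x (EuclideanSpace.single j 1) = mollify h (pderiv j k) x := by
  have := hk.2.hasFDerivAt_convolution_right (ContinuousLinearMap.mul ℝ ℝ) hh
    (hk.1.of_le (by simp)) x
  rw [mollify_eq_convolution]
  refine ⟨this.differentiableAt, fun j => ?_⟩
  rw [this.fderiv, convolution_precompR_apply _ hh (hk.2.fderiv ℝ) (hk.1.continuous_fderiv (by simp))]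
  rfl

lemma integrable_mollify {h k : Plane → ℝ} (hh : LocallyIntegrable h) (hk : IsTest k) (x : Plane) :
    Integrable fun y => h y * k (x - y) := by
  have := hh.integrable_smul_right_of_hasCompactSupport (hk.reflect x).1.continuous (hk.reflect x).2
  simpa using this

lemma mollify_add {h h' k : Plane → ℝ} (hh : LocallyIntegrable h) (hh' : LocallyIntegrable h')
    (hk : IsTest k) (x : Plane) :
    mollify (fun y => h y + h' y) k x = mollify h k x + mollify h' k x := by
  simp only [mollify, add_mul]
  exact integral_add (integrable_mollify hh hk x) (integrable_mollify hh' hk x)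

lemma mollify_sub {h h' k : Plane → ℝ} (hh : LocallyIntegrable h) (hh' : LocallyIntegrable h')
    (hk : IsTest k) (x : Plane) :
    mollify (fun y => h y - h' y) k x = mollify h k x - mollify h' k x := by
  simp only [mollify, sub_mul]
  exact integral_sub (integrable_mollify hh hk x) (integrable_mollify hh' hk x)

/-- Integration by parts for square integrable mollified functions. -/
lemma integral_mollify_mul {h k p q : Plane → ℝ} {j : Fin 2} (hh : LocallyIntegrable h)
    (hk : IsTest k) (h1 : MemLp (mollify h k) 2) (h2 : MemLp (mollify h (pderiv j k)) 2)
    (hp : MemLp p 2) (hq : MemLp q 2) (hpd : Differentiable ℝ p)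
    (hpq : ∀ x, fderiv ℝ p x (EuclideanSpace.single j 1) = q x) :
    ∫ x, mollify h (pderiv j k) x * p x = -∫ x, mollify h k x * q x := by
  have hd := hasFDerivAt_mollify hh hk
  have key := integral_mul_fderiv_eq_neg_fderiv_mul_of_integrable (μ := (volume : Measure Plane))
    (f := mollify h k) (g := p) (v := EuclideanSpace.single j (1 : ℝ))
    (by simp only [(hd _).2]; exact h2.integrable_mul hp)
    (by simp only [hpq]; exact h1.integrable_mul hq) (h1.integrable_mul hp)
    (fun x _ => (hd x).1) (fun x _ => hpd x)
  simp only [(hd _).2, hpq] at key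
  rw [key, neg_neg]

lemma sq_lintegral_le {α : Type*} [MeasurableSpace α] (μ : Measure α) {f : α → ℝ≥0∞}
    (hf : AEMeasurable f μ) : (∫⁻ x, f x ∂μ) ^ 2 ≤ μ univ * ∫⁻ x, f x ^ 2 ∂μ := by
  have h := ENNReal.lintegral_mul_le_Lp_mul_Lq μ Real.HolderConjugate.two_two hf
    (aemeasurable_const (b := (1 : ℝ≥0∞)))
  simp only [Pi.mul_apply, mul_one, ENNReal.one_rpow, lintegral_const, one_mul] at h
  have h2 := pow_le_pow_left₀ (zero_le) h 2
  refine h2.trans_eq ?_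
  rw [mul_pow, ← ENNReal.rpow_natCast, ← ENNReal.rpow_natCast, ← ENNReal.rpow_mul,
    ← ENNReal.rpow_mul, mul_comm]
  norm_num

/-- Young's inequality. -/
lemma lintegral_sq_mollify_le {h k : Plane → ℝ} (hh : Measurable h) (hk : Continuous k) :
    ∫⁻ x, ‖mollify h k x‖ₑ ^ 2 ≤ (∫⁻ x, ‖k x‖ₑ) ^ 2 * ∫⁻ x, ‖h x‖ₑ ^ 2 := by
  have hkm : ∀ x, Measurable fun y => ‖k (x - y)‖ₑ := fun x =>
    (hk.measurable.comp (measurable_const.sub measurable_id)).enorm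
  have h1 : ∀ x, ‖mollify h k x‖ₑ ^ 2 ≤
      (∫⁻ x, ‖k x‖ₑ) * ∫⁻ y, ‖k (x - y)‖ₑ * ‖h y‖ₑ ^ 2 := by
    intro x
    -- Cauchy–Schwarz is applied with respect to the measure |k(x-y)| dy, whose total mass is the L¹
    -- norm of k.
    have e1 : ‖mollify h k x‖ₑ ≤ ∫⁻ y, ‖h y‖ₑ ∂(volume.withDensity fun y => ‖k (x - y)‖ₑ) := by
      rw [lintegral_withDensity_eq_lintegral_mul _ (hkm x) hh.enorm]
      refine (enorm_integral_le_lintegral_enorm _).trans_eq ?_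
      congr 1; ext y
      rw [enorm_mul, mul_comm, Pi.mul_apply]
    refine (pow_le_pow_left₀ (zero_le) e1 2).trans ((sq_lintegral_le _ hh.enorm.aemeasurable).trans_eq ?_)
    rw [lintegral_withDensity_eq_lintegral_mul _ (hkm x) (hh.enorm.pow_const 2),
      withDensity_apply _ MeasurableSet.univ, Measure.restrict_univ,
      lintegral_sub_left_eq_self (fun y => ‖k y‖ₑ) x]
    rfl
  refine (lintegral_mono h1).trans_eq ?_
  have hm : Measurable fun p : Plane × Plane => ‖k (p.1 - p.2)‖ₑ * ‖h p.2‖ₑ ^ 2 :=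
    (hk.measurable.comp (measurable_fst.sub measurable_snd)).enorm.mul
      ((hh.comp measurable_snd).enorm.pow_const 2)
  have hm2 : Measurable fun x => ∫⁻ y, ‖k (x - y)‖ₑ * ‖h y‖ₑ ^ 2 := hm.lintegral_prod_right'
  rw [lintegral_const_mul _ hm2, lintegral_lintegral_swap hm.aemeasurable]
  have : ∀ y, ∫⁻ x, ‖k (x - y)‖ₑ * ‖h y‖ₑ ^ 2 = (∫⁻ x, ‖k x‖ₑ) * ‖h y‖ₑ ^ 2 := by
    intro y
    have hm' : Measurable fun x => ‖k (x - y)‖ₑ :=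
      (hk.measurable.comp (measurable_id.sub measurable_const)).enorm
    rw [lintegral_mul_const _ hm',
      lintegral_sub_right_eq_self (fun y => ‖k y‖ₑ) y]
  simp only [this]
  rw [lintegral_const_mul _ (hh.enorm.pow_const 2), ← mul_assoc, sq]

/-! ### Square integrable functions on a time slab -/

/-- Lebesgue measure on `[0, T]`. -/
def timeMeasure (T : ℝ) : Measure ℝ := volume.restrict (Icc 0 T)

instance (T : ℝ) : IsFiniteMeasure (timeMeasure T) := by unfold timeMeasure; infer_instance

/-- Lebesgue measure on `[0, T] × ℝ²`. -/
def slab (T : ℝ) : Measure (ℝ × Plane) := (timeMeasure T).prod volume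

/-- `h` is measurable, and square integrable on `[0, T] × ℝ²`. -/
structure L2On (T : ℝ) (h : ℝ → Plane → ℝ) : Prop where
  meas : Measurable (Function.uncurry h)
  fin : ∫⁻ s, ∫⁻ x, ‖h s x‖ₑ ^ 2 ∂volume ∂(timeMeasure T) < (⊤ : ℝ≥0∞)

lemma memLp_two_of_lintegral_lt_top {α : Type*} [MeasurableSpace α] {μ : Measure α} {f : α → ℝ}
    (hf : AEStronglyMeasurable f μ) (h : ∫⁻ x, ‖f x‖ₑ ^ 2 ∂μ < (⊤ : ℝ≥0∞)) : MemLp f 2 μ := by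
  refine ⟨hf, ?_⟩
  rw [eLpNorm_lt_top_iff_lintegral_rpow_enorm_lt_top two_ne_zero (by simp)]
  simpa using h

lemma lintegral_lt_top_of_memLp_two {α : Type*} [MeasurableSpace α] {μ : Measure α} {f : α → ℝ}
    (h : MemLp f 2 μ) : ∫⁻ x, ‖f x‖ₑ ^ 2 ∂μ < (⊤ : ℝ≥0∞) := by
  have := h.2
  rw [eLpNorm_lt_top_iff_lintegral_rpow_enorm_lt_top two_ne_zero (by simp)] at this
  simpa using this

namespace L2On

variable {T : ℝ} {h h' : ℝ → Plane → ℝ}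

lemma lintegral_slab (hm : Measurable (Function.uncurry h)) :
    ∫⁻ p, ‖Function.uncurry h p‖ₑ ^ 2 ∂(slab T) =
      ∫⁻ s, ∫⁻ x, ‖h s x‖ₑ ^ 2 ∂volume ∂(timeMeasure T) := by
  unfold slab
  rw [lintegral_prod _ (hm.enorm.pow_const 2).aemeasurable]
  rfl

lemma memLp (hh : L2On T h) : MemLp (Function.uncurry h) 2 (slab T) :=
  memLp_two_of_lintegral_lt_top hh.meas.aestronglyMeasurable
    (by rw [lintegral_slab hh.meas]; exact hh.fin)

lemma of_memLp (hm : Measurable (Function.uncurry h)) (hL : MemLp (Function.uncurry h) 2 (slab T)) :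
    L2On T h :=
  ⟨hm, by rw [← lintegral_slab hm]; exact lintegral_lt_top_of_memLp_two hL⟩

lemma add (hh : L2On T h) (hh' : L2On T h') : L2On T fun s x => h s x + h' s x :=
  of_memLp (hh.meas.add hh'.meas) (hh.memLp.add hh'.memLp)

lemma sub (hh : L2On T h) (hh' : L2On T h') : L2On T fun s x => h s x - h' s x :=
  of_memLp (hh.meas.sub hh'.meas) (hh.memLp.sub hh'.memLp)

lemma const_mul (c : ℝ) (hh : L2On T h) : L2On T fun s x => c * h s x :=
  of_memLp (hh.meas.const_mul c) (hh.memLp.const_mul c)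

lemma integrable_mul (hh : L2On T h) (hh' : L2On T h') :
    Integrable (fun p : ℝ × Plane => h p.1 p.2 * h' p.1 p.2) (slab T) :=
  hh.memLp.integrable_mul hh'.memLp

lemma measurable_slice (hh : L2On T h) (s : ℝ) : Measurable (h s) :=
  hh.meas.comp measurable_prodMk_left

lemma ae_memLp (hh : L2On T h) : ∀ᵐ s ∂(timeMeasure T), MemLp (h s) 2 volume := by
  have hm : Measurable fun s => ∫⁻ x, ‖h s x‖ₑ ^ 2 :=
    (hh.meas.enorm.pow_const 2).lintegral_prod_right'
  filter_upwards [ae_lt_top hm hh.fin.ne] with s hs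
  exact memLp_two_of_lintegral_lt_top (hh.measurable_slice s).aestronglyMeasurable hs

lemma mollify (hh : L2On T h) {k : Plane → ℝ} (hk : IsTest k) :
    L2On T fun s x => mollify (h s) k x := by
  constructor
  · have : Measurable fun q : (ℝ × Plane) × Plane => h q.1.1 q.2 * k (q.1.2 - q.2) :=
      (hh.meas.comp (measurable_fst.fst.prodMk measurable_snd)).mul
        (hk.1.continuous.measurable.comp (measurable_fst.snd.sub measurable_snd))
    exact this.stronglyMeasurable.integral_prod_right'.measurable
  · refine lt_of_le_of_lt (lintegral_mono fun s =>
      lintegral_sq_mollify_le (hh.measurable_slice s) hk.1.continuous) ?_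
    have hfin : (∫⁻ x, ‖k x‖ₑ) ^ 2 ≠ (⊤ : ℝ≥0∞) := ENNReal.pow_ne_top hk.integrable.2.ne
    rw [lintegral_const_mul' _ _ hfin]
    exact ENNReal.mul_lt_top hfin.lt_top hh.fin

end L2On

/-! ### Primitives in time -/

/-- The integral of `b` over `[s, T]`. -/
def primFrom (T : ℝ) (b : ℝ → ℝ) (s : ℝ) : ℝ := ∫ τ, (if s ≤ τ then b τ else 0) ∂(timeMeasure T)

/-- The integral of `b` over `[0, s]`. -/
def primTo (T : ℝ) (b : ℝ → ℝ) (s : ℝ) : ℝ := ∫ τ, (if τ ≤ s then b τ else 0) ∂(timeMeasure T)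

lemma primFrom_eq {T s : ℝ} (hs : s ∈ Icc 0 T) (b : ℝ → ℝ) : primFrom T b s = ∫ τ in s..T, b τ := by
  rw [intervalIntegral.integral_of_le hs.2, ← integral_Icc_eq_integral_Ioc, primFrom, timeMeasure]
  have : (fun τ => if s ≤ τ then b τ else 0) = (Ici s).indicator b := by
    ext τ; simp [indicator_apply]
  rw [this, integral_indicator measurableSet_Ici, Measure.restrict_restrict measurableSet_Ici]
  congr 2
  ext τ; simp only [mem_inter_iff, mem_Ici, mem_Icc]
  exact ⟨fun h => ⟨h.1, h.2.2⟩, fun h => ⟨h.1, hs.1.trans h.1, h.2⟩⟩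

lemma primTo_eq {T s : ℝ} (hs : s ∈ Icc 0 T) (b : ℝ → ℝ) : primTo T b s = ∫ τ in (0 : ℝ)..s, b τ := by
  rw [intervalIntegral.integral_of_le hs.1, ← integral_Icc_eq_integral_Ioc, primTo, timeMeasure]
  have : (fun τ => if τ ≤ s then b τ else 0) = (Iic s).indicator b := by
    ext τ; simp [indicator_apply]
  rw [this, integral_indicator measurableSet_Iic, Measure.restrict_restrict measurableSet_Iic]
  congr 2
  ext τ; simp only [mem_inter_iff, mem_Iic, mem_Icc]
  exact ⟨fun h => ⟨h.2.1, h.1⟩, fun h => ⟨h.2, h.1, h.2.trans hs.2⟩⟩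

/-- Integration by parts for the two primitives. -/
lemma integral_mul_primFrom {T : ℝ} {a b : ℝ → ℝ} (ha : Integrable a (timeMeasure T))
    (hb : Integrable b (timeMeasure T)) (ham : Measurable a) (hbm : Measurable b) :
    ∫ s, a s * primFrom T b s ∂(timeMeasure T) = ∫ s, primTo T a s * b s ∂(timeMeasure T) := by
  -- Both sides are the integral of a(s)b(τ) over the triangle s ≤ τ.
  have hm : Measurable fun q : ℝ × ℝ => if q.1 ≤ q.2 then a q.1 * b q.2 else 0 :=
    Measurable.ite (measurableSet_le measurable_fst measurable_snd)
      ((ham.comp measurable_fst).mul (hbm.comp measurable_snd)) measurable_const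
  have hi : Integrable (Function.uncurry fun s τ : ℝ => if s ≤ τ then a s * b τ else 0)
      ((timeMeasure T).prod (timeMeasure T)) := by
    refine (ha.mul_prod hb).mono hm.aestronglyMeasurable (Eventually.of_forall fun q => ?_)
    simp only [Function.uncurry]
    split_ifs
    · exact le_rfl
    · simp; positivity
  have := integral_integral_swap hi
  have e1 : ∀ s, ∫ τ, (if s ≤ τ then a s * b τ else 0) ∂(timeMeasure T) = a s * primFrom T b s := by
    intro s
    rw [primFrom, ← integral_const_mul]
    congr 1; ext τ; split_ifs <;> simp
  have e2 : ∀ τ, ∫ s, (if s ≤ τ then a s * b τ else 0) ∂(timeMeasure T) = primTo T a τ * b τ := by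
    intro s
    rw [primTo, ← integral_mul_const]
    congr 1; ext τ; split_ifs <;> simp
  simpa only [e1, e2] using this

lemma L2On.primFrom {T : ℝ} {h : ℝ → Plane → ℝ} (hh : L2On T h) :
    L2On T fun s x => primFrom T (fun τ => h τ x) s := by
  constructor
  · have : Measurable fun q : (ℝ × Plane) × ℝ => if q.1.1 ≤ q.2 then h q.2 q.1.2 else 0 :=
      Measurable.ite (measurableSet_le measurable_fst.fst measurable_snd)
        (hh.meas.comp (measurable_snd.prodMk measurable_fst.snd)) measurable_const
    exact this.stronglyMeasurable.integral_prod_right'.measurable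
  · have hx : ∀ x, Measurable fun τ => h τ x := fun x => hh.meas.comp measurable_prodMk_right
    have h1 : ∀ s x, ‖Hughes.primFrom T (fun τ => h τ x) s‖ₑ ^ 2 ≤
        timeMeasure T univ * ∫⁻ τ, ‖h τ x‖ₑ ^ 2 ∂(timeMeasure T) := by
      intro s x
      refine le_trans (pow_le_pow_left₀ (zero_le) ?_ 2)
        (sq_lintegral_le (timeMeasure T) (hx x).enorm.aemeasurable)
      refine (enorm_integral_le_lintegral_enorm _).trans (lintegral_mono fun τ => ?_)
      split_ifs <;> simp
    refine lt_of_le_of_lt (lintegral_mono fun s => lintegral_mono (h1 s)) ?_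
    have hm : Measurable fun x => ∫⁻ τ, ‖h τ x‖ₑ ^ 2 ∂(timeMeasure T) :=
      Measurable.lintegral_prod_left' (hh.meas.enorm.pow_const 2)
    rw [lintegral_const, lintegral_const_mul _ hm,
      ← lintegral_lintegral_swap (hh.meas.enorm.pow_const 2).aemeasurable]
    exact ENNReal.mul_lt_top (ENNReal.mul_lt_top (measure_lt_top _ _) hh.fin) (measure_lt_top _ _)

/-! ### The energy identity -/

lemma L2On.ae_integrable_time {T : ℝ} {h : ℝ → Plane → ℝ} (hh : L2On T h) :
    ∀ᵐ x ∂(volume : Measure Plane), Integrable (fun s => h s x) (timeMeasure T) := by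
  have hm : Measurable fun x => ∫⁻ τ, ‖h τ x‖ₑ ^ 2 ∂(timeMeasure T) :=
    Measurable.lintegral_prod_left' (hh.meas.enorm.pow_const 2)
  have hfin := hh.fin
  rw [lintegral_lintegral_swap (hh.meas.enorm.pow_const 2).aemeasurable] at hfin
  filter_upwards [ae_lt_top hm hfin.ne] with x hx
  exact (memLp_two_of_lintegral_lt_top
    (hh.meas.comp measurable_prodMk_right).aestronglyMeasurable hx).integrable (by norm_num)

/-- If `u_t = ∫_0^t α` and `D_t = -∫_t^T β` then `∫∫ (α D + u β) = 0`. -/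
lemma integral_cross_eq_zero {T : ℝ} {α β u D : ℝ → Plane → ℝ} (hα : L2On T α) (hβ : L2On T β)
    (hu : L2On T u) (huα : ∀ᵐ s ∂(timeMeasure T), ∀ x, u s x = primTo T (fun τ => α τ x) s)
    (hDβ : ∀ᵐ s ∂(timeMeasure T), ∀ x, D s x = -primFrom T (fun τ => β τ x) s) :
    (∀ᵐ s ∂(timeMeasure T), MemLp (D s) 2 volume) ∧
    ∫ s, (∫ x, (α s x * D s x + u s x * β s x)) ∂(timeMeasure T) = 0 := by
  have hP := hβ.primFrom
  constructor
  · filter_upwards [hDβ, hP.ae_memLp] with s h1 h2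
    have : D s = -fun x => primFrom T (fun τ => β τ x) s := funext h1
    rw [this]; exact h2.neg
  have i1 := hα.integrable_mul hP
  have i2 := hu.integrable_mul hβ
  have e1 : ∫ s, (∫ x, (α s x * D s x + u s x * β s x)) ∂(timeMeasure T) =
      ∫ s, (∫ x, (u s x * β s x - α s x * primFrom T (fun τ => β τ x) s)) ∂(timeMeasure T) := by
    refine integral_congr_ae ?_
    filter_upwards [hDβ] with s hs
    congr 1; ext x
    rw [hs]; ring
  rw [e1]
  have hi : Integrable (Function.uncurry fun s x =>
      u s x * β s x - α s x * primFrom T (fun τ => β τ x) s) ((timeMeasure T).prod volume) :=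
    i2.sub i1
  rw [integral_integral_swap hi]
  refine integral_eq_zero_of_ae ?_
  filter_upwards [hα.ae_integrable_time, hβ.ae_integrable_time,
    (Integrable.prod_left_ae (f := fun p : ℝ × Plane => u p.1 p.2 * β p.1 p.2) i2),
    (Integrable.prod_left_ae (f := fun p : ℝ × Plane =>
      α p.1 p.2 * primFrom T (fun τ => β τ p.2) p.1) i1)] with x h1 h2 h3 h4
  rw [integral_sub h3 h4, integral_mul_primFrom h1 h2 (hα.meas.comp measurable_prodMk_right)
    (hβ.meas.comp measurable_prodMk_right), Pi.zero_apply, sub_eq_zero]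
  refine integral_congr_ae ?_
  filter_upwards [huα] with s hs
  rw [hs]

/-- Two weak solutions: the differences of the densities, the potentials, the gradients, the fluxes
and the rates. -/
structure IsDifference (σ T : ℝ) (u D : ℝ → Plane → ℝ) (g F : Fin 2 → ℝ → Plane → ℝ)
    (R : ℝ → Plane → ℝ) : Prop where
  hu : L2On T u
  hg : ∀ j, L2On T (g j)
  hF : ∀ j, L2On T (F j)
  hR : L2On T R
  locInt : ∀ᵐ s ∂(timeMeasure T), LocallyIntegrable (D s)
  grad : ∀ᵐ s ∂(timeMeasure T), ∀ η, IsTest η → ∀ j,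
    ∫ x, D s x * pderiv j η x = -∫ x, g j s x * η x
  density : ∀ᵐ t ∂(timeMeasure T), ∀ η, IsTest η → ∫ x, u t x * η x =
    primTo T (fun s => -((∫ x, F 0 s x * pderiv 0 η x) + ∫ x, F 1 s x * pderiv 1 η x)
      + σ * ((∫ x, u s x * pderiv 0 (pderiv 0 η) x) + ∫ x, u s x * pderiv 1 (pderiv 1 η) x)) t
  potential : ∀ᵐ t ∂(timeMeasure T), ∀ η, IsTest η → ∫ x, D t x * η x =
    -primFrom T (fun s => (∫ x, R s x * η x)
      + σ * ((∫ x, g 0 s x * pderiv 0 η x) + ∫ x, g 1 s x * pderiv 1 η x)) t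

lemma MemLp.locallyIntegrable_two {h : Plane → ℝ} (hh : MemLp h 2) : LocallyIntegrable h :=
  hh.locallyIntegrable (by norm_num)

/-- Testing with y ↦ k(x-y) shows that the mollified differences satisfy ∂ₜu = α and ∂ₜD = β, in
integrated form, with square integrable right sides. Since u vanishes at 0 and D at T, the integral
of αD + uβ is zero. Integration by parts in space turns this into the claim, and the viscous terms
cancel because they enter the two equations with opposite signs. -/
lemma IsDifference.energy {σ T : ℝ} {u D : ℝ → Plane → ℝ} {g F : Fin 2 → ℝ → Plane → ℝ}
    {R : ℝ → Plane → ℝ} (h : IsDifference σ T u D g F R) {k : Plane → ℝ} (hk : IsTest k) :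
    ∫ s, (∫ x, (mollify (F 0 s) k x * mollify (g 0 s) k x + mollify (F 1 s) k x * mollify (g 1 s) k x
      - mollify (u s) k x * mollify (R s) k x)) ∂(timeMeasure T) = 0 := by
  have hkj := fun j => hk.pderiv j
  have hkjj := fun j => (hk.pderiv j).pderiv j
  have test_pair : ∀ (f : Plane → ℝ) j x, ∫ y, f y * pderiv j (fun y => k (x - y)) y =
      -mollify f (pderiv j k) x := by
    intro f j x
    simp only [pderiv_reflect hk, mul_neg, integral_neg, mollify]
  have test_pair2 : ∀ (f : Plane → ℝ) j x,
      ∫ y, f y * pderiv j (pderiv j (fun y => k (x - y))) y = mollify f (pderiv j (pderiv j k)) x := by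
    intro f j x
    simp only [pderiv_pderiv_reflect hk, mollify]
  set α : ℝ → Plane → ℝ := fun s x =>
    (mollify (F 0 s) (pderiv 0 k) x + mollify (F 1 s) (pderiv 1 k) x)
      + σ * (mollify (u s) (pderiv 0 (pderiv 0 k)) x + mollify (u s) (pderiv 1 (pderiv 1 k)) x) with hα
  set β : ℝ → Plane → ℝ := fun s x => mollify (R s) k x
      - σ * (mollify (g 0 s) (pderiv 0 k) x + mollify (g 1 s) (pderiv 1 k) x) with hβ
  have Lα : L2On T α := (((h.hF 0).mollify (hkj 0)).add ((h.hF 1).mollify (hkj 1))).add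
    (((h.hu.mollify (hkjj 0)).add (h.hu.mollify (hkjj 1))).const_mul σ)
  have Lβ : L2On T β := (h.hR.mollify hk).sub
    ((((h.hg 0).mollify (hkj 0)).add ((h.hg 1).mollify (hkj 1))).const_mul σ)
  -- Nothing is assumed about the integrability of D at infinity. Its mollification is square
  -- integrable because it is a primitive of β vanishing at T.
  obtain ⟨hD2, hcross⟩ := integral_cross_eq_zero (D := fun s x => mollify (D s) k x) Lα Lβ
    (h.hu.mollify hk)
    (by
      filter_upwards [h.density] with t ht x
      have := ht _ (hk.reflect x)
      simp only [test_pair, test_pair2] at this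
      rw [mollify, this]
      congr 1; ext s
      rw [hα]; ring)
    (by
      filter_upwards [h.potential] with t ht x
      have := ht _ (hk.reflect x)
      simp only [test_pair] at this
      rw [mollify, this]
      congr 2; ext s
      rw [hβ]; simp only [mollify]; ring)
  rw [← neg_eq_zero, ← integral_neg, ← hcross]
  refine integral_congr_ae ?_
  filter_upwards [hD2, h.locInt, h.grad, h.hu.ae_memLp, h.hR.ae_memLp,
    ae_all_iff.2 fun j => (h.hF j).ae_memLp, ae_all_iff.2 fun j => (h.hg j).ae_memLp,
    (h.hu.mollify hk).ae_memLp, (h.hR.mollify hk).ae_memLp,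
    ae_all_iff.2 fun j => (h.hu.mollify (hkj j)).ae_memLp,
    ae_all_iff.2 fun j => (h.hu.mollify (hkjj j)).ae_memLp,
    ae_all_iff.2 fun j => ((h.hF j).mollify hk).ae_memLp,
    ae_all_iff.2 fun j => ((h.hF j).mollify (hkj j)).ae_memLp,
    ae_all_iff.2 fun j => ((h.hg j).mollify hk).ae_memLp,
    ae_all_iff.2 fun j => ((h.hg j).mollify (hkj j)).ae_memLp] with
    s hDs hDl hDg hu hR hF hg mu mR muj mujj mF mFj mg mgj
  have hdD := hasFDerivAt_mollify hDl hk
  have hDgj : ∀ j x, mollify (D s) (pderiv j k) x = mollify (g j s) k x := by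
    intro j x
    have := hDg _ (hk.reflect x) j
    rw [test_pair, neg_inj] at this
    exact this
  have hDd : ∀ j x, fderiv ℝ (mollify (D s) k) x (EuclideanSpace.single j 1) = mollify (g j s) k x :=
    fun j x => by rw [(hdD x).2, hDgj]
  have hDdiff : Differentiable ℝ (mollify (D s) k) := fun x => (hdD x).1
  -- The flux term needs one integration by parts. The viscous term needs two: one moves a
  -- derivative to D and produces its gradient, the other moves the remaining derivative from u to
  -- that gradient.
  have a1 := fun j => integral_mollify_mul (MemLp.locallyIntegrable_two (hF j)) hk (mF j) (mFj j) hDs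
    (mg j) hDdiff (hDd j)
  have a2 := fun j => integral_mollify_mul (MemLp.locallyIntegrable_two hu) (hkj j) (muj j) (mujj j)
    hDs (mg j) hDdiff (hDd j)
  have hgd := fun j => hasFDerivAt_mollify (MemLp.locallyIntegrable_two (hg j)) hk
  have a3 := fun j => integral_mollify_mul (MemLp.locallyIntegrable_two hu) hk mu (muj j) (mg j) (mgj j)
    (fun x => (hgd j x).1) (fun x => (hgd j x).2 j)
  have iFg : ∀ j, Integrable fun x => mollify (F j s) k x * mollify (g j s) k x :=
    fun j => (mF j).integrable_mul (mg j)
  have iFD : ∀ j, Integrable fun x => mollify (F j s) (pderiv j k) x * mollify (D s) k x :=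
    fun j => (mFj j).integrable_mul hDs
  have iuD : ∀ j, Integrable fun x =>
      mollify (u s) (pderiv j (pderiv j k)) x * mollify (D s) k x :=
    fun j => (mujj j).integrable_mul hDs
  have iuR : Integrable fun x => mollify (u s) k x * mollify (R s) k x := mu.integrable_mul mR
  have iug : ∀ j, Integrable fun x => mollify (u s) k x * mollify (g j s) (pderiv j k) x :=
    fun j => mu.integrable_mul (mgj j)
  have e1 : ∫ x, (mollify (F 0 s) k x * mollify (g 0 s) k x
      + mollify (F 1 s) k x * mollify (g 1 s) k x - mollify (u s) k x * mollify (R s) k x) =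
      (∫ x, mollify (F 0 s) k x * mollify (g 0 s) k x)
      + (∫ x, mollify (F 1 s) k x * mollify (g 1 s) k x)
      - ∫ x, mollify (u s) k x * mollify (R s) k x := by
    rw [← integral_add (iFg 0) (iFg 1)]
    exact integral_sub ((iFg 0).add (iFg 1)) iuR
  have e2 : ∫ x, (α s x * mollify (D s) k x + mollify (u s) k x * β s x) =
      (((∫ x, mollify (F 0 s) (pderiv 0 k) x * mollify (D s) k x)
        + ∫ x, mollify (F 1 s) (pderiv 1 k) x * mollify (D s) k x)
      + σ * ((∫ x, mollify (u s) (pderiv 0 (pderiv 0 k)) x * mollify (D s) k x)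
        + ∫ x, mollify (u s) (pderiv 1 (pderiv 1 k)) x * mollify (D s) k x))
      + ((∫ x, mollify (u s) k x * mollify (R s) k x)
        + (-σ) * ((∫ x, mollify (u s) k x * mollify (g 0 s) (pderiv 0 k) x)
          + ∫ x, mollify (u s) k x * mollify (g 1 s) (pderiv 1 k) x)) := by
    rw [← integral_add_mul_add (-σ) iuR (iug 0) (iug 1)]
    have i1 : Integrable fun x => 1 * (mollify (F 0 s) (pderiv 0 k) x * mollify (D s) k x
        + mollify (F 1 s) (pderiv 1 k) x * mollify (D s) k x)
        + σ * (mollify (u s) (pderiv 0 (pderiv 0 k)) x * mollify (D s) k x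
          + mollify (u s) (pderiv 1 (pderiv 1 k)) x * mollify (D s) k x) :=
      (((iFD 0).add (iFD 1)).const_mul 1).add (((iuD 0).add (iuD 1)).const_mul σ)
    have i2 : Integrable fun x => mollify (u s) k x * mollify (R s) k x
        + (-σ) * (mollify (u s) k x * mollify (g 0 s) (pderiv 0 k) x
          + mollify (u s) k x * mollify (g 1 s) (pderiv 1 k) x) :=
      iuR.add (((iug 0).add (iug 1)).const_mul (-σ))
    have := integral_mul_add_add_mul_add 1 σ (iFD 0) (iFD 1) (iuD 0) (iuD 1)
    rw [one_mul] at this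
    refine Eq.trans ?_ ((integral_add i1 i2).trans (congrArg₂ _ this rfl))
    congr 1; ext x
    rw [hα, hβ]; ring
  rw [e1, e2, a1 0, a1 1, a2 0, a2 1]
  have b0 := a3 0
  have b1 := a3 1
  linear_combination σ * b0 + σ * b1

/-! ### Removing the mollification -/

/-- Normed bumps at scale 1/(n+1) with outer radius twice the inner one. The bounded ratio is what
Lebesgue differentiation needs for convergence almost everywhere. -/
lemma exists_mollifier : ∃ k : ℕ → Plane → ℝ, (∀ n, IsTest (k n)) ∧ (∀ n, ∫⁻ x, ‖k n x‖ₑ = 1) ∧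
    ∀ h : Plane → ℝ, LocallyIntegrable h →
      ∀ᵐ x, Tendsto (fun n => mollify h (k n) x) atTop (𝓝 (h x)) := by
  let φ : ℕ → ContDiffBump (0 : Plane) := fun n =>
    ⟨1 / ((n : ℝ) + 1), 2 * (1 / ((n : ℝ) + 1)), by positivity, by
      have : 0 < 1 / ((n : ℝ) + 1) := by positivity
      linarith⟩
  refine ⟨fun n => (φ n).normed volume, fun n => ⟨(φ n).contDiff_normed,
    (φ n).hasCompactSupport_normed⟩, fun n => ?_, fun h hh => ?_⟩
  · have h1 := ofReal_integral_eq_lintegral_ofReal ((φ n).integrable_normed (μ := volume))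
      (Eventually.of_forall fun x => (φ n).nonneg_normed x)
    rw [(φ n).integral_normed, ENNReal.ofReal_one] at h1
    rw [h1]
    congr 1; ext x
    rw [Real.enorm_eq_ofReal ((φ n).nonneg_normed x)]
  · have hlim : Tendsto (fun n => (φ n).rOut) atTop (𝓝 0) := by
      have := (tendsto_one_div_add_atTop_nhds_zero_nat (𝕜 := ℝ)).const_mul 2
      simpa only [mul_zero] using this
    filter_upwards [ContDiffBump.ae_convolution_tendsto_right_of_locallyIntegrable (K := 2) hlim
      (Eventually.of_forall fun n => le_rfl) hh] with x hx
    refine hx.congr fun n => ?_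
    rw [convolution_lsmul_swap, mollify]
    congr 1; ext y
    rw [smul_eq_mul, mul_comm]

lemma L2On.integral_sq {T : ℝ} {h : ℝ → Plane → ℝ} (hh : L2On T h) :
    ∫ p : ℝ × Plane, h p.1 p.2 ^ 2 ∂(slab T) =
      (∫⁻ s, ∫⁻ x, ‖h s x‖ₑ ^ 2 ∂volume ∂(timeMeasure T)).toReal := by
  rw [← L2On.lintegral_slab hh.meas, integral_eq_lintegral_of_nonneg_ae
    (f := fun p : ℝ × Plane => h p.1 p.2 ^ 2)
    (Eventually.of_forall fun p => sq_nonneg _) (hh.meas.pow_const 2).aestronglyMeasurable]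
  congr 2; ext p
  rw [← enorm_pow, Real.enorm_eq_ofReal (sq_nonneg _)]
  rfl

/-- Fatou bounds the lower limit from below; Young's inequality with kernels of mass 1 bounds the
upper limit from above. -/
lemma L2On.tendsto_integral_sq_mollify {T : ℝ} {h : ℝ → Plane → ℝ} (hh : L2On T h)
    {k : ℕ → Plane → ℝ} (hk : ∀ n, IsTest (k n)) (hk1 : ∀ n, ∫⁻ x, ‖k n x‖ₑ = 1)
    (hlim : ∀ h : Plane → ℝ, LocallyIntegrable h →
      ∀ᵐ x, Tendsto (fun n => Hughes.mollify h (k n) x) atTop (𝓝 (h x))) :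
    Tendsto (fun n => ∫ p : ℝ × Plane, Hughes.mollify (h p.1) (k n) p.2 ^ 2 ∂(slab T)) atTop
      (𝓝 (∫ p : ℝ × Plane, h p.1 p.2 ^ 2 ∂(slab T))) := by
  have hm := fun n => hh.mollify (hk n)
  rw [hh.integral_sq]
  simp only [fun n => (hm n).integral_sq]
  refine (ENNReal.tendsto_toReal hh.fin.ne).comp ?_
  refine tendsto_of_le_liminf_of_limsup_le ?_ ?_
  · rw [← lintegral_slab hh.meas]
    change _ ≤ liminf (fun n =>
      ∫⁻ s, ∫⁻ x, ‖Hughes.mollify (h s) (k n) x‖ₑ ^ 2 ∂volume ∂(timeMeasure T)) atTop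
    rw [show (fun n => ∫⁻ s, ∫⁻ x, ‖Hughes.mollify (h s) (k n) x‖ₑ ^ 2 ∂volume ∂(timeMeasure T)) =
      _ from funext fun n => (lintegral_slab (hm n).meas).symm]
    refine le_trans (lintegral_mono_ae ?_) (lintegral_liminf_le fun n =>
      (hm n).meas.enorm.pow_const 2)
    have hset : MeasurableSet {p : ℝ × Plane | Tendsto (fun n => Hughes.mollify (h p.1) (k n) p.2)
        atTop (𝓝 (h p.1 p.2))} :=
      measurableSet_tendsto_fun (f := fun n (p : ℝ × Plane) => Hughes.mollify (h p.1) (k n) p.2)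
        (fun n => (hm n).meas) hh.meas
    have hae : ∀ᵐ p ∂(slab T), Tendsto (fun n => Hughes.mollify (h p.1) (k n) p.2)
        atTop (𝓝 (h p.1 p.2)) := by
      refine (Measure.ae_prod_iff_ae_ae hset).2 ?_
      filter_upwards [hh.ae_memLp] with s hs
      exact hlim _ (MemLp.locallyIntegrable_two hs)
    filter_upwards [hae] with p hp
    have : Tendsto (fun n => ‖Hughes.mollify (h p.1) (k n) p.2‖ₑ ^ 2) atTop
        (𝓝 (‖h p.1 p.2‖ₑ ^ 2)) := (ENNReal.continuous_pow 2).continuousAt.tendsto.comp hp.enorm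
    exact this.liminf_eq.ge
  · refine limsup_le_of_le (by isBoundedDefault) (Eventually.of_forall fun n => lintegral_mono fun s => ?_)
    have := lintegral_sq_mollify_le (hh.measurable_slice s) (hk n).1.continuous
    rwa [hk1, one_pow, one_mul] at this

/-- By polarisation, products reduce to squares of the sum and of the difference, since
mollification is linear. -/
lemma L2On.tendsto_integral_mollify_mul {T : ℝ} {h h' : ℝ → Plane → ℝ} (hh : L2On T h)
    (hh' : L2On T h')
    {k : ℕ → Plane → ℝ} (hk : ∀ n, IsTest (k n)) (hk1 : ∀ n, ∫⁻ x, ‖k n x‖ₑ = 1)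
    (hlim : ∀ h : Plane → ℝ, LocallyIntegrable h →
      ∀ᵐ x, Tendsto (fun n => Hughes.mollify h (k n) x) atTop (𝓝 (h x))) :
    Tendsto (fun n => ∫ p : ℝ × Plane,
      Hughes.mollify (h p.1) (k n) p.2 * Hughes.mollify (h' p.1) (k n) p.2 ∂(slab T)) atTop
      (𝓝 (∫ p : ℝ × Plane, h p.1 p.2 * h' p.1 p.2 ∂(slab T))) := by
  have polar : ∀ {a b : ℝ → Plane → ℝ}, L2On T a → L2On T b →
      ∫ p : ℝ × Plane, a p.1 p.2 * b p.1 p.2 ∂(slab T) =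
        1 / 4 * ((∫ p : ℝ × Plane, (a p.1 p.2 + b p.1 p.2) ^ 2 ∂(slab T))
          - ∫ p : ℝ × Plane, (a p.1 p.2 - b p.1 p.2) ^ 2 ∂(slab T)) := by
    intro a b ha hb
    have i1 : Integrable (fun p : ℝ × Plane => (a p.1 p.2 + b p.1 p.2) ^ 2) (slab T) := by
      simpa only [sq] using (ha.add hb).integrable_mul (ha.add hb)
    have i2 : Integrable (fun p : ℝ × Plane => (a p.1 p.2 - b p.1 p.2) ^ 2) (slab T) := by
      simpa only [sq] using (ha.sub hb).integrable_mul (ha.sub hb)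
    rw [← integral_sub i1 i2, ← integral_const_mul]
    congr 1; ext p; ring
  have hm := fun n => hh.mollify (hk n)
  have hm' := fun n => hh'.mollify (hk n)
  rw [polar hh hh']
  simp only [fun n => polar (hm n) (hm' n)]
  have hloc : ∀ᵐ s ∂(timeMeasure T), LocallyIntegrable (h s) ∧ LocallyIntegrable (h' s) := by
    filter_upwards [hh.ae_memLp, hh'.ae_memLp] with s h1 h2
    exact ⟨MemLp.locallyIntegrable_two h1, MemLp.locallyIntegrable_two h2⟩
  have hloc' : ∀ᵐ p ∂(slab T), LocallyIntegrable (h p.1) ∧ LocallyIntegrable (h' p.1) :=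
    Measure.quasiMeasurePreserving_fst.ae hloc
  have t1 := (hh.add hh').tendsto_integral_sq_mollify hk hk1 hlim
  have t2 := (hh.sub hh').tendsto_integral_sq_mollify hk hk1 hlim
  refine ((t1.sub t2).const_mul (1 / 4)).congr fun n => ?_
  congr 2
  · refine integral_congr_ae ?_
    filter_upwards [hloc'] with p hp
    rw [mollify_add hp.1 hp.2 (hk n)]
  · refine integral_congr_ae ?_
    filter_upwards [hloc'] with p hp
    rw [mollify_sub hp.1 hp.2 (hk n)]

lemma IsDifference.integral_eq_zero {σ T : ℝ} {u D : ℝ → Plane → ℝ} {g F : Fin 2 → ℝ → Plane → ℝ}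
    {R : ℝ → Plane → ℝ} (h : IsDifference σ T u D g F R) :
    ∫ p : ℝ × Plane, (F 0 p.1 p.2 * g 0 p.1 p.2 + F 1 p.1 p.2 * g 1 p.1 p.2
      - u p.1 p.2 * R p.1 p.2) ∂(slab T) = 0 := by
  obtain ⟨k, hk, hk1, hlim⟩ := exists_mollifier
  have split : ∀ {a b c d e f : ℝ → Plane → ℝ}, L2On T a → L2On T b → L2On T c → L2On T d →
      L2On T e → L2On T f →
      ∫ p : ℝ × Plane, (a p.1 p.2 * b p.1 p.2 + c p.1 p.2 * d p.1 p.2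
        - e p.1 p.2 * f p.1 p.2) ∂(slab T) =
      (∫ p : ℝ × Plane, a p.1 p.2 * b p.1 p.2 ∂(slab T))
        + (∫ p : ℝ × Plane, c p.1 p.2 * d p.1 p.2 ∂(slab T))
        - ∫ p : ℝ × Plane, e p.1 p.2 * f p.1 p.2 ∂(slab T) := by
    intro a b c d e f ha hb hc hd he hf
    rw [← integral_add (ha.integrable_mul hb) (hc.integrable_mul hd)]
    exact integral_sub ((ha.integrable_mul hb).add (hc.integrable_mul hd)) (he.integrable_mul hf)
  rw [split (h.hF 0) (h.hg 0) (h.hF 1) (h.hg 1) h.hu h.hR]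
  have t := (((h.hF 0).tendsto_integral_mollify_mul (h.hg 0) hk hk1 hlim).add
    ((h.hF 1).tendsto_integral_mollify_mul (h.hg 1) hk hk1 hlim)).sub
    (h.hu.tendsto_integral_mollify_mul h.hR hk hk1 hlim)
  refine tendsto_nhds_unique t (tendsto_const_nhds.congr fun n => ?_)
  have F0 := (h.hF 0).mollify (hk n)
  have F1 := (h.hF 1).mollify (hk n)
  have g0 := (h.hg 0).mollify (hk n)
  have g1 := (h.hg 1).mollify (hk n)
  have u0 := h.hu.mollify (hk n)
  have R0 := h.hR.mollify (hk n)
  rw [← split F0 g0 F1 g1 u0 R0, ← h.energy (hk n)]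
  exact (integral_prod _ (((F0.integrable_mul g0).add (F1.integrable_mul g1)).sub
    (u0.integrable_mul R0))).symm

/-! ### Monotonicity -/

/-- The left side is the integrand of the energy identity in terms of the densities r, r' and of ∇Φ
= (a,b), ∇Φ' = (a',b'). Constants in the flux and in the rate drop out of the differences. -/
lemma monotone_identity (ρm r r' a a' b b' : ℝ) :
    (r * (ρm - r) ^ 2 * a - r' * (ρm - r') ^ 2 * a') * (a - a')
      + (r * (ρm - r) ^ 2 * b - r' * (ρm - r') ^ 2 * b') * (b - b')
      - (r - r') * (1 / 2 * (ρm - r) ^ 2 * (a ^ 2 + b ^ 2)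
        - 1 / 2 * (ρm - r') ^ 2 * (a' ^ 2 + b' ^ 2)) =
      1 / 2 * (r + r') * ((ρm - r) ^ 2 * (a ^ 2 + b ^ 2) + (ρm - r') ^ 2 * (a' ^ 2 + b' ^ 2))
        - (r * (ρm - r) ^ 2 + r' * (ρm - r') ^ 2) * (a * a' + b * b') := by
  ring

/-- If ∇Φ·∇Φ' < 0, both terms are nonnegative and the second is strictly positive. Otherwise `key`
rewrites the expression as ½(r+r')|f∇Φ - f'∇Φ'|² + (r-r')²(ρ_m-r-r')∇Φ·∇Φ', with f = ρ_m-r and f' =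
ρ_m-r', where r+r' < ρ_m. If it vanishes and ∇Φ ≠ 0, the first square makes the gradients parallel
with positive product, and then the second term gives r = r'. -/
lemma monotone_nonneg {ρm r r' : ℝ} (hr : 0 < r) (hr' : 0 < r') (h : r < ρm / 2) (h' : r' < ρm / 2)
    (a a' b b' : ℝ) :
    0 ≤ 1 / 2 * (r + r') * ((ρm - r) ^ 2 * (a ^ 2 + b ^ 2) + (ρm - r') ^ 2 * (a' ^ 2 + b' ^ 2))
        - (r * (ρm - r) ^ 2 + r' * (ρm - r') ^ 2) * (a * a' + b * b') ∧
    ((1 / 2 * (r + r') * ((ρm - r) ^ 2 * (a ^ 2 + b ^ 2) + (ρm - r') ^ 2 * (a' ^ 2 + b' ^ 2))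
        - (r * (ρm - r) ^ 2 + r' * (ρm - r') ^ 2) * (a * a' + b * b') = 0) → (a ≠ 0 ∨ b ≠ 0) →
      r = r' ∧ a = a' ∧ b = b') := by
  have hR : 0 < r + r' := by linarith
  have hW : 0 < ρm - r - r' := by linarith
  have hf : 0 < ρm - r := by linarith
  have hf' : 0 < ρm - r' := by linarith
  have key : 1 / 2 * (r + r') * ((ρm - r) ^ 2 * (a ^ 2 + b ^ 2) + (ρm - r') ^ 2 * (a' ^ 2 + b' ^ 2))
        - (r * (ρm - r) ^ 2 + r' * (ρm - r') ^ 2) * (a * a' + b * b') =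
      1 / 2 * (r + r') * (((ρm - r) * a - (ρm - r') * a') ^ 2 + ((ρm - r) * b - (ρm - r') * b') ^ 2)
        + (r - r') ^ 2 * (ρm - r - r') * (a * a' + b * b') := by ring
  rcases lt_or_ge (a * a' + b * b') 0 with hc | hc
  · have h1 : 0 ≤ 1 / 2 * (r + r') *
        ((ρm - r) ^ 2 * (a ^ 2 + b ^ 2) + (ρm - r') ^ 2 * (a' ^ 2 + b' ^ 2)) := by positivity
    have h2 : (r * (ρm - r) ^ 2 + r' * (ρm - r') ^ 2) * (a * a' + b * b') < 0 :=
      mul_neg_of_pos_of_neg (by positivity) hc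
    exact ⟨by linarith, fun h => by linarith⟩
  · rw [key]
    have h1 : 0 ≤ 1 / 2 * (r + r') * (((ρm - r) * a - (ρm - r') * a') ^ 2
        + ((ρm - r) * b - (ρm - r') * b') ^ 2) := by positivity
    have h2 : 0 ≤ (r - r') ^ 2 * (ρm - r - r') * (a * a' + b * b') := by positivity
    refine ⟨by linarith, fun h hne => ?_⟩
    have e1 : ((ρm - r) * a - (ρm - r') * a') ^ 2 + ((ρm - r) * b - (ρm - r') * b') ^ 2 = 0 := by
      have : 1 / 2 * (r + r') * (((ρm - r) * a - (ρm - r') * a') ^ 2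
        + ((ρm - r) * b - (ρm - r') * b') ^ 2) = 0 := by linarith
      exact (mul_eq_zero.1 this).resolve_left (by positivity)
    have ea : (ρm - r) * a = (ρm - r') * a' := by nlinarith only [e1]
    have eb : (ρm - r) * b = (ρm - r') * b' := by nlinarith only [e1]
    have hpos : 0 < a * a' + b * b' := by
      have h3 : (ρm - r') * (a * a' + b * b') = (ρm - r) * (a ^ 2 + b ^ 2) := by
        linear_combination -a * ea - b * eb
      have h4 : 0 < a ^ 2 + b ^ 2 := by
        rcases hne with h | h <;> positivity
      have : 0 < (ρm - r') * (a * a' + b * b') := by rw [h3]; positivity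
      exact pos_of_mul_pos_right this hf'.le
    have e2 : (r - r') ^ 2 * (ρm - r - r') * (a * a' + b * b') = 0 := by linarith
    have er : r = r' := by
      have := (mul_eq_zero.1 ((mul_eq_zero.1 e2).resolve_right hpos.ne')).resolve_right hW.ne'
      exact sub_eq_zero.1 (pow_eq_zero_iff two_ne_zero |>.1 this)
    subst er
    exact ⟨rfl, mul_left_cancel₀ hf.ne' ea, mul_left_cancel₀ hf.ne' eb⟩

lemma HasWeakGradient.ae_eq {u u' : Plane → ℝ} {g g' : Plane → Plane} (h : HasWeakGradient u g)
    (h' : HasWeakGradient u' g') (hu : u =ᵐ[volume] u') : g =ᵐ[volume] g' := by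
  refine ae_eq_of_integral_contDiff_smul_eq h.2.1 h'.2.1 fun η h1 h2 => ?_
  have e1 := h.2.2 η ⟨h1, h2⟩
  have e2 := h'.2.2 η ⟨h1, h2⟩
  have e3 : ∫ x, u x • gradient η x = ∫ x, u' x • gradient η x := by
    refine integral_congr_ae ?_
    filter_upwards [hu] with x hx
    rw [hx]
  rw [e1, e2] at e3
  exact neg_injective e3

/-! ### Measurable representatives of solutions -/

/-- A jointly measurable representative, set to 0 where it exceeds C. On almost every time slice
this changes only a null set, and the bounds then hold at every point. -/
lemma exists_bounded_rep {E : Type*} [NormedAddCommGroup E] [MeasurableSpace E] [BorelSpace E]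
    [SecondCountableTopology E] {T : ℝ} {h : ℝ → Plane → E}
    (hm : AEStronglyMeasurable (Function.uncurry h) (slab T)) {C : ℝ≥0}
    (hC : ∀ t ∈ Icc 0 T, eLpNorm (h t) 2 ≤ C ∧ eLpNorm (h t) (⊤ : ℝ≥0∞) ≤ C) :
    ∃ r : ℝ → Plane → E, Measurable (Function.uncurry r) ∧ (∀ s x, ‖r s x‖ ≤ C) ∧
      (∀ᵐ s ∂(timeMeasure T), h s =ᵐ[volume] r s) ∧ L2On T fun s x => ‖r s x‖ := by
  have hmk : Measurable (hm.mk _) := hm.stronglyMeasurable_mk.measurable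
  let r : ℝ → Plane → E := fun s x => if ‖hm.mk _ (s, x)‖ ≤ C then hm.mk _ (s, x) else 0
  have hr : Measurable (Function.uncurry r) :=
    Measurable.ite (measurableSet_le hmk.norm measurable_const) hmk measurable_const
  have hae : ∀ᵐ s ∂(timeMeasure T), h s =ᵐ[volume] r s := by
    have h1 : ∀ᵐ s ∂(timeMeasure T), ∀ᵐ x, Function.uncurry h (s, x) = hm.mk _ (s, x) :=
      Measure.ae_ae_of_ae_prod hm.ae_eq_mk
    filter_upwards [h1, ae_restrict_mem measurableSet_Icc] with s hs hsT
    have h2 : ∀ᵐ x, ‖h s x‖ₑ ≤ C := by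
      filter_upwards [ae_le_eLpNormEssSup (f := h s)] with x hx
      exact hx.trans (by simpa using (hC s hsT).2)
    filter_upwards [hs, h2] with x hx hx2
    have hx3 : ‖hm.mk _ (s, x)‖ ≤ C := by
      rw [← hx]
      rw [enorm_le_coe] at hx2
      exact_mod_cast hx2
    simp only [r, if_pos hx3]
    exact hx
  refine ⟨r, hr, fun s x => ?_, hae, hr.norm, ?_⟩
  · simp only [r]; split_ifs with h
    · exact h
    · simp
  · refine lt_of_le_of_lt (b := ∫⁻ _, (C : ℝ≥0∞) ^ 2 ∂(timeMeasure T)) (lintegral_mono_ae ?_) ?_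
    · filter_upwards [hae, ae_restrict_mem measurableSet_Icc] with s hs hsT
      have h1 := eLpNorm_nnreal_pow_eq_lintegral (f := h s) (μ := volume) (p := 2) two_ne_zero
      have h2 : ∫⁻ x, ‖‖r s x‖‖ₑ ^ 2 = eLpNorm (h s) 2 volume ^ 2 := by
        have : (eLpNorm (h s) 2 volume) ^ 2 = ∫⁻ x, ‖h s x‖ₑ ^ 2 := by simpa using h1
        rw [this]
        refine lintegral_congr_ae ?_
        filter_upwards [hs] with x hx
        rw [hx, enorm_norm]
      rw [h2]
      exact pow_le_pow_left₀ (zero_le) (hC s hsT).1 2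
    · rw [lintegral_const]
      exact ENNReal.mul_lt_top (by simp) (measure_lt_top _ _)

/-- Flux and rate are polynomials without constant term, so on bounded sets they grow at most
linearly. Hence they inherit square integrability from ψ and ∇φ. -/
lemma exists_flux_bound (ρm ρbar C : ℝ) : ∃ K : ℝ, ∀ (ψ : ℝ) (p : Plane), |ψ| ≤ C → ‖p‖ ≤ C →
    ‖flux ρm ρbar ψ p‖ ≤ K * (|ψ| + ‖p‖) ∧ |potentialRate ρm ρbar ψ p| ≤ K * (|ψ| + ‖p‖) := by
  set f := speed ρm ρbar with hf
  -- A factor ψ is taken out of all but the pure ∇φ terms; the cofactors are continuous, hence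
  -- bounded on the ball.
  let u₁ : ℝ × Plane → Plane := fun q =>
    ((f - 2 * ρbar) + 1 / f * q.1 ^ 2 + (ρbar / f - 2) * q.1) • e₁
      + (f ^ 2 - 2 * f * (ρbar + q.1) + (ρbar + q.1) * q.1) • q.2
  let u₂ : ℝ × Plane → ℝ := fun q => -(1 / f) + 1 / 2 * (q.1 - 2 * f) * ‖q.2‖ ^ 2
      + 1 / (2 * f ^ 2) * q.1 + q.2 0 * (1 / f * q.1 - 2)
  have hu₁ : Continuous u₁ := by fun_prop
  have hu₂ : Continuous u₂ := by fun_prop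
  have hcomp := isCompact_closedBall (0 : ℝ × Plane) C
  obtain ⟨K₁, h₁⟩ := hcomp.exists_bound_of_continuousOn hu₁.continuousOn
  obtain ⟨K₂, h₂⟩ := hcomp.exists_bound_of_continuousOn hu₂.continuousOn
  refine ⟨|K₁| + |K₂| + |ρbar * f ^ 2| + |f| + 1 / 2 * f ^ 2 * |C|, fun ψ p hψ hp => ?_⟩
  have hmem : (ψ, p) ∈ Metric.closedBall (0 : ℝ × Plane) C := by
    rw [mem_closedBall_zero_iff, Prod.norm_def]
    exact max_le hψ hp
  have b₁ := (h₁ _ hmem).trans (le_abs_self K₁)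
  have b₂ := (h₂ _ hmem).trans (le_abs_self K₂)
  have e₁' : flux ρm ρbar ψ p = ψ • u₁ (ψ, p) + (ρbar * f ^ 2) • p := by
    ext i
    simp only [flux, u₁, ← hf, PiLp.add_apply, PiLp.smul_apply, smul_eq_mul]
    ring
  have e₂' : potentialRate ρm ρbar ψ p = ψ * u₂ (ψ, p) + (f * p 0 + 1 / 2 * f ^ 2 * ‖p‖ * ‖p‖) := by
    simp only [potentialRate, u₂, ← hf]
    ring
  have hp0 : |p 0| ≤ ‖p‖ := PiLp.norm_apply_le p 0
  have n1 := abs_nonneg ψ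
  have n2 := norm_nonneg p
  have n3 := abs_nonneg K₁
  have n4 := abs_nonneg K₂
  have n5 := abs_nonneg (ρbar * f ^ 2)
  have n6 := abs_nonneg f
  have n7 : 0 ≤ 1 / 2 * f ^ 2 * |C| := by positivity
  constructor
  · rw [e₁']
    have s1 : ‖ψ • u₁ (ψ, p)‖ ≤ |K₁| * |ψ| := by
      rw [norm_smul, mul_comm]; exact mul_le_mul_of_nonneg_right b₁ n1
    have s2 : ‖(ρbar * f ^ 2) • p‖ = |ρbar * f ^ 2| * ‖p‖ := by rw [norm_smul]; rfl
    refine (norm_add_le _ _).trans ((add_le_add s1 s2.le).trans ?_)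
    have : 0 ≤ (|K₂| + |ρbar * f ^ 2| + |f| + 1 / 2 * f ^ 2 * |C|) * |ψ|
      + (|K₁| + |K₂| + |f| + 1 / 2 * f ^ 2 * |C|) * ‖p‖ := by positivity
    linarith
  · rw [e₂']
    have s1 : |ψ * u₂ (ψ, p)| ≤ |K₂| * |ψ| := by
      rw [abs_mul, mul_comm]; exact mul_le_mul_of_nonneg_right b₂ n1
    have s2 : |f * p 0| ≤ |f| * ‖p‖ := by
      rw [abs_mul]; exact mul_le_mul_of_nonneg_left hp0 n6
    have s3 : |1 / 2 * f ^ 2 * ‖p‖ * ‖p‖| ≤ 1 / 2 * f ^ 2 * |C| * ‖p‖ := by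
      rw [abs_of_nonneg (by positivity)]
      exact mul_le_mul_of_nonneg_right (mul_le_mul_of_nonneg_left (hp.trans (le_abs_self C))
        (by positivity)) n2
    refine (abs_add_le _ _).trans ((add_le_add s1 ((abs_add_le _ _).trans (add_le_add s2 s3))).trans ?_)
    have : 0 ≤ (|K₁| + |ρbar * f ^ 2| + |f| + 1 / 2 * f ^ 2 * |C|) * |ψ|
      + (|K₁| + |K₂| + |ρbar * f ^ 2|) * ‖p‖ := by positivity
    linarith

lemma L2On.of_le {T : ℝ} {h h' : ℝ → Plane → ℝ} (hh : L2On T h)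
    (hm : Measurable (Function.uncurry h')) (hle : ∀ s x, |h' s x| ≤ h s x) : L2On T h' :=
  of_memLp hm (hh.memLp.of_le_mul (c := 1) hm.aestronglyMeasurable (Eventually.of_forall fun p => by
    rw [one_mul]; exact (hle p.1 p.2).trans (le_abs_self _)))

lemma L2On.integrable_pairing {T : ℝ} {h : ℝ → Plane → ℝ} (hh : L2On T h) {η : Plane → ℝ}
    (hη : IsTest η) : Integrable (fun s => ∫ x, h s x * η x) (timeMeasure T) := by
  have hL : L2On T fun _ x => η x := by
    refine ⟨hη.1.continuous.measurable.comp measurable_snd, ?_⟩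
    rw [lintegral_const]
    refine ENNReal.mul_lt_top ?_ (measure_lt_top _ _)
    exact lintegral_lt_top_of_memLp_two (hη.1.continuous.memLp_of_hasCompactSupport hη.2)
  exact (hh.integrable_mul hL).integral_prod_left

/-- Everywhere defined, measurable and square integrable representatives `r`, `q` of the density and
of the gradient of a solution, with the equations in terms of these. -/
structure IsRepresented (ρm ρbar σ T : ℝ) (ψ₀ φT : Plane → ℝ) (ψ φ : ℝ → Plane → ℝ)
    (G : ℝ → Plane → Plane) (r : ℝ → Plane → ℝ) (q : ℝ → Plane → Plane) : Prop where
  density_ae : ∀ᵐ s ∂(timeMeasure T), ψ s =ᵐ[volume] r s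
  gradient_ae : ∀ᵐ s ∂(timeMeasure T), G s =ᵐ[volume] q s
  hr : L2On T r
  hq : ∀ j, L2On T fun s x => q s x j
  hF : ∀ j, L2On T fun s x => flux ρm ρbar (r s x) (q s x) j
  hR : L2On T fun s x => potentialRate ρm ρbar (r s x) (q s x)
  density : ∀ t ∈ Icc 0 T, ∀ η, IsTest η → ∫ x, ψ t x * η x = (∫ x, ψ₀ x * η x)
    + primTo T (fun s => -((∫ x, flux ρm ρbar (r s x) (q s x) 0 * pderiv 0 η x)
        + ∫ x, flux ρm ρbar (r s x) (q s x) 1 * pderiv 1 η x)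
      + σ * ((∫ x, r s x * pderiv 0 (pderiv 0 η) x) + ∫ x, r s x * pderiv 1 (pderiv 1 η) x)) t
  potential : ∀ t ∈ Icc 0 T, ∀ η, IsTest η → ∫ x, φ t x * η x = (∫ x, φT x * η x)
    - primFrom T (fun s => (∫ x, potentialRate ρm ρbar (r s x) (q s x) * η x)
      + σ * ((∫ x, q s x 0 * pderiv 0 η x) + ∫ x, q s x 1 * pderiv 1 η x)) t

lemma primTo_congr {T : ℝ} {b b' : ℝ → ℝ} (h : b =ᵐ[timeMeasure T] b') (t : ℝ) :
    primTo T b t = primTo T b' t := by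
  refine integral_congr_ae ?_
  filter_upwards [h] with s hs
  rw [hs]

lemma primFrom_congr {T : ℝ} {b b' : ℝ → ℝ} (h : b =ᵐ[timeMeasure T] b') (t : ℝ) :
    primFrom T b t = primFrom T b' t := by
  refine integral_congr_ae ?_
  filter_upwards [h] with s hs
  rw [hs]

lemma continuous_flux (ρm ρbar : ℝ) :
    Continuous fun p : ℝ × Plane => flux ρm ρbar p.1 p.2 := by
  unfold flux; fun_prop

lemma continuous_potentialRate (ρm ρbar : ℝ) :
    Continuous fun p : ℝ × Plane => potentialRate ρm ρbar p.1 p.2 := by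
  unfold potentialRate; fun_prop

lemma MemLp.integrable_mul_test {h η : Plane → ℝ} (hh : MemLp h 2) (hη : IsTest η) :
    Integrable fun x => h x * η x :=
  MemLp.integrable_mul (p := 2) (q := 2) hh (hη.1.continuous.memLp_of_hasCompactSupport hη.2)

lemma L2On.comp_of_le {T : ℝ} {r S : ℝ → Plane → ℝ} {q : ℝ → Plane → Plane}
    (hr : Measurable (Function.uncurry r)) (hq : Measurable (Function.uncurry q)) (hS : L2On T S)
    {Θ : ℝ × Plane → ℝ} (hΘ : Continuous Θ) (hle : ∀ s x, |Θ (r s x, q s x)| ≤ S s x) :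
    L2On T fun s x => Θ (r s x, q s x) := by
  refine hS.of_le ?_ hle
  exact hΘ.measurable.comp (hr.prodMk hq)

/-- Changing ψ and ∇φ on a null set of times does not affect the integrated equations. The left
sides keep the original functions, so the equations still hold at every t. -/
lemma IsSolution.exists_isRepresented {ρm ρbar σ T : ℝ} {ψ₀ φT : Plane → ℝ} {ψ φ : ℝ → Plane → ℝ}
    {G : ℝ → Plane → Plane} (h : IsSolution ρm ρbar σ T ψ₀ φT ψ φ G) :
    ∃ r q, IsRepresented ρm ρbar σ T ψ₀ φT ψ φ G r q := by
  obtain ⟨C, hC⟩ := h.bounded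
  have hCψ : ∀ t ∈ Icc 0 T, eLpNorm (ψ t) 2 ≤ C ∧ eLpNorm (ψ t) (⊤ : ℝ≥0∞) ≤ C := fun t ht =>
    ⟨le_trans (le_self_add.trans (le_self_add.trans le_self_add)) (hC t ht),
     le_trans (le_add_self.trans (le_self_add.trans le_self_add)) (hC t ht)⟩
  have hCG : ∀ t ∈ Icc 0 T, eLpNorm (G t) 2 ≤ C ∧ eLpNorm (G t) (⊤ : ℝ≥0∞) ≤ C := fun t ht =>
    ⟨le_trans (le_add_self.trans le_self_add) (hC t ht), le_trans le_add_self (hC t ht)⟩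
  obtain ⟨r, rm, rC, rae, rL⟩ := exists_bounded_rep h.measurable_density hCψ
  obtain ⟨q, qm, qC, qae, qL⟩ := exists_bounded_rep h.measurable_gradient hCG
  obtain ⟨K, hK⟩ := exists_flux_bound ρm ρbar C
  have hr : L2On T r := rL.of_le rm fun s x => le_rfl
  have happ : ∀ j : Fin 2, Continuous fun p : Plane => p j := fun j => by fun_prop
  have hq : ∀ j, L2On T fun s x => q s x j := fun j =>
    L2On.comp_of_le (Θ := fun p => p.2 j) rm qm qL ((happ j).comp continuous_snd)
      fun s x => PiLp.norm_apply_le (q s x) j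
  have hS : L2On T fun s x => K * (‖r s x‖ + ‖q s x‖) := (rL.add qL).const_mul K
  have hF : ∀ j, L2On T fun s x => flux ρm ρbar (r s x) (q s x) j := fun j =>
    L2On.comp_of_le (Θ := fun p => flux ρm ρbar p.1 p.2 j) rm qm hS
      ((happ j).comp (continuous_flux ρm ρbar)) fun s x =>
      (PiLp.norm_apply_le (flux ρm ρbar (r s x) (q s x)) j).trans (hK _ _ (rC s x) (qC s x)).1
  have hR : L2On T fun s x => potentialRate ρm ρbar (r s x) (q s x) :=
    L2On.comp_of_le (Θ := fun p => potentialRate ρm ρbar p.1 p.2) rm qm hS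
      (continuous_potentialRate ρm ρbar) fun s x => (hK _ _ (rC s x) (qC s x)).2
  refine ⟨r, q, rae, qae, hr, hq, hF, hR, fun t ht η hη => ?_, fun t ht η hη => ?_⟩
  · rw [h.density_eq η hη t ht, ← primTo_eq ht]
    congr 1
    refine primTo_congr ?_ t
    filter_upwards [rae, qae, hr.ae_memLp, ae_all_iff.2 fun j => (hF j).ae_memLp]
      with s h1 h2 h3 h4
    have iF := fun j => MemLp.integrable_mul_test (h4 j) (hη.pderiv j)
    have ir := fun j => MemLp.integrable_mul_test h3 ((hη.pderiv j).pderiv j)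
    have e := integral_mul_add_add_mul_add (-1) σ (iF 0) (iF 1) (ir 0) (ir 1)
    rw [neg_one_mul] at e
    rw [← e]
    refine integral_congr_ae ?_
    filter_upwards [h1, h2] with x hx1 hx2
    rw [hx1, hx2, inner_gradient, laplacian_eq_pderiv hη]
    ring
  · rw [h.potential_eq η hη t ht, ← primFrom_eq ht]
    congr 1
    refine primFrom_congr ?_ t
    filter_upwards [rae, qae, hR.ae_memLp, ae_all_iff.2 fun j => (hq j).ae_memLp]
      with s h1 h2 h3 h4
    have iq := fun j => MemLp.integrable_mul_test (h4 j) (hη.pderiv j)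
    have iR := MemLp.integrable_mul_test h3 hη
    rw [← integral_add_mul_add σ iR (iq 0) (iq 1)]
    refine integral_congr_ae ?_
    filter_upwards [h1, h2] with x hx1 hx2
    rw [hx1, hx2, inner_gradient]

section

/-! ### Uniqueness -/

lemma primTo_sub {T : ℝ} {b b' : ℝ → ℝ} (hb : Integrable b (timeMeasure T))
    (hb' : Integrable b' (timeMeasure T)) (t : ℝ) :
    primTo T (fun s => b s - b' s) t = primTo T b t - primTo T b' t := by
  have e : ∀ b : ℝ → ℝ, primTo T b t = ∫ τ, (Iic t).indicator b τ ∂(timeMeasure T) := fun b => by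
    rw [primTo]; congr 1
  rw [e, e, e, ← integral_sub (hb.indicator measurableSet_Iic) (hb'.indicator measurableSet_Iic)]
  congr 1; ext τ
  simp only [indicator_apply]; split_ifs <;> simp

lemma primFrom_sub {T : ℝ} {b b' : ℝ → ℝ} (hb : Integrable b (timeMeasure T))
    (hb' : Integrable b' (timeMeasure T)) (t : ℝ) :
    primFrom T (fun s => b s - b' s) t = primFrom T b t - primFrom T b' t := by
  have e : ∀ b : ℝ → ℝ, primFrom T b t = ∫ τ, (Ici t).indicator b τ ∂(timeMeasure T) := fun b => by
    rw [primFrom]; congr 1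
  rw [e, e, e, ← integral_sub (hb.indicator measurableSet_Ici) (hb'.indicator measurableSet_Ici)]
  congr 1; ext τ
  simp only [indicator_apply]; split_ifs <;> simp

variable {ρm ρbar σ T : ℝ} {ψ₀ φT : Plane → ℝ} {ψ φ ψ' φ' : ℝ → Plane → ℝ}
  {G G' : ℝ → Plane → Plane} {r r' : ℝ → Plane → ℝ} {q q' : ℝ → Plane → Plane}

lemma IsSolution.isDifference (h : IsSolution ρm ρbar σ T ψ₀ φT ψ φ G)
    (h' : IsSolution ρm ρbar σ T ψ₀ φT ψ' φ' G')
    (hr : IsRepresented ρm ρbar σ T ψ₀ φT ψ φ G r q)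
    (hr' : IsRepresented ρm ρbar σ T ψ₀ φT ψ' φ' G' r' q') :
    IsDifference σ T (fun s x => r s x - r' s x) (fun s x => φ s x - φ' s x)
      (fun j s x => q s x j - q' s x j)
      (fun j s x => flux ρm ρbar (r s x) (q s x) j - flux ρm ρbar (r' s x) (q' s x) j)
      (fun s x => potentialRate ρm ρbar (r s x) (q s x) - potentialRate ρm ρbar (r' s x) (q' s x)) := by
  refine ⟨hr.hr.sub hr'.hr, fun j => (hr.hq j).sub (hr'.hq j), fun j => (hr.hF j).sub (hr'.hF j),
    hr.hR.sub hr'.hR, ?_, ?_, ?_, ?_⟩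
  · filter_upwards [ae_restrict_mem measurableSet_Icc] with s hs
    exact (h.weak_gradient s hs).1.sub (h'.weak_gradient s hs).1
  · filter_upwards [ae_restrict_mem measurableSet_Icc, hr.gradient_ae, hr'.gradient_ae,
      ae_all_iff.2 fun j => (hr.hq j).ae_memLp, ae_all_iff.2 fun j => (hr'.hq j).ae_memLp]
      with s hs h1 h2 h3 h4 η hη j
    have w := h.weak_gradient s hs
    have w' := h'.weak_gradient s hs
    have i1 : Integrable fun x => φ s x * pderiv j η x :=
      w.1.integrable_smul_right_of_hasCompactSupport (hη.pderiv j).1.continuous (hη.pderiv j).2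
    have i2 : Integrable fun x => φ' s x * pderiv j η x :=
      w'.1.integrable_smul_right_of_hasCompactSupport (hη.pderiv j).1.continuous (hη.pderiv j).2
    have e1 : ∫ x, G s x j * η x = ∫ x, q s x j * η x := by
      refine integral_congr_ae ?_
      filter_upwards [h1] with x hx
      rw [hx]
    have e2 : ∫ x, G' s x j * η x = ∫ x, q' s x j * η x := by
      refine integral_congr_ae ?_
      filter_upwards [h2] with x hx
      rw [hx]
    simp only [sub_mul]
    rw [integral_sub i1 i2, w.integral_mul_pderiv hη, w'.integral_mul_pderiv hη, e1, e2,
      integral_sub (MemLp.integrable_mul_test (h3 j) hη) (MemLp.integrable_mul_test (h4 j) hη)]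
    ring
  · filter_upwards [ae_restrict_mem measurableSet_Icc, hr.density_ae, hr'.density_ae,
      hr.hr.ae_memLp, hr'.hr.ae_memLp] with t ht h1 h2 h3 h4 η hη
    have e1 : ∫ x, ψ t x * η x = ∫ x, r t x * η x := by
      refine integral_congr_ae ?_
      filter_upwards [h1] with x hx
      rw [hx]
    have e2 : ∫ x, ψ' t x * η x = ∫ x, r' t x * η x := by
      refine integral_congr_ae ?_
      filter_upwards [h2] with x hx
      rw [hx]
    have d1 := hr.density t ht η hη
    have d2 := hr'.density t ht η hη
    rw [e1] at d1
    rw [e2] at d2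
    have hj := fun j => hη.pderiv j
    have hjj := fun j => (hη.pderiv j).pderiv j
    have p1 := (((hr.hF 0).integrable_pairing (hj 0)).add ((hr.hF 1).integrable_pairing (hj 1))).neg.add
      (((hr.hr.integrable_pairing (hjj 0)).add (hr.hr.integrable_pairing (hjj 1))).const_mul σ)
    have p2 := (((hr'.hF 0).integrable_pairing (hj 0)).add
      ((hr'.hF 1).integrable_pairing (hj 1))).neg.add
      (((hr'.hr.integrable_pairing (hjj 0)).add (hr'.hr.integrable_pairing (hjj 1))).const_mul σ)
    simp only [sub_mul]
    rw [integral_sub (MemLp.integrable_mul_test h3 hη) (MemLp.integrable_mul_test h4 hη), d1, d2,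
      add_sub_add_left_eq_sub]
    refine (primTo_sub p1 p2 t).symm.trans (primTo_congr ?_ t)
    filter_upwards [hr.hr.ae_memLp, hr'.hr.ae_memLp, ae_all_iff.2 fun j => (hr.hF j).ae_memLp,
      ae_all_iff.2 fun j => (hr'.hF j).ae_memLp] with s m1 m2 m3 m4
    have s1 := fun j => integral_sub (MemLp.integrable_mul_test (m3 j) (hj j))
      (MemLp.integrable_mul_test (m4 j) (hj j))
    have s2 := fun j => integral_sub (MemLp.integrable_mul_test m1 (hjj j))
      (MemLp.integrable_mul_test m2 (hjj j))
    rw [s1, s1, s2, s2]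
    simp only [Pi.add_apply, Pi.neg_apply]
    ring
  · filter_upwards [ae_restrict_mem measurableSet_Icc] with t ht η hη
    have w := h.weak_gradient t ht
    have w' := h'.weak_gradient t ht
    have i1 : Integrable fun x => φ t x * η x :=
      w.1.integrable_smul_right_of_hasCompactSupport hη.1.continuous hη.2
    have i2 : Integrable fun x => φ' t x * η x :=
      w'.1.integrable_smul_right_of_hasCompactSupport hη.1.continuous hη.2
    have hj := fun j => hη.pderiv j
    have p1 := (hr.hR.integrable_pairing hη).add ((((hr.hq 0).integrable_pairing (hj 0)).add
      ((hr.hq 1).integrable_pairing (hj 1))).const_mul σ)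
    have p2 := (hr'.hR.integrable_pairing hη).add ((((hr'.hq 0).integrable_pairing (hj 0)).add
      ((hr'.hq 1).integrable_pairing (hj 1))).const_mul σ)
    simp only [sub_mul]
    rw [integral_sub i1 i2, hr.potential t ht η hη, hr'.potential t ht η hη, sub_sub_sub_cancel_left,
      ← neg_sub, neg_inj]
    refine (primFrom_sub p1 p2 t).symm.trans (primFrom_congr ?_ t)
    filter_upwards [hr.hR.ae_memLp, hr'.hR.ae_memLp, ae_all_iff.2 fun j => (hr.hq j).ae_memLp,
      ae_all_iff.2 fun j => (hr'.hq j).ae_memLp] with s m1 m2 m3 m4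
    have s1 := fun j => integral_sub (MemLp.integrable_mul_test (m3 j) (hj j))
      (MemLp.integrable_mul_test (m4 j) (hj j))
    have s2 := integral_sub (MemLp.integrable_mul_test m1 hη) (MemLp.integrable_mul_test m2 hη)
    rw [s1, s1, s2]
    simp only [Pi.add_apply]
    ring

/-- Pointwise monotonicity of the system in the range `(0, ρm / 2)` of densities. -/
lemma flux_rate_monotone (hs : speed ρm ρbar ≠ 0) {ψ ψ' : ℝ} (h0 : 0 < ρbar + ψ)
    (h0' : 0 < ρbar + ψ') (h1 : ρbar + ψ < ρm / 2) (h1' : ρbar + ψ' < ρm / 2) (p p' : Plane) :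
    0 ≤ (flux ρm ρbar ψ p 0 - flux ρm ρbar ψ' p' 0) * (p 0 - p' 0)
        + (flux ρm ρbar ψ p 1 - flux ρm ρbar ψ' p' 1) * (p 1 - p' 1)
        - (ψ - ψ') * (potentialRate ρm ρbar ψ p - potentialRate ρm ρbar ψ' p') ∧
    ((flux ρm ρbar ψ p 0 - flux ρm ρbar ψ' p' 0) * (p 0 - p' 0)
        + (flux ρm ρbar ψ p 1 - flux ρm ρbar ψ' p' 1) * (p 1 - p' 1)
        - (ψ - ψ') * (potentialRate ρm ρbar ψ p - potentialRate ρm ρbar ψ' p') = 0 →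
      (speed ρm ρbar)⁻¹ + p 0 ≠ 0 → ψ = ψ' ∧ p = p') := by
  set c := (speed ρm ρbar)⁻¹ with hc
  have hF0 : ∀ (ψ : ℝ) (p : Plane), flux ρm ρbar ψ p 0 =
      (ρbar + ψ) * (ρm - (ρbar + ψ)) ^ 2 * (c + p 0) - ρbar * speed ρm ρbar := fun ψ p => by
    rw [flux_eq hs]; simp [e₁, speed, hc]; ring
  have hF1 : ∀ (ψ : ℝ) (p : Plane), flux ρm ρbar ψ p 1 =
      (ρbar + ψ) * (ρm - (ρbar + ψ)) ^ 2 * p 1 := fun ψ p => by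
    rw [flux_eq hs]; simp [e₁, speed]
  have hR : ∀ (ψ : ℝ) (p : Plane), potentialRate ρm ρbar ψ p =
      1 / 2 * (ρm - (ρbar + ψ)) ^ 2 * ((c + p 0) ^ 2 + p 1 ^ 2) - 1 / 2 := fun ψ p => by
    rw [potentialRate_eq hs, EuclideanSpace.norm_sq_eq, Fin.sum_univ_two]
    simp [e₁, speed, hc]
  have key : (flux ρm ρbar ψ p 0 - flux ρm ρbar ψ' p' 0) * (p 0 - p' 0)
        + (flux ρm ρbar ψ p 1 - flux ρm ρbar ψ' p' 1) * (p 1 - p' 1)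
        - (ψ - ψ') * (potentialRate ρm ρbar ψ p - potentialRate ρm ρbar ψ' p') = _ :=
    Eq.trans (by rw [hF0, hF0, hF1, hF1, hR, hR]; ring)
      (monotone_identity ρm (ρbar + ψ) (ρbar + ψ') (c + p 0) (c + p' 0) (p 1) (p' 1))
  rw [key]
  obtain ⟨m1, m2⟩ := monotone_nonneg h0 h0' h1 h1' (c + p 0) (c + p' 0) (p 1) (p' 1)
  refine ⟨m1, fun he hne => ?_⟩
  obtain ⟨e1, e2, e3⟩ := m2 he (Or.inl hne)
  refine ⟨add_left_cancel e1, ?_⟩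
  ext j
  fin_cases j
  · exact add_left_cancel e2
  · exact e3

/-- The energy identity says that a pointwise nonnegative function has integral zero, so it vanishes
almost everywhere. The equality case of the monotonicity then identifies the two states. The
gradient condition `hne` is required of one of the solutions only. -/
theorem IsSolution.unique (hs : speed ρm ρbar ≠ 0) (h : IsSolution ρm ρbar σ T ψ₀ φT ψ φ G)
    (hsub : IsSubcritical ρm ρbar T ψ)
    (hne : ∀ t ∈ Icc 0 T, ∀ᵐ x ∂(volume : Measure Plane), (speed ρm ρbar)⁻¹ + G t x 0 ≠ 0)
    (h' : IsSolution ρm ρbar σ T ψ₀ φT ψ' φ' G') (hsub' : IsSubcritical ρm ρbar T ψ') :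
    ∀ t ∈ Icc 0 T, ψ' t =ᵐ[volume] ψ t ∧ φ' t =ᵐ[volume] φ t ∧ G' t =ᵐ[volume] G t := by
  obtain ⟨r, q, hr⟩ := h.exists_isRepresented
  obtain ⟨r', q', hr'⟩ := h'.exists_isRepresented
  have hd := h.isDifference h' hr hr'
  have hzero := hd.integral_eq_zero
  have hint : Integrable (fun p : ℝ × Plane =>
      (flux ρm ρbar (r p.1 p.2) (q p.1 p.2) 0 - flux ρm ρbar (r' p.1 p.2) (q' p.1 p.2) 0)
          * (q p.1 p.2 0 - q' p.1 p.2 0)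
        + (flux ρm ρbar (r p.1 p.2) (q p.1 p.2) 1 - flux ρm ρbar (r' p.1 p.2) (q' p.1 p.2) 1)
          * (q p.1 p.2 1 - q' p.1 p.2 1)
        - (r p.1 p.2 - r' p.1 p.2) * (potentialRate ρm ρbar (r p.1 p.2) (q p.1 p.2)
          - potentialRate ρm ρbar (r' p.1 p.2) (q' p.1 p.2))) (slab T) :=
    (((hd.hF 0).integrable_mul (hd.hg 0)).add ((hd.hF 1).integrable_mul (hd.hg 1))).sub
      (hd.hu.integrable_mul hd.hR)
  set I : ℝ × Plane → ℝ := fun p =>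
      (flux ρm ρbar (r p.1 p.2) (q p.1 p.2) 0 - flux ρm ρbar (r' p.1 p.2) (q' p.1 p.2) 0)
          * (q p.1 p.2 0 - q' p.1 p.2 0)
        + (flux ρm ρbar (r p.1 p.2) (q p.1 p.2) 1 - flux ρm ρbar (r' p.1 p.2) (q' p.1 p.2) 1)
          * (q p.1 p.2 1 - q' p.1 p.2 1)
        - (r p.1 p.2 - r' p.1 p.2) * (potentialRate ρm ρbar (r p.1 p.2) (q p.1 p.2)
          - potentialRate ρm ρbar (r' p.1 p.2) (q' p.1 p.2)) with hI
  have hgood : ∀ᵐ s ∂(timeMeasure T), ∀ᵐ x, (0 < ρbar + r s x ∧ ρbar + r s x < ρm / 2) ∧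
      (0 < ρbar + r' s x ∧ ρbar + r' s x < ρm / 2) ∧ (speed ρm ρbar)⁻¹ + q s x 0 ≠ 0 := by
    filter_upwards [ae_restrict_mem measurableSet_Icc, hr.density_ae, hr'.density_ae,
      hr.gradient_ae] with s hs h1 h2 h3
    filter_upwards [h1, h2, h3, hsub s hs, hsub' s hs, hne s hs] with x x1 x2 x3 x4 x5 x6
    rw [← x1, ← x2, ← x3]
    exact ⟨x4, x5, x6⟩
  have hnonneg : 0 ≤ᵐ[slab T] I := by
    have hm : Measurable I :=
      (((hd.hF 0).meas.mul (hd.hg 0).meas).add ((hd.hF 1).meas.mul (hd.hg 1).meas)).sub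
        (hd.hu.meas.mul hd.hR.meas)
    refine (Measure.ae_prod_iff_ae_ae (measurableSet_le measurable_const hm)).2 ?_
    filter_upwards [hgood] with s h1
    filter_upwards [h1] with x h3
    exact (flux_rate_monotone hs h3.1.1 h3.2.1.1 h3.1.2 h3.2.1.2 (q s x) (q' s x)).1
  have hI0 : I =ᵐ[slab T] 0 := (integral_eq_zero_iff_of_nonneg_ae hnonneg hint).1 hzero
  have hI1 : ∀ᵐ s ∂(timeMeasure T), ∀ᵐ x, I (s, x) = 0 := Measure.ae_ae_of_ae_prod hI0
  have heq : ∀ᵐ s ∂(timeMeasure T), (r' s =ᵐ[volume] r s) ∧ q' s =ᵐ[volume] q s := by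
    filter_upwards [hgood, hI1] with s h1 h2
    have : ∀ᵐ x, r' s x = r s x ∧ q' s x = q s x := by
      filter_upwards [h1, h2] with x h3 h4
      obtain ⟨e1, e2⟩ := (flux_rate_monotone hs h3.1.1 h3.2.1.1 h3.1.2 h3.2.1.2 (q s x) (q' s x)).2
        h4 h3.2.2
      exact ⟨e1.symm, e2.symm⟩
    exact ⟨this.mono fun x hx => hx.1, this.mono fun x hx => hx.2⟩
  -- From almost every time to every time: the integrated equations determine ψ(t) and φ(t) by the
  -- states at almost all times, and φ(t) determines its weak gradient.
  intro t ht
  have eψ : ψ' t =ᵐ[volume] ψ t := by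
    refine ae_eq_of_integral_contDiff_smul_eq (MemLp.locallyIntegrable_two (h'.memLp t ht).1)
      (MemLp.locallyIntegrable_two (h.memLp t ht).1) fun η h1 h2 => ?_
    simp only [smul_eq_mul, mul_comm (η _)]
    rw [hr.density t ht η ⟨h1, h2⟩, hr'.density t ht η ⟨h1, h2⟩]
    congr 1
    refine primTo_congr ?_ t
    filter_upwards [heq] with s hs
    congr 1
    · congr 2
      all_goals
        refine integral_congr_ae ?_
        filter_upwards [hs.1, hs.2] with x h3 h4
        rw [h3, h4]
    · congr 2
      all_goals
        refine integral_congr_ae ?_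
        filter_upwards [hs.1] with x h3
        rw [h3]
  have eφ : φ' t =ᵐ[volume] φ t := by
    refine ae_eq_of_integral_contDiff_smul_eq (h'.weak_gradient t ht).1
      (h.weak_gradient t ht).1 fun η h1 h2 => ?_
    simp only [smul_eq_mul, mul_comm (η _)]
    rw [hr.potential t ht η ⟨h1, h2⟩, hr'.potential t ht η ⟨h1, h2⟩]
    congr 1
    refine primFrom_congr ?_ t
    filter_upwards [heq] with s hs
    congr 1
    · refine integral_congr_ae ?_
      filter_upwards [hs.1, hs.2] with x h3 h4
      rw [h3, h4]
    · congr 2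
      all_goals
        refine integral_congr_ae ?_
        filter_upwards [hs.2] with x h4
        rw [h4]
  exact ⟨eψ, eφ, (h'.weak_gradient t ht).ae_eq (h.weak_gradient t ht) eφ⟩

end

/-! ### Preparation of the data -/

/-- The transform of a real function has a measurable Hermitian representative for which the
weighted bound holds everywhere. -/
lemma HasFourierTransform.exists_hermitian {u : Plane → ℝ} {a : Plane → ℂ}
    (h : HasFourierTransform u a) {w : ℝ → ℝ} (hwm : Measurable w)
    (hw : ∀ ρ, 0 ≤ ρ → 0 ≤ w ρ) (hfin : weightedSup w a ≠ (⊤ : ℝ≥0∞)) :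
    ∃ a' : Plane → ℂ, Measurable a' ∧ (∀ ξ, a' (-ξ) = (starRingEnd ℂ) (a' ξ)) ∧
      (∀ ξ, w ‖ξ‖ * ‖a' ξ‖ ≤ (weightedSup w a).toReal) ∧ HasInvFourier u a' := by
  obtain ⟨hi, hu⟩ := h
  set N := (weightedSup w a).toReal with hN
  set b := hi.1.mk a with hb
  have hbm : Measurable b := hi.1.stronglyMeasurable_mk.measurable
  have hab : a =ᵐ[volume] b := hi.1.ae_eq_mk
  -- Hermitian symmetrisation; because u is real, its inverse transform is still u.
  let c : Plane → ℂ := fun ξ => (1 / 2 : ℂ) * (b ξ + (starRingEnd ℂ) (b (-ξ)))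
  have hcm : Measurable c :=
    (hbm.add (Complex.continuous_conj.measurable.comp (hbm.comp measurable_neg))).const_mul _
  have hch : ∀ ξ, c (-ξ) = (starRingEnd ℂ) (c ξ) := fun ξ => by
    simp only [c, neg_neg, map_mul, map_add, Complex.conj_conj, map_div₀, map_one, map_ofNat]
    ring
  have hbd : ∀ᵐ ξ : Plane, w ‖ξ‖ * ‖b ξ‖ ≤ N := by
    filter_upwards [ae_le_eLpNormEssSup (f := fun ξ : Plane => w ‖ξ‖ • a ξ) (μ := volume), hab]
      with ξ h1 h2
    rw [← h2]
    have h3 : ‖w ‖ξ‖ • a ξ‖ₑ ≤ weightedSup w a := by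
      rw [weightedSup, eLpNorm_exponent_top]; exact h1
    have h4 := ENNReal.toReal_mono hfin h3
    rwa [toReal_enorm, norm_smul, Real.norm_of_nonneg (hw _ (norm_nonneg _))] at h4
  have hneg : ∀ᵐ ξ : Plane, w ‖ξ‖ * ‖b (-ξ)‖ ≤ N := by
    have := (Measure.measurePreserving_neg (volume : Measure Plane)).quasiMeasurePreserving.ae hbd
    simpa using this
  have hcb : ∀ᵐ ξ : Plane, w ‖ξ‖ * ‖c ξ‖ ≤ N := by
    filter_upwards [hbd, hneg] with ξ h1 h2
    have h3 : ‖c ξ‖ ≤ 1 / 2 * (‖b ξ‖ + ‖b (-ξ)‖) := by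
      simp only [c, norm_mul]
      have := norm_add_le (b ξ) ((starRingEnd ℂ) (b (-ξ)))
      rw [RCLike.norm_conj] at this
      norm_num
      linarith
    have := mul_le_mul_of_nonneg_left h3 (hw _ (norm_nonneg ξ))
    linarith
  -- The set where the bound fails is null and symmetric under ξ ↦ -ξ, so removing it keeps the
  -- Hermitian symmetry.
  let a' : Plane → ℂ := fun ξ => if w ‖ξ‖ * ‖c ξ‖ ≤ N then c ξ else 0
  have ha'c : a' =ᵐ[volume] c := by
    filter_upwards [hcb] with ξ h1
    simp only [a', if_pos h1]
  have hbi : Integrable b := hi.congr hab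
  have hbi' : Integrable fun ξ => (starRingEnd ℂ) (b (-ξ)) :=
    (Complex.conjCLE.toContinuousLinearMap.integrable_comp hbi.comp_neg)
  have hci : Integrable c := (hbi.add hbi').const_mul _
  refine ⟨a', ?_, ?_, ?_, hci.congr ha'c.symm, ?_⟩
  · exact Measurable.ite (measurableSet_le ((hwm.comp measurable_norm).mul hcm.norm)
      measurable_const) hcm measurable_const
  · intro ξ
    simp only [a', norm_neg, hch, RCLike.norm_conj]
    split_ifs <;> simp
  · intro ξ
    simp only [a']
    split_ifs with h
    · exact h
    · rw [norm_zero, mul_zero]; exact ENNReal.toReal_nonneg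
  · filter_upwards [hu] with x hx
    have e1 : invFourier a' x = invFourier c x := by
      unfold invFourier
      congr 1
      refine integral_congr_ae ?_
      filter_upwards [ha'c] with ξ h1
      rw [h1]
    have e2 : invFourier b x = (u x : ℂ) := by
      rw [hx]
      unfold invFourier
      refine congrArg (cpi • ·) (integral_congr_ae ?_)
      filter_upwards [hab] with ξ h1
      rw [h1]; rfl
    rw [e1]
    simp only [c]
    rw [invFourier_const_mul, invFourier_add hbi hbi', ← invFourier_conj, e2, Complex.conj_ofReal]
    ring

lemma exists_goodData {σ : ℝ} (hσ : 0 ≤ σ) {ψ₀ φT : Plane → ℝ} {a b : Plane → ℂ}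
    (ha : HasFourierTransform ψ₀ a) (hb : HasFourierTransform φT b)
    (hN : initialNorm σ a ≠ (⊤ : ℝ≥0∞)) (hM : terminalNorm σ b ≠ (⊤ : ℝ≥0∞)) :
    ∃ a' b', GoodData σ (initialNorm σ a).toReal (terminalNorm σ b).toReal a' b' ∧
      HasInvFourier ψ₀ a' ∧ HasInvFourier φT b' := by
  obtain ⟨a', m1, h1, b1, i1⟩ := ha.exists_hermitian (by fun_prop) (fun ρ hρ => by positivity) hN
  obtain ⟨b', m2, h2, b2, i2⟩ := hb.exists_hermitian (by fun_prop) (fun ρ hρ => by positivity) hM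
  refine ⟨a', b', ⟨⟨m1, m2⟩, h1, h2, fun ξ => ?_, fun ξ => ?_⟩, i1, i2⟩
  · rw [decay, ← div_eq_mul_inv, le_div_iff₀ (by positivity)]
    refine le_trans (le_of_eq ?_) (b1 ξ)
    ring
  · rw [decay, ← div_eq_mul_inv, le_div_iff₀ (by positivity)]
    refine le_trans (le_of_eq ?_) (b2 ξ)
    ring

/-! ### Solutions -/

/-- The exponent 5/2 exceeds the dimension 2, so `slowDecay` and its square are integrable.
Differences of transforms of size d thus give differences of functions of size d in L² and in L^∞.
-/
lemma exists_slowDecay_bounds : ∃ K > 0, ∀ (a : Plane → ℂ) (F : Plane → ℝ) (d : ℝ), 0 ≤ d → Rep a F →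
    (∀ ξ, ‖a ξ‖ ≤ d * slowDecay ξ) → eLpNorm F 2 volume ≤ ENNReal.ofReal (K * d) ∧
      eLpNorm F (⊤ : ℝ≥0∞) volume ≤ ENNReal.ofReal (K * d) := by
  have h2 : Integrable fun ξ => slowDecay ξ ^ 2 :=
    integrable_slowDecay.mono' (continuous_slowDecay.pow 2).aestronglyMeasurable
      (Eventually.of_forall fun ξ => by
        have h0 := slowDecay_pos ξ
        rw [Real.norm_of_nonneg (by positivity), sq]
        exact mul_le_of_le_one_left h0.le (slowDecay_le_one ξ))
  have n1 : 0 ≤ ∫ ξ, slowDecay ξ := integral_nonneg fun ξ => (slowDecay_pos ξ).le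
  have n2 : 0 ≤ ∫ ξ, slowDecay ξ ^ 2 := integral_nonneg fun ξ => sq_nonneg _
  have nc := cpi_pos
  refine ⟨1 + cpi * (∫ ξ, slowDecay ξ) + √(cpi * ∫ ξ, slowDecay ξ ^ 2), by positivity,
    fun a F d hd hr hb => ⟨?_, ?_⟩⟩
  · refine (hr.memLp_two hb (by simpa only [mul_pow] using h2.const_mul (d ^ 2))).2.trans
      (ENNReal.ofReal_le_ofReal ?_)
    have e : cpi * ∫ ξ, (d * slowDecay ξ) ^ 2 = d ^ 2 * (cpi * ∫ ξ, slowDecay ξ ^ 2) := by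
      simp only [mul_pow]; rw [integral_const_mul]; ring
    rw [e, Real.sqrt_mul (sq_nonneg d), Real.sqrt_sq hd, mul_comm]
    refine mul_le_mul_of_nonneg_right ?_ hd
    have : 0 ≤ cpi * ∫ ξ, slowDecay ξ := by positivity
    linarith
  · refine eLpNormEssSup_le_of_ae_bound (Eventually.of_forall fun x => ?_)
    refine (hr.abs_le (integrable_slowDecay.const_mul d) hb x).trans ?_
    rw [integral_const_mul]
    have : 0 ≤ √(cpi * ∫ ξ, slowDecay ξ ^ 2) := by positivity
    have := mul_nonneg this hd
    linarith

/-- The estimates of the solution with transforms `U`, for data of sizes `N` and `M`. -/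
structure HasBounds (ρm ρbar σ T N M K : ℝ) (ψ₀ φT : Plane → ℝ)
    (U : Fin 2 → ℝ → Plane → ℂ) : Prop where
  unique : IsUniqueSolution ρm ρbar σ T ψ₀ φT (psiOf U) (phiOf U) (gradOf U)
  rep_psi : ∀ t, Rep (U 0 t) (psiOf U t)
  rep_grad : ∀ t j, Rep (pHat (U 1) t j) (fun x => gradOf U t x j)
  hessian : 0 < σ → ∀ t ∈ Icc 0 T, HasWeakJacobian (gradOf U t) (hessOf U t) ∧
    (∀ i, Continuous fun x => σ * hessOf U t x i) ∧
    ∀ F : Plane → ℝ, (F = psiOf U t ∨ (∃ j, F = fun x => gradOf U t x j) ∨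
      ∃ i, F = fun x => σ * hessOf U t x i) →
      (∀ x, |F x| ≤ K * (N / (1 + t) ^ 2 + M / (1 + T - t) ^ 2)) ∧
      eLpNorm F 2 volume ≤ ENNReal.ofReal (K * (N / (1 + t) + M / (1 + T - t)))

/-- All viscosities in [0, σ₀] use the same N, M and hence the same weight, which makes the
solutions comparable with the inviscid one. Smallness in L^∞ then gives the two pointwise conditions
for uniqueness. -/
theorem exists_hasBounds {ρm ρbar : ℝ} (hpos : 0 < ρbar) (hlt : ρbar < ρm / 2) :
    ∃ ε₀ > 0, ∃ K > 0, ∃ B > 0, ∀ T N M : ℝ, 0 ≤ T → 0 ≤ N → 0 ≤ M → N + M ≤ ε₀ →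
      ∀ (ψ₀ φT : Plane → ℝ) (a b : Plane → ℂ) (σ₀ : ℝ), 0 ≤ σ₀ → GoodData σ₀ N M a b →
        HasInvFourier ψ₀ a → HasInvFourier φT b →
        ∃ U : ℝ → Fin 2 → ℝ → Plane → ℂ, ∀ σ ∈ Icc 0 σ₀,
          HasBounds ρm ρbar σ T N M K ψ₀ φT (U σ) ∧
          ∀ i t ξ, ‖U σ i t ξ - U 0 i t ξ‖ ≤ B * √σ * slowDecay ξ := by
  obtain ⟨c, hc, B, hB, ε, hε, hBε, hex⟩ := exists_spectralSol hpos hlt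
  obtain ⟨K, hK, hbd⟩ := exists_twoSided_bounds hc hB
  have hf := speed_pos hpos hlt
  -- Values below m keep the density in (0, ρ_m/2) and the first component of ∇Φ = e₁/f + ∇φ
  -- positive. The bound m/(2K) on N+M leaves K(N+M) ≤ m/2 < m.
  set m := min (min ρbar (ρm / 2 - ρbar)) (speed ρm ρbar)⁻¹ with hm
  have hm0 : 0 < m := lt_min (lt_min hpos (by linarith)) (inv_pos.2 hf)
  refine ⟨min ε (m / (2 * K)), by positivity, K, hK, B, hB, ?_⟩
  intro T N M hT hN hM hNM ψ₀ φT a b σ₀ hσ₀ hgood hψ₀ hφT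
  have hNε := hNM.trans (min_le_left _ _)
  have hNm : K * (N + M) < m := by
    have := mul_le_mul_of_nonneg_left (hNM.trans (min_le_right _ _)) hK.le
    have e : K * (m / (2 * K)) = m / 2 := by field_simp
    linarith
  have hW : ∀ t ξ, B * twoSided c N M T t ξ ≤ decay ξ := fun t ξ => by
    have h1 := twoSided_le hc.le hN hM hT t ξ
    have h2 : B * (N + M) ≤ 1 := (mul_le_mul_of_nonneg_left hNε hB.le).trans hBε
    have h3 := decay_pos ξ
    calc B * twoSided c N M T t ξ ≤ B * ((N + M) * decay ξ) := by gcongr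
      _ = B * (N + M) * decay ξ := by ring
      _ ≤ 1 * decay ξ := by gcongr
      _ = decay ξ := one_mul _
  have hsol : ∀ σ ∈ Icc 0 σ₀, ∃ U, IsSpectralSol ρm ρbar σ T (fun t ξ => B * twoSided c N M T t ξ)
      a b U ∧ ∀ U₀, IsSpectralSol ρm ρbar 0 T (fun t ξ => B * twoSided c N M T t ξ) a b U₀ →
        ∀ i t ξ, ‖U i t ξ - U₀ i t ξ‖ ≤ B * √σ * slowDecay ξ := fun σ hσ =>
    hex σ T N M hσ.1 hT hN hM hNε a b (hgood.mono hσ.2)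
  choose! U hU using hsol
  refine ⟨U, fun σ hσ => ⟨?_, (hU σ hσ).2 _ (hU 0 ⟨le_rfl, hσ₀⟩).1⟩⟩
  have h := (hU σ hσ).1
  have hsmall : ∀ t ∈ Icc 0 T, ∀ (c' : Plane → ℂ) (F : Plane → ℝ), Rep c' F →
      (∀ ξ, ‖c' ξ‖ ≤ B * twoSided c N M T t ξ) → ∀ x, |F x| < m := by
    intro t ht c' F hr hc' x
    refine ((hbd N M T t hN hM ht c' F hr hc').1 x).trans_lt (lt_of_le_of_lt ?_ hNm)
    have e1 : N / (1 + t) ^ 2 ≤ N := div_le_self hN (one_le_pow₀ (by linarith [ht.1]))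
    have e2 : M / (1 + T - t) ^ 2 ≤ M := div_le_self hM (one_le_pow₀ (by linarith [ht.2]))
    gcongr
  have hU0 : ∀ t ξ, ‖U σ 0 t ξ‖ ≤ B * twoSided c N M T t ξ := (h.sym 0).bound
  have hpH : ∀ t j ξ, ‖pHat (U σ 1) t j ξ‖ ≤ B * twoSided c N M T t ξ := fun t j =>
    ((h.sym 1).pHat j).bound t
  have hsub : IsSubcritical ρm ρbar T (psiOf (U σ)) := fun t ht =>
    Eventually.of_forall fun x => by
      have h1 := abs_lt.1 (hsmall t ht _ _ (h.rep_psi hW t) (hU0 t) x)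
      have h2 : m ≤ ρbar := (min_le_left _ _).trans (min_le_left _ _)
      have h3 : m ≤ ρm / 2 - ρbar := (min_le_left _ _).trans (min_le_right _ _)
      constructor <;> linarith
  have hne : ∀ t ∈ Icc 0 T, ∀ᵐ x ∂(volume : Measure Plane),
      (speed ρm ρbar)⁻¹ + gradOf (U σ) t x 0 ≠ 0 := fun t ht => Eventually.of_forall fun x => by
    have h1 := abs_lt.1 (hsmall t ht _ _ (h.rep_grad hW t 0) (hpH t 0) x)
    have h2 : m ≤ (speed ρm ρbar)⁻¹ := min_le_right _ _
    exact (by linarith : 0 < (speed ρm ρbar)⁻¹ + gradOf (U σ) t x 0).ne'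
  have hs := h.isSolution hW hT hψ₀ hφT
  refine ⟨⟨hs, hsub, fun ψ' φ' G' h1 h2 => hs.unique hf.ne' hsub hne h1 h2⟩,
    h.rep_psi hW, h.rep_grad hW, fun hσ0 t ht => ?_⟩
  obtain ⟨hJ, hH⟩ := h.hessian hW hσ0 t
  refine ⟨hJ, fun i => (hH i).1.continuous, fun F hF => ?_⟩
  rcases hF with rfl | ⟨j, rfl⟩ | ⟨i, rfl⟩
  · exact hbd N M T t hN hM ht _ _ (h.rep_psi hW t) (hU0 t)
  · exact hbd N M T t hN hM ht _ _ (h.rep_grad hW t j) (hpH t j)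
  · exact hbd N M T t hN hM ht _ _ (hH i).1 (hH i).2

/-- The norms of vectors are at most the sums over components, and there are 1 + 2 + 4 of them. -/
lemma eLpNorm_add_le_of_apply {p : ℝ≥0∞} (hp : 1 ≤ p) {σ : ℝ} (hσ : 0 ≤ σ) {ψ : Plane → ℝ}
    {G : Plane → Plane} {H : Plane → EuclideanSpace ℝ (Fin 2 × Fin 2)} {S : ℝ≥0∞}
    (hG : ∀ j, Continuous fun x => G x j) (hH : ∀ i, Continuous fun x => σ * H x i)
    (h1 : eLpNorm ψ p volume ≤ S) (h2 : ∀ j, eLpNorm (fun x => G x j) p volume ≤ S)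
    (h3 : ∀ i, eLpNorm (fun x => σ * H x i) p volume ≤ S) :
    eLpNorm ψ p volume + eLpNorm G p volume + ENNReal.ofReal σ * eLpNorm H p volume ≤ 7 * S := by
  have b2 : eLpNorm G p volume ≤ 2 * S := by
    refine (eLpNorm_le_sum_apply hp fun j => (hG j).aestronglyMeasurable).trans ?_
    refine (Finset.sum_le_sum fun j _ => h2 j).trans_eq ?_
    simp
  have b3 : ENNReal.ofReal σ * eLpNorm H p volume ≤ 4 * S := by
    have e : ENNReal.ofReal σ * eLpNorm H p volume = eLpNorm (σ • H) p volume := by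
      rw [eLpNorm_const_smul, Real.enorm_eq_ofReal hσ]
    rw [e]
    refine (eLpNorm_le_sum_apply hp fun i => (hH i).aestronglyMeasurable).trans ?_
    refine (Finset.sum_le_sum fun i _ => h3 i).trans_eq ?_
    simp
  calc _ ≤ S + 2 * S + 4 * S := by gcongr
    _ = 7 * S := by ring

lemma ofReal_bound_eq {K N M s t : ℝ} (hK : 0 ≤ K) (hN : 0 ≤ N) (hM : 0 ≤ M) (hs : 0 < s)
    (ht : 0 < t) : 7 * ENNReal.ofReal (K * (N / s + M / t)) = ENNReal.ofReal (7 * K) *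
      (ENNReal.ofReal N / ENNReal.ofReal s + ENNReal.ofReal M / ENNReal.ofReal t) := by
  rw [ENNReal.ofReal_mul hK, ENNReal.ofReal_add (by positivity) (by positivity),
    ENNReal.ofReal_div_of_pos hs, ENNReal.ofReal_div_of_pos ht, ENNReal.ofReal_mul (by norm_num),
    ← mul_assoc]
  norm_num

lemma HasBounds.estimates {ρm ρbar σ T N M K : ℝ} {ψ₀ φT : Plane → ℝ}
    {U : Fin 2 → ℝ → Plane → ℂ} (h : HasBounds ρm ρbar σ T N M K ψ₀ φT U) (hσ : 0 < σ)
    (hK : 0 < K) (hN : 0 ≤ N) (hM : 0 ≤ M) {t : ℝ} (ht : t ∈ Icc 0 T) :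
    eLpNorm (psiOf U t) 2 volume + eLpNorm (gradOf U t) 2 volume
        + ENNReal.ofReal σ * eLpNorm (hessOf U t) 2 volume
      ≤ ENNReal.ofReal (7 * K) * (ENNReal.ofReal N / ENNReal.ofReal (1 + t)
          + ENNReal.ofReal M / ENNReal.ofReal (1 + T - t)) ∧
    eLpNorm (psiOf U t) (⊤ : ℝ≥0∞) volume + eLpNorm (gradOf U t) (⊤ : ℝ≥0∞) volume
        + ENNReal.ofReal σ * eLpNorm (hessOf U t) (⊤ : ℝ≥0∞) volume
      ≤ ENNReal.ofReal (7 * K) * (ENNReal.ofReal N / ENNReal.ofReal ((1 + t) ^ 2)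
          + ENNReal.ofReal M / ENNReal.ofReal ((1 + T - t) ^ 2)) := by
  obtain ⟨-, hc, hF⟩ := h.hessian hσ t ht
  have e1 : 0 < 1 + t := by linarith [ht.1]
  have e2 : 0 < 1 + T - t := by linarith [ht.2]
  have hG := fun j => (h.rep_grad t j).continuous
  rw [← ofReal_bound_eq hK.le hN hM e1 e2,
    ← ofReal_bound_eq hK.le hN hM (pow_pos e1 2) (pow_pos e2 2)]
  have htop : ∀ F : Plane → ℝ, (F = psiOf U t ∨ (∃ j, F = fun x => gradOf U t x j) ∨
      ∃ i, F = fun x => σ * hessOf U t x i) → eLpNorm F (⊤ : ℝ≥0∞) volume ≤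
        ENNReal.ofReal (K * (N / (1 + t) ^ 2 + M / (1 + T - t) ^ 2)) := fun F hF' =>
    eLpNormEssSup_le_of_ae_bound (Eventually.of_forall fun x => (hF F hF').1 x)
  exact ⟨eLpNorm_add_le_of_apply (by norm_num) hσ.le hG hc (hF _ (Or.inl rfl)).2
      (fun j => (hF _ (Or.inr (Or.inl ⟨j, rfl⟩))).2) fun i => (hF _ (Or.inr (Or.inr ⟨i, rfl⟩))).2,
    eLpNorm_add_le_of_apply le_top hσ.le hG hc (htop _ (Or.inl rfl))
      (fun j => htop _ (Or.inr (Or.inl ⟨j, rfl⟩))) fun i => htop _ (Or.inr (Or.inr ⟨i, rfl⟩))⟩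

/-- The pointwise bound on the transforms is uniform in t, so the supremum is of order √σ. -/
lemma HasBounds.tendsto {ρm ρbar σ₀ T N M B K : ℝ} (hB : 0 < B) (hσ₀ : 0 < σ₀) {ψ₀ φT : Plane → ℝ}
    {U : ℝ → Fin 2 → ℝ → Plane → ℂ}
    (h : ∀ σ ∈ Icc 0 σ₀, HasBounds ρm ρbar σ T N M K ψ₀ φT (U σ) ∧
      ∀ i t ξ, ‖U σ i t ξ - U 0 i t ξ‖ ≤ B * √σ * slowDecay ξ) :
    Tendsto (fun σ => ⨆ t ∈ Icc (0 : ℝ) T,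
        (eLpNorm (psiOf (U σ) t - psiOf (U 0) t) 2 volume
          + eLpNorm (psiOf (U σ) t - psiOf (U 0) t) (⊤ : ℝ≥0∞) volume
          + eLpNorm (gradOf (U σ) t - gradOf (U 0) t) 2 volume
          + eLpNorm (gradOf (U σ) t - gradOf (U 0) t) (⊤ : ℝ≥0∞) volume)) (𝓝[>] 0) (𝓝 0) := by
  obtain ⟨K', hK', hbd⟩ := exists_slowDecay_bounds
  have hlim : Tendsto (fun σ : ℝ => 6 * ENNReal.ofReal (K' * (B * √σ))) (𝓝[>] 0) (𝓝 0) := by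
    have h1 : Continuous fun σ : ℝ => 6 * ENNReal.ofReal (K' * (B * √σ)) :=
      (ENNReal.continuous_const_mul (by simp)).comp (ENNReal.continuous_ofReal.comp (by fun_prop))
    have h2 := h1.tendsto 0
    simp only [Real.sqrt_zero, mul_zero, ENNReal.ofReal_zero] at h2
    exact h2.mono_left nhdsWithin_le_nhds
  refine tendsto_of_tendsto_of_tendsto_of_le_of_le' tendsto_const_nhds hlim
    (Eventually.of_forall fun σ => zero_le) ?_
  filter_upwards [Ioc_mem_nhdsGT hσ₀] with σ hσ
  obtain ⟨h1, hd⟩ := h σ ⟨hσ.1.le, hσ.2⟩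
  obtain ⟨h0, -⟩ := h 0 ⟨le_rfl, hσ₀.le⟩
  have hd0 : 0 ≤ B * √σ := by positivity
  refine iSup₂_le fun t ht => ?_
  set S := ENNReal.ofReal (K' * (B * √σ)) with hS
  have sub : ∀ {a a' : Plane → ℂ} {F F' : Plane → ℝ}, Rep a F → Rep a' F' →
      Rep (fun ξ => a ξ - a' ξ) (fun x => F x - F' x) := fun hr hr' =>
    ((hr.add (hr'.const_mul (-1))).congr fun x => by ring).congr_left fun ξ => by push_cast; ring
  have bψ := hbd _ _ _ hd0 (sub (h1.rep_psi t) (h0.rep_psi t)) (hd 0 t)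
  have bG := fun j => hbd _ _ _ hd0 (sub (h1.rep_grad t j) (h0.rep_grad t j)) fun ξ => by
    refine le_trans ?_ (hd 1 t ξ)
    rw [pHat, pHat, ← mul_sub, norm_mul]
    exact mul_le_of_le_one_left (norm_nonneg _) (norm_pHat_factor_le ξ j)
  have bG' : ∀ p : ℝ≥0∞, 1 ≤ p →
      (∀ j, eLpNorm (fun x => gradOf (U σ) t x j - gradOf (U 0) t x j) p volume ≤ S) →
      eLpNorm (gradOf (U σ) t - gradOf (U 0) t) p volume ≤ 2 * S := fun p hp hj => by
    refine (eLpNorm_le_sum_apply hp fun j =>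
      ((h1.rep_grad t j).continuous.sub (h0.rep_grad t j).continuous).aestronglyMeasurable).trans ?_
    refine (Finset.sum_le_sum fun j _ => hj j).trans_eq ?_
    simp
  calc _ ≤ S + S + 2 * S + 2 * S := by
        gcongr
        · exact bψ.1
        · exact bψ.2
        · exact bG' 2 (by norm_num) fun j => (bG j).1
        · exact bG' _ le_top fun j => (bG j).2
    _ = 6 * S := by ring

end Hughes

end

/-! ### The theorem -/

theorem theorem2 (ρm ρbar : ℝ) (hpos : 0 < ρbar) (hlt : ρbar < ρm / 2) :
    ∃ ε₀ > (0 : ℝ), ∃ K > (0 : ℝ),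
      (∀ σ > (0 : ℝ), ∀ T > (0 : ℝ), ∀ (ψ₀ φT : Hughes.Plane → ℝ) (a b : Hughes.Plane → ℂ),
        Hughes.HasFourierTransform ψ₀ a → Hughes.HasFourierTransform φT b →
        Hughes.initialNorm σ a + Hughes.terminalNorm σ b ≤ ENNReal.ofReal ε₀ →
        ∃ (ψ φ : ℝ → Hughes.Plane → ℝ) (G : ℝ → Hughes.Plane → Hughes.Plane),
          Hughes.IsUniqueSolution ρm ρbar σ T ψ₀ φT ψ φ G ∧
          ∀ t ∈ Icc 0 T, ∃ H : Hughes.Plane → EuclideanSpace ℝ (Fin 2 × Fin 2),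
            Hughes.HasWeakJacobian (G t) H ∧
            eLpNorm (ψ t) 2 volume + eLpNorm (G t) 2 volume
                + ENNReal.ofReal σ * eLpNorm H 2 volume
              ≤ ENNReal.ofReal K *
                (Hughes.initialNorm σ a / ENNReal.ofReal (1 + t)
                  + Hughes.terminalNorm σ b / ENNReal.ofReal (1 + T - t)) ∧
            eLpNorm (ψ t) ∞ volume + eLpNorm (G t) ∞ volume
                + ENNReal.ofReal σ * eLpNorm H ∞ volume
              ≤ ENNReal.ofReal K *
                (Hughes.initialNorm σ a / ENNReal.ofReal ((1 + t) ^ 2)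
                  + Hughes.terminalNorm σ b / ENNReal.ofReal ((1 + T - t) ^ 2))) ∧
      (∀ σ₀ > (0 : ℝ), ∀ T > (0 : ℝ), ∀ (ψ₀ φT : Hughes.Plane → ℝ) (a b : Hughes.Plane → ℂ),
        Hughes.HasFourierTransform ψ₀ a → Hughes.HasFourierTransform φT b →
        Hughes.initialNorm σ₀ a + Hughes.terminalNorm σ₀ b ≤ ENNReal.ofReal ε₀ →
        Hughes.weightedSup (fun r => (1 + r) ^ 5 * (1 + σ₀ * r)) a
          + Hughes.weightedSup (fun r => (1 + r) ^ 7) b < (⊤ : ℝ≥0∞) →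
        ∃ (ψ φ : ℝ → Hughes.Plane → ℝ) (G : ℝ → Hughes.Plane → Hughes.Plane)
          (ψv φv : ℝ → ℝ → Hughes.Plane → ℝ) (Gv : ℝ → ℝ → Hughes.Plane → Hughes.Plane),
          Hughes.IsUniqueSolution ρm ρbar 0 T ψ₀ φT ψ φ G ∧
          (∀ σ ∈ Ioc 0 σ₀,
            Hughes.IsUniqueSolution ρm ρbar σ T ψ₀ φT (ψv σ) (φv σ) (Gv σ)) ∧
          Tendsto
            (fun σ => ⨆ t ∈ Icc (0 : ℝ) T,
              (eLpNorm (ψv σ t - ψ t) 2 volume + eLpNorm (ψv σ t - ψ t) ∞ volume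
                + eLpNorm (Gv σ t - G t) 2 volume + eLpNorm (Gv σ t - G t) ∞ volume))
            (𝓝[>] 0) (𝓝 0)) := by
  obtain ⟨ε₀, hε, K, hK, B, hB, hex⟩ := Hughes.exists_hasBounds hpos hlt
  have hdata : ∀ (σ T : ℝ), 0 < σ → 0 < T → ∀ (ψ₀ φT : Hughes.Plane → ℝ) (a b : Hughes.Plane → ℂ),
      Hughes.HasFourierTransform ψ₀ a → Hughes.HasFourierTransform φT b →
      Hughes.initialNorm σ a + Hughes.terminalNorm σ b ≤ ENNReal.ofReal ε₀ →
      Hughes.initialNorm σ a ≠ (⊤ : ℝ≥0∞) ∧ Hughes.terminalNorm σ b ≠ (⊤ : ℝ≥0∞) ∧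
      ∃ U : ℝ → Fin 2 → ℝ → Hughes.Plane → ℂ, ∀ σ' ∈ Icc 0 σ,
        Hughes.HasBounds ρm ρbar σ' T (Hughes.initialNorm σ a).toReal
          (Hughes.terminalNorm σ b).toReal K ψ₀ φT (U σ') ∧
        ∀ i t ξ, ‖U σ' i t ξ - U 0 i t ξ‖ ≤ B * √σ' * Hughes.slowDecay ξ := by
    intro σ T hσ hT ψ₀ φT a b ha hb hNM
    have hfin := ne_top_of_le_ne_top ENNReal.ofReal_ne_top hNM
    obtain ⟨hN, hM⟩ := ENNReal.add_ne_top.1 hfin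
    have hsum : (Hughes.initialNorm σ a).toReal + (Hughes.terminalNorm σ b).toReal ≤ ε₀ := by
      rw [← ENNReal.toReal_add hN hM]
      exact ENNReal.toReal_le_of_le_ofReal hε.le hNM
    obtain ⟨a', b', hg, h1, h2⟩ := Hughes.exists_goodData hσ.le ha hb hN hM
    exact ⟨hN, hM, hex T _ _ hT.le ENNReal.toReal_nonneg ENNReal.toReal_nonneg hsum ψ₀ φT a' b' σ
      hσ.le hg h1 h2⟩
  -- The factor 7 counts the scalar components of ψ, ∇φ and ∇²φ.
  refine ⟨ε₀, hε, 7 * K, by positivity, ?_, ?_⟩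
  · intro σ hσ T hT ψ₀ φT a b ha hb hNM
    obtain ⟨hN, hM, U, hU⟩ := hdata σ T hσ hT ψ₀ φT a b ha hb hNM
    have h := (hU σ ⟨hσ.le, le_rfl⟩).1
    refine ⟨_, _, _, h.unique, fun t ht => ⟨_, (h.hessian hσ t ht).1, ?_⟩⟩
    have := h.estimates hσ hK ENNReal.toReal_nonneg ENNReal.toReal_nonneg ht
    rwa [ENNReal.ofReal_toReal hN, ENNReal.ofReal_toReal hM] at this
  · intro σ₀ hσ₀ T hT ψ₀ φT a b ha hb hNM _
    obtain ⟨-, -, U, hU⟩ := hdata σ₀ T hσ₀ hT ψ₀ φT a b ha hb hNM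
    exact ⟨_, _, _, fun σ => Hughes.psiOf (U σ), fun σ => Hughes.phiOf (U σ),
      fun σ => Hughes.gradOf (U σ), (hU 0 ⟨le_rfl, hσ₀.le⟩).1.unique,
      fun σ hσ => (hU σ ⟨hσ.1.le, hσ.2⟩).1.unique, Hughes.HasBounds.tendsto hB hσ₀ hU⟩
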